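/- Let $\gamma:\mathbb R\to\mathbb R^2$ be a smooth curve with $|\gamma'|=1$, $\mathbf n=\gamma'^{\perp}$ (so that $(\gamma',\mathbf n)$ is a direct orthonormal basis), and suppose that its curvature $\kappa$, given by $\gamma''=\kappa\,\mathbf n$, has compact support. Let $\delta>0$ be so small that $\delta|\kappa|<1$ and $\Theta(s,t)=\gamma(s)+t\,\mathbf n(s)$ is injective on $\mathbb R\times[-\delta,\delta]$. Let $\Omega=\Theta(\mathbb R\times(-\delta,\delta))\subset\mathbb R^2\simeq\mathbb C$, with outward unit normal $\mathbf N$, and let $S_\delta=\{w\in\mathbb C:|\mathrm{Im}\,w|<\delta\}$. Let $\phi\in\mathscr C^\infty(\overline\Omega)$ be the function with $\Delta\phi=1$ in $\Omega$, $\phi=0$ on $\partial\Omega$ and $\phi-\frac{t^2-\delta^2}{2}\circ\Theta^{-1}\in\mathscr S(\overline\Omega)$, and let $\mathbf A=(A_1,A_2)=(-\partial_2\phi,\partial_1\phi)$. For $h>0$ put $$d_{\mathbf A}=-2ih\partial_z-A_1+iA_2,\qquad d^\times_{\mathbf A}=-2ih\partial_{\bar z}-A_1-iA_2 .$$ The magnetic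 Dirac operator with infinite mass boundary conditions is the operator in $L^2(\Omega,\mathbb C^2)$ $$\mathscr D_h=\begin{pmatrix}0&d_{\mathbf A}\\ d^\times_{\mathbf A}&0\end{pmatrix},\qquad \mathrm{Dom}\,\mathscr D_h=\{\psi\in H^1(\Omega,\mathbb C^2):\ -i\sigma_3(\sigma\cdot\mathbf N)\psi=\psi\ \text{on }\partial\Omega\},$$ where $\sigma=(\sigma_1,\sigma_2)$ and $\sigma_1,\sigma_2,\sigma_3$ are the Pauli matrices. Let $f:\Omega\to S_\delta$ be a biholomorphism such that $f'$ and $(f^{-1})'$ are bounded. Let $\mathscr H^2(S_\delta)$ be the space of holomorphic functions $U$ on $S_\delta$ with $\sup_{|y|<\delta}\|U(\cdot+iy)\|_{L^2(\mathbb R)}<\infty$, and $\mathscr H^2(\Omega)$ the space of holomorphic functions $v$ on $\Omega$ with $v\circ f^{-1}\in\mathscr H^2(S_\delta)$; the trace of $v$ on $\partial\Omega$ is obtained by composing with $f$ the $L^2(\mathbb R)$-limits of $(v\circ f^{-1})(\cdot+iy)$ as $y\to\pm\delta$. For $\lambda>0$ let $\mathscr L_\lambda$ be the operator in $L^2(\Omega)$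 associated with the quadratic form $$q_\lambda(u)=\|d^\times_{\mathbf A}u\|^2_{L^2(\Omega)}+h\lambda\|u\|^2_{L^2(\partial\Omega)}-\lambda^2\|u\|^2_{L^2(\Omega)},\qquad u\in H^1(\Omega)+e^{-\phi/h}\mathscr H^2(\Omega).$$ That is, $u\in\mathrm{Dom}\,\mathscr L_\lambda$ and $\mathscr L_\lambda u=w$ if $u$ is in the form domain, $w\in L^2(\Omega)$ and $q_\lambda(u,v)=\langle w,v\rangle$ for all $v$ in the form domain. For $u\in\mathrm{Dom}\,\mathscr L_\lambda$ let $\mathscr J_\lambda(u)=(u,\lambda^{-1}d^\times_{\mathbf A}u)$. Then, for all $h>0$ and $\lambda>0$: 1. $\mathscr J_\lambda$ sends $\mathrm{Dom}\,\mathscr L_\lambda$ into $\mathrm{Dom}\,\mathscr D_h$ and, for all $u\in\mathrm{Dom}\,\mathscr L_\lambda$, $(\mathscr D_h-\lambda)\mathscr J_\lambda(u)=(\lambda^{-1}\mathscr L_\lambda u,0)$. 2. $\mathscr J_\lambda$ induces an isomorphism (of normed spaces, linear and bicontinuous for the $L^2$ norms) from $\ker\mathscr L_\lambda$ onto $\ker(\mathscr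 D_h-\lambda)$. 3. The range of $\mathscr J_\lambda$ is closed in $\mathrm{Dom}\,\mathscr D_h$ equipped with the graph norm. 4. If $\mathscr D_h-\lambda$ is Fredholm with index $0$, then so is $\mathscr L_\lambda$. If $\lambda\in\mathrm{sp}_{\mathrm{dis}}(\mathscr D_h)$, then $0\in\mathrm{sp}_{\mathrm{dis}}(\mathscr L_\lambda)$. Here $\mathrm{sp}_{\mathrm{dis}}$ denotes the set of isolated points of the spectrum that are eigenvalues of finite multiplicity, and an operator is Fredholm if it is closed with finite-dimensional kernel and closed range of finite codimension. -/

import Mathlib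

open MeasureTheory Filter Set Topology
open scoped ContDiff ENNReal NNReal SchwartzMap ComplexConjugate InnerProductSpace

noncomputable section

/-! ### Unbounded operators: kernel, Fredholm property, spectrum -/

namespace UnboundedOp

variable {H : Type*} [NormedAddCommGroup H] [NormedSpace ℂ H]

/-- The operator `T - z`, with the same domain as `T`. -/
def shift (T : H →ₗ.[ℂ] H) (z : ℂ) : H →ₗ.[ℂ] H :=
  ⟨T.domain, T.toFun - z • T.domain.subtype⟩

/-- The kernel of `T`, as a subspace of the domain of `T`. -/
abbrev ker (T : H →ₗ.[ℂ] H) : Submodule ℂ T.domain := LinearMap.ker T.toFun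

/-- The range of `T`. -/
abbrev range (T : H →ₗ.[ℂ] H) : Submodule ℂ H := LinearMap.range T.toFun

/-- A closed operator is Fredholm if its kernel is finite-dimensional and its range is closed and
of finite codimension. -/
structure IsFredholm (T : H →ₗ.[ℂ] H) : Prop where
  closed : T.IsClosed
  finite_ker : FiniteDimensional ℂ (ker T)
  closed_range : IsClosed (range T : Set H)
  finite_coker : FiniteDimensional ℂ (H ⧸ range T)

/-- The Fredholm index `dim ker T - codim ran T`. -/
def index (T : H →ₗ.[ℂ] H) : ℤ :=
  (Module.finrank ℂ (ker T) : ℤ) - (Module.finrank ℂ (H ⧸ range T) : ℤ)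

/-- `z` is in the resolvent set if `T - z` is a bijection from the domain of `T` onto the whole
space, with a bounded inverse `R`. -/
def resolventSet (T : H →ₗ.[ℂ] H) : Set ℂ :=
  {z | ∃ R : H →L[ℂ] H,
    (∀ x : H, ∃ hx : R x ∈ T.domain, shift T z ⟨R x, hx⟩ = x) ∧
    ∀ u : T.domain, R (shift T z u) = u}

/-- The spectrum of `T`. -/
def spectrum (T : H →ₗ.[ℂ] H) : Set ℂ := (resolventSet T)ᶜ

/-- The discrete spectrum (of a self-adjoint operator): the isolated points of the spectrum
that are eigenvalues of finite multiplicity. -/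
def discreteSpectrum (T : H →ₗ.[ℂ] H) : Set ℂ :=
  {z | z ∈ spectrum T ∧ (∃ ε > 0, ∀ w ∈ spectrum T, w ≠ z → ε ≤ dist w z) ∧
    ker (shift T z) ≠ ⊥ ∧ FiniteDimensional ℂ (ker (shift T z))}

/-- The graph-norm topology on the domain of `T`. -/
abbrev graphTopology (T : H →ₗ.[ℂ] H) : TopologicalSpace T.domain :=
  TopologicalSpace.induced (fun u : T.domain => ((u : H), T u)) inferInstance

end UnboundedOp

/-! ### The curved strip

The plane is identified with `ℂ`; rotation by `π / 2` is multiplication by `Complex.I`. -/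

/-- The unit normal `γ'^⊥`, such that `(γ', n)` is a direct orthonormal basis. -/
def unitNormal (γ : ℝ → ℂ) (s : ℝ) : ℂ := Complex.I * deriv γ s

/-- The signed curvature `κ` of a unit-speed curve, `γ'' = κ n`. -/
def signedCurvature (γ : ℝ → ℂ) (s : ℝ) : ℝ := (deriv (deriv γ) s * conj (unitNormal γ s)).re

/-- The tubular map `Θ(s, t) = γ(s) + t n(s)`. -/
def tubularMap (γ : ℝ → ℂ) (s t : ℝ) : ℂ := γ s + (t : ℂ) * unitNormal γ s

/-- A smooth strip of half-width `δ` about a smooth unit-speed base curve `γ` whose curvature is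
compactly supported; `δ` is so small that the closed strip is a tubular neighbourhood of `γ`. -/
structure CurvedStrip where
  γ : ℝ → ℂ
  δ : ℝ
  smooth : ContDiff ℝ ∞ γ
  unit_speed : ∀ s, ‖deriv γ s‖ = 1
  curvature_compact : HasCompactSupport (signedCurvature γ)
  δ_pos : 0 < δ
  curvature_lt : ∀ s, δ * |signedCurvature γ s| < 1
  injOn : InjOn (fun p : ℝ × ℝ => tubularMap γ p.1 p.2) (univ ×ˢ Icc (-δ) δ)

/-- The open straight strip `{|Im w| < δ}`. -/
def straightStrip (δ : ℝ) : Set ℂ := {w | |w.im| < δ}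

/-- The Hardy space of the straight strip: holomorphic functions whose `L²` norms on horizontal
lines are uniformly bounded. -/
def MemHardyStraight (δ : ℝ) (U : ℂ → ℂ) : Prop :=
  DifferentiableOn ℂ U (straightStrip δ) ∧
    ∃ C : ℝ≥0, ∀ y ∈ Ioo (-δ) δ,
      eLpNorm (fun x : ℝ => U ((x : ℂ) + (y : ℂ) * Complex.I)) 2 volume ≤ C

namespace CurvedStrip

variable (S : CurvedStrip)

/-- The tubular map of the strip. -/
abbrev Θ (s t : ℝ) : ℂ := tubularMap S.γ s t

/-- The curved strip `Ω = Θ(ℝ × (-δ, δ))`. -/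
def Ω : Set ℂ := (fun p : ℝ × ℝ => S.Θ p.1 p.2) '' (univ ×ˢ Ioo (-S.δ) S.δ)

/-- The arc-length measure on the curve `s ↦ Θ(s, t)`. -/
def arcLength (t : ℝ) : Measure ℂ :=
  (volume.withDensity fun s : ℝ => (‖deriv (fun s' : ℝ => S.Θ s' t) s‖₊ : ℝ≥0∞)).map
    fun s => S.Θ s t

/-- The arc-length measure on `∂Ω`, which consists of the two curves `s ↦ Θ(s, ±δ)`. -/
def boundaryMeasure : Measure ℂ := S.arcLength S.δ + S.arcLength (-S.δ)

/-- `L²(Ω; ℂ)`. -/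
abbrev L2 : Type := Lp ℂ 2 (volume.restrict S.Ω)

/-- `L²(∂Ω; ℂ)`. -/
abbrev L2b : Type := Lp ℂ 2 S.boundaryMeasure

/-- `L²(Ω; ℂ²)`. -/
abbrev Spinor : Type := WithLp 2 (S.L2 × S.L2)

/-! ### The magnetic potential -/

/-- The function `φ` on the closure of `Ω`: smooth up to the boundary (that is, the restriction of
a smooth function on the plane), with `Δφ = 1` in `Ω` and `φ = 0` on `∂Ω`, and differing from
`(t² - δ²) / 2` by (the restriction to `Ω` of) a Schwartz function. These conditions determine `φ`
on the closure of `Ω`, and nothing below uses its values elsewhere. -/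
structure Potential where
  φ : ℂ → ℝ
  smooth : ContDiff ℝ ∞ φ
  laplacian_eq : ∀ z ∈ S.Ω, Laplacian.laplacian φ z = 1
  boundary : ∀ z ∈ frontier S.Ω, φ z = 0
  schwartz : ∃ χ : 𝓢(ℂ, ℝ), ∀ s : ℝ, ∀ t ∈ Ioo (-S.δ) S.δ,
    φ (S.Θ s t) = (t ^ 2 - S.δ ^ 2) / 2 + χ (S.Θ s t)

/-! ### The Hardy space of the curved strip -/

/-- A biholomorphism `f : Ω → {|Im w| < δ}` such that `f'` and `(f⁻¹)'` are bounded. The inverse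
`f⁻¹`, being Lipschitz, extends continuously to the closed straight strip; `inv` denotes this
extension. -/
structure Uniformization where
  f : ℂ → ℂ
  inv : ℂ → ℂ
  mapsTo : MapsTo f S.Ω (straightStrip S.δ)
  inv_mapsTo : MapsTo inv (straightStrip S.δ) S.Ω
  left_inv : LeftInvOn inv f S.Ω
  right_inv : RightInvOn inv f (straightStrip S.δ)
  holomorphic : DifferentiableOn ℂ f S.Ω
  inv_holomorphic : DifferentiableOn ℂ inv (straightStrip S.δ)
  deriv_bounded : ∃ C : ℝ, ∀ z ∈ S.Ω, ‖deriv f z‖ ≤ C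
  inv_deriv_bounded : ∃ C : ℝ, ∀ w ∈ straightStrip S.δ, ‖deriv inv w‖ ≤ C
  inv_continuousOn : ContinuousOn inv {w : ℂ | |w.im| ≤ S.δ}

variable {S}

/-- The Hardy space of `Ω`: holomorphic functions `v` such that `v ∘ f⁻¹` is in the Hardy space
of the straight strip. -/
def MemHardy (R : S.Uniformization) (v : ℂ → ℂ) : Prop :=
  DifferentiableOn ℂ v S.Ω ∧ MemHardyStraight S.δ (v ∘ R.inv)

/-- `g` is the trace on `∂Ω` of the Hardy function `v`: as `y → ±δ`, the functions
`x ↦ (v ∘ f⁻¹)(x + i y)` converge in `L²(ℝ)` to `x ↦ (g ∘ f⁻¹)(x ± i δ)`. -/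
def IsHardyTrace (R : S.Uniformization) (v g : ℂ → ℂ) : Prop :=
  Measurable g ∧
  Tendsto (fun y : ℝ => eLpNorm (fun x : ℝ =>
      v (R.inv ((x : ℂ) + (y : ℂ) * Complex.I)) -
        g (R.inv ((x : ℂ) + (S.δ : ℂ) * Complex.I))) 2 volume) (𝓝[<] S.δ) (𝓝 0) ∧
  Tendsto (fun y : ℝ => eLpNorm (fun x : ℝ =>
      v (R.inv ((x : ℂ) + (y : ℂ) * Complex.I)) -
        g (R.inv ((x : ℂ) + ((-S.δ : ℝ) : ℂ) * Complex.I))) 2 volume) (𝓝[>] (-S.δ)) (𝓝 0)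

/-! ### Sobolev functions and their traces -/

/-- Real-valued test functions on `Ω`. -/
def IsTestFunction (S : CurvedStrip) (θ : ℂ → ℝ) : Prop :=
  ContDiff ℝ ∞ θ ∧ HasCompactSupport θ ∧ tsupport θ ⊆ S.Ω

/-- `p` is the weak derivative in `Ω` of `u` in the direction `e`. -/
def IsWeakDeriv (e : ℂ) (u p : S.L2) : Prop :=
  ∀ θ : ℂ → ℝ, IsTestFunction S θ →
    ∫ z in S.Ω, (fderiv ℝ θ z e : ℂ) * u z = -∫ z in S.Ω, (θ z : ℂ) * p z

/-- `u` is in `H¹(Ω)`, with weak partial derivatives `∂₁u = p₁` and `∂₂u = p₂`. -/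
def HasWeakGradient (u p₁ p₂ : S.L2) : Prop :=
  IsWeakDeriv 1 u p₁ ∧ IsWeakDeriv Complex.I u p₂

/-- `u` is in `H¹(Ω)`, with weak gradient `(p₁, p₂)` and trace `g` on `∂Ω`: there are smooth
compactly supported functions on the plane that converge to `u` in `H¹(Ω)` and whose restrictions
to `∂Ω` converge to `g` in `L²(∂Ω)`. -/
def IsSobolevTrace (u p₁ p₂ : S.L2) (g : S.L2b) : Prop :=
  HasWeakGradient u p₁ p₂ ∧
  ∃ F : ℕ → ℂ → ℂ, (∀ n, ContDiff ℝ ∞ (F n) ∧ HasCompactSupport (F n)) ∧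
    Tendsto (fun n => eLpNorm (fun z => F n z - u z) 2 (volume.restrict S.Ω)) atTop (𝓝 0) ∧
    Tendsto (fun n => eLpNorm (fun z => fderiv ℝ (F n) z 1 - p₁ z) 2 (volume.restrict S.Ω))
      atTop (𝓝 0) ∧
    Tendsto (fun n => eLpNorm (fun z => fderiv ℝ (F n) z Complex.I - p₂ z) 2
      (volume.restrict S.Ω)) atTop (𝓝 0) ∧
    Tendsto (fun n => eLpNorm (fun z => F n z - g z) 2 S.boundaryMeasure) atTop (𝓝 0)

namespace Potential

variable (P : S.Potential)

/-- The vector potential `A = (∇φ)^⊥ = (-∂₂φ, ∂₁φ)`, first component. -/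
def A₁ (z : ℂ) : ℝ := -fderiv ℝ P.φ z Complex.I

/-- The vector potential `A = (∇φ)^⊥ = (-∂₂φ, ∂₁φ)`, second component. -/
def A₂ (z : ℂ) : ℝ := fderiv ℝ P.φ z 1

end Potential

/-! ### The magnetic Dirac operator -/

/-- The Pauli matrix `σ₁`. -/
def pauli₁ : Matrix (Fin 2) (Fin 2) ℂ := !![0, 1; 1, 0]

/-- The Pauli matrix `σ₂`. -/
def pauli₂ : Matrix (Fin 2) (Fin 2) ℂ := !![0, -Complex.I; Complex.I, 0]

/-- The Pauli matrix `σ₃`. -/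
def pauli₃ : Matrix (Fin 2) (Fin 2) ℂ := !![1, 0; 0, -1]

/-- The matrix `-i σ₃ (σ · N)` of the infinite mass boundary condition. -/
def infiniteMassMatrix (N : ℂ) : Matrix (Fin 2) (Fin 2) ℂ :=
  (-Complex.I) • (pauli₃ * ((N.re : ℂ) • pauli₁ + (N.im : ℂ) • pauli₂))

/-- `N` is the outward unit normal at the boundary point `z`: it is `±n(s)` at `Θ(s, ±δ)`. -/
def IsOutwardNormal (S : CurvedStrip) (z N : ℂ) : Prop :=
  ∃ s : ℝ, (z = S.Θ s S.δ ∧ N = unitNormal S.γ s) ∨ (z = S.Θ s (-S.δ) ∧ N = -unitNormal S.γ s)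

/-- The infinite mass boundary condition `-i σ₃ (σ · N) ψ = ψ` for the boundary values
`ψ = (g₁, g₂)`, almost everywhere on `∂Ω`. -/
def InfiniteMass (g₁ g₂ : S.L2b) : Prop :=
  ∀ᵐ z ∂S.boundaryMeasure, ∀ N : ℂ, IsOutwardNormal S z N →
    (infiniteMassMatrix N).mulVec ![g₁ z, g₂ z] = ![g₁ z, g₂ z]

/-- `D_h ψ = χ`: both components of `ψ` are in `H¹(Ω)`, their traces satisfy the infinite mass
boundary condition, and
`χ₁ = d_A ψ₂ = (-2ih ∂_z - A₁ + i A₂) ψ₂`, `χ₂ = d_A^× ψ₁ = (-2ih ∂_{z̄} - A₁ - i A₂) ψ₁`. -/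
def DiracRel (P : S.Potential) (h : ℝ) (ψ χ : S.Spinor) : Prop :=
  ∃ (p₁ p₂ q₁ q₂ : S.L2) (g₁ g₂ : S.L2b),
    IsSobolevTrace ψ.fst p₁ p₂ g₁ ∧ IsSobolevTrace ψ.snd q₁ q₂ g₂ ∧ InfiniteMass g₁ g₂ ∧
    (∀ᵐ z ∂(volume.restrict S.Ω), χ.fst z =
      -(2 * Complex.I * h) * ((q₁ z - Complex.I * q₂ z) / 2)
        + (-(P.A₁ z : ℂ) + Complex.I * P.A₂ z) * ψ.snd z) ∧
    (∀ᵐ z ∂(volume.restrict S.Ω), χ.snd z =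
      -(2 * Complex.I * h) * ((p₁ z + Complex.I * p₂ z) / 2)
        + (-(P.A₁ z : ℂ) - Complex.I * P.A₂ z) * ψ.fst z)

/-! ### The form `q_λ` -/

/-- `d = d_A^× u = (-2ih ∂_{z̄} - A₁ - i A₂) u` in the sense of distributions on `Ω`. -/
def IsDTimes (P : S.Potential) (h : ℝ) (u d : S.L2) : Prop :=
  ∀ θ : ℂ → ℝ, IsTestFunction S θ →
    ∫ z in S.Ω, (θ z : ℂ) * d z =
      ∫ z in S.Ω, (Complex.I * h * ((fderiv ℝ θ z 1 : ℂ) + Complex.I * (fderiv ℝ θ z Complex.I : ℂ))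
        + (-(P.A₁ z : ℂ) - Complex.I * P.A₂ z) * (θ z : ℂ)) * u z

/-- `u = u₁ + e^{-φ/h} v` with `u₁` in `H¹(Ω)` and `v` in the Hardy space of `Ω`, that is, `u` is
in the form domain `H¹(Ω) + e^{-φ/h} 𝓗²(Ω)`, and `g` is the trace of `u` on `∂Ω`
(where `e^{-φ/h} = 1`). -/
def IsFormTrace (P : S.Potential) (R : S.Uniformization) (h : ℝ) (u : S.L2) (g : S.L2b) : Prop :=
  ∃ (u₁ p₁ p₂ : S.L2) (g₁ : S.L2b) (v g₂ : ℂ → ℂ),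
    IsSobolevTrace u₁ p₁ p₂ g₁ ∧ MemHardy R v ∧ IsHardyTrace R v g₂ ∧
    (∀ᵐ z ∂(volume.restrict S.Ω), u z = u₁ z + (Real.exp (-P.φ z / h) : ℂ) * v z) ∧
    (∀ᵐ z ∂S.boundaryMeasure, g z = g₁ z + g₂ z)

/-! ### Linearity of these relations -/

theorem tendsto_eLpNorm_add {ι α : Type*} [MeasurableSpace α] {μ : Measure α} {l : Filter ι}
    {a b c : ι → α → ℂ} (ha : Tendsto (fun n => eLpNorm (a n) 2 μ) l (𝓝 0))
    (hb : Tendsto (fun n => eLpNorm (b n) 2 μ) l (𝓝 0))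
    (hma : ∀ᶠ n in l, AEStronglyMeasurable (a n) μ)
    (hmb : ∀ᶠ n in l, AEStronglyMeasurable (b n) μ)
    (hc : ∀ n, c n =ᵐ[μ] a n + b n) : Tendsto (fun n => eLpNorm (c n) 2 μ) l (𝓝 0) := by
  have h0 := ha.add hb
  rw [add_zero] at h0
  refine tendsto_of_tendsto_of_tendsto_of_le_of_le' tendsto_const_nhds h0
    (Eventually.of_forall fun _ => zero_le) ?_
  filter_upwards [hma, hmb] with n h1 h2
  rw [eLpNorm_congr_ae (hc n)]
  exact eLpNorm_add_le h1 h2 (by norm_num)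

theorem tendsto_eLpNorm_smul {ι α : Type*} [MeasurableSpace α] {μ : Measure α} {l : Filter ι}
    {a c : ι → α → ℂ} (k : ℂ) (ha : Tendsto (fun n => eLpNorm (a n) 2 μ) l (𝓝 0))
    (hc : ∀ n, c n =ᵐ[μ] k • a n) : Tendsto (fun n => eLpNorm (c n) 2 μ) l (𝓝 0) := by
  have h1 : ∀ n, eLpNorm (c n) 2 μ = ‖k‖ₑ * eLpNorm (a n) 2 μ := fun n => by
    rw [eLpNorm_congr_ae (hc n), eLpNorm_const_smul]
  simp_rw [h1]
  have := ENNReal.Tendsto.const_mul (a := ‖k‖ₑ) ha (Or.inr enorm_ne_top)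
  simpa using this

theorem integrable_mul_test {θ : ℂ → ℂ} (hc : Continuous θ) (hs : HasCompactSupport θ)
    (u : S.L2) : Integrable (fun z => θ z * u z) (volume.restrict S.Ω) := by
  have h1 : MemLp θ 2 (volume.restrict S.Ω) :=
    (hc.memLp_of_hasCompactSupport hs).restrict _
  exact h1.integrable_mul (Lp.memLp u)

theorem integrable_weak_right {θ : ℂ → ℝ} (hθ : IsTestFunction S θ) (u : S.L2) :
    Integrable (fun z => (θ z : ℂ) * u z) (volume.restrict S.Ω) := by
  refine integrable_mul_test (by have := hθ.1.continuous; fun_prop) ?_ u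
  exact hθ.2.1.comp_left (g := fun x : ℝ => (x : ℂ)) (by simp)

theorem integrable_weak_left {θ : ℂ → ℝ} (hθ : IsTestFunction S θ) (e : ℂ) (u : S.L2) :
    Integrable (fun z => (fderiv ℝ θ z e : ℂ) * u z) (volume.restrict S.Ω) := by
  have hc : Continuous (fderiv ℝ θ) := hθ.1.continuous_fderiv (by simp)
  refine integrable_mul_test (by fun_prop) ?_ u
  exact (hθ.2.1.fderiv (𝕜 := ℝ)).comp_left
    (g := fun L : ℂ →L[ℝ] ℝ => ((L e : ℝ) : ℂ)) (by simp)

theorem continuous_dTimesTest (P : S.Potential) (h : ℝ) {θ : ℂ → ℝ} (hθ : IsTestFunction S θ) :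
    Continuous (fun z => Complex.I * h *
      ((fderiv ℝ θ z 1 : ℂ) + Complex.I * (fderiv ℝ θ z Complex.I : ℂ))
        + (-(P.A₁ z : ℂ) - Complex.I * P.A₂ z) * (θ z : ℂ)) := by
  have hc : Continuous (fderiv ℝ θ) := hθ.1.continuous_fderiv (by simp)
  have hp : Continuous (fderiv ℝ P.φ) := P.smooth.continuous_fderiv (by simp)
  have := hθ.1.continuous
  unfold Potential.A₁ Potential.A₂
  fun_prop

theorem integrable_dTimesTest (P : S.Potential) (h : ℝ) {θ : ℂ → ℝ} (hθ : IsTestFunction S θ)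
    (u : S.L2) : Integrable (fun z => (Complex.I * h *
      ((fderiv ℝ θ z 1 : ℂ) + Complex.I * (fderiv ℝ θ z Complex.I : ℂ))
        + (-(P.A₁ z : ℂ) - Complex.I * P.A₂ z) * (θ z : ℂ)) * u z) (volume.restrict S.Ω) := by
  refine integrable_mul_test (continuous_dTimesTest P h hθ) ?_ u
  have h1 : HasCompactSupport fun z => ((fderiv ℝ θ z 1 : ℝ) : ℂ) :=
    (hθ.2.1.fderiv (𝕜 := ℝ)).comp_left
      (g := fun L : ℂ →L[ℝ] ℝ => ((L 1 : ℝ) : ℂ)) (by simp)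
  have h2 : HasCompactSupport fun z => ((fderiv ℝ θ z Complex.I : ℝ) : ℂ) :=
    (hθ.2.1.fderiv (𝕜 := ℝ)).comp_left
      (g := fun L : ℂ →L[ℝ] ℝ => ((L Complex.I : ℝ) : ℂ)) (by simp)
  have h3 : HasCompactSupport fun z => ((θ z : ℝ) : ℂ) :=
    hθ.2.1.comp_left (g := fun x : ℝ => (x : ℂ)) (by simp)
  exact ((h1.add (h2.mul_left (f := fun _ => Complex.I))).mul_left
    (f := fun _ => Complex.I * h)).add (h3.mul_left)

/-- A pairing `u ↦ ∫ θ u` that occurs in the weak formulations is additive and homogeneous. -/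
theorem integral_mul_add {θ : ℂ → ℂ} (hi : ∀ u : S.L2, Integrable (fun z => θ z * u z)
    (volume.restrict S.Ω)) (u v : S.L2) :
    ∫ z in S.Ω, θ z * (u + v : S.L2) z
      = (∫ z in S.Ω, θ z * u z) + ∫ z in S.Ω, θ z * v z := by
  rw [← integral_add (hi u) (hi v)]
  refine integral_congr_ae ?_
  filter_upwards [Lp.coeFn_add u v] with z hz
  rw [hz, Pi.add_apply, mul_add]

theorem integral_mul_smul {θ : ℂ → ℂ} (k : ℂ) (u : S.L2) :
    ∫ z in S.Ω, θ z * (k • u : S.L2) z = k * ∫ z in S.Ω, θ z * u z := by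
  rw [← integral_const_mul]
  refine integral_congr_ae ?_
  filter_upwards [Lp.coeFn_smul k u] with z hz
  rw [hz, Pi.smul_apply, smul_eq_mul]
  ring

theorem IsWeakDeriv.add {e : ℂ} {u p u' p' : S.L2} (h : IsWeakDeriv e u p)
    (h' : IsWeakDeriv e u' p') : IsWeakDeriv e (u + u') (p + p') := fun θ hθ => by
  rw [integral_mul_add (integrable_weak_left hθ e), integral_mul_add (integrable_weak_right hθ),
    h θ hθ, h' θ hθ, neg_add]

theorem IsWeakDeriv.smul {e : ℂ} {u p : S.L2} (k : ℂ) (h : IsWeakDeriv e u p) :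
    IsWeakDeriv e (k • u) (k • p) := fun θ hθ => by
  rw [integral_mul_smul, integral_mul_smul, h θ hθ, mul_neg]

theorem IsDTimes.add {P : S.Potential} {h : ℝ} {u d u' d' : S.L2} (H : IsDTimes P h u d)
    (H' : IsDTimes P h u' d') : IsDTimes P h (u + u') (d + d') := fun θ hθ => by
  rw [integral_mul_add (integrable_dTimesTest P h hθ), integral_mul_add (integrable_weak_right hθ),
    H θ hθ, H' θ hθ]

theorem IsDTimes.smul {P : S.Potential} {h : ℝ} {u d : S.L2} (k : ℂ) (H : IsDTimes P h u d) :
    IsDTimes P h (k • u) (k • d) := fun θ hθ => by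
  rw [integral_mul_smul, integral_mul_smul, H θ hθ]

theorem IsSobolevTrace.add {u p₁ p₂ u' p₁' p₂' : S.L2} {g g' : S.L2b}
    (H : IsSobolevTrace u p₁ p₂ g) (H' : IsSobolevTrace u' p₁' p₂' g') :
    IsSobolevTrace (u + u') (p₁ + p₁') (p₂ + p₂') (g + g') := by
  obtain ⟨⟨w1, w2⟩, F, hF, a1, a2, a3, a4⟩ := H
  obtain ⟨⟨w1', w2'⟩, F', hF', b1, b2, b3, b4⟩ := H'
  have hd : ∀ n, Continuous (fderiv ℝ (F n)) := fun n => (hF n).1.continuous_fderiv (by simp)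
  have hd' : ∀ n, Continuous (fderiv ℝ (F' n)) := fun n => (hF' n).1.continuous_fderiv (by simp)
  have hc : ∀ n, Continuous (F n) := fun n => (hF n).1.continuous
  have hc' : ∀ n, Continuous (F' n) := fun n => (hF' n).1.continuous
  have hadd : ∀ n z, fderiv ℝ (F n + F' n) z = fderiv ℝ (F n) z + fderiv ℝ (F' n) z :=
    fun n z => fderiv_add ((hF n).1.differentiable (by simp) z)
      ((hF' n).1.differentiable (by simp) z)
  refine ⟨⟨w1.add w1', w2.add w2'⟩, fun n => F n + F' n,
    fun n => ⟨(hF n).1.add (hF' n).1, (hF n).2.add (hF' n).2⟩, ?_, ?_, ?_, ?_⟩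
  · refine tendsto_eLpNorm_add a1 b1
      (Eventually.of_forall fun n => (hc n).aestronglyMeasurable.sub (Lp.aestronglyMeasurable u))
      (Eventually.of_forall fun n => (hc' n).aestronglyMeasurable.sub (Lp.aestronglyMeasurable u'))
      fun n => ?_
    filter_upwards [Lp.coeFn_add u u'] with z hz
    simp only [hz, Pi.add_apply]; ring
  · refine tendsto_eLpNorm_add a2 b2
      (Eventually.of_forall fun n => ((hd n).clm_apply continuous_const).aestronglyMeasurable.sub
        (Lp.aestronglyMeasurable p₁))
      (Eventually.of_forall fun n => ((hd' n).clm_apply continuous_const).aestronglyMeasurable.sub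
        (Lp.aestronglyMeasurable p₁'))
      fun n => ?_
    filter_upwards [Lp.coeFn_add p₁ p₁'] with z hz
    simp only [hz, hadd, Pi.add_apply, _root_.add_apply]; ring
  · refine tendsto_eLpNorm_add a3 b3
      (Eventually.of_forall fun n => ((hd n).clm_apply continuous_const).aestronglyMeasurable.sub
        (Lp.aestronglyMeasurable p₂))
      (Eventually.of_forall fun n => ((hd' n).clm_apply continuous_const).aestronglyMeasurable.sub
        (Lp.aestronglyMeasurable p₂'))
      fun n => ?_
    filter_upwards [Lp.coeFn_add p₂ p₂'] with z hz
    simp only [hz, hadd, Pi.add_apply, _root_.add_apply]; ring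
  · refine tendsto_eLpNorm_add a4 b4
      (Eventually.of_forall fun n => (hc n).aestronglyMeasurable.sub (Lp.aestronglyMeasurable g))
      (Eventually.of_forall fun n => (hc' n).aestronglyMeasurable.sub (Lp.aestronglyMeasurable g'))
      fun n => ?_
    filter_upwards [Lp.coeFn_add g g'] with z hz
    simp only [hz, Pi.add_apply]; ring

theorem IsSobolevTrace.smul {u p₁ p₂ : S.L2} {g : S.L2b} (k : ℂ)
    (H : IsSobolevTrace u p₁ p₂ g) :
    IsSobolevTrace (k • u) (k • p₁) (k • p₂) (k • g) := by
  obtain ⟨⟨w1, w2⟩, F, hF, a1, a2, a3, a4⟩ := H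
  have hsm : ∀ n z, fderiv ℝ (k • F n) z = k • fderiv ℝ (F n) z :=
    fun n z => fderiv_const_smul ((hF n).1.differentiable (by simp) z) k
  refine ⟨⟨w1.smul k, w2.smul k⟩, fun n => k • F n,
    fun n => ⟨(hF n).1.const_smul k, (hF n).2.smul_left (f := fun _ => k)⟩, ?_, ?_, ?_, ?_⟩
  · refine tendsto_eLpNorm_smul k a1 fun n => ?_
    filter_upwards [Lp.coeFn_smul k u] with z hz
    simp only [hz, Pi.smul_apply, smul_eq_mul]; ring
  · refine tendsto_eLpNorm_smul k a2 fun n => ?_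
    filter_upwards [Lp.coeFn_smul k p₁] with z hz
    simp only [hz, hsm, Pi.smul_apply, smul_eq_mul, _root_.smul_apply]; ring
  · refine tendsto_eLpNorm_smul k a3 fun n => ?_
    filter_upwards [Lp.coeFn_smul k p₂] with z hz
    simp only [hz, hsm, Pi.smul_apply, smul_eq_mul, _root_.smul_apply]; ring
  · refine tendsto_eLpNorm_smul k a4 fun n => ?_
    filter_upwards [Lp.coeFn_smul k g] with z hz
    simp only [hz, Pi.smul_apply, smul_eq_mul]; ring

theorem InfiniteMass.add {g₁ g₂ g₁' g₂' : S.L2b} (H : InfiniteMass g₁ g₂)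
    (H' : InfiniteMass g₁' g₂') : InfiniteMass (g₁ + g₁') (g₂ + g₂') := by
  filter_upwards [H, H', Lp.coeFn_add g₁ g₁', Lp.coeFn_add g₂ g₂'] with z h h' e₁ e₂ N hN
  have e : ![(g₁ + g₁' : S.L2b) z, (g₂ + g₂' : S.L2b) z]
      = ![g₁ z, g₂ z] + ![g₁' z, g₂' z] := by
    rw [e₁, e₂]; ext i; fin_cases i <;> simp
  rw [e, Matrix.mulVec_add, h N hN, h' N hN]

theorem InfiniteMass.smul {g₁ g₂ : S.L2b} (k : ℂ) (H : InfiniteMass g₁ g₂) :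
    InfiniteMass (k • g₁) (k • g₂) := by
  filter_upwards [H, Lp.coeFn_smul k g₁, Lp.coeFn_smul k g₂] with z h e₁ e₂ N hN
  have e : ![(k • g₁ : S.L2b) z, (k • g₂ : S.L2b) z] = k • ![g₁ z, g₂ z] := by
    rw [e₁, e₂]; ext i; fin_cases i <;> simp
  rw [e, Matrix.mulVec_smul, h N hN]

theorem DiracRel.add {P : S.Potential} {h : ℝ} {ψ χ ψ' χ' : S.Spinor} (H : DiracRel P h ψ χ)
    (H' : DiracRel P h ψ' χ') : DiracRel P h (ψ + ψ') (χ + χ') := by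
  obtain ⟨p₁, p₂, q₁, q₂, g₁, g₂, t1, t2, bc, e1, e2⟩ := H
  obtain ⟨p₁', p₂', q₁', q₂', g₁', g₂', t1', t2', bc', e1', e2'⟩ := H'
  refine ⟨_, _, _, _, _, _, t1.add t1', t2.add t2', bc.add bc', ?_, ?_⟩
  · filter_upwards [e1, e1', Lp.coeFn_add χ.fst χ'.fst, Lp.coeFn_add q₁ q₁',
      Lp.coeFn_add q₂ q₂', Lp.coeFn_add ψ.snd ψ'.snd] with z a b c d e f
    rw [WithLp.add_fst, WithLp.add_snd, c, d, e, f]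
    simp only [Pi.add_apply, a, b]; ring
  · filter_upwards [e2, e2', Lp.coeFn_add χ.snd χ'.snd, Lp.coeFn_add p₁ p₁',
      Lp.coeFn_add p₂ p₂', Lp.coeFn_add ψ.fst ψ'.fst] with z a b c d e f
    rw [WithLp.add_fst, WithLp.add_snd, c, d, e, f]
    simp only [Pi.add_apply, a, b]; ring

theorem DiracRel.smul {P : S.Potential} {h : ℝ} {ψ χ : S.Spinor} (k : ℂ)
    (H : DiracRel P h ψ χ) : DiracRel P h (k • ψ) (k • χ) := by
  obtain ⟨p₁, p₂, q₁, q₂, g₁, g₂, t1, t2, bc, e1, e2⟩ := H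
  refine ⟨_, _, _, _, _, _, t1.smul k, t2.smul k, bc.smul k, ?_, ?_⟩
  · filter_upwards [e1, Lp.coeFn_smul k χ.fst, Lp.coeFn_smul k q₁,
      Lp.coeFn_smul k q₂, Lp.coeFn_smul k ψ.snd] with z a c d e f
    rw [WithLp.smul_fst, WithLp.smul_snd, c, d, e, f]
    simp only [Pi.smul_apply, smul_eq_mul, a]; ring
  · filter_upwards [e2, Lp.coeFn_smul k χ.snd, Lp.coeFn_smul k p₁,
      Lp.coeFn_smul k p₂, Lp.coeFn_smul k ψ.fst] with z a c d e f
    rw [WithLp.smul_fst, WithLp.smul_snd, c, d, e, f]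
    simp only [Pi.smul_apply, smul_eq_mul, a]; ring

theorem MemHardy.add {R : S.Uniformization} {v v' : ℂ → ℂ} (H : MemHardy R v)
    (H' : MemHardy R v') : MemHardy R (v + v') := by
  obtain ⟨a, b, C, c⟩ := H
  obtain ⟨a', b', C', c'⟩ := H'
  refine ⟨a.add a', b.add b', C + C', fun y hy => ?_⟩
  have hline : Continuous fun x : ℝ => (x : ℂ) + (y : ℂ) * Complex.I := by fun_prop
  have hmem : ∀ x : ℝ, (x : ℂ) + (y : ℂ) * Complex.I ∈ straightStrip S.δ := fun x => by
    simpa [straightStrip, abs_lt] using hy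
  have m := (b.continuousOn.comp_continuous hline hmem).aestronglyMeasurable
    (μ := (volume : Measure ℝ))
  have m' := (b'.continuousOn.comp_continuous hline hmem).aestronglyMeasurable
    (μ := (volume : Measure ℝ))
  refine (eLpNorm_add_le m m' (by norm_num)).trans ?_
  rw [ENNReal.coe_add]
  exact add_le_add (c y hy) (c' y hy)

theorem MemHardy.smul {R : S.Uniformization} {v : ℂ → ℂ} (k : ℂ) (H : MemHardy R v) :
    MemHardy R (k • v) := by
  obtain ⟨a, b, C, c⟩ := H
  refine ⟨a.const_smul k, b.const_smul k, ‖k‖₊ * C, fun y hy => ?_⟩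
  have := eLpNorm_const_smul k
    (fun x : ℝ => (v ∘ R.inv) ((x : ℂ) + (y : ℂ) * Complex.I)) 2 volume
  rw [ENNReal.coe_mul]
  exact this.le.trans (mul_le_mul_right (c y hy) _)

theorem hardySlice_measurable {R : S.Uniformization} {v g : ℂ → ℂ} (H : MemHardy R v)
    (hg : Measurable g) {y t : ℝ} (hy : y ∈ Ioo (-S.δ) S.δ) (ht : |t| ≤ S.δ) :
    AEStronglyMeasurable (fun x : ℝ => v (R.inv ((x : ℂ) + (y : ℂ) * Complex.I)) -
        g (R.inv ((x : ℂ) + (t : ℂ) * Complex.I))) volume := by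
  have hline : ∀ y : ℝ, Continuous fun x : ℝ => (x : ℂ) + (y : ℂ) * Complex.I := by
    intro y; fun_prop
  have hmem : ∀ x : ℝ, (x : ℂ) + (y : ℂ) * Complex.I ∈ straightStrip S.δ := fun x => by
    simpa [straightStrip, abs_lt] using hy
  have m : Continuous (fun x : ℝ => v (R.inv ((x : ℂ) + (y : ℂ) * Complex.I))) :=
    H.2.1.continuousOn.comp_continuous (hline y) hmem
  have m' : Continuous (fun x : ℝ => R.inv ((x : ℂ) + (t : ℂ) * Complex.I)) :=
    R.inv_continuousOn.comp_continuous (hline t) fun x => by simpa using ht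
  exact m.aestronglyMeasurable.sub (hg.comp m'.measurable).aestronglyMeasurable

theorem IsHardyTrace.add {R : S.Uniformization} {v v' g g' : ℂ → ℂ} (hv : MemHardy R v)
    (hv' : MemHardy R v') (H : IsHardyTrace R v g) (H' : IsHardyTrace R v' g') :
    IsHardyTrace R (v + v') (g + g') := by
  obtain ⟨m, a, b⟩ := H
  obtain ⟨m', a', b'⟩ := H'
  have hδ := S.δ_pos
  have e1 : ∀ᶠ y in 𝓝[<] S.δ, y ∈ Ioo (-S.δ) S.δ := Ioo_mem_nhdsLT (by linarith)
  have e2 : ∀ᶠ y in 𝓝[>] (-S.δ), y ∈ Ioo (-S.δ) S.δ := Ioo_mem_nhdsGT (by linarith)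
  refine ⟨m.add m', ?_, ?_⟩
  · refine tendsto_eLpNorm_add a a' ?_ ?_ fun n => Eventually.of_forall fun x => ?_
    · filter_upwards [e1] with y hy
      exact hardySlice_measurable hv m hy (abs_of_pos hδ).le
    · filter_upwards [e1] with y hy
      exact hardySlice_measurable hv' m' hy (abs_of_pos hδ).le
    · simp only [Pi.add_apply]; ring
  · refine tendsto_eLpNorm_add b b' ?_ ?_ fun n => Eventually.of_forall fun x => ?_
    · filter_upwards [e2] with y hy
      exact hardySlice_measurable hv m hy (by rw [abs_neg]; exact (abs_of_pos hδ).le)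
    · filter_upwards [e2] with y hy
      exact hardySlice_measurable hv' m' hy (by rw [abs_neg]; exact (abs_of_pos hδ).le)
    · simp only [Pi.add_apply]; ring

theorem IsHardyTrace.smul {R : S.Uniformization} {v g : ℂ → ℂ} (k : ℂ)
    (H : IsHardyTrace R v g) : IsHardyTrace R (k • v) (k • g) := by
  obtain ⟨m, a, b⟩ := H
  refine ⟨m.const_smul k, ?_, ?_⟩
  · refine tendsto_eLpNorm_smul k a fun n => Eventually.of_forall fun x => ?_
    simp only [Pi.smul_apply, smul_eq_mul]; ring
  · refine tendsto_eLpNorm_smul k b fun n => Eventually.of_forall fun x => ?_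
    simp only [Pi.smul_apply, smul_eq_mul]; ring

theorem IsFormTrace.add {P : S.Potential} {R : S.Uniformization} {h : ℝ} {u u' : S.L2}
    {g g' : S.L2b} (H : IsFormTrace P R h u g) (H' : IsFormTrace P R h u' g') :
    IsFormTrace P R h (u + u') (g + g') := by
  obtain ⟨u₁, p₁, p₂, g₁, v, g₂, a, b, c, d, e⟩ := H
  obtain ⟨u₁', p₁', p₂', g₁', v', g₂', a', b', c', d', e'⟩ := H'
  refine ⟨_, _, _, _, _, _, a.add a', b.add b', c.add b b' c', ?_, ?_⟩
  · filter_upwards [d, d', Lp.coeFn_add u u', Lp.coeFn_add u₁ u₁'] with z h1 h2 h3 h4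
    rw [h3, h4]; simp only [Pi.add_apply, h1, h2]; ring
  · filter_upwards [e, e', Lp.coeFn_add g g', Lp.coeFn_add g₁ g₁'] with z h1 h2 h3 h4
    rw [h3, h4]; simp only [Pi.add_apply, h1, h2]; ring

theorem IsFormTrace.smul {P : S.Potential} {R : S.Uniformization} {h : ℝ} {u : S.L2}
    {g : S.L2b} (k : ℂ) (H : IsFormTrace P R h u g) : IsFormTrace P R h (k • u) (k • g) := by
  obtain ⟨u₁, p₁, p₂, g₁, v, g₂, a, b, c, d, e⟩ := H
  refine ⟨_, _, _, _, _, _, a.smul k, b.smul k, c.smul k, ?_, ?_⟩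
  · filter_upwards [d, Lp.coeFn_smul k u, Lp.coeFn_smul k u₁] with z h1 h3 h4
    rw [h3, h4]; simp only [Pi.smul_apply, smul_eq_mul, h1]; ring
  · filter_upwards [e, Lp.coeFn_smul k g, Lp.coeFn_smul k g₁] with z h1 h3 h4
    rw [h3, h4]; simp only [Pi.smul_apply, smul_eq_mul, h1]; ring

/-! Zero elements -/

theorem integral_mul_zero {θ : ℂ → ℂ} : ∫ z in S.Ω, θ z * (0 : S.L2) z = 0 := by
  have := integral_mul_smul (θ := θ) 0 (0 : S.L2)
  rwa [zero_smul, zero_mul] at this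

theorem isDTimes_zero (P : S.Potential) (h : ℝ) : IsDTimes P h (0 : S.L2) 0 := fun θ _ => by
  rw [integral_mul_zero, integral_mul_zero]

theorem isWeakDeriv_zero (e : ℂ) : IsWeakDeriv e (0 : S.L2) 0 := fun θ _ => by
  rw [integral_mul_zero, integral_mul_zero, neg_zero]

theorem isSobolevTrace_zero : IsSobolevTrace (0 : S.L2) 0 0 0 := by
  have e := Lp.coeFn_zero ℂ 2 (volume.restrict S.Ω)
  have e' := Lp.coeFn_zero ℂ 2 S.boundaryMeasure
  have key : ∀ {α : Type} [MeasurableSpace α] {μ : Measure α} {f : α → ℂ}, f =ᵐ[μ] 0 →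
      Tendsto (fun _ : ℕ => eLpNorm f 2 μ) atTop (𝓝 0) := by
    intro α _ μ f hf
    rw [eLpNorm_congr_ae hf, eLpNorm_zero]
    exact tendsto_const_nhds
  refine ⟨⟨isWeakDeriv_zero _, isWeakDeriv_zero _⟩, fun _ _ => 0,
    fun _ => ⟨contDiff_const, HasCompactSupport.zero⟩, key ?_, key ?_, key ?_, key ?_⟩
  · filter_upwards [e] with z hz
    rw [hz]; simp
  · filter_upwards [e] with z hz
    rw [hz]; simp
  · filter_upwards [e] with z hz
    rw [hz]; simp
  · filter_upwards [e'] with z hz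
    rw [hz]; simp

theorem infiniteMass_zero : InfiniteMass (0 : S.L2b) 0 := by
  filter_upwards [Lp.coeFn_zero ℂ 2 S.boundaryMeasure] with z hz N _
  rw [hz]
  ext i
  fin_cases i <;> simp [Matrix.mulVec, dotProduct]

theorem diracRel_zero (P : S.Potential) (h : ℝ) : DiracRel P h 0 0 := by
  have e := Lp.coeFn_zero ℂ 2 (volume.restrict S.Ω)
  refine ⟨0, 0, 0, 0, 0, 0, isSobolevTrace_zero, isSobolevTrace_zero, infiniteMass_zero, ?_, ?_⟩
  · filter_upwards [e] with z hz
    rw [WithLp.zero_fst, WithLp.zero_snd, hz]; simp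
  · filter_upwards [e] with z hz
    rw [WithLp.zero_fst, WithLp.zero_snd, hz]; simp

theorem isFormTrace_zero (P : S.Potential) (R : S.Uniformization) (h : ℝ) :
    IsFormTrace P R h 0 0 := by
  refine ⟨0, 0, 0, 0, 0, 0, isSobolevTrace_zero,
    ⟨differentiableOn_const 0, differentiableOn_const 0, 0, fun y _ => ?_⟩,
    ⟨measurable_const, ?_, ?_⟩, ?_, ?_⟩
  · exact (eLpNorm_zero (p := 2) (μ := (volume : Measure ℝ)) (ε := ℂ)).le
  · simp [eLpNorm_zero']
  · simp [eLpNorm_zero']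
  · filter_upwards [Lp.coeFn_zero ℂ 2 (volume.restrict S.Ω)] with z hz
    rw [hz]; simp
  · filter_upwards [Lp.coeFn_zero ℂ 2 S.boundaryMeasure] with z hz
    rw [hz]; simp

/-! ### The operators -/

/-- The graph of the magnetic Dirac operator `D_h`. -/
def diracGraph (P : S.Potential) (h : ℝ) : Submodule ℂ (S.Spinor × S.Spinor) where
  carrier := {x | DiracRel P h x.1 x.2}
  add_mem' := fun a b => DiracRel.add a b
  zero_mem' := diracRel_zero P h
  smul_mem' := fun k _ a => DiracRel.smul k a

/-- The magnetic Dirac operator `D_h` on `L²(Ω; ℂ²)`. -/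
def dirac (P : S.Potential) (h : ℝ) : S.Spinor →ₗ.[ℂ] S.Spinor := (diracGraph P h).toLinearPMap

/-- The graph of the maximal realisation of `d_A^×` in `L²(Ω)`. -/
def dTimesGraph (P : S.Potential) (h : ℝ) : Submodule ℂ (S.L2 × S.L2) where
  carrier := {x | IsDTimes P h x.1 x.2}
  add_mem' := fun a b => IsDTimes.add a b
  zero_mem' := isDTimes_zero P h
  smul_mem' := fun k _ a => IsDTimes.smul k a

/-- The maximal realisation of `d_A^×` in `L²(Ω)`. -/
def dTimes (P : S.Potential) (h : ℝ) : S.L2 →ₗ.[ℂ] S.L2 := (dTimesGraph P h).toLinearPMap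

/-- The elements `u` of the form domain `H¹(Ω) + e^{-φ/h} 𝓗²(Ω)`, each together with `d_A^× u`
and with its trace on `∂Ω`: the triples `(u, d_A^× u, u|_∂Ω)`. -/
def formGraph (P : S.Potential) (R : S.Uniformization) (h : ℝ) :
    Submodule ℂ (S.L2 × S.L2 × S.L2b) where
  carrier := {x | IsDTimes P h x.1 x.2.1 ∧ IsFormTrace P R h x.1 x.2.2}
  add_mem' := fun a b => ⟨a.1.add b.1, a.2.add b.2⟩
  zero_mem' := ⟨isDTimes_zero P h, isFormTrace_zero P R h⟩
  smul_mem' := fun k _ a => ⟨a.1.smul k, a.2.smul k⟩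

/-- The sesquilinear form of `q_λ(u) = ‖d_A^× u‖² + h λ ‖u‖²_∂Ω - λ² ‖u‖²`, linear in `x` and
antilinear in `y`, for `x = (u, d_A^× u, u|_∂Ω)` and `y = (v, d_A^× v, v|_∂Ω)`. -/
def qForm (h lam : ℝ) (x y : S.L2 × S.L2 × S.L2b) : ℂ :=
  ⟪y.2.1, x.2.1⟫_ℂ + (h * lam : ℝ) * ⟪y.2.2, x.2.2⟫_ℂ - (lam ^ 2 : ℝ) * ⟪y.1, x.1⟫_ℂ

/-- The graph of the operator associated with `q_λ`: the pairs `(u, w)` with `u` in the form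
domain and `q_λ(u, v) = ⟨w, v⟩` for all `v` in the form domain. -/
def effGraph (P : S.Potential) (R : S.Uniformization) (h lam : ℝ) :
    Submodule ℂ (S.L2 × S.L2) where
  carrier := {a | ∃ x ∈ formGraph P R h, x.1 = a.1 ∧
    ∀ y ∈ formGraph P R h, qForm h lam x y = ⟪y.1, a.2⟫_ℂ}
  add_mem' := by
    rintro a b ⟨x, hx, ex, qx⟩ ⟨y, hy, ey, qy⟩
    refine ⟨x + y, add_mem hx hy, by simp [ex, ey], fun z hz => ?_⟩
    rw [Prod.snd_add, inner_add_right, ← qx z hz, ← qy z hz]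
    simp only [qForm, Prod.fst_add, Prod.snd_add, inner_add_right]
    ring
  zero_mem' := ⟨0, zero_mem _, rfl, fun z _ => by simp [qForm]⟩
  smul_mem' := by
    rintro k a ⟨x, hx, ex, qx⟩
    refine ⟨k • x, Submodule.smul_mem _ k hx, by simp [ex], fun z hz => ?_⟩
    rw [Prod.smul_snd, inner_smul_right, ← qx z hz]
    simp only [qForm, Prod.smul_fst, Prod.smul_snd, inner_smul_right]
    ring

/-- The operator `L_λ` associated with the form `q_λ`. -/
def effOperator (P : S.Potential) (R : S.Uniformization) (h lam : ℝ) : S.L2 →ₗ.[ℂ] S.L2 :=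
  (effGraph P R h lam).toLinearPMap

theorem effOperator_domain_le (P : S.Potential) (R : S.Uniformization) (h lam : ℝ) :
    (effOperator P R h lam).domain ≤ (dTimes P h).domain := by
  rintro _ ⟨a, ⟨x, hx, ex, -⟩, rfl⟩
  exact ⟨(x.1, x.2.1), hx.1, ex⟩

/-- The map `J_λ(u) = (u, λ⁻¹ d_A^× u)` on the domain of `L_λ`. -/
def jMap (P : S.Potential) (R : S.Uniformization) (h lam : ℝ) :
    (effOperator P R h lam).domain →ₗ[ℂ] S.Spinor :=
  (WithLp.linearEquiv 2 ℂ (S.L2 × S.L2)).symm.toLinearMap ∘ₗ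
    ((effOperator P R h lam).domain.subtype.prod
      (((lam : ℂ)⁻¹) • ((dTimes P h).toFun ∘ₗ
        Submodule.inclusion (effOperator_domain_le P R h lam))))

end CurvedStrip

end

open UnboundedOp CurvedStrip

/-! Two facts carry the theorem: a Green formula on the form domain, and the self-adjointness of
D_h.

The Green formula (`HasGreen.inner_eq`) pairs u in the form domain, with d = d_A^× u and trace g,
with an H¹ function ψ₂ whose trace g₂ is tied to some g₁ by the infinite mass condition: ⟨ψ₂, d⟩ =
⟨d_A ψ₂, u⟩ − h⟨g₁, g⟩. Since g₂ = iN g₁, the flux through ∂Ω becomes exactly the boundary term of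
q_λ. Hence a solution of (D_h − λ)ψ = (a, 0) satisfies L_λ ψ₁ = λa (`mem_effGraph_of_diracRel`).
Conversely, if L_λ u = w, the same formula shows that (u, λ⁻¹d) lies in the domain of the adjoint of
D_h, hence in Dom D_h (`diracRel_of_form`). Thus the H¹ regularity of Dom L_λ is borrowed from D_h
and never proved on L_λ directly.

For the Hardy part of u the formula is Cauchy–Stokes in conformal coordinates on slightly thinner
strips, because e^{-φ/h} conjugates d_A^× into −2ih∂_{z̄} and equals 1 on ∂Ω. The conformal
parametrisation of ∂Ω is never compared with arc length: the trace is approximated by smooth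
functions in L² of both boundary measures at once, and for smooth functions the formula is known in
both descriptions (`integral_hardy_dbar`).

Self-adjointness is proved on a core of smooth pairs satisfying the boundary condition. An a priori
estimate bounds the H¹ norm by the graph norm, the only boundary contribution being a curvature term
(`exists_apriori_estimate`); with the trace inequality it puts the closure of the core inside D_h.
For the reverse inclusion it is enough that the adjoint of the core has a real quadratic form
(`mem_closure_of_adjoint_real`). In tubular coordinates the combinations ψ₁ ± conj(γ')ψ₂ solve a
weak first-order system, each vanishing on one side of the strip. Averaging in s makes the equations
regular enough to integrate by parts in t, the difference quotients in s drop out of the real part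
up to a commutator, and the limit is Im⟨ψ, χ⟩ = 0 (`WeakST.energy`, `IsAdjointPair.im_inner`).

The rest is abstract. The image of J_λ is the set where the second component of (D_h − λ)ψ vanishes,
which gives the kernel isomorphism and the closed range. The cokernel of L_λ embeds in that of D_h −
λ; with the symmetry of L_λ this forces index 0. A discrete eigenvalue of D_h makes D_h − λ Fredholm
of index 0, by functional calculus for a resolvent, and the reduced inverse of L_λ isolates 0 in its
spectrum. -/

namespace CurvedStrip

variable (S : CurvedStrip)

/-! ### Geometry of the tubular map -/

/-- The unit tangent. -/
noncomputable def tangent (s : ℝ) : ℂ := deriv S.γ s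

/-- The curvature of the base curve. -/
noncomputable def curv (s : ℝ) : ℝ := signedCurvature S.γ s

/-- The Jacobian `1 - t κ(s)` of the tubular map. -/
noncomputable def jac (s t : ℝ) : ℝ := 1 - t * S.curv s

theorem contDiff_tangent : ContDiff ℝ ∞ S.tangent :=
  (contDiff_infty_iff_deriv.1 S.smooth).2

theorem continuous_tangent : Continuous S.tangent := S.contDiff_tangent.continuous

theorem norm_tangent (s : ℝ) : ‖S.tangent s‖ = 1 := S.unit_speed s

theorem enorm_tangent (s : ℝ) : ‖S.tangent s‖ₑ = 1 := by
  rw [← ofReal_norm, norm_tangent, ENNReal.ofReal_one]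

theorem tangent_mul_conj (s : ℝ) : S.tangent s * conj (S.tangent s) = 1 := by
  rw [Complex.mul_conj, Complex.normSq_eq_norm_sq, norm_tangent]; simp

theorem conj_mul_tangent (s : ℝ) : conj (S.tangent s) * S.tangent s = 1 := by
  rw [mul_comm, tangent_mul_conj]

theorem unitNormal_eq (s : ℝ) : unitNormal S.γ s = Complex.I * S.tangent s := rfl

theorem hasDerivAt_curve (s : ℝ) : HasDerivAt S.γ (S.tangent s) s :=
  (S.smooth.differentiable (by simp) s).hasDerivAt

/-- Differentiating |γ'|² = 1 shows that γ'' is orthogonal to γ'; so γ'' conj(n) is real and the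
signed curvature, defined as a real part, recovers all of γ''. -/
theorem hasDerivAt_tangent (s : ℝ) :
    HasDerivAt S.tangent (S.curv s * (Complex.I * S.tangent s)) s := by
  have h1 : HasDerivAt S.tangent (deriv S.tangent s) s :=
    (S.contDiff_tangent.differentiable (by simp) s).hasDerivAt
  have h2 : HasDerivAt (fun x => S.tangent x * conj (S.tangent x))
      (deriv S.tangent s * conj (S.tangent s) + S.tangent s * conj (deriv S.tangent s)) s :=
    h1.mul h1.star
  have h3 : deriv S.tangent s * conj (S.tangent s) + S.tangent s * conj (deriv S.tangent s) = 0 := by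
    have : (fun x => S.tangent x * conj (S.tangent x)) = fun _ => (1 : ℂ) :=
      funext S.tangent_mul_conj
    rw [this] at h2
    exact h2.unique (hasDerivAt_const s 1)
  have h4 : S.curv s = (deriv S.tangent s * conj (Complex.I * S.tangent s)).re := rfl
  have h5 : deriv S.tangent s * conj (Complex.I * S.tangent s) = S.curv s := by
    apply Complex.ext
    · rw [h4, Complex.ofReal_re]
    · have := congrArg Complex.re h3
      simp only [Complex.add_re, Complex.mul_re, Complex.conj_re, Complex.conj_im,
        Complex.zero_re] at this
      simp only [map_mul, Complex.conj_I, Complex.mul_im, Complex.mul_re, Complex.neg_re,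
        Complex.neg_im, Complex.I_re, Complex.I_im, Complex.conj_re, Complex.conj_im,
        Complex.ofReal_im]
      linarith
  have h6 : deriv S.tangent s = S.curv s * (Complex.I * S.tangent s) := by
    rw [← h5, mul_assoc, map_mul, mul_assoc]
    have : (conj Complex.I * (conj (S.tangent s) * (Complex.I * S.tangent s)) : ℂ) = 1 := by
      rw [Complex.conj_I]
      linear_combination (-Complex.I ^ 2) * S.tangent_mul_conj s - Complex.I_sq
    rw [this, mul_one]
  rwa [h6] at h1

theorem contDiff_curv : ContDiff ℝ ∞ S.curv := by
  have h1 : ContDiff ℝ ∞ (deriv S.tangent) := (contDiff_infty_iff_deriv.1 S.contDiff_tangent).2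
  have h2 : ContDiff ℝ ∞ (fun s => deriv S.tangent s * conj (Complex.I * S.tangent s)) :=
    h1.mul (Complex.conjCLE.contDiff.comp (contDiff_const.mul S.contDiff_tangent))
  exact Complex.reCLM.contDiff.comp h2

theorem continuous_curv : Continuous S.curv := S.contDiff_curv.continuous

/-- A continuous compactly supported function attains its maximum, so the pointwise bound δ|κ| < 1
becomes uniform. This is what keeps the Jacobian away from zero on the closed strip. -/
theorem exists_curv_bound : ∃ k, 0 ≤ k ∧ k < 1 ∧ ∀ s, S.δ * |S.curv s| ≤ k := by
  have hc : HasCompactSupport S.curv := S.curvature_compact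
  obtain ⟨x, hx⟩ := (S.continuous_curv.abs).exists_forall_ge_of_hasCompactSupport
    (hc.comp_left (g := fun x : ℝ => |x|) (by simp))
  exact ⟨S.δ * |S.curv x|, mul_nonneg S.δ_pos.le (abs_nonneg _), S.curvature_lt x,
    fun s => mul_le_mul_of_nonneg_left (hx s) S.δ_pos.le⟩

theorem jac_le {s t : ℝ} (ht : |t| ≤ S.δ) : S.jac s t ≤ 2 := by
  have h1 : |t * S.curv s| ≤ S.δ * |S.curv s| := by
    rw [abs_mul]; exact mul_le_mul_of_nonneg_right ht (abs_nonneg _)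
  have h2 : S.δ * |S.curv s| < 1 := S.curvature_lt s
  have := abs_le.1 (h1.trans h2.le)
  unfold jac; linarith [this.1]

theorem exists_le_jac : ∃ c > 0, ∀ s t, |t| ≤ S.δ → c ≤ S.jac s t := by
  obtain ⟨k, hk, hk', h⟩ := S.exists_curv_bound
  refine ⟨1 - k, by linarith, fun s t ht => ?_⟩
  have h1 : |t * S.curv s| ≤ S.δ * |S.curv s| := by
    rw [abs_mul]; exact mul_le_mul_of_nonneg_right ht (abs_nonneg _)
  have := abs_le.1 (h1.trans (h s))
  unfold jac; linarith [this.2]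

theorem jac_pos {s t : ℝ} (ht : |t| ≤ S.δ) : 0 < S.jac s t := by
  obtain ⟨c, hc, h⟩ := S.exists_le_jac
  exact hc.trans_le (h s t ht)

theorem contDiff_jac : ContDiff ℝ ∞ (fun p : ℝ × ℝ => S.jac p.1 p.2) :=
  contDiff_const.sub (contDiff_snd.mul (S.contDiff_curv.comp contDiff_fst))

theorem continuous_jac : Continuous (fun p : ℝ × ℝ => S.jac p.1 p.2) := S.contDiff_jac.continuous

/-- The tubular map as a function on `ℝ × ℝ`. -/
noncomputable def tube (p : ℝ × ℝ) : ℂ := S.Θ p.1 p.2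

theorem tube_eq (p : ℝ × ℝ) : S.tube p = S.γ p.1 + p.2 * (Complex.I * S.tangent p.1) := rfl

theorem contDiff_tube : ContDiff ℝ ∞ S.tube :=
  (S.smooth.comp contDiff_fst).add ((Complex.ofRealCLM.contDiff.comp contDiff_snd).mul
    (contDiff_const.mul (S.contDiff_tangent.comp contDiff_fst)))

theorem continuous_tube : Continuous S.tube := S.contDiff_tube.continuous

/-- Since n' = −κγ', the tangential direction is scaled by 1 − tκ and the normal one is not scaled
at all. -/
theorem hasFDerivAt_tube (p : ℝ × ℝ) : HasFDerivAt S.tube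
    ((ContinuousLinearMap.fst ℝ ℝ ℝ).smulRight ((S.jac p.1 p.2 : ℂ) * S.tangent p.1) +
      (ContinuousLinearMap.snd ℝ ℝ ℝ).smulRight (Complex.I * S.tangent p.1)) p := by
  have h1 := (S.hasDerivAt_curve p.1).hasFDerivAt.comp p (hasFDerivAt_fst (𝕜 := ℝ))
  have h2 := (S.hasDerivAt_tangent p.1).hasFDerivAt.comp p (hasFDerivAt_fst (𝕜 := ℝ))
  have h3 := (Complex.ofRealCLM.hasFDerivAt (x := p.2)).comp p (hasFDerivAt_snd (𝕜 := ℝ))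
  refine (h1.add (h3.mul (h2.const_mul Complex.I))).congr_fderiv ?_
  ext
  · simp [jac]; ring_nf; simp; ring
  · simp

theorem hasDerivAt_tube_left (s t : ℝ) :
    HasDerivAt (fun x => S.tube (x, t)) ((S.jac s t : ℂ) * S.tangent s) s := by
  have := (S.hasFDerivAt_tube (s, t)).comp_hasDerivAt s
    ((hasDerivAt_id s).prodMk (hasDerivAt_const s t))
  simpa [Function.comp_def] using this

theorem hasDerivAt_tube_right (s t : ℝ) :
    HasDerivAt (fun x => S.tube (s, x)) (Complex.I * S.tangent s) t := by
  have := (S.hasFDerivAt_tube (s, t)).comp_hasDerivAt t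
    ((hasDerivAt_const t s).prodMk (hasDerivAt_id t))
  simpa [Function.comp_def] using this

theorem Ω_eq : S.Ω = S.tube '' (univ ×ˢ Ioo (-S.δ) S.δ) := rfl

theorem injOn_tube : InjOn S.tube (univ ×ˢ Icc (-S.δ) S.δ) := S.injOn

theorem tube_mem {p : ℝ × ℝ} (hp : p.2 ∈ Ioo (-S.δ) S.δ) : S.tube p ∈ S.Ω :=
  ⟨p, ⟨mem_univ _, hp⟩, rfl⟩

/-! ### Properness -/

/-- Outside the support of the curvature the tangent is constant, so γ consists of a compact arc and
two half-lines. This is the source of the properness of the tubular map. -/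
theorem exists_abs_le_norm_curve : ∃ C, ∀ s, |s| ≤ ‖S.γ s‖ + C := by
  obtain ⟨L, hL0, hL⟩ : ∃ L : ℝ, 0 < L ∧ ∀ s, L ≤ |s| → S.curv s = 0 := by
    have hb := (show HasCompactSupport S.curv from S.curvature_compact).isCompact.isBounded
    obtain ⟨L, hL⟩ := hb.subset_ball (0 : ℝ)
    refine ⟨max L 1, by positivity, fun s hs => ?_⟩
    by_contra h
    have := hL (subset_tsupport _ h)
    rw [mem_ball_zero_iff, Real.norm_eq_abs] at this
    exact absurd this (not_lt.2 ((le_max_left _ _).trans hs))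
  have key : ∀ a b : ℝ, a ≤ b → (∀ s ∈ Ico a b, S.curv s = 0) → ∀ s ∈ Icc a b, S.tangent s = S.tangent a := by
    intro a b _ h0
    refine constant_of_has_deriv_right_zero S.continuous_tangent.continuousOn fun x hx => ?_
    have := (S.hasDerivAt_tangent x).hasDerivWithinAt (s := Ici x)
    rwa [h0 x hx, Complex.ofReal_zero, zero_mul] at this
  have lin : ∀ a b : ℝ, a ≤ b → (∀ s ∈ Ico a b, S.curv s = 0) → ‖S.γ b - S.γ a‖ = b - a := by
    intro a b hab h0
    have h1 := key a b hab h0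
    have h2 : ∀ x ∈ Icc a b, S.γ x - (x : ℂ) * S.tangent a = S.γ a - (a : ℂ) * S.tangent a := by
      refine constant_of_has_deriv_right_zero (f := fun x => S.γ x - (x : ℂ) * S.tangent a) ?_
        fun x hx => ?_
      · have := S.smooth.continuous
        fun_prop
      · have h3 := ((S.hasDerivAt_curve x).sub
          ((Complex.ofRealCLM.hasDerivAt (x := x)).mul_const (S.tangent a)))
        rw [h1 x ⟨hx.1, hx.2.le⟩] at h3
        simpa [Pi.sub_def] using h3.hasDerivWithinAt
    have h3 := h2 b ⟨hab, le_rfl⟩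
    have h4 : S.γ b - S.γ a = ((b - a : ℝ) : ℂ) * S.tangent a := by
      push_cast; linear_combination h3
    rw [h4, norm_mul, norm_tangent, mul_one, Complex.norm_real, Real.norm_eq_abs,
      abs_of_nonneg (by linarith)]
  have hbd := isCompact_Icc.exists_bound_of_continuousOn (s := Icc (-L) L)
    S.smooth.continuous.continuousOn
  obtain ⟨B, hB⟩ := hbd
  refine ⟨L + B, fun s => ?_⟩
  have hB0 : 0 ≤ B := (norm_nonneg _).trans (hB 0 ⟨by linarith, hL0.le⟩)
  rcases le_total L s with h | h
  · have h1 := lin L s h fun x hx => hL x (hx.1.trans (le_abs_self x))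
    have h2 := norm_sub_le (S.γ s) (S.γ L)
    have h3 := hB L ⟨by linarith, le_rfl⟩
    rw [abs_of_nonneg (by linarith)]; linarith
  rcases le_total s (-L) with h' | h'
  · have h1 := lin s (-L) h' fun x hx => hL x (by
      rw [abs_of_nonpos (by linarith [hx.2])]; linarith [hx.2])
    have h2 := norm_sub_le (S.γ (-L)) (S.γ s)
    have h3 := hB (-L) ⟨le_rfl, by linarith⟩
    rw [abs_of_nonpos (by linarith)]; linarith
  · have : |s| ≤ L := abs_le.2 ⟨h', h⟩
    have := norm_nonneg (S.γ s)
    linarith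

theorem exists_abs_le_norm_tube : ∃ C, ∀ s t, |t| ≤ S.δ → |s| ≤ ‖S.tube (s, t)‖ + C := by
  obtain ⟨C, hC⟩ := S.exists_abs_le_norm_curve
  refine ⟨C + S.δ, fun s t ht => ?_⟩
  have h1 := hC s
  have h2 : ‖S.γ s‖ ≤ ‖S.tube (s, t)‖ + ‖(t : ℂ) * (Complex.I * S.tangent s)‖ := by
    rw [tube_eq]
    exact norm_le_add_norm_add _ _
  rw [norm_mul, norm_mul, norm_tangent, Complex.norm_I, Complex.norm_real, Real.norm_eq_abs] at h2
  linarith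

/-- The closed straight strip in tubular coordinates. -/
def closedStrip : Set (ℝ × ℝ) := univ ×ˢ Icc (-S.δ) S.δ

theorem mem_closedStrip {p : ℝ × ℝ} : p ∈ S.closedStrip ↔ |p.2| ≤ S.δ := by
  simp [closedStrip, abs_le]

theorem isClosed_closedStrip : IsClosed S.closedStrip := isClosed_univ.prod isClosed_Icc

theorem isCompact_closedStrip_inter_preimage (K : Set ℂ) (hK : IsCompact K) :
    IsCompact (S.closedStrip ∩ S.tube ⁻¹' K) := by
  obtain ⟨C, hC⟩ := S.exists_abs_le_norm_tube
  obtain ⟨B, hB⟩ := hK.isBounded.subset_closedBall (0 : ℂ)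
  refine IsCompact.of_isClosed_subset (isCompact_Icc.prod isCompact_Icc : IsCompact
    (Icc (-(B + C)) (B + C) ×ˢ Icc (-S.δ) S.δ))
    (S.isClosed_closedStrip.inter (hK.isClosed.preimage S.continuous_tube)) ?_
  rintro ⟨s, t⟩ ⟨h1, h2⟩
  refine ⟨abs_le.1 ?_, h1.2⟩
  have h3 := hC s t (S.mem_closedStrip.1 h1)
  have h4 := hB h2
  rw [mem_closedBall_zero_iff] at h4
  exact h3.trans (by gcongr)

/-- Properness: preimages of a convergent sequence stay in a compact set, so a subsequence of them
converges. -/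
theorem isClosed_image_tube_of_subset {A : Set (ℝ × ℝ)} (hA : IsClosed A)
    (hAS : A ⊆ S.closedStrip) : IsClosed (S.tube '' A) := by
  refine IsSeqClosed.isClosed fun z a hz ha => ?_
  choose q hq hqz using hz
  have hK : IsCompact (insert a (range z)) := ha.isCompact_insert_range
  have hK' := S.isCompact_closedStrip_inter_preimage _ hK
  obtain ⟨p, hp, φ, hφ, hlim⟩ := hK'.tendsto_subseq (x := q)
    fun n => ⟨hAS (hq n), mem_insert_of_mem _ ⟨n, (hqz n).symm⟩⟩
  refine ⟨p, hA.mem_of_tendsto hlim (Eventually.of_forall fun n => hq _), ?_⟩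
  have h1 : Tendsto (fun n => S.tube (q (φ n))) atTop (𝓝 (S.tube p)) :=
    (S.continuous_tube.tendsto p).comp hlim
  simp_rw [hqz] at h1
  exact tendsto_nhds_unique h1 (ha.comp hφ.tendsto_atTop)

theorem isClosed_image_tube : IsClosed (S.tube '' S.closedStrip) :=
  S.isClosed_image_tube_of_subset S.isClosed_closedStrip le_rfl

/-! ### The local inverse of the tubular map -/

/-- The derivative of the tubular map, which is invertible where the Jacobian does not vanish. -/
noncomputable def tubeDeriv (s t : ℝ) (hj : S.jac s t ≠ 0) : (ℝ × ℝ) ≃L[ℝ] ℂ :=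
  LinearEquiv.toContinuousLinearEquiv
    { toFun := fun v => (S.jac s t : ℂ) * S.tangent s * v.1 + Complex.I * S.tangent s * v.2
      map_add' := fun v w => by simp; ring
      map_smul' := fun r v => by simp; ring
      invFun := fun z => ((conj (S.tangent s) * z).re / S.jac s t, (conj (S.tangent s) * z).im)
      left_inv := fun v => by
        have h : conj (S.tangent s) * ((S.jac s t : ℂ) * S.tangent s * v.1
            + Complex.I * S.tangent s * v.2) = ((S.jac s t * v.1 : ℝ) : ℂ) + (v.2 : ℝ) * Complex.I := by
          push_cast
          linear_combination ((S.jac s t : ℂ) * v.1 + Complex.I * v.2) * S.conj_mul_tangent s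
        simp only [h, Complex.add_re, Complex.add_im, Complex.ofReal_re, Complex.ofReal_im,
          Complex.re_ofReal_mul, Complex.im_ofReal_mul, Complex.I_re, Complex.I_im]
        ext
        · simp; field_simp
        · simp
      right_inv := fun z => by
        have h : (S.jac s t : ℂ) * ((((conj (S.tangent s) * z).re / S.jac s t : ℝ)) : ℂ)
            = ((conj (S.tangent s) * z).re : ℂ) := by
          have : (S.jac s t : ℂ) ≠ 0 := by exact_mod_cast hj
          push_cast; field_simp
        have h2 := Complex.re_add_im (conj (S.tangent s) * z)
        simp only
        linear_combination S.tangent s * h + S.tangent s * h2 + z * S.tangent_mul_conj s }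

theorem hasFDerivAt_tube_equiv (p : ℝ × ℝ) (hj : S.jac p.1 p.2 ≠ 0) :
    HasFDerivAt S.tube (S.tubeDeriv p.1 p.2 hj : (ℝ × ℝ) →L[ℝ] ℂ) p := by
  refine (S.hasFDerivAt_tube p).congr_fderiv ?_
  ext <;> simp [tubeDeriv]

theorem isOpen_Ω : IsOpen S.Ω := by
  rw [Ω_eq, isOpen_iff_mem_nhds]
  rintro _ ⟨p, hp, rfl⟩
  have hj := (S.jac_pos (s := p.1) (t := p.2) (abs_le.2 ⟨hp.2.1.le, hp.2.2.le⟩)).ne'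
  have h1 := (S.contDiff_tube.contDiffAt (x := p)).hasStrictFDerivAt' (S.hasFDerivAt_tube_equiv p hj)
    (by simp)
  have h2 := h1.map_nhds_eq_of_equiv
  rw [← h2]
  exact image_mem_map ((isOpen_univ.prod isOpen_Ioo).mem_nhds hp)

theorem closure_Ω : closure S.Ω = S.tube '' S.closedStrip := by
  apply Subset.antisymm
  · refine closure_minimal ?_ S.isClosed_image_tube
    exact image_mono (prod_mono le_rfl Ioo_subset_Icc_self)
  · have hδ := S.δ_pos
    have : closure ((univ : Set ℝ) ×ˢ Ioo (-S.δ) S.δ) = S.closedStrip := by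
      rw [closure_prod_eq, closure_univ, closure_Ioo (by linarith), closedStrip]
    rw [← this]
    exact image_closure_subset_closure_image S.continuous_tube

/-- Injectivity on the closed strip, not only on the open one, keeps the boundary curves out of Ω.
-/
theorem tube_mem_frontier (s : ℝ) {t : ℝ} (ht : |t| = S.δ) : S.tube (s, t) ∈ frontier S.Ω := by
  rw [S.isOpen_Ω.frontier_eq, closure_Ω]
  have h1 : (s, t) ∈ S.closedStrip := S.mem_closedStrip.2 ht.le
  refine ⟨⟨_, h1, rfl⟩, ?_⟩
  rintro ⟨q, hq, h⟩
  have := S.injOn_tube ⟨mem_univ _, Ioo_subset_Icc_self hq.2⟩ h1 h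
  rw [this] at hq
  exact absurd (abs_lt.2 hq.2) (by rw [ht]; exact lt_irrefl _)

end CurvedStrip

namespace CurvedStrip

variable (S : CurvedStrip)

/-! ### Extension of smooth functions from the closed strip to the plane -/

open scoped Manifold in
-- Locally Φ composed with a local inverse of the tubular map is an extension. Being an extension is
-- an affine constraint on the values, so a partition of unity glues the local choices.
theorem exists_smooth_extension {Φ : ℝ × ℝ → ℂ} {W : Set (ℝ × ℝ)} (hW : IsOpen W)
    (hSW : S.closedStrip ⊆ W) (hΦ : ContDiffOn ℝ ∞ Φ W) :
    ∃ G : ℂ → ℂ, ContDiff ℝ ∞ G ∧ ∀ p ∈ S.closedStrip, G (S.tube p) = Φ p := by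
  let t : ℂ → Set ℂ := fun z => {w | ∀ p ∈ S.closedStrip, S.tube p = z → w = Φ p}
  have ht : ∀ z, Convex ℝ (t z) := by
    intro z a ha b hb r r' _ _ hr p hp hpz
    rw [ha p hp hpz, hb p hp hpz, ← add_smul, hr, one_smul]
  have key : ∀ z : ℂ, ∃ U ∈ 𝓝 z, ∃ g : ℂ → ℂ, ContMDiffOn 𝓘(ℝ, ℂ) 𝓘(ℝ, ℂ) ∞ g U ∧
      ∀ y ∈ U, g y ∈ t y := by
    intro z
    by_cases hz : z ∈ S.tube '' S.closedStrip
    · obtain ⟨p, hp, rfl⟩ := hz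
      have hj := (S.jac_pos (s := p.1) (S.mem_closedStrip.1 hp)).ne'
      let e := (S.contDiff_tube.contDiffAt (x := p)).toOpenPartialHomeomorph S.tube
        (S.hasFDerivAt_tube_equiv p hj) (by simp)
      have hpe : p ∈ e.source := ContDiffAt.mem_toOpenPartialHomeomorph_source
        (S.contDiff_tube.contDiffAt (x := p)) (S.hasFDerivAt_tube_equiv p hj) (by simp)
      have hecoe : ∀ q, e q = S.tube q := fun q => rfl
      let V : Set (ℝ × ℝ) := W ∩ {q | S.jac q.1 q.2 ≠ 0}
      have hV : IsOpen V := hW.inter (isOpen_ne_fun S.continuous_jac continuous_const)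
      have hU1 : IsOpen (e.target ∩ e.symm ⁻¹' V) := e.isOpen_inter_preimage_symm hV
      -- Points of the strip outside the local chart might also be mapped near Θ(p). Their images
      -- form a closed set, which misses Θ(p) by injectivity and can be removed from the
      -- neighbourhood.
      have hcl : IsClosed (S.tube '' (S.closedStrip \ e.source)) :=
        S.isClosed_image_tube_of_subset (S.isClosed_closedStrip.sdiff e.open_source) sdiff_subset
      refine ⟨(e.target ∩ e.symm ⁻¹' V) ∩ (S.tube '' (S.closedStrip \ e.source))ᶜ,
        (hU1.inter hcl.isOpen_compl).mem_nhds ⟨⟨?_, ?_⟩, ?_⟩, Φ ∘ e.symm, ?_, ?_⟩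
      · exact e.map_source hpe
      · have : e.symm (S.tube p) = p := e.left_inv hpe
        rw [mem_preimage, this]
        exact ⟨hSW hp, hj⟩
      · rintro ⟨q, hq, hqp⟩
        have := S.injOn_tube hq.1 hp hqp
        rw [this] at hq
        exact hq.2 hpe
      · rw [contMDiffOn_iff_contDiffOn]
        intro y hy
        refine ContDiffAt.contDiffWithinAt ?_
        have h1 : ContDiffAt ℝ ∞ e.symm y :=
          e.contDiffAt_symm hy.1.1 (S.hasFDerivAt_tube_equiv _ hy.1.2.2) S.contDiff_tube.contDiffAt
        exact (hΦ.contDiffAt (hW.mem_nhds hy.1.2.1)).comp y h1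
      · intro y hy q hq hqy
        have hqe : q ∈ e.source := by
          by_contra h
          exact hy.2 ⟨q, ⟨hq, h⟩, hqy⟩
        have : e.symm y = q := by rw [← hqy]; exact e.left_inv hqe
        rw [Function.comp_apply, this]
    · exact ⟨_, S.isClosed_image_tube.isOpen_compl.mem_nhds hz, fun _ => 0, contMDiffOn_const,
        fun y hy p hp hpy => absurd ⟨p, hp, hpy⟩ hy⟩
  obtain ⟨g, hg⟩ := exists_contMDiffMap_forall_mem_convex_of_local 𝓘(ℝ, ℂ) (n := ⊤) ht key
  exact ⟨g, g.contMDiff.contDiff, fun p hp => hg _ p hp rfl⟩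

/-- This produces test functions on the plane from functions prescribed in (s, t). The cut-off
equals 1 on the image of |s| ≤ X, and elsewhere on the closed strip Φ vanishes. -/
theorem exists_extension {Φ : ℝ × ℝ → ℂ} {W : Set (ℝ × ℝ)} (hW : IsOpen W)
    (hSW : S.closedStrip ⊆ W) (hΦ : ContDiffOn ℝ ∞ Φ W) (X : ℝ)
    (hX : ∀ p ∈ S.closedStrip, X < |p.1| → Φ p = 0) :
    ∃ F : ℂ → ℂ, ContDiff ℝ ∞ F ∧ HasCompactSupport F ∧
      ∀ p ∈ S.closedStrip, F (S.tube p) = Φ p := by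
  obtain ⟨G, hG, hGΦ⟩ := S.exists_smooth_extension hW hSW hΦ
  have hK : IsCompact (S.tube '' (Icc (-X) X ×ˢ Icc (-S.δ) S.δ)) :=
    (isCompact_Icc.prod isCompact_Icc).image S.continuous_tube
  obtain ⟨B, hB0, hB⟩ := hK.isBounded.subset_closedBall_lt 0 (0 : ℂ)
  let χ : ContDiffBump (0 : ℂ) := ⟨B, B + 1, hB0, by linarith⟩
  refine ⟨fun z => χ z • G z, χ.contDiff.smul hG, χ.hasCompactSupport.smul_right, fun p hp => ?_⟩
  simp only [hGΦ p hp]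
  by_cases h : X < |p.1|
  · rw [hX p hp h, smul_zero]
  · have : χ (S.tube p) = 1 := χ.one_of_mem_closedBall
      (hB ⟨p, ⟨abs_le.1 (not_lt.1 h), hp.2⟩, rfl⟩)
    rw [this, one_smul]

/-! ### Integration in tubular coordinates -/

/-- Lebesgue measure on `ℝ × (-δ, δ)`. -/
noncomputable def stripMeasure : Measure (ℝ × ℝ) :=
  (volume : Measure ℝ).prod (volume.restrict (Ioo (-S.δ) S.δ))

instance : SFinite S.stripMeasure := by unfold stripMeasure; infer_instance

instance : IsLocallyFiniteMeasure S.stripMeasure := by unfold stripMeasure; infer_instance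

theorem stripMeasure_eq : S.stripMeasure = volume.restrict (univ ×ˢ Ioo (-S.δ) S.δ) := by
  rw [stripMeasure, Measure.volume_eq_prod, ← Measure.prod_restrict, Measure.restrict_univ]

theorem ae_stripMeasure : ∀ᵐ p ∂S.stripMeasure, p.2 ∈ Ioo (-S.δ) S.δ := by
  rw [stripMeasure_eq]
  filter_upwards [ae_restrict_mem (MeasurableSet.univ.prod measurableSet_Ioo)] with p hp using hp.2

theorem map_tube_withDensity : (S.stripMeasure.withDensity
    fun p => ENNReal.ofReal (S.jac p.1 p.2)).map S.tube = volume.restrict S.Ω := by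
  -- The change of variables formula takes the determinant of an endomorphism, so (s, t) is encoded
  -- as the complex number s + it.
  let L : ℂ → ℂ →L[ℝ] ℂ := fun w =>
    Complex.reCLM.smulRight ((S.jac w.re w.im : ℂ) * S.tangent w.re) +
      Complex.imCLM.smulRight (Complex.I * S.tangent w.re)
  have hdet : ∀ w, (L w).det = S.jac w.re w.im := by
    intro w
    have h1 := S.conj_mul_tangent w.re
    have h2 : (S.tangent w.re).re ^ 2 + (S.tangent w.re).im ^ 2 = 1 := by
      have := congrArg Complex.re h1
      simp [Complex.mul_re] at this
      linarith
    rw [ContinuousLinearMap.det, ← LinearMap.det_toMatrix Complex.basisOneI, Matrix.det_fin_two]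
    simp [LinearMap.toMatrix_apply, L]
    linear_combination S.jac w.re w.im * h2
  let T : ℂ → ℂ := fun w => S.tube (w.re, w.im)
  have hT : ∀ w, HasFDerivAt T (L w) w := by
    intro w
    have := (S.hasFDerivAt_tube (w.re, w.im)).comp w
      ((Complex.reCLM.hasFDerivAt (x := w)).prodMk (Complex.imCLM.hasFDerivAt (x := w)))
    refine this.congr_fderiv ?_
    ext; simp [L]
  let A : Set ℂ := straightStrip S.δ
  have hAo : IsOpen A := isOpen_lt (by fun_prop) continuous_const
  have hmp := Complex.volume_preserving_equiv_real_prod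
  have hA : Complex.measurableEquivRealProd ⁻¹' (univ ×ˢ Ioo (-S.δ) S.δ) = A := by
    ext w; simp [A, straightStrip, abs_lt]
  have himg : T '' A = S.Ω := by
    rw [Ω_eq]
    ext z; constructor
    · rintro ⟨w, hw, rfl⟩
      exact ⟨(w.re, w.im), ⟨mem_univ _, abs_lt.1 hw⟩, rfl⟩
    · rintro ⟨p, hp, rfl⟩
      exact ⟨⟨p.1, p.2⟩, abs_lt.2 hp.2, rfl⟩
  have hinj : InjOn T A := by
    intro a ha b hb hab
    have hA' : ∀ w ∈ A, (w.re, w.im) ∈ univ ×ˢ Icc (-S.δ) S.δ :=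
      fun w hw => ⟨mem_univ _, Ioo_subset_Icc_self (abs_lt.1 hw)⟩
    have := S.injOn_tube (hA' a ha) (hA' b hb) hab
    simp only [Prod.mk.injEq] at this
    exact Complex.ext this.1 this.2
  have hTm : Measurable T := by
    have := S.continuous_tube
    fun_prop
  have h1 := map_withDensity_abs_det_fderiv_eq_addHaar volume hAo.measurableSet.nullMeasurableSet
    (fun x _ => (hT x).hasFDerivWithinAt) hinj
  rw [himg] at h1
  have h2 : S.stripMeasure =
      (volume.restrict A).map Complex.measurableEquivRealProd := by
    rw [stripMeasure_eq, ← hA, ← hmp.map_eq, Measure.restrict_map hmp.measurable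
      (MeasurableSet.univ.prod measurableSet_Ioo)]
  rw [← h1, h2]
  have hjm : Measurable fun p : ℝ × ℝ => ENNReal.ofReal (S.jac p.1 p.2) :=
    S.continuous_jac.measurable.ennreal_ofReal
  ext s hs
  rw [Measure.map_apply S.continuous_tube.measurable hs, Measure.map_apply hTm hs,
    withDensity_apply _ (hTm hs), withDensity_apply _ (S.continuous_tube.measurable hs),
    setLIntegral_map (S.continuous_tube.measurable hs) hjm hmp.measurable]
  refine setLIntegral_congr_fun_ae (hTm hs) ?_
  filter_upwards [ae_restrict_mem hAo.measurableSet] with w hw _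
  rw [hdet, abs_of_pos (S.jac_pos (le_of_lt hw))]
  rfl

theorem quasiMeasurePreserving_tube :
    Measure.QuasiMeasurePreserving S.tube S.stripMeasure (volume.restrict S.Ω) := by
  refine ⟨S.continuous_tube.measurable, ?_⟩
  rw [← S.map_tube_withDensity]
  refine Measure.AbsolutelyContinuous.map ?_ S.continuous_tube.measurable
  refine withDensity_absolutelyContinuous' ?_ ?_
  · exact S.continuous_jac.measurable.ennreal_ofReal.aemeasurable
  · filter_upwards [S.ae_stripMeasure] with p hp
    exact (ENNReal.ofReal_pos.2 (S.jac_pos (abs_le.2 ⟨hp.1.le, hp.2.le⟩))).ne'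

theorem integral_Ω_smul {E : Type*} [NormedAddCommGroup E] [NormedSpace ℝ E] {f : ℂ → E}
    (hf : AEStronglyMeasurable f (volume.restrict S.Ω)) :
    ∫ z in S.Ω, f z = ∫ p, S.jac p.1 p.2 • f (S.tube p) ∂S.stripMeasure := by
  rw [← S.map_tube_withDensity] at hf ⊢
  rw [integral_map S.continuous_tube.aemeasurable hf,
    integral_withDensity_eq_integral_toReal_smul S.continuous_jac.measurable.ennreal_ofReal
      (Eventually.of_forall fun _ => ENNReal.ofReal_lt_top)]
  refine integral_congr_ae ?_
  filter_upwards [S.ae_stripMeasure] with p hp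
  rw [ENNReal.toReal_ofReal (S.jac_pos (abs_le.2 ⟨hp.1.le, hp.2.le⟩)).le]

theorem integral_Ω {f : ℂ → ℂ} (hf : AEStronglyMeasurable f (volume.restrict S.Ω)) :
    ∫ z in S.Ω, f z = ∫ p, (S.jac p.1 p.2 : ℂ) * f (S.tube p) ∂S.stripMeasure := by
  simp_rw [S.integral_Ω_smul hf, Complex.real_smul]

theorem lintegral_Ω {f : ℂ → ℝ≥0∞} (hf : AEMeasurable f (volume.restrict S.Ω)) :
    ∫⁻ z in S.Ω, f z = ∫⁻ p, ENNReal.ofReal (S.jac p.1 p.2) * f (S.tube p) ∂S.stripMeasure := by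
  have hq := hf.comp_quasiMeasurePreserving S.quasiMeasurePreserving_tube
  rw [← S.map_tube_withDensity] at hf ⊢
  rw [lintegral_map' hf S.continuous_tube.aemeasurable,
    ← Function.comp_def f, lintegral_withDensity_eq_lintegral_mul₀
      S.continuous_jac.measurable.ennreal_ofReal.aemeasurable hq]
  rfl

theorem memLp_comp_tube {f : ℂ → ℂ} (hf : MemLp f 2 (volume.restrict S.Ω)) :
    MemLp (fun p => f (S.tube p)) 2 S.stripMeasure := by
  obtain ⟨c, hc, hcj⟩ := S.exists_le_jac
  refine ⟨hf.1.comp_quasiMeasurePreserving S.quasiMeasurePreserving_tube, ?_⟩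
  rw [eLpNorm_lt_top_iff_lintegral_rpow_enorm_lt_top (by norm_num) (by norm_num)]
  have h1 := (eLpNorm_lt_top_iff_lintegral_rpow_enorm_lt_top (by norm_num) (by norm_num)).1 hf.2
  rw [S.lintegral_Ω (hf.1.enorm.pow_const _)] at h1
  have h2 : ∫⁻ p, ENNReal.ofReal c * ‖f (S.tube p)‖ₑ ^ (2 : ℝ≥0∞).toReal ∂S.stripMeasure < ⊤ := by
    refine lt_of_le_of_lt (lintegral_mono_ae ?_) h1
    filter_upwards [S.ae_stripMeasure] with p hp
    gcongr
    exact hcj _ _ (abs_le.2 ⟨hp.1.le, hp.2.le⟩)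
  rw [lintegral_const_mul' _ _ ENNReal.ofReal_ne_top] at h2
  exact (ENNReal.mul_lt_top_iff.1 h2).elim (fun h => h.2) fun h => h.elim
    (fun h => absurd h (ENNReal.ofReal_pos.2 hc).ne') fun h => h ▸ ENNReal.zero_lt_top

/-! ### Integration over the boundary -/

theorem enorm_deriv_tube {t : ℝ} (ht : |t| ≤ S.δ) (s : ℝ) :
    ((‖deriv (fun s' : ℝ => S.Θ s' t) s‖₊ : ℝ≥0) : ℝ≥0∞) = ENNReal.ofReal (S.jac s t) := by
  have h1 := (S.hasDerivAt_tube_left s t).deriv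
  have h2 : (fun s' : ℝ => S.Θ s' t) = fun x => S.tube (x, t) := rfl
  rw [h2, h1, ← enorm_eq_nnnorm, ← ofReal_norm, norm_mul, norm_tangent, mul_one,
    Complex.norm_real, Real.norm_eq_abs, abs_of_pos (S.jac_pos ht)]

theorem arcLength_eq {t : ℝ} (ht : |t| ≤ S.δ) : S.arcLength t =
    (volume.withDensity fun s : ℝ => ENNReal.ofReal (S.jac s t)).map fun s => S.tube (s, t) := by
  unfold arcLength
  simp_rw [S.enorm_deriv_tube ht]
  rfl

theorem continuous_tube_left (t : ℝ) : Continuous fun s => S.tube (s, t) := by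
  have := S.continuous_tube
  fun_prop

theorem continuous_jac_left (t : ℝ) : Continuous fun s => S.jac s t := by
  have := S.continuous_jac
  fun_prop

theorem quasiMeasurePreserving_arc {t : ℝ} (ht : |t| ≤ S.δ) :
    Measure.QuasiMeasurePreserving (fun s => S.tube (s, t)) volume (S.arcLength t) := by
  refine ⟨(S.continuous_tube_left t).measurable, ?_⟩
  rw [S.arcLength_eq ht]
  refine Measure.AbsolutelyContinuous.map ?_ (S.continuous_tube_left t).measurable
  refine withDensity_absolutelyContinuous' ?_ ?_
  · exact (S.continuous_jac_left t).measurable.ennreal_ofReal.aemeasurable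
  · filter_upwards with p
    exact (ENNReal.ofReal_pos.2 (S.jac_pos ht)).ne'

theorem lintegral_arc {t : ℝ} (ht : |t| ≤ S.δ) {f : ℂ → ℝ≥0∞} (hf : AEMeasurable f (S.arcLength t)) :
    ∫⁻ z, f z ∂S.arcLength t = ∫⁻ s, ENNReal.ofReal (S.jac s t) * f (S.tube (s, t)) := by
  have hq := hf.comp_quasiMeasurePreserving (S.quasiMeasurePreserving_arc ht)
  rw [S.arcLength_eq ht] at hf ⊢
  rw [lintegral_map' hf (S.continuous_tube_left t).aemeasurable]
  change ∫⁻ a, (f ∘ fun s => S.tube (s, t)) a ∂_ = _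
  rw [lintegral_withDensity_eq_lintegral_mul₀
      (S.continuous_jac_left t).measurable.ennreal_ofReal.aemeasurable hq]
  rfl

theorem integral_arc_smul {E : Type*} [NormedAddCommGroup E] [NormedSpace ℝ E] {t : ℝ}
    (ht : |t| ≤ S.δ) {f : ℂ → E} (hf : AEStronglyMeasurable f (S.arcLength t)) :
    ∫ z, f z ∂S.arcLength t = ∫ s, S.jac s t • f (S.tube (s, t)) := by
  rw [S.arcLength_eq ht] at hf ⊢
  rw [integral_map (S.continuous_tube_left t).aemeasurable hf,
    integral_withDensity_eq_integral_toReal_smul (S.continuous_jac_left t).measurable.ennreal_ofReal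
      (Eventually.of_forall fun _ => ENNReal.ofReal_lt_top)]
  simp_rw [ENNReal.toReal_ofReal (S.jac_pos ht).le]

theorem integral_arc {t : ℝ} (ht : |t| ≤ S.δ) {f : ℂ → ℂ}
    (hf : AEStronglyMeasurable f (S.arcLength t)) :
    ∫ z, f z ∂S.arcLength t = ∫ s, (S.jac s t : ℂ) * f (S.tube (s, t)) := by
  simp_rw [S.integral_arc_smul ht hf, Complex.real_smul]

theorem integrable_arc {t : ℝ} (ht : |t| ≤ S.δ) {f : ℂ → ℂ} (hf : Integrable f (S.arcLength t)) :
    Integrable fun s => (S.jac s t : ℂ) * f (S.tube (s, t)) := by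
  rw [S.arcLength_eq ht] at hf
  have h1 := hf.comp_measurable (S.continuous_tube_left t).measurable
  rw [integrable_withDensity_iff_integrable_smul'
    (S.continuous_jac_left t).measurable.ennreal_ofReal
      (Eventually.of_forall fun _ => ENNReal.ofReal_lt_top)] at h1
  simpa [ENNReal.toReal_ofReal (S.jac_pos ht).le, Complex.real_smul] using h1

theorem abs_δ : |S.δ| ≤ S.δ := (abs_of_pos S.δ_pos).le

theorem abs_neg_δ : |-S.δ| ≤ S.δ := by rw [abs_neg]; exact S.abs_δ

theorem isLocallyFiniteMeasure_arcLength {t : ℝ} (ht : |t| ≤ S.δ) :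
    IsFiniteMeasureOnCompacts (S.arcLength t) := by
  refine ⟨fun K hK => ?_⟩
  rw [S.arcLength_eq ht, Measure.map_apply (S.continuous_tube_left t).measurable hK.measurableSet,
    withDensity_apply _ ((S.continuous_tube_left t).measurable hK.measurableSet)]
  have h1 : IsCompact ((fun s => S.tube (s, t)) ⁻¹' K) := by
    have h2 := (S.isCompact_closedStrip_inter_preimage K hK).image continuous_fst
    refine h2.of_isClosed_subset (hK.isClosed.preimage (S.continuous_tube_left t)) ?_
    intro s hs
    exact ⟨(s, t), ⟨S.mem_closedStrip.2 ht, hs⟩, rfl⟩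
  have : ∫⁻ s in (fun s => S.tube (s, t)) ⁻¹' K, ENNReal.ofReal (S.jac s t) ≤
      ∫⁻ s in (fun s => S.tube (s, t)) ⁻¹' K, ENNReal.ofReal 2 :=
    lintegral_mono fun s => ENNReal.ofReal_le_ofReal (S.jac_le ht)
  refine this.trans_lt ?_
  rw [setLIntegral_const]
  exact ENNReal.mul_lt_top ENNReal.ofReal_lt_top h1.measure_lt_top

instance : IsFiniteMeasureOnCompacts S.boundaryMeasure := by
  have h1 := S.isLocallyFiniteMeasure_arcLength S.abs_δ
  have h2 := S.isLocallyFiniteMeasure_arcLength S.abs_neg_δ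
  refine ⟨fun K hK => ?_⟩
  rw [boundaryMeasure, Measure.add_apply]
  exact ENNReal.add_lt_top.2 ⟨hK.measure_lt_top, hK.measure_lt_top⟩

end CurvedStrip

namespace CurvedStrip

variable (S : CurvedStrip)

/-! ### Integration by parts on the straight strip -/

theorem integrable_strip {E : Type*} [NormedAddCommGroup E] {f : ℝ × ℝ → E} (hf : Continuous f) {X : ℝ}
    (hX : ∀ p : ℝ × ℝ, p.2 ∈ Ioo (-S.δ) S.δ → X < |p.1| → f p = 0) :
    Integrable f S.stripMeasure := by
  rw [stripMeasure_eq]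
  have hc : IsCompact (Icc (-X) X ×ˢ Icc (-S.δ) S.δ) := isCompact_Icc.prod isCompact_Icc
  refine IntegrableOn.of_forall_sdiff_eq_zero (s := (Icc (-X) X ×ˢ Ioo (-S.δ) S.δ))
    ((hf.continuousOn.integrableOn_compact hc).mono_set
      (prod_mono le_rfl Ioo_subset_Icc_self))
    (MeasurableSet.univ.prod measurableSet_Ioo) ?_
  rintro p ⟨h1, h2⟩
  refine hX p h1.2 ?_
  by_contra h
  exact h2 ⟨abs_le.1 (not_lt.1 h), h1.2⟩

theorem integral_strip_deriv_left {f f' : ℝ × ℝ → ℂ}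
    (hd : ∀ s t, HasDerivAt (fun x => f (x, t)) (f' (s, t)) s) (hf : Integrable f S.stripMeasure)
    (hf' : Integrable f' S.stripMeasure) : ∫ p, f' p ∂S.stripMeasure = 0 := by
  unfold stripMeasure at *
  rw [integral_prod_symm _ hf']
  refine integral_eq_zero_of_ae ?_
  filter_upwards [hf.prod_left_ae, hf'.prod_left_ae] with t h1 h2
  exact integral_eq_zero_of_hasDerivAt_of_integrable (fun s => hd s t) h2 h1

theorem integral_strip_deriv_right {f f' : ℝ × ℝ → ℂ}
    (hd : ∀ s t, HasDerivAt (fun x => f (s, x)) (f' (s, t)) t)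
    (hf' : Integrable f' S.stripMeasure) (hc : Continuous f') :
    ∫ p, f' p ∂S.stripMeasure = ∫ s, (f (s, S.δ) - f (s, -S.δ)) := by
  have hδ := S.δ_pos
  unfold stripMeasure at *
  rw [integral_prod _ hf']
  refine integral_congr_ae (Eventually.of_forall fun s => ?_)
  simp only
  rw [← integral_Ioc_eq_integral_Ioo, ← intervalIntegral.integral_of_le (by linarith)]
  exact intervalIntegral.integral_eq_sub_of_hasDerivAt (fun t _ => hd s t)
    (Continuous.intervalIntegrable (by fun_prop) _ _)

theorem exists_bound_of_isCompact {K : Set ℂ} (hK : IsCompact K) :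
    ∃ X : ℝ, ∀ p : ℝ × ℝ, |p.2| ≤ S.δ → X < |p.1| → S.tube p ∉ K := by
  have h := (S.isCompact_closedStrip_inter_preimage K hK).image continuous_fst
  obtain ⟨X, hX⟩ := h.isBounded.subset_closedBall (0 : ℝ)
  refine ⟨X, fun p hp hpX hpK => ?_⟩
  have := hX ⟨p, ⟨S.mem_closedStrip.2 hp, hpK⟩, rfl⟩
  rw [mem_closedBall_zero_iff, Real.norm_eq_abs] at this
  linarith

/-- The derivative along the curves `t = const`, in tubular coordinates. -/
theorem hasDerivAt_comp_tube_left {F : ℂ → ℂ} (hF : ContDiff ℝ ∞ F) (s t : ℝ) :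
    HasDerivAt (fun x => F (S.tube (x, t)))
      (S.jac s t * fderiv ℝ F (S.tube (s, t)) (S.tangent s)) s := by
  have h1 := ((hF.differentiable (by simp) (S.tube (s, t))).hasFDerivAt).comp_hasDerivAt s
    (S.hasDerivAt_tube_left s t)
  have h2 : (S.jac s t : ℂ) * S.tangent s = S.jac s t • S.tangent s := by
    rw [Complex.real_smul]
  rw [h2, map_smul, Complex.real_smul] at h1
  exact h1

theorem hasDerivAt_comp_tube_right {F : ℂ → ℂ} (hF : ContDiff ℝ ∞ F) (s t : ℝ) :
    HasDerivAt (fun x => F (S.tube (s, x)))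
      (fderiv ℝ F (S.tube (s, t)) (Complex.I * S.tangent s)) t :=
  ((hF.differentiable (by simp) (S.tube (s, t))).hasFDerivAt).comp_hasDerivAt t
    (S.hasDerivAt_tube_right s t)

theorem clm_apply_eq (L : ℂ →L[ℝ] ℂ) (w : ℂ) : L w = w.re * L 1 + w.im * L Complex.I := by
  have h : w = w.re • (1 : ℂ) + w.im • Complex.I := by
    simp [Complex.re_add_im]
  conv_lhs => rw [h, map_add, map_smul, map_smul]
  simp

/-- The Cauchy–Riemann operator is covariant under rotations: the frame (w, iw) costs a factor conj
w. With w = γ' this passes to tubular coordinates. -/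
theorem clm_dbar_rotate (L : ℂ →L[ℝ] ℂ) (w : ℂ) :
    L w + Complex.I * L (Complex.I * w) = conj w * (L 1 + Complex.I * L Complex.I) := by
  rw [clm_apply_eq L w, clm_apply_eq L (Complex.I * w)]
  have h : conj w = w.re - w.im * Complex.I := by
    apply Complex.ext <;> simp
  rw [h]
  simp
  linear_combination ((w.im : ℂ) * L Complex.I) * Complex.I_sq

theorem clm_d_rotate (L : ℂ →L[ℝ] ℂ) (w : ℂ) :
    L w - Complex.I * L (Complex.I * w) = w * (L 1 - Complex.I * L Complex.I) := by
  rw [clm_apply_eq L w, clm_apply_eq L (Complex.I * w)]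
  have h : w = w.re + w.im * Complex.I := (Complex.re_add_im w).symm
  simp
  linear_combination ((w.im : ℂ) * L Complex.I) * Complex.I_sq -
    (L 1 - Complex.I * L Complex.I) * h

/-- The boundary integral `∫_∂Ω N H`. -/
noncomputable def bdry (H : ℂ → ℂ) : ℂ :=
  (∫ s, Complex.I * S.tangent s * (S.jac s S.δ * H (S.tube (s, S.δ)))) -
    ∫ s, Complex.I * S.tangent s * (S.jac s (-S.δ) * H (S.tube (s, -S.δ)))

variable {S} in
theorem memLp_smooth {F : ℂ → ℂ} (hF : Continuous F) (hc : HasCompactSupport F) :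
    MemLp F 2 (volume.restrict S.Ω) := (hF.memLp_of_hasCompactSupport hc).restrict _

theorem exists_tsupport_bound {F : ℂ → ℂ} (hc : HasCompactSupport F) :
    ∃ X : ℝ, ∀ p : ℝ × ℝ, |p.2| ≤ S.δ → X < |p.1| →
      F (S.tube p) = 0 ∧ fderiv ℝ F (S.tube p) = 0 := by
  obtain ⟨X, hX⟩ := S.exists_bound_of_isCompact hc.isCompact
  refine ⟨X, fun p hp hpX => ⟨image_eq_zero_of_notMem_tsupport (hX p hp hpX), ?_⟩⟩
  by_contra h
  exact hX p hp hpX (support_fderiv_subset ℝ h)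

theorem integrable_arc_smooth {F : ℂ → ℂ} (hF : Continuous F) (hc : HasCompactSupport F) {t : ℝ}
    (ht : |t| ≤ S.δ) {g : ℝ → ℂ} (hg : Continuous g) :
    Integrable fun s => g s * F (S.tube (s, t)) := by
  obtain ⟨X, hX⟩ := S.exists_tsupport_bound hc
  have hcont : Continuous fun s => g s * F (S.tube (s, t)) := by
    have := S.continuous_tube; fun_prop
  refine hcont.integrable_of_hasCompactSupport ?_
  refine HasCompactSupport.intro (isCompact_Icc (a := -X) (b := X)) fun s hs => ?_
  rw [(hX (s, t) ht ?_).1, mul_zero]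
  by_contra h
  exact hs (abs_le.1 (not_lt.1 h))

/-- In tubular coordinates J(∂₁ + i∂₂)H = ∂_s(γ'H) + ∂_t(iγ'JH): the derivative of γ' in s and that
of J in t contribute opposite curvature terms. The s-derivative integrates to zero and the
t-derivative gives the two boundary curves. -/
theorem integral_dbar_eq_bdry {H : ℂ → ℂ} (hH : ContDiff ℝ ∞ H) (hc : HasCompactSupport H) :
    ∫ z in S.Ω, (fderiv ℝ H z 1 + Complex.I * fderiv ℝ H z Complex.I) = S.bdry H := by
  have hHd : Continuous (fderiv ℝ H) := hH.continuous_fderiv (by simp)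
  have hHc := hH.continuous
  have htc := S.continuous_tube
  have hT := S.continuous_tangent
  have hj := S.continuous_jac
  have hk := S.continuous_curv
  obtain ⟨X, hX⟩ := S.exists_tsupport_bound hc
  rw [S.integral_Ω (by fun_prop)]
  let f : ℝ × ℝ → ℂ := fun p => S.tangent p.1 * H (S.tube p)
  let f' : ℝ × ℝ → ℂ := fun p => S.curv p.1 * (Complex.I * S.tangent p.1) * H (S.tube p) +
    S.tangent p.1 * (S.jac p.1 p.2 * fderiv ℝ H (S.tube p) (S.tangent p.1))
  let g : ℝ × ℝ → ℂ := fun p => Complex.I * S.tangent p.1 * (S.jac p.1 p.2 * H (S.tube p))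
  let g' : ℝ × ℝ → ℂ := fun p => Complex.I * S.tangent p.1 * (-(S.curv p.1 : ℂ) * H (S.tube p) +
    S.jac p.1 p.2 * fderiv ℝ H (S.tube p) (Complex.I * S.tangent p.1))
  have hf : ∀ s t, HasDerivAt (fun x => f (x, t)) (f' (s, t)) s := fun s t =>
    (S.hasDerivAt_tangent s).mul (S.hasDerivAt_comp_tube_left hH s t)
  have hg : ∀ s t, HasDerivAt (fun x => g (s, x)) (g' (s, t)) t := by
    intro s t
    have h1 : HasDerivAt (fun x : ℝ => ((S.jac s x : ℝ) : ℂ)) (-(S.curv s : ℂ)) t := by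
      have : HasDerivAt (fun x : ℝ => S.jac s x) (-S.curv s) t := by
        have := ((hasDerivAt_id t).mul_const (S.curv s)).const_sub 1
        simpa [jac] using this
      have := this.ofReal_comp
      simpa using this
    exact (h1.mul (S.hasDerivAt_comp_tube_right hH s t)).const_mul (Complex.I * S.tangent s)
  have hfi : Integrable f S.stripMeasure := S.integrable_strip (X := X) (by fun_prop)
    fun p hp h => by simp [f, (hX p (abs_le.2 ⟨hp.1.le, hp.2.le⟩) h).1]
  have hfi' : Integrable f' S.stripMeasure := S.integrable_strip (X := X) (by fun_prop)
    fun p hp h => by simp [f', (hX p (abs_le.2 ⟨hp.1.le, hp.2.le⟩) h)]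
  have hgc' : Continuous g' := by fun_prop
  have hgi' : Integrable g' S.stripMeasure := S.integrable_strip (X := X) hgc'
    fun p hp h => by simp [g', (hX p (abs_le.2 ⟨hp.1.le, hp.2.le⟩) h)]
  have hsum : ∀ p, (S.jac p.1 p.2 : ℂ) * (fderiv ℝ H (S.tube p) 1 +
      Complex.I * fderiv ℝ H (S.tube p) Complex.I) = f' p + g' p := by
    intro p
    have h1 := clm_dbar_rotate (fderiv ℝ H (S.tube p)) (S.tangent p.1)
    have h2 := S.tangent_mul_conj p.1
    simp only [f', g']
    linear_combination (-(S.jac p.1 p.2 : ℂ) * S.tangent p.1) * h1 - (S.jac p.1 p.2 : ℂ) *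
      (fderiv ℝ H (S.tube p) 1 + Complex.I * fderiv ℝ H (S.tube p) Complex.I) * h2
  simp_rw [hsum]
  rw [integral_add hfi' hgi', S.integral_strip_deriv_left hf hfi hfi', zero_add,
    S.integral_strip_deriv_right hg hgi' hgc', integral_sub, bdry]
  · have := S.integrable_arc_smooth hHc hc S.abs_δ (g := fun s => Complex.I * S.tangent s * S.jac s S.δ)
      (by fun_prop)
    simpa only [mul_assoc, g] using this
  · have := S.integrable_arc_smooth hHc hc S.abs_neg_δ
      (g := fun s => Complex.I * S.tangent s * S.jac s (-S.δ)) (by fun_prop)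
    simpa only [mul_assoc, g] using this

/-! ### Trace inequality -/

/-- `∫ ‖F‖²` over `Ω`. -/
noncomputable def sqΩ (F : ℂ → ℂ) : ℝ := ∫ z in S.Ω, ‖F z‖ ^ 2

/-- `‖∇F‖²` in `L²(Ω)`. -/
noncomputable def gradΩ (F : ℂ → ℂ) : ℝ :=
  S.sqΩ (fun z => fderiv ℝ F z 1) + S.sqΩ (fun z => fderiv ℝ F z Complex.I)

theorem sqΩ_eq {F : ℂ → ℂ} (hF : Continuous F) :
    S.sqΩ F = ∫ p, S.jac p.1 p.2 * ‖F (S.tube p)‖ ^ 2 ∂S.stripMeasure := by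
  rw [sqΩ, S.integral_Ω_smul (by fun_prop)]
  rfl

theorem norm_grad_rotate (L : ℂ →L[ℝ] ℂ) {w : ℂ} (hw : ‖w‖ = 1) :
    ‖L w‖ ^ 2 + ‖L (Complex.I * w)‖ ^ 2 = ‖L 1‖ ^ 2 + ‖L Complex.I‖ ^ 2 := by
  have h : w.re * w.re + w.im * w.im = 1 := by
    rw [← Complex.normSq_apply, Complex.normSq_eq_norm_sq, hw]; norm_num
  rw [clm_apply_eq L w, clm_apply_eq L (Complex.I * w)]
  simp only [← Complex.normSq_eq_norm_sq, Complex.normSq_apply]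
  simp
  linear_combination ((L 1).re ^ 2 + (L 1).im ^ 2 + (L Complex.I).re ^ 2 + (L Complex.I).im ^ 2) * h

theorem gradΩ_eq {F : ℂ → ℂ} (hF : ContDiff ℝ ∞ F) (hc : HasCompactSupport F) :
    S.gradΩ F = ∫ p, S.jac p.1 p.2 * (‖fderiv ℝ F (S.tube p) (S.tangent p.1)‖ ^ 2 +
      ‖fderiv ℝ F (S.tube p) (Complex.I * S.tangent p.1)‖ ^ 2) ∂S.stripMeasure := by
  have hd : Continuous (fderiv ℝ F) := hF.continuous_fderiv (by simp)
  have htc := S.continuous_tube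
  have hj := S.continuous_jac
  obtain ⟨X, hX⟩ := S.exists_tsupport_bound hc
  rw [gradΩ, S.sqΩ_eq (by fun_prop), S.sqΩ_eq (by fun_prop), ← integral_add]
  · refine integral_congr_ae (Eventually.of_forall fun p => ?_)
    simp only
    rw [norm_grad_rotate _ (S.norm_tangent p.1)]; ring
  all_goals
    refine S.integrable_strip (X := X) (by fun_prop) fun p hp h => ?_
    rw [(hX p (abs_le.2 ⟨hp.1.le, hp.2.le⟩) h).2]; simp

theorem re_conj_mul_le (a b : ℂ) : 2 * |(a * conj b).re| ≤ ‖a‖ ^ 2 + ‖b‖ ^ 2 := by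
  have h1 : |(a * conj b).re| ≤ ‖a‖ * ‖b‖ := by
    refine (Complex.abs_re_le_norm _).trans ?_
    rw [norm_mul, Complex.norm_conj]
  nlinarith [sq_nonneg (‖a‖ - ‖b‖)]

theorem hasDerivAt_normSq_right {F : ℂ → ℂ} (hF : ContDiff ℝ ∞ F) (s t : ℝ) :
    HasDerivAt (fun x => ‖F (S.tube (s, x))‖ ^ 2)
      (2 * (fderiv ℝ F (S.tube (s, t)) (Complex.I * S.tangent s) * conj (F (S.tube (s, t)))).re) t := by
  have h1 := (S.hasDerivAt_comp_tube_right hF s t).norm_sq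
  rwa [Complex.inner] at h1

/-- Weighted fundamental theorem of calculus for `‖F‖²` across the strip. -/
theorem integral_sq_sub {F : ℂ → ℂ} (hF : ContDiff ℝ ∞ F) (hc : HasCompactSupport F)
    {w : ℝ × ℝ → ℝ} {w' : ℝ × ℝ → ℝ} (hw : Continuous w) (hw' : Continuous w')
    (hww : ∀ s t, HasDerivAt (fun x => w (s, x)) (w' (s, t)) t) :
    Integrable (fun p => w' p * ‖F (S.tube p)‖ ^ 2 + w p * (2 * (fderiv ℝ F (S.tube p)
      (Complex.I * S.tangent p.1) * conj (F (S.tube p))).re)) S.stripMeasure ∧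
    ∫ p, (w' p * ‖F (S.tube p)‖ ^ 2 + w p * (2 * (fderiv ℝ F (S.tube p)
      (Complex.I * S.tangent p.1) * conj (F (S.tube p))).re)) ∂S.stripMeasure =
    ∫ s, (w (s, S.δ) * ‖F (S.tube (s, S.δ))‖ ^ 2 - w (s, -S.δ) * ‖F (S.tube (s, -S.δ))‖ ^ 2) := by
  have hd : Continuous (fderiv ℝ F) := hF.continuous_fderiv (by simp)
  have hFc := hF.continuous
  have htc := S.continuous_tube
  have hT := S.continuous_tangent
  have hδ := S.δ_pos
  obtain ⟨X, hX⟩ := S.exists_tsupport_bound hc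
  have hcont : Continuous (fun p => w' p * ‖F (S.tube p)‖ ^ 2 + w p * (2 * (fderiv ℝ F (S.tube p)
      (Complex.I * S.tangent p.1) * conj (F (S.tube p))).re)) := by fun_prop
  have hint := S.integrable_strip (X := X) hcont
    fun p hp h => by simp [(hX p (abs_le.2 ⟨hp.1.le, hp.2.le⟩) h).1]
  refine ⟨hint, ?_⟩
  unfold stripMeasure at *
  rw [integral_prod _ hint]
  refine integral_congr_ae (Eventually.of_forall fun s => ?_)
  simp only
  rw [← integral_Ioc_eq_integral_Ioo, ← intervalIntegral.integral_of_le (by linarith)]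
  exact intervalIntegral.integral_eq_sub_of_hasDerivAt
    (fun t _ => (hww s t).mul (S.hasDerivAt_normSq_right hF s t))
    (Continuous.intervalIntegrable (by fun_prop) _ _)

theorem integrable_sq_arc {F : ℂ → ℂ} (hF : Continuous F) (hc : HasCompactSupport F) {t : ℝ}
    (ht : |t| ≤ S.δ) {g : ℝ → ℝ} (hg : Continuous g) :
    Integrable fun s => g s * ‖F (S.tube (s, t))‖ ^ 2 := by
  obtain ⟨X, hX⟩ := S.exists_tsupport_bound hc
  have hcont : Continuous fun s => g s * ‖F (S.tube (s, t))‖ ^ 2 := by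
    have := S.continuous_tube; fun_prop
  refine hcont.integrable_of_hasCompactSupport ?_
  refine HasCompactSupport.intro (isCompact_Icc (a := -X) (b := X)) fun s hs => ?_
  rw [(hX (s, t) ht ?_).1]
  · simp
  by_contra h
  exact hs (abs_le.1 (not_lt.1 h))

theorem integrable_energy {F : ℂ → ℂ} (hF : ContDiff ℝ ∞ F) (hc : HasCompactSupport F) :
    Integrable (fun p => S.jac p.1 p.2 * ‖F (S.tube p)‖ ^ 2) S.stripMeasure ∧
    Integrable (fun p => S.jac p.1 p.2 * (‖fderiv ℝ F (S.tube p) (S.tangent p.1)‖ ^ 2 +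
      ‖fderiv ℝ F (S.tube p) (Complex.I * S.tangent p.1)‖ ^ 2)) S.stripMeasure := by
  have hd : Continuous (fderiv ℝ F) := hF.continuous_fderiv (by simp)
  have hFc := hF.continuous
  have htc := S.continuous_tube
  have hT := S.continuous_tangent
  have hj := S.continuous_jac
  obtain ⟨X, hX⟩ := S.exists_tsupport_bound hc
  exact ⟨S.integrable_strip (X := X) (by fun_prop) fun p hp h => by
      simp [(hX p (abs_le.2 ⟨hp.1.le, hp.2.le⟩) h)], S.integrable_strip (X := X) (by fun_prop)
        fun p hp h => by simp [(hX p (abs_le.2 ⟨hp.1.le, hp.2.le⟩) h)]⟩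

theorem integral_boundary_sq {F : ℂ → ℂ} (hF : Continuous F) (hc : HasCompactSupport F) :
    ∫ z, ‖F z‖ ^ 2 ∂S.boundaryMeasure = (∫ s, S.jac s S.δ * ‖F (S.tube (s, S.δ))‖ ^ 2) +
      ∫ s, S.jac s (-S.δ) * ‖F (S.tube (s, -S.δ))‖ ^ 2 := by
  have hi : Integrable (fun z => ‖F z‖ ^ 2) S.boundaryMeasure :=
    (by fun_prop : Continuous fun z => ‖F z‖ ^ 2).integrable_of_hasCompactSupport
      (hc.comp_left (g := fun z : ℂ => ‖z‖ ^ 2) (by simp))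
  rw [boundaryMeasure] at hi ⊢
  rw [integral_add_measure (hi.mono_measure (Measure.le_add_right le_rfl))
    (hi.mono_measure (Measure.le_add_left le_rfl)), S.integral_arc_smul S.abs_δ (by fun_prop),
    S.integral_arc_smul S.abs_neg_δ (by fun_prop)]
  rfl

/-- Fundamental theorem of calculus for a weight times |F|² across the strip, followed by
Cauchy–Schwarz; the lower bound of J converts the result back to integrals over Ω. -/
theorem exists_trace_inequality : ∃ C, 0 ≤ C ∧ ∀ F : ℂ → ℂ, ContDiff ℝ ∞ F → HasCompactSupport F →
    ∫ z, ‖F z‖ ^ 2 ∂S.boundaryMeasure ≤ C * (S.sqΩ F + S.gradΩ F) := by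
  obtain ⟨c, hc0, hcj⟩ := S.exists_le_jac
  have hδ := S.δ_pos
  refine ⟨(2 / S.δ) * ((1 + 2 * S.δ) / c), by positivity, fun F hF hc => ?_⟩
  have hwt : ∀ r : ℝ, ∀ s t : ℝ, HasDerivAt (fun x => (s, x).2 + r) ((fun _ => 1 : ℝ × ℝ → ℝ) (s, t)) t :=
    fun r s t => (hasDerivAt_id t).add_const r
  -- The weights t + δ and t − δ each vanish on one side, so each isolates one boundary curve, with
  -- factor 2δ.
  have h1 := S.integral_sq_sub hF hc (w := fun p => p.2 + S.δ) (w' := fun _ => 1) (by fun_prop)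
    (by fun_prop) (hwt S.δ)
  have h2 := S.integral_sq_sub hF hc (w := fun p => p.2 + -S.δ) (w' := fun _ => 1) (by fun_prop)
    (by fun_prop) (hwt (-S.δ))
  have hE := S.integrable_energy hF hc
  have hbd : ∀ r, |r| ≤ S.δ → ∀ p : ℝ × ℝ, p.2 ∈ Ioo (-S.δ) S.δ →
      1 * ‖F (S.tube p)‖ ^ 2 + (p.2 + r) * (2 * (fderiv ℝ F (S.tube p)
      (Complex.I * S.tangent p.1) * conj (F (S.tube p))).re) ≤ ((1 + 2 * S.δ) / c) *
      (S.jac p.1 p.2 * ‖F (S.tube p)‖ ^ 2 + S.jac p.1 p.2 * (‖fderiv ℝ F (S.tube p) (S.tangent p.1)‖ ^ 2 +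
      ‖fderiv ℝ F (S.tube p) (Complex.I * S.tangent p.1)‖ ^ 2)) := by
    intro r hr p hp
    have hp' : |p.2| ≤ S.δ := abs_le.2 ⟨hp.1.le, hp.2.le⟩
    have a1 := re_conj_mul_le (fderiv ℝ F (S.tube p) (Complex.I * S.tangent p.1)) (F (S.tube p))
    set A := fderiv ℝ F (S.tube p) (Complex.I * S.tangent p.1)
    set B := F (S.tube p)
    set A' := fderiv ℝ F (S.tube p) (S.tangent p.1)
    have a2 : (p.2 + r) * (2 * (A * conj B).re) ≤ 2 * S.δ * (‖A‖ ^ 2 + ‖B‖ ^ 2) := by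
      have h3 : |p.2 + r| ≤ 2 * S.δ := (abs_add_le _ _).trans (by linarith)
      calc (p.2 + r) * (2 * (A * conj B).re) ≤ |p.2 + r| * (2 * |(A * conj B).re|) := by
            rw [← abs_two, ← abs_mul, ← abs_mul, abs_two]; exact le_abs_self _
        _ ≤ 2 * S.δ * (‖A‖ ^ 2 + ‖B‖ ^ 2) := by gcongr
    have a3 : 1 ≤ S.jac p.1 p.2 / c := by rw [le_div_iff₀ hc0, one_mul]; exact hcj _ _ hp'
    have a4 : (1 + 2 * S.δ) * (‖B‖ ^ 2 + ‖A'‖ ^ 2 + ‖A‖ ^ 2) * 1 ≤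
        (1 + 2 * S.δ) * (‖B‖ ^ 2 + ‖A'‖ ^ 2 + ‖A‖ ^ 2) * (S.jac p.1 p.2 / c) := by gcongr
    calc 1 * ‖B‖ ^ 2 + (p.2 + r) * (2 * (A * conj B).re)
        ≤ (1 + 2 * S.δ) * (‖B‖ ^ 2 + ‖A'‖ ^ 2 + ‖A‖ ^ 2) * 1 := by
          nlinarith [sq_nonneg ‖A‖, sq_nonneg ‖A'‖, mul_nonneg hδ.le (sq_nonneg ‖A'‖)]
      _ ≤ _ := a4
      _ = _ := by ring
  have hint : ∀ r, |r| ≤ S.δ → Integrable (fun p : ℝ × ℝ => 1 * ‖F (S.tube p)‖ ^ 2 + (p.2 + r) *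
      (2 * (fderiv ℝ F (S.tube p) (Complex.I * S.tangent p.1) * conj (F (S.tube p))).re)) S.stripMeasure →
      ∫ p : ℝ × ℝ, (1 * ‖F (S.tube p)‖ ^ 2 + (p.2 + r) *
      (2 * (fderiv ℝ F (S.tube p) (Complex.I * S.tangent p.1) * conj (F (S.tube p))).re)) ∂S.stripMeasure ≤
      ((1 + 2 * S.δ) / c) * (S.sqΩ F + S.gradΩ F) := by
    intro r hr hi
    rw [S.sqΩ_eq hF.continuous, S.gradΩ_eq hF hc, ← integral_add hE.1 hE.2, ← integral_const_mul]
    refine integral_mono_ae hi ((hE.1.add hE.2).const_mul _) ?_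
    filter_upwards [S.ae_stripMeasure] with p hp using hbd r hr p hp
  have h3 := hint _ S.abs_δ h1.1
  have h4 := hint _ S.abs_neg_δ h2.1
  rw [h1.2] at h3
  rw [h2.2] at h4
  have hq : ∀ t, |t| ≤ S.δ → ∫ s, S.jac s t * ‖F (S.tube (s, t))‖ ^ 2 ≤ (1 / S.δ) *
      ∫ s, (2 * S.δ) * ‖F (S.tube (s, t))‖ ^ 2 := by
    intro t ht
    rw [← integral_const_mul]
    refine integral_mono (S.integrable_sq_arc hF.continuous hc ht (S.continuous_jac_left t))
      ((S.integrable_sq_arc hF.continuous hc ht continuous_const).const_mul _) fun s => ?_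
    have := S.jac_le (s := s) ht
    have e : 1 / S.δ * (2 * S.δ * ‖F (S.tube (s, t))‖ ^ 2) = 2 * ‖F (S.tube (s, t))‖ ^ 2 := by
      field_simp
    simp only [e]
    gcongr
  have e1 : ∀ s, (S.δ + S.δ) * ‖F (S.tube (s, S.δ))‖ ^ 2 - (-S.δ + S.δ) * ‖F (S.tube (s, -S.δ))‖ ^ 2
      = 2 * S.δ * ‖F (S.tube (s, S.δ))‖ ^ 2 := fun s => by ring
  have e2 : ∀ s, (S.δ + -S.δ) * ‖F (S.tube (s, S.δ))‖ ^ 2 - (-S.δ + -S.δ) * ‖F (S.tube (s, -S.δ))‖ ^ 2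
      = 2 * S.δ * ‖F (S.tube (s, -S.δ))‖ ^ 2 := fun s => by ring
  simp only [e1] at h3
  simp only [e2] at h4
  rw [S.integral_boundary_sq hF.continuous hc]
  have h5 := (hq _ S.abs_δ).trans (mul_le_mul_of_nonneg_left h3 (by positivity))
  have h6 := (hq _ S.abs_neg_δ).trans (mul_le_mul_of_nonneg_left h4 (by positivity))
  calc _ ≤ _ := add_le_add h5 h6
    _ = _ := by ring

/-! ### The a priori estimate for the Dirac operator -/

/-- `∫ 2 Im(∂ₛU conj(∂ₜU))` is a boundary term. -/
theorem integral_null_lagrangian {F : ℂ → ℂ} (hF : ContDiff ℝ ∞ F) (hc : HasCompactSupport F) :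
    ∫ p, S.jac p.1 p.2 * (2 * (fderiv ℝ F (S.tube p) (S.tangent p.1) *
      conj (fderiv ℝ F (S.tube p) (Complex.I * S.tangent p.1))).im) ∂S.stripMeasure =
    ∫ s, (((S.jac s S.δ * fderiv ℝ F (S.tube (s, S.δ)) (S.tangent s)) *
        conj (F (S.tube (s, S.δ)))).im -
      ((S.jac s (-S.δ) * fderiv ℝ F (S.tube (s, -S.δ)) (S.tangent s)) *
        conj (F (S.tube (s, -S.δ)))).im) := by
  have hd : ContDiff ℝ ∞ (fderiv ℝ F) := hF.fderiv_right (by simp)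
  have hdc : Continuous (fderiv ℝ F) := hd.continuous
  have hFc := hF.continuous
  have htc := S.continuous_tube
  have hT := S.continuous_tangent
  have hj := S.continuous_jac
  obtain ⟨X, hX⟩ := S.exists_tsupport_bound hc
  let U : ℝ × ℝ → ℂ := fun p => F (S.tube p)
  let Us : ℝ × ℝ → ℂ := fun p => S.jac p.1 p.2 * fderiv ℝ F (S.tube p) (S.tangent p.1)
  let Ut : ℝ × ℝ → ℂ := fun p => fderiv ℝ F (S.tube p) (Complex.I * S.tangent p.1)
  have hU : ContDiff ℝ ∞ U := hF.comp S.contDiff_tube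
  have hdt : ContDiff ℝ ∞ fun p => fderiv ℝ F (S.tube p) := hd.comp S.contDiff_tube
  have hTs : ContDiff ℝ ∞ fun p : ℝ × ℝ => S.tangent p.1 := S.contDiff_tangent.comp contDiff_fst
  have hUs : ContDiff ℝ ∞ Us :=
    (Complex.ofRealCLM.contDiff.comp S.contDiff_jac).mul (hdt.clm_apply hTs)
  have hUt : ContDiff ℝ ∞ Ut := hdt.clm_apply (contDiff_const.mul hTs)
  have hsl : ∀ (G : ℝ × ℝ → ℂ), ContDiff ℝ ∞ G → ∀ s t,
      HasDerivAt (fun x => G (x, t)) (fderiv ℝ G (s, t) (1, 0)) s := fun G hG s t =>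
    (hG.differentiable (by simp) (s, t)).hasFDerivAt.comp_hasDerivAt s
      ((hasDerivAt_id s).prodMk (hasDerivAt_const s t))
  have hsr : ∀ (G : ℝ × ℝ → ℂ), ContDiff ℝ ∞ G → ∀ s t,
      HasDerivAt (fun x => G (s, x)) (fderiv ℝ G (s, t) (0, 1)) t := fun G hG s t =>
    (hG.differentiable (by simp) (s, t)).hasFDerivAt.comp_hasDerivAt t
      ((hasDerivAt_const t s).prodMk (hasDerivAt_id t))
  have eUs : ∀ p, fderiv ℝ U p (1, 0) = Us p := fun p =>
    (hsl U hU p.1 p.2).unique (S.hasDerivAt_comp_tube_left hF p.1 p.2)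
  have eUt : ∀ p, fderiv ℝ U p (0, 1) = Ut p := fun p =>
    (hsr U hU p.1 p.2).unique (S.hasDerivAt_comp_tube_right hF p.1 p.2)
  -- Symmetry of second derivatives: it makes the second-order terms of ∂_t(U_s conj U) − ∂_s(U_t
  -- conj U) cancel, leaving 2i Im(U_s conj U_t).
  have hsymm : ∀ p, fderiv ℝ Us p (0, 1) = fderiv ℝ Ut p (1, 0) := by
    intro p
    have h1 : IsSymmSndFDerivAt ℝ U p := hU.contDiffAt.isSymmSndFDerivAt (by
      rw [minSmoothness_of_isRCLikeNormedField]; exact WithTop.coe_le_coe.2 le_top)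
    have hdU : DifferentiableAt ℝ (fderiv ℝ U) p :=
      (hU.fderiv_right (m := ∞) (by simp)).differentiable (by simp) p
    have e1 : Us = fun p => fderiv ℝ U p (1, 0) := funext fun p => (eUs p).symm
    have e2 : Ut = fun p => fderiv ℝ U p (0, 1) := funext fun p => (eUt p).symm
    have f1 : fderiv ℝ Us p (0, 1) = fderiv ℝ (fderiv ℝ U) p (0, 1) (1, 0) := by
      rw [e1, fderiv_clm_apply hdU (differentiableAt_const _)]; simp
    have f2 : fderiv ℝ Ut p (1, 0) = fderiv ℝ (fderiv ℝ U) p (1, 0) (0, 1) := by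
      rw [e2, fderiv_clm_apply hdU (differentiableAt_const _)]; simp
    rw [f1, f2, h1.eq]
  let f' : ℝ × ℝ → ℂ := fun p => fderiv ℝ Ut p (1, 0) * conj (U p) + Ut p * conj (Us p)
  let g' : ℝ × ℝ → ℂ := fun p => fderiv ℝ Us p (0, 1) * conj (U p) + Us p * conj (Ut p)
  have hf : ∀ s t, HasDerivAt (fun x => Ut (x, t) * conj (U (x, t))) (f' (s, t)) s := fun s t => by
    have h1 := (hsl U hU s t).star
    rw [eUs] at h1
    exact (hsl Ut hUt s t).mul h1
  have hg : ∀ s t, HasDerivAt (fun x => Us (s, x) * conj (U (s, x))) (g' (s, t)) t := fun s t => by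
    have h1 := (hsr U hU s t).star
    rw [eUt] at h1
    exact (hsr Us hUs s t).mul h1
  have c1 : Continuous (fderiv ℝ Ut) := hUt.continuous_fderiv (by simp)
  have c2 : Continuous (fderiv ℝ Us) := hUs.continuous_fderiv (by simp)
  have c3 := hUt.continuous
  have c4 := hUs.continuous
  have c5 := hU.continuous
  have hz : ∀ p : ℝ × ℝ, p.2 ∈ Ioo (-S.δ) S.δ → X < |p.1| → U p = 0 ∧ Us p = 0 ∧ Ut p = 0 := by
    intro p hp h
    have := hX p (abs_le.2 ⟨hp.1.le, hp.2.le⟩) h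
    simp [U, Us, Ut, this]
  have hfi : Integrable (fun p => Ut p * conj (U p)) S.stripMeasure :=
    S.integrable_strip (X := X) (by fun_prop) fun p hp h => by simp [hz p hp h]
  have hfi' : Integrable f' S.stripMeasure :=
    S.integrable_strip (X := X) (by fun_prop) fun p hp h => by simp [f', hz p hp h]
  have hgc : Continuous g' := by fun_prop
  have hgi' : Integrable g' S.stripMeasure :=
    S.integrable_strip (X := X) hgc fun p hp h => by simp [g', hz p hp h]
  have hI : ∫ p, (g' p - f' p) ∂S.stripMeasure =
      ∫ s, (Us (s, S.δ) * conj (U (s, S.δ)) - Us (s, -S.δ) * conj (U (s, -S.δ))) := by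
    rw [integral_sub hgi' hfi', S.integral_strip_deriv_left (f := fun p => Ut p * conj (U p)) hf hfi hfi', sub_zero,
      S.integral_strip_deriv_right (f := fun p => Us p * conj (U p)) hg hgi' hgc]
  have hgf : ∀ p, S.jac p.1 p.2 * (2 * (fderiv ℝ F (S.tube p) (S.tangent p.1) *
      conj (fderiv ℝ F (S.tube p) (Complex.I * S.tangent p.1))).im) = (g' p - f' p).im := by
    intro p
    have : g' p - f' p = Us p * conj (Ut p) - Ut p * conj (Us p) := by
      simp only [g', f', hsymm]; ring
    rw [this]
    simp [Us, Ut]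
    ring
  have hbi : Integrable fun s => Us (s, S.δ) * conj (U (s, S.δ)) -
      Us (s, -S.δ) * conj (U (s, -S.δ)) := by
    have hcU : ∀ t, |t| ≤ S.δ → Integrable fun s => Us (s, t) * conj (U (s, t)) := by
      intro t ht
      refine (S.integrable_arc_smooth (F := fun z => conj (F z)) (by fun_prop)
        (hc.comp_left (g := fun z : ℂ => conj z) (by simp)) ht (g := fun s => Us (s, t)) (by fun_prop))
    exact (hcU _ S.abs_δ).sub (hcU _ S.abs_neg_δ)
  simp_rw [hgf]
  have := integral_im (hgi'.sub hfi')
  have h2 := integral_im hbi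
  simp only [RCLike.im_to_complex, Pi.sub_apply, Complex.sub_im] at this h2 ⊢
  rw [this]
  have h3 := congrArg Complex.im hI
  rw [h3, ← h2]

/-- The two Cauchy–Riemann operators differ from the gradient energy by opposite multiples of one
null Lagrangian, whose integral only sees the boundary. -/
theorem norm_dbar_sq (L : ℂ →L[ℝ] ℂ) {w : ℂ} (hw : ‖w‖ = 1) :
    ‖L 1 + Complex.I * L Complex.I‖ ^ 2 = ‖L w‖ ^ 2 + ‖L (Complex.I * w)‖ ^ 2 +
      2 * (L w * conj (L (Complex.I * w))).im := by
  have h : ‖L 1 + Complex.I * L Complex.I‖ = ‖L w + Complex.I * L (Complex.I * w)‖ := by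
    rw [clm_dbar_rotate, norm_mul, Complex.norm_conj, hw, one_mul]
  rw [h]
  simp only [← Complex.normSq_eq_norm_sq, Complex.normSq_apply]
  simp
  ring

theorem norm_d_sq (L : ℂ →L[ℝ] ℂ) {w : ℂ} (hw : ‖w‖ = 1) :
    ‖L 1 - Complex.I * L Complex.I‖ ^ 2 = ‖L w‖ ^ 2 + ‖L (Complex.I * w)‖ ^ 2 -
      2 * (L w * conj (L (Complex.I * w))).im := by
  have h : ‖L 1 - Complex.I * L Complex.I‖ = ‖L w - Complex.I * L (Complex.I * w)‖ := by
    rw [clm_d_rotate, norm_mul, hw, one_mul]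
  rw [h]
  simp only [← Complex.normSq_eq_norm_sq, Complex.normSq_apply]
  simp
  ring

theorem integrable_null_lagrangian {F : ℂ → ℂ} (hF : ContDiff ℝ ∞ F) (hc : HasCompactSupport F) :
    Integrable (fun p => S.jac p.1 p.2 * (2 * (fderiv ℝ F (S.tube p) (S.tangent p.1) *
      conj (fderiv ℝ F (S.tube p) (Complex.I * S.tangent p.1))).im)) S.stripMeasure := by
  have hd : Continuous (fderiv ℝ F) := hF.continuous_fderiv (by simp)
  have htc := S.continuous_tube
  have hT := S.continuous_tangent
  have hj := S.continuous_jac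
  obtain ⟨X, hX⟩ := S.exists_tsupport_bound hc
  exact S.integrable_strip (X := X) (by fun_prop) fun p hp h => by
      simp [(hX p (abs_le.2 ⟨hp.1.le, hp.2.le⟩) h)]

theorem sqΩ_dbar {F : ℂ → ℂ} (hF : ContDiff ℝ ∞ F) (hc : HasCompactSupport F) :
    S.sqΩ (fun z => fderiv ℝ F z 1 + Complex.I * fderiv ℝ F z Complex.I) = S.gradΩ F +
      ∫ p, S.jac p.1 p.2 * (2 * (fderiv ℝ F (S.tube p) (S.tangent p.1) *
      conj (fderiv ℝ F (S.tube p) (Complex.I * S.tangent p.1))).im) ∂S.stripMeasure := by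
  have hd : Continuous (fderiv ℝ F) := hF.continuous_fderiv (by simp)
  rw [S.sqΩ_eq (by fun_prop), S.gradΩ_eq hF hc,
    ← integral_add (S.integrable_energy hF hc).2 (S.integrable_null_lagrangian hF hc)]
  refine integral_congr_ae (Eventually.of_forall fun p => ?_)
  simp only
  rw [norm_dbar_sq _ (S.norm_tangent p.1)]; ring

theorem sqΩ_d {F : ℂ → ℂ} (hF : ContDiff ℝ ∞ F) (hc : HasCompactSupport F) :
    S.sqΩ (fun z => fderiv ℝ F z 1 - Complex.I * fderiv ℝ F z Complex.I) = S.gradΩ F -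
      ∫ p, S.jac p.1 p.2 * (2 * (fderiv ℝ F (S.tube p) (S.tangent p.1) *
      conj (fderiv ℝ F (S.tube p) (Complex.I * S.tangent p.1))).im) ∂S.stripMeasure := by
  have hd : Continuous (fderiv ℝ F) := hF.continuous_fderiv (by simp)
  rw [S.sqΩ_eq (by fun_prop), S.gradΩ_eq hF hc,
    ← integral_sub (S.integrable_energy hF hc).2 (S.integrable_null_lagrangian hF hc)]
  refine integral_congr_ae (Eventually.of_forall fun p => ?_)
  simp only
  rw [norm_d_sq _ (S.norm_tangent p.1)]; ring

/-- The infinite mass boundary condition for a pair of smooth functions. -/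
def SmoothBC (F₁ F₂ : ℂ → ℂ) : Prop :=
  ∀ s, F₂ (S.tube (s, S.δ)) = -(S.tangent s * F₁ (S.tube (s, S.δ))) ∧
    F₂ (S.tube (s, -S.δ)) = S.tangent s * F₁ (S.tube (s, -S.δ))

/-- On each side F₂ = ∓γ'F₁. Differentiating this along the boundary, the terms containing the
derivative of F₁ cancel between the two null Lagrangians; only the rotation of γ' survives, and it
contributes κ|F₁|². -/
theorem integral_null_lagrangian_sub {F₁ F₂ : ℂ → ℂ} (hF₁ : ContDiff ℝ ∞ F₁)
    (hc₁ : HasCompactSupport F₁) (hF₂ : ContDiff ℝ ∞ F₂) (hc₂ : HasCompactSupport F₂)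
    (hbc : S.SmoothBC F₁ F₂) :
    (∫ p, S.jac p.1 p.2 * (2 * (fderiv ℝ F₂ (S.tube p) (S.tangent p.1) *
      conj (fderiv ℝ F₂ (S.tube p) (Complex.I * S.tangent p.1))).im) ∂S.stripMeasure) -
    (∫ p, S.jac p.1 p.2 * (2 * (fderiv ℝ F₁ (S.tube p) (S.tangent p.1) *
      conj (fderiv ℝ F₁ (S.tube p) (Complex.I * S.tangent p.1))).im) ∂S.stripMeasure) =
    ∫ s, (S.curv s * ‖F₁ (S.tube (s, S.δ))‖ ^ 2 - S.curv s * ‖F₁ (S.tube (s, -S.δ))‖ ^ 2) := by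
  have hint : ∀ F : ℂ → ℂ, ContDiff ℝ ∞ F → HasCompactSupport F → Integrable fun s =>
      (((S.jac s S.δ * fderiv ℝ F (S.tube (s, S.δ)) (S.tangent s)) *
        conj (F (S.tube (s, S.δ)))).im -
      ((S.jac s (-S.δ) * fderiv ℝ F (S.tube (s, -S.δ)) (S.tangent s)) *
        conj (F (S.tube (s, -S.δ)))).im) := by
    intro F hF hc
    have hd : Continuous (fderiv ℝ F) := hF.continuous_fderiv (by simp)
    have htc := S.continuous_tube
    have hT := S.continuous_tangent
    have hj := S.continuous_jac
    have h1 : ∀ t, |t| ≤ S.δ → Integrable fun s =>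
        ((S.jac s t * fderiv ℝ F (S.tube (s, t)) (S.tangent s)) * conj (F (S.tube (s, t)))).im := by
      intro t ht
      exact (S.integrable_arc_smooth (F := fun z => conj (F z)) (by have := hF.continuous; fun_prop)
        (hc.comp_left (g := fun z : ℂ => conj z) (by simp)) ht
        (g := fun s => S.jac s t * fderiv ℝ F (S.tube (s, t)) (S.tangent s)) (by fun_prop)).im
    exact (h1 _ S.abs_δ).sub (h1 _ S.abs_neg_δ)
  rw [S.integral_null_lagrangian hF₁ hc₁, S.integral_null_lagrangian hF₂ hc₂,
    ← integral_sub (hint F₂ hF₂ hc₂) (hint F₁ hF₁ hc₁)]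
  refine integral_congr_ae (Eventually.of_forall fun s => ?_)
  have key : ∀ ε : ℂ, ε * conj ε = 1 → ∀ t, (∀ s, F₂ (S.tube (s, t)) = ε * (S.tangent s * F₁ (S.tube (s, t)))) →
      ((S.jac s t * fderiv ℝ F₂ (S.tube (s, t)) (S.tangent s)) * conj (F₂ (S.tube (s, t)))).im -
      ((S.jac s t * fderiv ℝ F₁ (S.tube (s, t)) (S.tangent s)) * conj (F₁ (S.tube (s, t)))).im =
      S.curv s * ‖F₁ (S.tube (s, t))‖ ^ 2 := by
    intro ε hε t hb
    have h1 := S.hasDerivAt_comp_tube_left hF₂ s t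
    have h2 := ((S.hasDerivAt_tangent s).mul (S.hasDerivAt_comp_tube_left hF₁ s t)).const_mul ε
    have h3 : (fun x => F₂ (S.tube (x, t))) = fun x => ε * (S.tangent x * F₁ (S.tube (x, t))) :=
      funext hb
    rw [h3] at h1
    have h4 := h1.unique h2
    rw [h4, hb s, ← Complex.sub_im]
    set a := F₁ (S.tube (s, t))
    set b := (S.jac s t : ℂ) * fderiv ℝ F₁ (S.tube (s, t)) (S.tangent s)
    have h5 : ε * (S.curv s * (Complex.I * S.tangent s) * a + S.tangent s * b) *
        conj (ε * (S.tangent s * a)) - b * conj a = ((S.curv s * ‖a‖ ^ 2 : ℝ) : ℂ) * Complex.I := by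
      have h6 : a * conj a = ((‖a‖ ^ 2 : ℝ) : ℂ) := by
        rw [Complex.mul_conj, Complex.normSq_eq_norm_sq]
      rw [map_mul, map_mul, Complex.ofReal_mul, ← h6]
      linear_combination (S.tangent s * conj (S.tangent s)) *
        (S.curv s * Complex.I * a * conj a + b * conj a) * hε +
        (S.curv s * Complex.I * a * conj a + b * conj a) * S.tangent_mul_conj s
    rw [h5, Complex.im_ofReal_mul, Complex.I_im, mul_one]
  have k1 := key (-1) (by simp) S.δ fun s => by rw [(hbc s).1]; ring
  have k2 := key 1 (by simp) (-S.δ) fun s => by rw [(hbc s).2]; ring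
  simp only
  linarith

/-- Adding the identities for ∂₁ + i∂₂ on F₁ and ∂₁ − i∂₂ on F₂ gives the full gradient energy up to
the curvature boundary term, which is of lower order and can be absorbed. -/
theorem exists_apriori_estimate : ∃ C, 0 ≤ C ∧ ∀ F₁ F₂ : ℂ → ℂ, ContDiff ℝ ∞ F₁ →
    HasCompactSupport F₁ → ContDiff ℝ ∞ F₂ → HasCompactSupport F₂ → S.SmoothBC F₁ F₂ →
    S.gradΩ F₁ + S.gradΩ F₂ ≤ C * (S.sqΩ F₁ +
      S.sqΩ (fun z => fderiv ℝ F₁ z 1 + Complex.I * fderiv ℝ F₁ z Complex.I) +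
      S.sqΩ (fun z => fderiv ℝ F₂ z 1 - Complex.I * fderiv ℝ F₂ z Complex.I)) := by
  obtain ⟨c, hc0, hcj⟩ := S.exists_le_jac
  have hδ := S.δ_pos
  have hK : ∀ s, |S.curv s| ≤ 1 / S.δ := fun s => by
    rw [le_div_iff₀ hδ, mul_comm]; exact (S.curvature_lt s).le
  set K := 1 / S.δ
  have hK0 : 0 < K := by positivity
  -- The curvature term costs half of the gradient energy of F₁ plus 2K²/c² times its mass;
  -- absorbing that half doubles the constant.
  refine ⟨2 * (1 + 2 * K ^ 2 / c ^ 2), by positivity, fun F₁ F₂ hF₁ hc₁ hF₂ hc₂ hbc => ?_⟩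
  have hNL := S.integral_null_lagrangian_sub hF₁ hc₁ hF₂ hc₂ hbc
  have e1 := S.sqΩ_dbar hF₁ hc₁
  have e2 := S.sqΩ_d hF₂ hc₂
  have hcc := S.continuous_curv
  -- The weight κ(s) does not depend on t, so the difference of the boundary integrals is the bulk
  -- integral of κ ∂_t|F₁|².
  obtain ⟨hi, hb⟩ := S.integral_sq_sub hF₁ hc₁ (w := fun p => S.curv p.1) (w' := fun _ => 0)
    (by fun_prop) (by fun_prop) (fun s t => hasDerivAt_const t (S.curv s))
  have hE := S.integrable_energy hF₁ hc₁
  have hle : ∫ s, (S.curv s * ‖F₁ (S.tube (s, S.δ))‖ ^ 2 - S.curv s * ‖F₁ (S.tube (s, -S.δ))‖ ^ 2) ≤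
      2 * K ^ 2 / c ^ 2 * S.sqΩ F₁ + (1 / 2) * S.gradΩ F₁ := by
    rw [← hb, S.sqΩ_eq hF₁.continuous, S.gradΩ_eq hF₁ hc₁, ← integral_const_mul,
      ← integral_const_mul, ← integral_add (hE.1.const_mul _) (hE.2.const_mul _)]
    refine integral_mono_ae hi ((hE.1.const_mul _).add (hE.2.const_mul _)) ?_
    filter_upwards [S.ae_stripMeasure] with p hp
    have hp' : |p.2| ≤ S.δ := abs_le.2 ⟨hp.1.le, hp.2.le⟩
    have hj := hcj p.1 p.2 hp'
    set A := fderiv ℝ F₁ (S.tube p) (Complex.I * S.tangent p.1)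
    set B := F₁ (S.tube p)
    set A' := fderiv ℝ F₁ (S.tube p) (S.tangent p.1)
    set j := S.jac p.1 p.2
    have a1 : |(A * conj B).re| ≤ ‖A‖ * ‖B‖ := by
      refine (Complex.abs_re_le_norm _).trans ?_
      rw [norm_mul, Complex.norm_conj]
    have a2 : S.curv p.1 * (2 * (A * conj B).re) ≤ 2 * K * (‖A‖ * ‖B‖) := by
      calc S.curv p.1 * (2 * (A * conj B).re) ≤ |S.curv p.1| * (2 * |(A * conj B).re|) := by
            rw [← abs_two, ← abs_mul, ← abs_mul, abs_two]; exact le_abs_self _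
        _ ≤ K * (2 * (‖A‖ * ‖B‖)) := by gcongr; exact hK _
        _ = _ := by ring
    have a3 : 2 * K * (‖A‖ * ‖B‖) ≤ c / 2 * ‖A‖ ^ 2 + 2 * K ^ 2 / c * ‖B‖ ^ 2 := by
      have : c / 2 * ‖A‖ ^ 2 + 2 * K ^ 2 / c * ‖B‖ ^ 2 - 2 * K * (‖A‖ * ‖B‖) =
          (c * ‖A‖ - 2 * K * ‖B‖) ^ 2 / (2 * c) := by field_simp; ring
      have h2 : 0 ≤ (c * ‖A‖ - 2 * K * ‖B‖) ^ 2 / (2 * c) := by positivity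
      linarith
    have a4 : 2 * K ^ 2 / c * ‖B‖ ^ 2 ≤ 2 * K ^ 2 / c ^ 2 * (j * ‖B‖ ^ 2) := by
      have : 2 * K ^ 2 / c * ‖B‖ ^ 2 = 2 * K ^ 2 / c ^ 2 * (c * ‖B‖ ^ 2) := by field_simp
      rw [this]; gcongr
    have a5 : c / 2 * ‖A‖ ^ 2 ≤ 1 / 2 * (j * (‖A'‖ ^ 2 + ‖A‖ ^ 2)) := by
      have := mul_le_mul_of_nonneg_right hj (sq_nonneg ‖A‖)
      have h3 := mul_nonneg (hc0.le.trans hj) (sq_nonneg ‖A'‖)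
      nlinarith
    simp only [zero_mul, zero_add]
    linarith
  rw [← hNL] at hle
  have hg1 : 0 ≤ S.gradΩ F₂ := add_nonneg (integral_nonneg fun _ => sq_nonneg _)
    (integral_nonneg fun _ => sq_nonneg _)
  have n1 : 0 ≤ S.sqΩ F₁ := integral_nonneg fun _ => sq_nonneg _
  have n2 : 0 ≤ S.sqΩ (fun z => fderiv ℝ F₁ z 1 + Complex.I * fderiv ℝ F₁ z Complex.I) :=
    integral_nonneg fun _ => sq_nonneg _
  have n3 : 0 ≤ S.sqΩ (fun z => fderiv ℝ F₂ z 1 - Complex.I * fderiv ℝ F₂ z Complex.I) :=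
    integral_nonneg fun _ => sq_nonneg _
  have n4 : 0 ≤ 2 * K ^ 2 / c ^ 2 := by positivity
  nlinarith [mul_nonneg n4 n2, mul_nonneg n4 n3]

end CurvedStrip

namespace CurvedStrip

variable {S : CurvedStrip}

/-! ### The uniformization of the strip -/

theorem isOpen_straightStrip (δ : ℝ) : IsOpen (straightStrip δ) :=
  isOpen_lt (by fun_prop) continuous_const

theorem convex_straightStrip (δ : ℝ) : Convex ℝ (straightStrip δ) := by
  have h : straightStrip δ = Complex.imLm ⁻¹' (Ioo (-δ) δ) := by
    ext w; simp [straightStrip, abs_lt]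
  rw [h]
  exact (convex_Ioo (-δ) δ).linear_preimage _

/-- The point `x + i y`. -/
noncomputable def pt (x y : ℝ) : ℂ := (x : ℂ) + (y : ℂ) * Complex.I

@[simp] theorem pt_re (x y : ℝ) : (pt x y).re = x := by simp [pt]
@[simp] theorem pt_im (x y : ℝ) : (pt x y).im = y := by simp [pt]

theorem continuous_pt (y : ℝ) : Continuous fun x => pt x y := by unfold pt; fun_prop

theorem pt_mem {x y δ : ℝ} (hy : |y| < δ) : pt x y ∈ straightStrip δ := by
  rw [straightStrip, mem_ofPred_eq, pt_im]; exact hy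

namespace Uniformization

variable (R : S.Uniformization)

/-- The straight strip is convex, so the bound on the derivative is a Lipschitz constant; continuity
carries it to the closed strip. -/
theorem exists_norm_inv_sub_le : ∃ C : ℝ, 0 ≤ C ∧ ∀ w w' : ℂ, |w.im| ≤ S.δ → |w'.im| ≤ S.δ →
    ‖R.inv w - R.inv w'‖ ≤ C * ‖w - w'‖ := by
  obtain ⟨C, hC⟩ := R.inv_deriv_bounded
  have hC0 : 0 ≤ C := (norm_nonneg _).trans (hC 0 (by simpa [straightStrip] using S.δ_pos))
  refine ⟨C, hC0, ?_⟩
  have hopen := isOpen_straightStrip S.δ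
  have h1 : LipschitzOnWith ⟨C, hC0⟩ R.inv (straightStrip S.δ) := by
    refine (convex_straightStrip S.δ).lipschitzOnWith_of_nnnorm_deriv_le (𝕜 := ℂ) ?_ ?_
    · exact fun w hw => R.inv_holomorphic.differentiableAt (hopen.mem_nhds hw)
    · exact fun w hw => hC w hw
  have hcl : closure (straightStrip S.δ) = {w : ℂ | |w.im| ≤ S.δ} := by
    have h : straightStrip S.δ = Complex.im ⁻¹' (Ioo (-S.δ) S.δ) := by
      ext w; simp [straightStrip, abs_lt]
    have hδ := S.δ_pos
    rw [h, Complex.closure_preimage_im, closure_Ioo (by linarith)]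
    ext w; simp [abs_le]
  have h2 : LipschitzOnWith ⟨C, hC0⟩ R.inv {w : ℂ | |w.im| ≤ S.δ} := by
    rw [← hcl]
    exact h1.closure (by rw [hcl]; exact R.inv_continuousOn)
  intro w w' hw hw'
  have := h2.dist_le_mul w hw w' hw'
  rwa [dist_eq_norm, dist_eq_norm] at this

/-- Ω need not be convex, so the mean value inequality is applied to f ∘ Θ on the convex strip of
coordinates. The factor 3 is 2 for the tangential direction, where J ≤ 2, plus 1 for the normal one.
-/
theorem exists_norm_f_sub_le : ∃ C : ℝ, ∀ p q : ℝ × ℝ, p.2 ∈ Ioo (-S.δ) S.δ →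
    q.2 ∈ Ioo (-S.δ) S.δ → ‖R.f (S.tube p) - R.f (S.tube q)‖ ≤ C * ‖p - q‖ := by
  obtain ⟨C, hC⟩ := R.deriv_bounded
  have hconv : Convex ℝ ((univ : Set ℝ) ×ˢ Ioo (-S.δ) S.δ) := convex_univ.prod (convex_Ioo _ _)
  refine ⟨C * 3, fun p q hp hq => ?_⟩
  refine hconv.norm_image_sub_le_of_norm_hasFDerivWithin_le (𝕜 := ℝ) (f := fun p => R.f (S.tube p))
    (f' := fun p => (deriv R.f (S.tube p) • (1 : ℂ →L[ℝ] ℂ)).comp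
      ((ContinuousLinearMap.fst ℝ ℝ ℝ).smulRight ((S.jac p.1 p.2 : ℂ) * S.tangent p.1) +
      (ContinuousLinearMap.snd ℝ ℝ ℝ).smulRight (Complex.I * S.tangent p.1)))
    (fun x hx => ?_) (fun x hx => ?_) ⟨mem_univ _, hq⟩ ⟨mem_univ _, hp⟩
  · have h1 : HasDerivAt R.f (deriv R.f (S.tube x)) (S.tube x) :=
      (R.holomorphic.differentiableAt (S.isOpen_Ω.mem_nhds (S.tube_mem hx.2))).hasDerivAt
    exact (h1.complexToReal_fderiv.comp x (S.hasFDerivAt_tube x)).hasFDerivWithinAt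
  · have hx' : |x.2| ≤ S.δ := abs_le.2 ⟨hx.2.1.le, hx.2.2.le⟩
    have hC' := hC _ (S.tube_mem hx.2)
    have hC0 : 0 ≤ C := (norm_nonneg _).trans hC'
    refine ContinuousLinearMap.opNorm_le_bound _ (by positivity) fun v => ?_
    have h1 : ‖v.1‖ ≤ ‖v‖ := norm_fst_le v
    have h2 : ‖v.2‖ ≤ ‖v‖ := norm_snd_le v
    have hj : ‖(S.jac x.1 x.2 : ℂ) * S.tangent x.1‖ ≤ 2 := by
      rw [norm_mul, S.norm_tangent, mul_one, Complex.norm_real, Real.norm_eq_abs,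
        abs_of_pos (S.jac_pos hx')]
      exact S.jac_le hx'
    have hn : ‖Complex.I * S.tangent x.1‖ = 1 := by
      rw [norm_mul, S.norm_tangent, Complex.norm_I, mul_one]
    simp only [ContinuousLinearMap.comp_apply, add_apply, ContinuousLinearMap.smulRight_apply,
      smul_apply, one_apply_eq_self, ContinuousLinearMap.coe_fst',
      ContinuousLinearMap.coe_snd', smul_eq_mul]
    rw [norm_mul]
    calc ‖deriv R.f (S.tube x)‖ * ‖v.1 • ((S.jac x.1 x.2 : ℂ) * S.tangent x.1) +
          v.2 • (Complex.I * S.tangent x.1)‖ ≤ C * (‖v‖ * 2 + ‖v‖ * 1) := by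
            gcongr
            refine (norm_add_le _ _).trans ?_
            rw [norm_smul, norm_smul, hn]
            gcongr
      _ = C * 3 * ‖v‖ := by ring

/-- Properness of the extended f⁻¹ up to the boundary. It confines E ∘ f⁻¹ to a bounded range of
abscissae when E has compact support. -/
theorem exists_re_bound {K : Set ℂ} (hK : IsCompact K) :
    ∃ X : ℝ, 0 < X ∧ ∀ w : ℂ, |w.im| ≤ S.δ → X < |w.re| → R.inv w ∉ K := by
  obtain ⟨B, hB0, hB⟩ := hK.isBounded.subset_closedBall_lt 0 (0 : ℂ)
  obtain ⟨X, hX⟩ := S.exists_bound_of_isCompact (isCompact_closedBall (0 : ℂ) (B + 1))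
  obtain ⟨C, hC⟩ := R.exists_norm_f_sub_le
  obtain ⟨L, hL0, hL⟩ := R.exists_norm_inv_sub_le
  have hδ := S.δ_pos
  set A := |C| * (max |X| S.δ) + ‖R.f (S.tube (0, 0))‖ + 1 with hA
  refine ⟨A, by positivity, fun w hw hwX hwK => ?_⟩
  have key : ∀ w ∈ straightStrip S.δ, R.inv w ∈ Metric.closedBall (0 : ℂ) (B + 1) → |w.re| ≤ A := by
    intro w hw hwB
    obtain ⟨p, hp, hpw⟩ := R.inv_mapsTo hw
    have hpw' : S.tube p = R.inv w := hpw
    have h1 : |p.1| ≤ X := by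
      by_contra h
      exact hX p (abs_le.2 ⟨hp.2.1.le, hp.2.2.le⟩) (not_le.1 h) (hpw' ▸ hwB)
    have h2 := hC p (0, 0) hp.2 ⟨by simpa using hδ, by simpa using hδ⟩
    have h3 : R.f (S.tube p) = w := by rw [hpw']; exact R.right_inv hw
    have h4 : ‖p - (0, 0)‖ ≤ max |X| S.δ := by
      rw [← Prod.zero_eq_mk, sub_zero, Prod.norm_def]
      exact max_le_max (h1.trans (le_abs_self _)) (abs_le.2 ⟨hp.2.1.le, hp.2.2.le⟩)
    rw [h3] at h2
    have h5 : ‖w‖ ≤ ‖w - R.f (S.tube (0, 0))‖ + ‖R.f (S.tube (0, 0))‖ := by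
      simpa using norm_add_le (w - R.f (S.tube (0, 0))) (R.f (S.tube (0, 0)))
    have h6 : C * ‖p - (0, 0)‖ ≤ |C| * max |X| S.δ := by
      gcongr; exact le_abs_self C
    have := Complex.abs_re_le_norm w
    rw [hA]; linarith
  -- A point of the closed strip is pushed inside by scaling its ordinate by 1 − t. The bound Ltδ ≤
  -- 1 keeps its image in the ball of radius B + 1, where `key` applies.
  obtain ⟨t, ht0, ht1, htL⟩ : ∃ t : ℝ, 0 < t ∧ t < 1 ∧ L * (t * S.δ) ≤ 1 := by
    refine ⟨1 / (2 + L * S.δ), by positivity, ?_, ?_⟩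
    · rw [div_lt_one (by positivity)]
      nlinarith [mul_nonneg hL0 hδ.le]
    · rw [one_div_mul_eq_div, mul_div_assoc', div_le_one (by positivity)]
      linarith
  have hw' : |(pt w.re ((1 - t) * w.im)).im| < S.δ := by
    rw [pt_im, abs_mul, abs_of_pos (by linarith)]
    nlinarith [abs_nonneg w.im]
  have h7 := hL (pt w.re ((1 - t) * w.im)) w hw'.le hw
  have h8 : ‖pt w.re ((1 - t) * w.im) - w‖ = t * |w.im| := by
    have : pt w.re ((1 - t) * w.im) - w = ((-t * w.im : ℝ) : ℂ) * Complex.I := by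
      apply Complex.ext <;> simp; ring
    rw [this, norm_mul, Complex.norm_I, mul_one, Complex.norm_real, Real.norm_eq_abs, abs_mul,
      abs_neg, abs_of_pos ht0]
  have h9 : R.inv (pt w.re ((1 - t) * w.im)) ∈ Metric.closedBall (0 : ℂ) (B + 1) := by
    have := hB hwK
    rw [mem_closedBall_zero_iff] at this ⊢
    have h10 := norm_add_le (R.inv (pt w.re ((1 - t) * w.im)) - R.inv w) (R.inv w)
    rw [sub_add_cancel] at h10
    rw [h8] at h7
    have : L * (t * |w.im|) ≤ L * (t * S.δ) := by gcongr
    linarith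
  have := key _ hw' h9
  rw [pt_re] at this
  linarith

/-! ### Conformal coordinates and thinner strips -/

theorem hasDerivAt_inv {w : ℂ} (hw : w ∈ straightStrip S.δ) :
    HasDerivAt R.inv (deriv R.inv w) w :=
  (R.inv_holomorphic.differentiableAt ((isOpen_straightStrip S.δ).mem_nhds hw)).hasDerivAt

theorem differentiableOn_deriv_inv : DifferentiableOn ℂ (deriv R.inv) (straightStrip S.δ) :=
  R.inv_holomorphic.deriv (isOpen_straightStrip S.δ)

theorem image_inv : R.inv '' straightStrip S.δ = S.Ω := by
  refine Subset.antisymm (image_subset_iff.2 R.inv_mapsTo) fun z hz => ?_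
  exact ⟨R.f z, R.mapsTo hz, R.left_inv hz⟩

theorem det_mul (a : ℂ) : ((a • (1 : ℂ →L[ℝ] ℂ)) : ℂ →L[ℝ] ℂ).det = ‖a‖ ^ 2 := by
  rw [ContinuousLinearMap.det, ← LinearMap.det_toMatrix Complex.basisOneI, Matrix.det_fin_two,
    ← Complex.normSq_eq_norm_sq, Complex.normSq_apply]
  simp [LinearMap.toMatrix_apply]

/-- Integration over `Ω` in conformal coordinates. -/
theorem integral_eq (u : ℂ → ℂ) : ∫ z in S.Ω, u z =
    ∫ w in straightStrip S.δ, ((‖deriv R.inv w‖ ^ 2 : ℝ) : ℂ) * u (R.inv w) := by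
  rw [← R.image_inv, integral_image_eq_integral_abs_det_fderiv_smul volume
    (isOpen_straightStrip S.δ).measurableSet
    (fun w hw => (R.hasDerivAt_inv hw).complexToReal_fderiv.hasFDerivWithinAt) R.right_inv.injOn]
  simp_rw [det_mul, abs_pow, abs_norm, Complex.real_smul]

theorem integrableOn_iff (u : ℂ → ℂ) : IntegrableOn u S.Ω ↔
    IntegrableOn (fun w => ((‖deriv R.inv w‖ ^ 2 : ℝ) : ℂ) * u (R.inv w)) (straightStrip S.δ) := by
  rw [← R.image_inv, integrableOn_image_iff_integrableOn_abs_det_fderiv_smul volume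
    (isOpen_straightStrip S.δ).measurableSet
    (fun w hw => (R.hasDerivAt_inv hw).complexToReal_fderiv.hasFDerivWithinAt) R.right_inv.injOn]
  simp_rw [det_mul, abs_pow, abs_norm, Complex.real_smul]

/-- The half-widths δ − δ/(n+2) increase to δ and are positive already for n = 0. On these strips
the slices of a Hardy function are honest L² functions, without any trace. -/
theorem tendsto_integral_straightStrip {u : ℂ → ℂ} (hu : IntegrableOn u (straightStrip S.δ)) :
    Tendsto (fun n : ℕ => ∫ w in straightStrip (S.δ - S.δ / (n + 2)), u w) atTop
      (𝓝 (∫ w in straightStrip S.δ, u w)) := by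
  have hδ := S.δ_pos
  have hU : straightStrip S.δ = ⋃ n : ℕ, straightStrip (S.δ - S.δ / (n + 2)) := by
    ext w
    simp only [straightStrip, mem_iUnion, mem_ofPred_eq]
    constructor
    · intro hw
      have h1 : Tendsto (fun n : ℕ => S.δ - S.δ / ((n : ℝ) + 2)) atTop (𝓝 (S.δ - 0)) := by
        refine tendsto_const_nhds.sub ?_
        exact tendsto_const_nhds.div_atTop (tendsto_atTop_add_const_right _ _ tendsto_natCast_atTop_atTop)
      rw [sub_zero] at h1
      exact (h1.eventually (lt_mem_nhds hw)).exists
    · rintro ⟨n, hn⟩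
      have : 0 < S.δ / ((n : ℝ) + 2) := by positivity
      linarith
  rw [hU] at hu ⊢
  refine tendsto_setIntegral_of_monotone (fun n => (isOpen_straightStrip _).measurableSet) ?_ hu
  intro m n hmn w hw
  have : S.δ / ((n : ℝ) + 2) ≤ S.δ / ((m : ℝ) + 2) := by
    have : (m : ℝ) ≤ n := by exact_mod_cast hmn
    gcongr
  simp only [straightStrip, mem_ofPred_eq] at hw ⊢
  linarith

/-- Green's formula on a thinner strip. -/
theorem integral_slice {V E : ℂ → ℂ} (hV : DifferentiableOn ℂ V (straightStrip S.δ))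
    (hE : ContDiff ℝ ∞ E) (hc : HasCompactSupport E) {y : ℝ} (hy0 : 0 < y) (hy : y < S.δ) :
    ∫ w in straightStrip y, ((‖deriv R.inv w‖ ^ 2 : ℝ) : ℂ) * (V w * (fderiv ℝ E (R.inv w) 1 +
      Complex.I * fderiv ℝ E (R.inv w) Complex.I)) =
    Complex.I * ((∫ x, V (pt x y) * (E (R.inv (pt x y)) * deriv R.inv (pt x y))) -
      ∫ x, V (pt x (-y)) * (E (R.inv (pt x (-y))) * deriv R.inv (pt x (-y)))) := by
  have hEd : Continuous (fderiv ℝ E) := hE.continuous_fderiv (by simp)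
  have hopen := isOpen_straightStrip S.δ
  obtain ⟨X, hX0, hX⟩ := R.exists_re_bound hc.isCompact
  have hXE : ∀ w : ℂ, |w.im| ≤ S.δ → X < |w.re| → E (R.inv w) = 0 ∧ fderiv ℝ E (R.inv w) = 0 := by
    intro w h1 h2
    refine ⟨image_eq_zero_of_notMem_tsupport (hX w h1 h2), ?_⟩
    by_contra h
    exact hX w h1 h2 (support_fderiv_subset ℝ h)
  let W : ℂ → ℂ := fun w => V w * deriv R.inv w
  have hW : DifferentiableOn ℂ W (straightStrip S.δ) := hV.mul R.differentiableOn_deriv_inv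
  -- The chain rule for E ∘ f⁻¹ produces conj((f⁻¹)'); the extra holomorphic factor (f⁻¹)' in W
  -- completes it to the Jacobian |(f⁻¹)'|².
  let Φ : ℂ → ℂ := fun w => W w * E (R.inv w)
  let Φ' : ℂ → ℂ →L[ℝ] ℂ := fun w => W w • (fderiv ℝ E (R.inv w)).comp (deriv R.inv w • (1 : ℂ →L[ℝ] ℂ)) +
    E (R.inv w) • (deriv W w • (1 : ℂ →L[ℝ] ℂ))
  have hΦ : ∀ w ∈ straightStrip S.δ, HasFDerivAt Φ (Φ' w) w := by
    intro w hw
    have h1 := ((hW.differentiableAt (hopen.mem_nhds hw)).hasDerivAt).complexToReal_fderiv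
    have h2 := ((hE.differentiable (by simp) (R.inv w)).hasFDerivAt).comp w
      (R.hasDerivAt_inv hw).complexToReal_fderiv
    exact h1.mul h2
  have hdbar : ∀ w, Φ' w 1 + Complex.I * Φ' w Complex.I =
      ((‖deriv R.inv w‖ ^ 2 : ℝ) : ℂ) * (V w * (fderiv ℝ E (R.inv w) 1 +
      Complex.I * fderiv ℝ E (R.inv w) Complex.I)) := by
    intro w
    have h1 := clm_dbar_rotate (fderiv ℝ E (R.inv w)) (deriv R.inv w)
    have h2 : ((‖deriv R.inv w‖ ^ 2 : ℝ) : ℂ) = deriv R.inv w * conj (deriv R.inv w) := by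
      rw [Complex.mul_conj, Complex.normSq_eq_norm_sq]
    rw [h2]
    simp only [Φ', W, add_apply, smul_apply, ContinuousLinearMap.comp_apply,
      one_apply_eq_self, smul_eq_mul, mul_one]
    rw [mul_comm (deriv R.inv w) Complex.I]
    linear_combination (V w * deriv R.inv w) * h1 + (E (R.inv w) * deriv (fun w => V w * deriv R.inv w) w) * Complex.I_sq
  let Ψ : ℂ → ℂ := fun w => ((‖deriv R.inv w‖ ^ 2 : ℝ) : ℂ) * (V w * (fderiv ℝ E (R.inv w) 1 +
      Complex.I * fderiv ℝ E (R.inv w) Complex.I))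
  have hΨc : ContinuousOn Ψ (straightStrip S.δ) := by
    have h1 := R.differentiableOn_deriv_inv.continuousOn
    have h2 := R.inv_holomorphic.continuousOn
    have h3 := hV.continuousOn
    have h4 : ContinuousOn (fun w => fderiv ℝ E (R.inv w)) (straightStrip S.δ) :=
      hEd.comp_continuousOn h2
    have h5 : ContinuousOn (fun w => (((‖deriv R.inv w‖ ^ 2 : ℝ)) : ℂ)) (straightStrip S.δ) :=
      Complex.continuous_ofReal.comp_continuousOn (h1.norm.pow 2)
    exact h5.mul (h3.mul ((h4.clm_apply continuousOn_const).add
      (continuousOn_const.mul (h4.clm_apply continuousOn_const))))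
  have hΨ0 : ∀ w : ℂ, |w.im| ≤ S.δ → X < |w.re| → Ψ w = 0 := fun w h1 h2 => by
    simp [Ψ, (hXE w h1 h2).2]
  -- The margin puts the vertical sides of the rectangle where E ∘ f⁻¹ vanishes.
  set X' := X + 1
  have hsub : (uIcc (-X') (X')) ×ℂ (uIcc (-y) (y)) ⊆ straightStrip S.δ := by
    rintro w ⟨-, h⟩
    rw [mem_preimage, uIcc_of_le (by linarith)] at h
    exact (abs_le.2 h).trans_lt hy
  have hrect := Complex.integral_boundary_rect_of_hasFDerivAt_real_off_countable Φ Φ'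
    (pt (-X') (-y)) (pt X' y) ∅ countable_empty
  simp only [pt_re, pt_im] at hrect
  have hcomp : IsCompact ((uIcc (-X') (X')) ×ℂ (uIcc (-y) (y))) := isCompact_uIcc.reProdIm isCompact_uIcc
  have hI : ∀ w, Complex.I • Φ' w 1 - Φ' w Complex.I = Complex.I * Ψ w := by
    intro w
    simp only [Ψ]
    rw [← hdbar, smul_eq_mul]
    linear_combination (-Φ' w Complex.I) * Complex.I_sq
  specialize hrect (fun w hw => (hΦ w (hsub hw)).continuousAt.continuousWithinAt) ?_ ?_
  · intro w hw
    refine hΦ w (hsub ⟨?_, ?_⟩)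
    · exact Ioo_subset_Icc_self hw.1.1
    · exact Ioo_subset_Icc_self hw.1.2
  · simp_rw [hI]
    exact (((hΨc.mono hsub).integrableOn_compact hcomp).const_mul _)
  have hΦ0 : ∀ w : ℂ, |w.im| ≤ S.δ → X < |w.re| → Φ w = 0 := fun w h1 h2 => by
    simp [Φ, (hXE w h1 h2).1]
  have hyδ : ∀ t ∈ (uIcc (-y) (y)), |t| ≤ S.δ := by
    intro t ht
    rw [uIcc_of_le (by linarith)] at ht
    exact (abs_le.2 ht).trans hy.le
  have hv : ∀ x : ℝ, X < |x| → ∫ t in (-y)..y, Φ (x + t * Complex.I) = 0 := by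
    intro x hx
    refine intervalIntegral.integral_zero_ae (Eventually.of_forall fun t ht => ?_)
    have h1 : ((x : ℂ) + t * Complex.I).im = t := by simp
    have h2 : ((x : ℂ) + t * Complex.I).re = x := by simp
    exact hΦ0 _ (by rw [h1]; exact hyδ t (uIoc_subset_uIcc ht)) (by rw [h2]; exact hx)
  have hh : ∀ t, |t| ≤ S.δ → ∫ x in (-X')..X', Φ (x + t * Complex.I) = ∫ x, Φ (pt x t) := by
    intro t ht
    rw [intervalIntegral.integral_eq_integral_of_support_subset]
    · rfl
    · intro x hx
      have : |x| ≤ X := by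
        by_contra h
        exact hx (hΦ0 (pt x t) (by rwa [pt_im]) (by rw [pt_re]; exact not_le.1 h))
      have := abs_le.1 this
      exact ⟨by linarith [this.1], by linarith [this.2]⟩
  have hX'1 : X < |X'| := by rw [abs_of_pos (by linarith)]; linarith
  rw [hv X' hX'1, hv (-X') (by rwa [abs_neg]), hh y (by rw [abs_of_pos hy0]; exact hy.le),
    hh (-y) (by rw [abs_neg, abs_of_pos hy0]; exact hy.le), smul_zero, add_zero, sub_zero] at hrect
  simp_rw [hI] at hrect
  have hdouble : ∫ x in (-X')..X', ∫ t in (-y)..y, Complex.I * Ψ (x + t * Complex.I) =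
      Complex.I * ∫ w in straightStrip y, Ψ w := by
    simp_rw [intervalIntegral.integral_const_mul]
    congr 1
    have hr : ∫ w in straightStrip y, Ψ w = ∫ w in (Ioc (-X') X' ×ℂ Ioo (-y) y), Ψ w := by
      refine setIntegral_eq_of_subset_of_forall_sdiff_eq_zero (isOpen_straightStrip y).measurableSet
        ?_ ?_
      · rintro w ⟨-, h⟩; exact abs_lt.2 h
      · rintro w ⟨h1, h2⟩
        refine hΨ0 w ((show |w.im| < y from h1).le.trans hy.le) ?_
        by_contra h
        have := abs_le.1 (not_lt.1 h)
        exact h2 ⟨⟨by linarith [this.1], by linarith [this.2]⟩, abs_lt.1 h1⟩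
    have hmp := Complex.volume_preserving_equiv_real_prod.symm
    have hpre : Complex.measurableEquivRealProd.symm ⁻¹' (Ioc (-X') X' ×ℂ Ioo (-y) y) =
        Ioc (-X') X' ×ˢ Ioo (-y) y := by
      ext p; simp [Complex.mem_reProdIm]
    rw [hr, ← hmp.setIntegral_preimage_emb (MeasurableEquiv.measurableEmbedding _), hpre,
      Measure.volume_eq_prod, setIntegral_prod]
    · rw [intervalIntegral.integral_of_le (by linarith)]
      refine integral_congr_ae (Eventually.of_forall fun x => ?_)
      simp only
      rw [intervalIntegral.integral_of_le (by linarith), integral_Ioc_eq_integral_Ioo]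
      refine integral_congr_ae (Eventually.of_forall fun t => ?_)
      have : (x : ℂ) + t * Complex.I = Complex.measurableEquivRealProd.symm (x, t) := by
        apply Complex.ext <;> simp
      simp only [this]
    · have h1 : IntegrableOn Ψ (Ioc (-X') X' ×ℂ Ioo (-y) y) := by
        refine ((hΨc.mono hsub).integrableOn_compact hcomp).mono_set ?_
        rintro w ⟨h1, h2⟩
        exact ⟨by rw [mem_preimage, uIcc_of_le (by linarith)]; exact Ioc_subset_Icc_self h1,
          by rw [mem_preimage, uIcc_of_le (by linarith)]; exact Ioo_subset_Icc_self h2⟩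
      rw [← Measure.volume_eq_prod, ← hpre]
      exact (hmp.integrableOn_comp_preimage (MeasurableEquiv.measurableEmbedding _)).2 h1
  rw [hdouble] at hrect
  have hcom : ∀ w, V w * (E (R.inv w) * deriv R.inv w) = Φ w := fun w => by simp only [Φ, W]; ring
  simp_rw [hcom]
  change ∫ w in straightStrip y, Ψ w = _
  linear_combination Complex.I * hrect + (∫ w in straightStrip y, Ψ w) * Complex.I_sq

end Uniformization

end CurvedStrip

namespace CurvedStrip

variable {S : CurvedStrip}

/-! ### Green's formula for Hardy functions -/

theorem enorm_bdry_le {H : ℂ → ℂ} (hH : AEStronglyMeasurable H S.boundaryMeasure) :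
    ‖S.bdry H‖ₑ ≤ eLpNorm H 1 S.boundaryMeasure := by
  have hm1 : AEStronglyMeasurable H (S.arcLength S.δ) :=
    hH.mono_measure (Measure.le_add_right le_rfl)
  have hm2 : AEStronglyMeasurable H (S.arcLength (-S.δ)) :=
    hH.mono_measure (Measure.le_add_left le_rfl)
  have key : ∀ t, |t| ≤ S.δ → AEStronglyMeasurable H (S.arcLength t) →
      ‖∫ s, Complex.I * S.tangent s * (S.jac s t * H (S.tube (s, t)))‖ₑ ≤
        eLpNorm H 1 (S.arcLength t) := by
    intro t ht hm
    rw [eLpNorm_one_eq_lintegral_enorm, S.lintegral_arc ht hm.enorm]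
    refine (enorm_integral_le_lintegral_enorm _).trans (lintegral_mono fun s => ?_)
    rw [enorm_mul, enorm_mul, enorm_mul, S.enorm_tangent, ← ofReal_norm Complex.I,
      Complex.norm_I, ← ofReal_norm (S.jac s t : ℂ), Complex.norm_real, Real.norm_eq_abs,
      abs_of_pos (S.jac_pos ht)]
    simp
  rw [boundaryMeasure, eLpNorm_one_add_measure, bdry]
  exact (enorm_sub_le).trans (add_le_add (key _ S.abs_δ hm1) (key _ S.abs_neg_δ hm2))

theorem integrable_bdry {H : ℂ → ℂ} (hH : Integrable H S.boundaryMeasure) {t : ℝ}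
    (ht : t = S.δ ∨ t = -S.δ) :
    Integrable fun s => Complex.I * S.tangent s * (S.jac s t * H (S.tube (s, t))) := by
  have h1 : Integrable H (S.arcLength t) := by
    rcases ht with rfl | rfl
    · exact hH.mono_measure (Measure.le_add_right le_rfl)
    · exact hH.mono_measure (Measure.le_add_left le_rfl)
  have ht' : |t| ≤ S.δ := by
    rcases ht with rfl | rfl
    exacts [S.abs_δ, S.abs_neg_δ]
  refine (S.integrable_arc ht' h1).bdd_mul (c := 1) ?_ (Eventually.of_forall fun s => ?_)
  · exact (continuous_const.mul S.continuous_tangent).aestronglyMeasurable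
  · rw [norm_mul, S.norm_tangent, Complex.norm_I, mul_one]

theorem bdry_add {H G : ℂ → ℂ} (hH : Integrable H S.boundaryMeasure)
    (hG : Integrable G S.boundaryMeasure) : S.bdry (fun z => H z + G z) = S.bdry H + S.bdry G := by
  simp only [bdry, mul_add]
  rw [integral_add (integrable_bdry hH (.inl rfl)) (integrable_bdry hG (.inl rfl)),
    integral_add (integrable_bdry hH (.inr rfl)) (integrable_bdry hG (.inr rfl))]
  ring

theorem bdry_const_mul (c : ℂ) (H : ℂ → ℂ) : S.bdry (fun z => c * H z) = c * S.bdry H := by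
  simp only [bdry, mul_sub, ← integral_const_mul]
  congr 1 <;> refine integral_congr_ae (Eventually.of_forall fun s => ?_) <;> simp only <;> ring

theorem bdry_sub {H G : ℂ → ℂ} (hH : Integrable H S.boundaryMeasure)
    (hG : Integrable G S.boundaryMeasure) : S.bdry (fun z => H z - G z) = S.bdry H - S.bdry G := by
  have := bdry_add hH (hG.const_mul (-1))
  rw [bdry_const_mul] at this
  simpa [sub_eq_add_neg] using this

theorem bdry_congr {H G : ℂ → ℂ} (h : H =ᵐ[S.boundaryMeasure] G) : S.bdry H = S.bdry G := by
  have h1 : H =ᵐ[S.arcLength S.δ] G :=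
    (Measure.absolutelyContinuous_of_le (Measure.le_add_right le_rfl)).ae_le h
  have h2 : H =ᵐ[S.arcLength (-S.δ)] G :=
    (Measure.absolutelyContinuous_of_le (Measure.le_add_left le_rfl)).ae_le h
  unfold bdry
  congr 1 <;> refine integral_congr_ae ?_
  · filter_upwards [(S.quasiMeasurePreserving_arc S.abs_δ).ae h1] with s hs
    rw [hs]
  · filter_upwards [(S.quasiMeasurePreserving_arc S.abs_neg_δ).ae h2] with s hs
    rw [hs]

/-! ### Hardy functions near the boundary, compared with smooth functions -/

namespace Uniformization

variable (R : S.Uniformization)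

theorem continuous_inv_pt {y : ℝ} (hy : |y| ≤ S.δ) : Continuous fun x => R.inv (pt x y) :=
  R.inv_continuousOn.comp_continuous (continuous_pt y) fun x => by simpa using hy

/-- The image of the Lebesgue measure under the parametrisation of a boundary curve by the
extended inverse of the uniformization. -/
noncomputable def lineMeasure (y : ℝ) : Measure ℂ := volume.map fun x : ℝ => R.inv (pt x y)

theorem isFiniteMeasureOnCompacts_lineMeasure {y : ℝ} (hy : |y| ≤ S.δ) :
    IsFiniteMeasureOnCompacts (R.lineMeasure y) := by
  refine ⟨fun K hK => ?_⟩
  obtain ⟨X, -, hX⟩ := R.exists_re_bound hK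
  rw [lineMeasure, Measure.map_apply (R.continuous_inv_pt hy).measurable hK.measurableSet]
  refine (measure_mono (t := Icc (-X) X) fun x hx => ?_).trans_lt isCompact_Icc.measure_lt_top
  exact abs_le.1 (not_lt.1 fun h => hX (pt x y) (by simpa using hy) (by simpa using h) hx)

variable {R}

theorem memLp_slice {v : ℂ → ℂ} (hv : MemHardy R v) {y : ℝ} (hy : |y| < S.δ) :
    MemLp (fun x => v (R.inv (pt x y))) 2 volume := by
  obtain ⟨C, hC⟩ := hv.2.2
  refine ⟨?_, (hC y (abs_lt.1 hy)).trans_lt ENNReal.coe_lt_top⟩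
  exact (hv.2.1.continuousOn.comp_continuous (continuous_pt y)
    fun x => pt_mem hy).aestronglyMeasurable

/-- One slice close enough to the boundary suffices: both the slice and its difference with the
trace are square integrable. -/
theorem memLp_line {v g : ℂ → ℂ} (hv : MemHardy R v) (hg : Measurable g) {b : ℝ} (hb : |b| ≤ S.δ)
    {l : Filter ℝ} [l.NeBot] (hl : ∀ᶠ y in l, |y| < S.δ)
    (ht : Tendsto (fun y => eLpNorm (fun x => v (R.inv (pt x y)) - g (R.inv (pt x b))) 2 volume)
      l (𝓝 0)) : MemLp g 2 (R.lineMeasure b) := by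
  have hgm : Measurable fun x => g (R.inv (pt x b)) := hg.comp (R.continuous_inv_pt hb).measurable
  rw [lineMeasure, memLp_map_measure_iff hg.aestronglyMeasurable
    (R.continuous_inv_pt hb).measurable.aemeasurable]
  obtain ⟨y, hy, hy1⟩ := (hl.and (ht.eventually (gt_mem_nhds (one_pos)))).exists
  have h1 := memLp_slice hv hy
  have h2 : MemLp (fun x => v (R.inv (pt x y)) - g (R.inv (pt x b))) 2 volume :=
    ⟨h1.1.sub hgm.aestronglyMeasurable, hy1.trans ENNReal.one_lt_top⟩
  have := h1.sub h2
  refine this.ae_eq (Eventually.of_forall fun x => ?_)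
  simp

/-- Comparison of a Hardy function with a smooth function, near one side of the strip. -/
theorem enorm_slice_le {v g η : ℂ → ℂ} (hv : MemHardy R v) (hg : Measurable g)
    (hη : Continuous η) {L : ℝ} (hL : ∀ w w' : ℂ, |w.im| ≤ S.δ → |w'.im| ≤ S.δ →
      ‖η (R.inv w) - η (R.inv w')‖ ≤ L * ‖w - w'‖) {k : ℂ → ℂ} {X M : ℝ}
    (hkM : ∀ w ∈ straightStrip S.δ, ‖k w‖ ≤ M)
    (hkX : ∀ w ∈ straightStrip S.δ, X < |w.re| → k w = 0) {y b : ℝ} (hy : |y| < S.δ)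
    (hb : |b| ≤ S.δ) :
    ‖∫ x, (v (R.inv (pt x y)) - η (R.inv (pt x y))) * k (pt x y)‖ₑ ≤
      ENNReal.ofReal M * volume (Icc (-X) X) ^ (1 / 2 : ℝ) *
      (eLpNorm (fun x => v (R.inv (pt x y)) - g (R.inv (pt x b))) 2 volume +
        (eLpNorm (fun z => g z - η z) 2 (R.lineMeasure b) +
          volume (Icc (-X) X) ^ (1 / 2 : ℝ) * ENNReal.ofReal (L * |y - b|))) := by
  set ρ := (volume : Measure ℝ).restrict (Icc (-X) X) with hρ
  have hρu : ρ univ = volume (Icc (-X) X) := by simp [hρ]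
  have hvm := (memLp_slice hv hy).1
  have hηm : ∀ t, |t| ≤ S.δ → Continuous fun x => η (R.inv (pt x t)) :=
    fun t ht => hη.comp (R.continuous_inv_pt ht)
  have hgm : Measurable fun x => g (R.inv (pt x b)) := hg.comp (R.continuous_inv_pt hb).measurable
  have h1 : ‖∫ x, (v (R.inv (pt x y)) - η (R.inv (pt x y))) * k (pt x y)‖ₑ ≤
      ENNReal.ofReal M * eLpNorm (fun x => v (R.inv (pt x y)) - η (R.inv (pt x y))) 1 ρ := by
    rw [eLpNorm_one_eq_lintegral_enorm, ← lintegral_const_mul' _ _ ENNReal.ofReal_ne_top, hρ,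
      ← lintegral_indicator measurableSet_Icc]
    refine (enorm_integral_le_lintegral_enorm _).trans (lintegral_mono fun x => ?_)
    by_cases hx : x ∈ Icc (-X) X
    · rw [indicator_of_mem hx, enorm_mul, mul_comm]
      gcongr
      rw [← ofReal_norm]
      exact ENNReal.ofReal_le_ofReal (hkM _ (pt_mem hy))
    · rw [hkX _ (pt_mem hy) (by rw [pt_re]; by_contra h; exact hx (abs_le.1 (not_lt.1 h))),
        mul_zero, enorm_zero]
      exact zero_le
  refine h1.trans ?_
  rw [mul_assoc]
  gcongr
  have h2 := eLpNorm_le_eLpNorm_mul_rpow_measure_univ (μ := ρ) (p := 1) (q := 2)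
    (f := fun x => v (R.inv (pt x y)) - η (R.inv (pt x y))) (by norm_num)
    (hvm.restrict.sub (hηm y hy.le).aestronglyMeasurable)
  refine h2.trans ?_
  rw [hρu, mul_comm]
  have he : (1 / (1 : ℝ≥0∞).toReal - 1 / (2 : ℝ≥0∞).toReal) = (1 / 2 : ℝ) := by norm_num
  rw [he]
  gcongr
  -- Three errors: the slice against the trace, the trace against η on the boundary line, and η
  -- against its own displacement from one line to the other.
  have h3 : (fun x => v (R.inv (pt x y)) - η (R.inv (pt x y))) =
      (fun x => v (R.inv (pt x y)) - g (R.inv (pt x b))) +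
      ((fun x => g (R.inv (pt x b)) - η (R.inv (pt x b))) +
      fun x => η (R.inv (pt x b)) - η (R.inv (pt x y))) := by
    ext x; simp
  rw [h3]
  have hm1 : AEStronglyMeasurable (fun x => v (R.inv (pt x y)) - g (R.inv (pt x b))) volume :=
    hvm.sub hgm.aestronglyMeasurable
  have hm2 : AEStronglyMeasurable (fun x => g (R.inv (pt x b)) - η (R.inv (pt x b))) volume :=
    hgm.aestronglyMeasurable.sub (hηm b hb).aestronglyMeasurable
  have hm3 : AEStronglyMeasurable (fun x => η (R.inv (pt x b)) - η (R.inv (pt x y))) volume :=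
    ((hηm b hb).sub (hηm y hy.le)).aestronglyMeasurable
  refine (eLpNorm_add_le hm1.restrict (hm2.restrict.add hm3.restrict) (by norm_num)).trans ?_
  refine add_le_add (eLpNorm_mono_measure _ Measure.restrict_le_self)
    ((eLpNorm_add_le hm2.restrict hm3.restrict (by norm_num)).trans (add_le_add ?_ ?_))
  · change _ ≤ eLpNorm (g - η) 2 _
    rw [lineMeasure, eLpNorm_map_measure (hg.aestronglyMeasurable.sub hη.aestronglyMeasurable)
      (R.continuous_inv_pt hb).measurable.aemeasurable]
    exact eLpNorm_mono_measure _ Measure.restrict_le_self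
  · refine (eLpNorm_le_of_ae_bound (C := L * |y - b|) (Eventually.of_forall fun x => ?_)).trans ?_
    · refine (hL _ _ (by simpa using hb) (by simpa using hy.le)).trans ?_
      have : pt x b - pt x y = ((b - y : ℝ) : ℂ) * Complex.I := by simp [pt]; ring
      rw [this, norm_mul, Complex.norm_I, mul_one, Complex.norm_real, Real.norm_eq_abs, abs_sub_comm]
    · rw [hρu]; norm_num

/-- For the smooth function ηE, Green's formula holds with arc length on ∂Ω and also on conformal
slices. Subtracting the slice formulas for vE and ηE leaves only v − η on slices, whose limit is
controlled by the trace. The constant K depends on E alone, so η can later be sent to the trace. -/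
theorem enorm_integral_hardy_sub_bdry_le {v g : ℂ → ℂ} (hv : MemHardy R v)
    (hg : IsHardyTrace R v g) {E : ℂ → ℂ} (hE : ContDiff ℝ ∞ E) (hc : HasCompactSupport E)
    (hint : IntegrableOn (fun z => v z * (fderiv ℝ E z 1 + Complex.I * fderiv ℝ E z Complex.I))
      S.Ω) : ∃ K : ℝ≥0∞, K ≠ ⊤ ∧ ∀ η : ℂ → ℂ, ContDiff ℝ ∞ η → HasCompactSupport η →
    ‖(∫ z in S.Ω, v z * (fderiv ℝ E z 1 + Complex.I * fderiv ℝ E z Complex.I)) -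
      S.bdry (fun z => η z * E z)‖ₑ ≤ K * (eLpNorm (fun z => g z - η z) 2 (R.lineMeasure S.δ) +
        eLpNorm (fun z => g z - η z) 2 (R.lineMeasure (-S.δ))) := by
  have hδ := S.δ_pos
  obtain ⟨X, hX0, hX⟩ := R.exists_re_bound hc.isCompact
  obtain ⟨C, hC⟩ := R.inv_deriv_bounded
  have hC0 : 0 ≤ C := (norm_nonneg _).trans (hC 0 (by simpa [straightStrip] using hδ))
  obtain ⟨B, hB⟩ := hc.exists_bound_of_continuous hE.continuous
  have hB0 : 0 ≤ B := (norm_nonneg _).trans (hB 0)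
  obtain ⟨Li, hLi0, hLi⟩ := R.exists_norm_inv_sub_le
  set k : ℂ → ℂ := fun w => E (R.inv w) * deriv R.inv w with hk
  have hkM : ∀ w ∈ straightStrip S.δ, ‖k w‖ ≤ B * C := fun w hw => by
    rw [hk, norm_mul]
    exact mul_le_mul (hB _) (hC w hw) (norm_nonneg _) hB0
  have hkX : ∀ w ∈ straightStrip S.δ, X < |w.re| → k w = 0 := fun w hw h => by
    rw [hk]; simp only
    rw [image_eq_zero_of_notMem_tsupport (hX w (le_of_lt hw) h), zero_mul]
  set K : ℝ≥0∞ := ENNReal.ofReal (B * C) * volume (Icc (-X) X) ^ (1 / 2 : ℝ) with hK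
  have hvol : volume (Icc (-X) X) ^ (1 / 2 : ℝ) ≠ ⊤ :=
    ENNReal.rpow_ne_top_of_nonneg (by norm_num) isCompact_Icc.measure_lt_top.ne
  have hKt : K ≠ ⊤ := ENNReal.mul_ne_top ENNReal.ofReal_ne_top hvol
  refine ⟨K, hKt, fun η hη hηc => ?_⟩
  have hηE : ContDiff ℝ ∞ fun z => η z * E z := hη.mul hE
  have hηEc : HasCompactSupport fun z => η z * E z := hηc.mul_right
  obtain ⟨Lη, hLη⟩ := hη.lipschitzWith_of_hasCompactSupport hηc (by simp)
  have hL : ∀ w w' : ℂ, |w.im| ≤ S.δ → |w'.im| ≤ S.δ →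
      ‖η (R.inv w) - η (R.inv w')‖ ≤ (Lη * Li) * ‖w - w'‖ := fun w w' hw hw' => by
    refine (hLη.norm_sub_le _ _).trans ?_
    rw [mul_assoc]
    gcongr
    exact hLi w w' hw hw'
  -- The same half-widths as in the exhaustion of the strip, so that slice identities and bulk
  -- limits match.
  set y : ℕ → ℝ := fun n => S.δ - S.δ / (n + 2) with hy
  have hy1 : ∀ n, 0 < y n := fun n => by
    simp only [hy]
    rw [sub_pos, div_lt_iff₀ (by positivity)]
    nlinarith [(Nat.cast_nonneg n : (0 : ℝ) ≤ n)]
  have hy2 : ∀ n, y n < S.δ := fun n => by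
    simp only [hy]
    have : 0 < S.δ / ((n : ℝ) + 2) := by positivity
    linarith
  have hylim : Tendsto y atTop (𝓝 S.δ) := by
    have : Tendsto (fun n : ℕ => S.δ - S.δ / ((n : ℝ) + 2)) atTop (𝓝 (S.δ - 0)) :=
      tendsto_const_nhds.sub (tendsto_const_nhds.div_atTop
        (tendsto_atTop_add_const_right _ _ tendsto_natCast_atTop_atTop))
    rwa [sub_zero] at this
  have hylim1 : Tendsto y atTop (𝓝[<] S.δ) :=
    tendsto_nhdsWithin_iff.2 ⟨hylim, Eventually.of_forall hy2⟩
  have hylim2 : Tendsto (fun n => -y n) atTop (𝓝[>] (-S.δ)) :=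
    tendsto_nhdsWithin_iff.2 ⟨hylim.neg, Eventually.of_forall fun n => neg_lt_neg (hy2 n)⟩
  have hyabs : ∀ n, |y n| < S.δ := fun n => by rw [abs_of_pos (hy1 n)]; exact hy2 n
  have hyabs' : ∀ n, |-y n| < S.δ := fun n => by rw [abs_neg]; exact hyabs n
  have hintη : IntegrableOn (fun z => fderiv ℝ (fun z => η z * E z) z 1 +
      Complex.I * fderiv ℝ (fun z => η z * E z) z Complex.I) S.Ω := by
    have hd := hηE.continuous_fderiv (n := ∞) (by simp)
    have hcont : Continuous fun z => fderiv ℝ (fun z => η z * E z) z 1 +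
      Complex.I * fderiv ℝ (fun z => η z * E z) z Complex.I := by fun_prop
    refine (hcont.integrable_of_hasCompactSupport ?_).integrableOn
    exact (hηEc.fderiv (𝕜 := ℝ)).comp_left (g := fun L : ℂ →L[ℝ] ℂ => L 1 + Complex.I * L Complex.I)
      (by simp)
  have hlim1 := tendsto_integral_straightStrip ((R.integrableOn_iff _).1 hint)
  rw [← R.integral_eq (fun z => v z * (fderiv ℝ E z 1 + Complex.I * fderiv ℝ E z Complex.I))]
    at hlim1
  have hlim2 := tendsto_integral_straightStrip ((R.integrableOn_iff _).1 hintη)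
  rw [← R.integral_eq (fun z => fderiv ℝ (fun z => η z * E z) z 1 +
    Complex.I * fderiv ℝ (fun z => η z * E z) z Complex.I),
    S.integral_dbar_eq_bdry hηE hηEc] at hlim2
  have hlim := (hlim1.sub hlim2).enorm
  have hslice1 := fun n => R.integral_slice hv.2.1 hE hc (hy1 n) (hy2 n)
  -- The slice identity for ηE itself, with the holomorphic factor equal to 1.
  have hslice2 := fun n => R.integral_slice (V := fun _ => 1) (differentiableOn_const _) hηE hηEc
    (hy1 n) (hy2 n)
  simp only [one_mul] at hslice2
  simp only [Function.comp_def] at hslice1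
  have hki : ∀ t, |t| < S.δ → ∀ V : ℂ → ℂ, MemLp (fun x => V (R.inv (pt x t))) 2 volume →
      Integrable fun x => V (R.inv (pt x t)) * k (pt x t) := by
    intro t ht V hV
    refine hV.integrable_mul (q := 2) ?_
    have hkc : Continuous fun x => k (pt x t) := by
      have h1 := R.differentiableOn_deriv_inv.continuousOn.comp_continuous (continuous_pt t)
        (fun x => pt_mem ht)
      exact (hE.continuous.comp (R.continuous_inv_pt ht.le)).mul h1
    refine hkc.memLp_of_hasCompactSupport
      (HasCompactSupport.intro (isCompact_Icc (a := -X) (b := X)) fun x hx => ?_)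
    exact hkX _ (pt_mem ht) (by rw [pt_re]; by_contra h; exact hx (abs_le.1 (not_lt.1 h)))
  have hηmem : ∀ t, |t| < S.δ → MemLp (fun x => η (R.inv (pt x t))) 2 volume := by
    intro t ht
    obtain ⟨Y, -, hY⟩ := R.exists_re_bound hηc.isCompact
    refine (hη.continuous.comp (R.continuous_inv_pt ht.le)).memLp_of_hasCompactSupport
      (HasCompactSupport.intro (isCompact_Icc (a := -Y) (b := Y)) fun x hx => ?_)
    refine image_eq_zero_of_notMem_tsupport (f := η) (hY (pt x t) (by simpa using ht.le) ?_)
    rw [pt_re]; by_contra h; exact hx (abs_le.1 (not_lt.1 h))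
  have hdiff : ∀ t, |t| < S.δ → (∫ x, v (R.inv (pt x t)) * k (pt x t)) -
      (∫ x, η (R.inv (pt x t)) * E (R.inv (pt x t)) * deriv R.inv (pt x t)) =
      ∫ x, (v (R.inv (pt x t)) - η (R.inv (pt x t))) * k (pt x t) := by
    intro t ht
    simp_rw [sub_mul]
    rw [integral_sub (hki t ht v (memLp_slice hv ht)) (hki t ht η (hηmem t ht))]
    simp only [hk, mul_assoc]
  set T : ℝ → ℝ → ℝ≥0∞ := fun t b => K *
    (eLpNorm (fun x => v (R.inv (pt x t)) - g (R.inv (pt x b))) 2 volume +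
      (eLpNorm (fun z => g z - η z) 2 (R.lineMeasure b) +
        volume (Icc (-X) X) ^ (1 / 2 : ℝ) * ENNReal.ofReal ((Lη * Li) * |t - b|))) with hT
  have hTlim : ∀ (t : ℕ → ℝ) (b : ℝ), Tendsto t atTop (𝓝 b) → Tendsto (fun n =>
      eLpNorm (fun x => v (R.inv (pt x (t n))) - g (R.inv (pt x b))) 2 volume) atTop (𝓝 0) →
      Tendsto (fun n => T (t n) b) atTop
        (𝓝 (K * eLpNorm (fun z => g z - η z) 2 (R.lineMeasure b))) := by
    intro t b ht h0
    have h1 : Tendsto (fun n => ENNReal.ofReal ((Lη * Li) * |t n - b|)) atTop (𝓝 0) := by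
      have : Tendsto (fun n => (Lη * Li) * |t n - b|) atTop (𝓝 ((Lη * Li) * |b - b|)) :=
        tendsto_const_nhds.mul ((ht.sub tendsto_const_nhds).abs)
      rw [sub_self, abs_zero, mul_zero] at this
      simpa using ENNReal.tendsto_ofReal this
    have h2 := ENNReal.Tendsto.const_mul (a := K) (h0.add ((tendsto_const_nhds (x :=
      eLpNorm (fun z => g z - η z) 2 (R.lineMeasure b))).add
      (ENNReal.Tendsto.const_mul (a := volume (Icc (-X) X) ^ (1 / 2 : ℝ)) h1 (.inr hvol))))
      (.inr hKt)
    simpa only [mul_zero, add_zero, zero_add] using h2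
  have hlimT := (hTlim y S.δ hylim (hg.2.1.comp hylim1)).add
    (hTlim (fun n => -y n) (-S.δ) hylim.neg (hg.2.2.comp hylim2))
  rw [mul_add]
  refine le_of_tendsto_of_tendsto' hlim hlimT fun n => ?_
  have e1 := hdiff (y n) (hyabs n)
  have e2 := hdiff (-y n) (hyabs' n)
  rw [hslice1, hslice2]
  have e3 : Complex.I * ((∫ x, v (R.inv (pt x (y n))) * (E (R.inv (pt x (y n))) *
      deriv R.inv (pt x (y n)))) - ∫ x, v (R.inv (pt x (-y n))) * (E (R.inv (pt x (-y n))) *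
      deriv R.inv (pt x (-y n)))) - Complex.I * ((∫ x, η (R.inv (pt x (y n))) *
      E (R.inv (pt x (y n))) * deriv R.inv (pt x (y n))) - ∫ x, η (R.inv (pt x (-y n))) *
      E (R.inv (pt x (-y n))) * deriv R.inv (pt x (-y n))) =
      Complex.I * ((∫ x, (v (R.inv (pt x (y n))) - η (R.inv (pt x (y n)))) * k (pt x (y n))) -
      ∫ x, (v (R.inv (pt x (-y n))) - η (R.inv (pt x (-y n)))) * k (pt x (-y n))) := by
    rw [← e1, ← e2]; ring
  rw [e3, enorm_mul, ← ofReal_norm Complex.I, Complex.norm_I, ENNReal.ofReal_one, one_mul]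
  exact enorm_sub_le.trans (add_le_add
    (enorm_slice_le hv hg.1 hη.continuous hL hkM hkX (hyabs n) S.abs_δ)
    (enorm_slice_le hv hg.1 hη.continuous hL hkM hkX (hyabs' n)
      S.abs_neg_δ))

/-- The trace g is in L² for arc length and for both conformal line measures, so one smooth η
approximates it in all three. The first gives closeness of the boundary integrals, the others make
the bound of the preceding comparison small. -/
theorem integral_hardy_dbar {v g : ℂ → ℂ} (hv : MemHardy R v) (hg : IsHardyTrace R v g)
    (hgm : MemLp g 2 S.boundaryMeasure) {E : ℂ → ℂ} (hE : ContDiff ℝ ∞ E)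
    (hc : HasCompactSupport E)
    (hint : IntegrableOn (fun z => v z * (fderiv ℝ E z 1 + Complex.I * fderiv ℝ E z Complex.I))
      S.Ω) : ∫ z in S.Ω, v z * (fderiv ℝ E z 1 + Complex.I * fderiv ℝ E z Complex.I) =
      S.bdry (fun z => g z * E z) := by
  have hδ := S.δ_pos
  obtain ⟨K, hK, hKη⟩ := enorm_integral_hardy_sub_bdry_le hv hg hE hc hint
  have hgδ : MemLp g 2 (R.lineMeasure S.δ) := by
    refine memLp_line hv hg.1 S.abs_δ (l := 𝓝[<] S.δ) ?_ hg.2.1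
    filter_upwards [Ioo_mem_nhdsLT (show -S.δ < S.δ by linarith)] with y hy using abs_lt.2 hy
  have hgδ' : MemLp g 2 (R.lineMeasure (-S.δ)) := by
    refine memLp_line hv hg.1 S.abs_neg_δ (l := 𝓝[>] (-S.δ)) ?_ hg.2.2
    filter_upwards [Ioo_mem_nhdsGT (show -S.δ < S.δ by linarith)] with y hy using abs_lt.2 hy
  -- Density of continuous or smooth functions in L² of the sum of the measures gives simultaneous
  -- approximation, without relating the measures to one another.
  set ν := S.boundaryMeasure + (R.lineMeasure S.δ + R.lineMeasure (-S.δ)) with hν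
  have i1 := R.isFiniteMeasureOnCompacts_lineMeasure S.abs_δ
  have i2 := R.isFiniteMeasureOnCompacts_lineMeasure S.abs_neg_δ
  have : IsFiniteMeasureOnCompacts ν := by
    refine ⟨fun A hA => ?_⟩
    rw [hν, Measure.add_apply, Measure.add_apply]
    exact ENNReal.add_lt_top.2 ⟨hA.measure_lt_top,
      ENNReal.add_lt_top.2 ⟨hA.measure_lt_top, hA.measure_lt_top⟩⟩
  have hgν : MemLp g 2 ν := by
    refine ⟨hg.1.aestronglyMeasurable, ?_⟩
    rw [eLpNorm_lt_top_iff_lintegral_rpow_enorm_lt_top (by norm_num) (by norm_num), hν,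
      lintegral_add_measure, lintegral_add_measure]
    have := fun {μ : Measure ℂ} (h : MemLp g 2 μ) =>
      (eLpNorm_lt_top_iff_lintegral_rpow_enorm_lt_top (by norm_num) (by norm_num)).1 h.2
    exact ENNReal.add_lt_top.2 ⟨this hgm, ENNReal.add_lt_top.2 ⟨this hgδ, this hgδ'⟩⟩
  have hEm : MemLp E 2 S.boundaryMeasure := hE.continuous.memLp_of_hasCompactSupport hc
  set c := eLpNorm E 2 S.boundaryMeasure with hcE
  rw [← sub_eq_zero, ← enorm_eq_zero, ← nonpos_iff_eq_zero]
  have hbound : ∀ ε : ℝ, 0 < ε → ‖(∫ z in S.Ω, v z * (fderiv ℝ E z 1 +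
      Complex.I * fderiv ℝ E z Complex.I)) - S.bdry (fun z => g z * E z)‖ₑ ≤
      (K * 2 + c) * ENNReal.ofReal ε := by
    intro ε hε
    obtain ⟨η, hηc, hη, hle⟩ := hgν.exist_eLpNorm_sub_le (by norm_num) (by norm_num) hε
    have hηm : MemLp η 2 S.boundaryMeasure := hη.continuous.memLp_of_hasCompactSupport hηc
    have l1 : eLpNorm (fun z => g z - η z) 2 (R.lineMeasure S.δ) ≤ ENNReal.ofReal ε :=
      (eLpNorm_mono_measure _ ((Measure.le_add_right le_rfl).trans
        (Measure.le_add_left le_rfl))).trans hle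
    have l2 : eLpNorm (fun z => g z - η z) 2 (R.lineMeasure (-S.δ)) ≤ ENNReal.ofReal ε :=
      (eLpNorm_mono_measure _ ((Measure.le_add_left le_rfl).trans
        (Measure.le_add_left le_rfl))).trans hle
    have l3 : eLpNorm (fun z => g z - η z) 2 S.boundaryMeasure ≤ ENNReal.ofReal ε :=
      (eLpNorm_mono_measure _ (Measure.le_add_right le_rfl)).trans hle
    have hb : ‖S.bdry (fun z => η z * E z) - S.bdry (fun z => g z * E z)‖ₑ ≤
        c * ENNReal.ofReal ε := by
      rw [← enorm_neg, neg_sub, 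
        ← bdry_sub (H := fun z => g z * E z) (G := fun z => η z * E z) (hgm.integrable_mul hEm)
          (hηm.integrable_mul hEm)]
      have hm : AEStronglyMeasurable (fun z => g z - η z) S.boundaryMeasure := hgm.1.sub hηm.1
      refine (enorm_bdry_le ((hgm.1.mul hEm.1).sub (hηm.1.mul hEm.1))).trans ?_
      have h1 : g * E - η * E = E • fun z => g z - η z := by
        ext z; simp; ring
      rw [h1]
      exact (eLpNorm_smul_le_mul_eLpNorm (p := 2) (q := 2) hm hEm.1).trans (by gcongr)
    have htri : (∫ z in S.Ω, v z * (fderiv ℝ E z 1 + Complex.I * fderiv ℝ E z Complex.I)) -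
        S.bdry (fun z => g z * E z) =
        ((∫ z in S.Ω, v z * (fderiv ℝ E z 1 + Complex.I * fderiv ℝ E z Complex.I)) -
          S.bdry (fun z => η z * E z)) +
        (S.bdry (fun z => η z * E z) - S.bdry (fun z => g z * E z)) := by ring
    rw [htri, add_mul]
    refine (enorm_add_le _ _).trans (add_le_add ((hKη η hη hηc).trans ?_) hb)
    rw [mul_assoc, two_mul]
    gcongr
  have hlim : Tendsto (fun ε : ℝ => (K * 2 + c) * ENNReal.ofReal ε) (𝓝[>] 0) (𝓝 0) := by
    have h1 : Tendsto (fun ε : ℝ => ENNReal.ofReal ε) (𝓝[>] 0) (𝓝 0) := by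
      simpa using (ENNReal.continuous_ofReal.tendsto 0).mono_left nhdsWithin_le_nhds
    have h2 := ENNReal.Tendsto.const_mul (a := K * 2 + c) h1 (.inr (by
      exact ENNReal.add_ne_top.2 ⟨ENNReal.mul_ne_top hK (by norm_num), hEm.2.ne⟩))
    simpa using h2
  refine ge_of_tendsto hlim ?_
  filter_upwards [self_mem_nhdsWithin] with ε hε using hbound ε hε

end Uniformization

end CurvedStrip

namespace CurvedStrip

variable {S : CurvedStrip}

/-! ### Convergence of pairings -/

theorem enorm_integral_mul_le {α : Type*} [MeasurableSpace α] {μ : Measure α} {f X : α → ℂ}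
    (hf : AEStronglyMeasurable f μ) (hX : AEStronglyMeasurable X μ) :
    eLpNorm (fun z => f z * X z) 1 μ ≤ eLpNorm f 2 μ * eLpNorm X 2 μ := by
  have h := eLpNorm_smul_le_mul_eLpNorm (p := 2) (q := 2) (r := 1) hX hf
  exact h

theorem tendsto_integral_mul {α : Type*} [MeasurableSpace α] {μ : Measure α} {F : ℕ → α → ℂ}
    {f X : α → ℂ} (hF : ∀ n, MemLp (F n) 2 μ) (hf : MemLp f 2 μ) (hX : MemLp X 2 μ)
    (h : Tendsto (fun n => eLpNorm (fun z => F n z - f z) 2 μ) atTop (𝓝 0)) :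
    Tendsto (fun n => ∫ z, F n z * X z ∂μ) atTop (𝓝 (∫ z, f z * X z ∂μ)) := by
  refine tendsto_integral_of_L1' _ (hf.integrable_mul hX).1
    (Eventually.of_forall fun n => (hF n).integrable_mul hX) ?_
  have h1 := ENNReal.Tendsto.mul_const (b := eLpNorm X 2 μ) h (.inr hX.2.ne)
  rw [zero_mul] at h1
  refine tendsto_of_tendsto_of_tendsto_of_le_of_le tendsto_const_nhds h1 (fun _ => zero_le)
    fun n => ?_
  have : (fun n z => F n z * X z) n - (f * X) = fun z => (F n z - f z) * X z := by
    ext z; simp; ring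
  change eLpNorm ((fun n z => F n z * X z) n - (f * X)) 1 μ ≤ _
  rw [this]
  exact enorm_integral_mul_le ((hF n).1.sub hf.1) hX.1

theorem tendsto_bdry_mul {F : ℕ → ℂ → ℂ} {f X : ℂ → ℂ} (hF : ∀ n, MemLp (F n) 2 S.boundaryMeasure)
    (hf : MemLp f 2 S.boundaryMeasure) (hX : MemLp X 2 S.boundaryMeasure)
    (h : Tendsto (fun n => eLpNorm (fun z => F n z - f z) 2 S.boundaryMeasure) atTop (𝓝 0)) :
    Tendsto (fun n => S.bdry fun z => F n z * X z) atTop (𝓝 (S.bdry fun z => f z * X z)) := by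
  rw [tendsto_iff_edist_tendsto_0]
  have h1 := ENNReal.Tendsto.mul_const (b := eLpNorm X 2 S.boundaryMeasure) h (.inr hX.2.ne)
  rw [zero_mul] at h1
  refine tendsto_of_tendsto_of_tendsto_of_le_of_le tendsto_const_nhds h1 (fun _ => zero_le)
    fun n => ?_
  rw [edist_eq_enorm_sub, ← bdry_sub (H := fun z => F n z * X z) (G := fun z => f z * X z)
    ((hF n).integrable_mul hX) (hf.integrable_mul hX)]
  refine (enorm_bdry_le (((hF n).1.mul hX.1).sub (hf.1.mul hX.1))).trans ?_
  have : F n * X - f * X = fun z => (F n z - f z) * X z := by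
    ext z; simp; ring
  rw [this]
  exact enorm_integral_mul_le ((hF n).1.sub hf.1) hX.1

theorem memLp_fderiv {F : ℂ → ℂ} (hF : ContDiff ℝ ∞ F) (hc : HasCompactSupport F) (e : ℂ)
    (μ : Measure ℂ) [IsFiniteMeasureOnCompacts μ] : MemLp (fun z => fderiv ℝ F z e) 2 μ := by
  have hd := hF.continuous_fderiv (n := ∞) (by simp)
  exact (hd.clm_apply continuous_const).memLp_of_hasCompactSupport
    ((hc.fderiv (𝕜 := ℝ)).comp_left (g := fun L : ℂ →L[ℝ] ℂ => L e) (by simp))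

theorem fderiv_mul_apply {F E : ℂ → ℂ} (hF : ContDiff ℝ ∞ F) (hE : ContDiff ℝ ∞ E) (z e : ℂ) :
    fderiv ℝ (fun z => F z * E z) z e = F z * fderiv ℝ E z e + E z * fderiv ℝ F z e := by
  have h1 := hF.differentiable (by simp) z
  have h2 := hE.differentiable (by simp) z
  have := (h1.hasFDerivAt.mul h2.hasFDerivAt).fderiv
  rw [show (fun z => F z * E z) = F * E from rfl, this]
  simp

/-- Green's formula for Sobolev functions. -/
theorem IsSobolevTrace.green {u p₁ p₂ : S.L2} {g : S.L2b} (H : IsSobolevTrace u p₁ p₂ g)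
    {E : ℂ → ℂ} (hE : ContDiff ℝ ∞ E) (hc : HasCompactSupport E) :
    (∫ z in S.Ω, u z * (fderiv ℝ E z 1 + Complex.I * fderiv ℝ E z Complex.I)) +
      ((∫ z in S.Ω, p₁ z * E z) + ∫ z in S.Ω, p₂ z * (Complex.I * E z)) =
    S.bdry fun z => g z * E z := by
  obtain ⟨-, F, hF, a1, a2, a3, a4⟩ := H
  have hEm : MemLp E 2 (volume.restrict S.Ω) := memLp_smooth hE.continuous hc
  have hIE : MemLp (fun z => Complex.I * E z) 2 (volume.restrict S.Ω) := hEm.const_mul _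
  have hdE : MemLp (fun z => fderiv ℝ E z 1 + Complex.I * fderiv ℝ E z Complex.I) 2
      (volume.restrict S.Ω) :=
    (memLp_fderiv hE hc 1 _).add ((memLp_fderiv hE hc Complex.I _).const_mul _)
  have hFm : ∀ n, MemLp (F n) 2 (volume.restrict S.Ω) := fun n =>
    memLp_smooth (hF n).1.continuous (hF n).2
  have l1 := tendsto_integral_mul hFm (Lp.memLp u) hdE a1
  have l2 := tendsto_integral_mul (fun n => memLp_fderiv (hF n).1 (hF n).2 1 _) (Lp.memLp p₁) hEm a2
  have l3 := tendsto_integral_mul (fun n => memLp_fderiv (hF n).1 (hF n).2 Complex.I _)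
    (Lp.memLp p₂) hIE a3
  have l4 := tendsto_bdry_mul (fun n => (hF n).1.continuous.memLp_of_hasCompactSupport (hF n).2)
    (Lp.memLp g) (hE.continuous.memLp_of_hasCompactSupport hc) a4
  refine tendsto_nhds_unique ((l1.add (l2.add l3)).congr fun n => ?_) l4
  have hFE : ContDiff ℝ ∞ fun z => F n z * E z := (hF n).1.mul hE
  rw [← S.integral_dbar_eq_bdry hFE (hc.mul_left), ← integral_add, ← integral_add]
  · refine integral_congr_ae (Eventually.of_forall fun z => ?_)
    simp only [fderiv_mul_apply (hF n).1 hE]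
    ring
  · exact (hFm n).integrable_mul hdE
  · exact ((memLp_fderiv (hF n).1 (hF n).2 1 _).integrable_mul hEm).add
      ((memLp_fderiv (hF n).1 (hF n).2 Complex.I _).integrable_mul hIE)
  · exact (memLp_fderiv (hF n).1 (hF n).2 1 _).integrable_mul hEm
  · exact (memLp_fderiv (hF n).1 (hF n).2 Complex.I _).integrable_mul hIE

/-! ### The magnetic potential -/

namespace Potential

variable (P : S.Potential)

/-- The zeroth-order coefficient of `d_A^×`. -/
noncomputable def coef (z : ℂ) : ℂ := -(P.A₁ z : ℂ) - Complex.I * P.A₂ z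

theorem conj_coef (z : ℂ) : conj (P.coef z) = -(P.A₁ z : ℂ) + Complex.I * P.A₂ z := by
  simp [coef]

theorem continuous_coef : Continuous P.coef := by
  have hd := P.smooth.continuous_fderiv (n := ∞) (by simp)
  unfold coef A₁ A₂
  fun_prop

/-- The gradient of (t² − δ²)/2 is t n, of length at most δ, and the Schwartz correction has a
bounded gradient. Multiplication by the magnetic coefficient is therefore bounded on L²(Ω). -/
theorem exists_norm_coef_le : ∃ C, 0 ≤ C ∧ ∀ z ∈ S.Ω, ‖P.coef z‖ ≤ C := by
  obtain ⟨χ, hχ⟩ := P.schwartz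
  obtain ⟨C, hC⟩ := χ.decay' 0 1
  have hC' : ∀ z, ‖fderiv ℝ χ z‖ ≤ C := fun z => by
    have := hC z
    rw [pow_zero, one_mul, norm_iteratedFDeriv_one] at this
    exact this
  have hC0 : 0 ≤ C := (norm_nonneg _).trans (hC' 0)
  have hδ := S.δ_pos
  refine ⟨2 * (2 * (C + S.δ)), by positivity, ?_⟩
  rintro _ ⟨⟨s, t⟩, ⟨-, ht⟩, rfl⟩
  change ‖P.coef (S.tube (s, t))‖ ≤ _
  have ht' : |t| ≤ S.δ := abs_le.2 ⟨ht.1.le, ht.2.le⟩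
  have hj := S.jac_pos (s := s) ht'
  have hφd := (P.smooth.differentiable (by simp) (S.tube (s, t))).hasFDerivAt
  have hχd := (χ.smooth'.differentiable (by simp) (S.tube (s, t))).hasFDerivAt
  have e1 : fderiv ℝ P.φ (S.tube (s, t)) (S.tangent s) = fderiv ℝ χ (S.tube (s, t)) (S.tangent s) := by
    have h1 := hφd.comp_hasDerivAt s (S.hasDerivAt_tube_left s t)
    have h2 := (hχd.comp_hasDerivAt s (S.hasDerivAt_tube_left s t)).const_add
      ((t ^ 2 - S.δ ^ 2) / 2)
    have h3 := h1.unique (h2.congr_of_eventuallyEq (Eventually.of_forall fun s' => hχ s' t ht))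
    have h4 : (S.jac s t : ℂ) * S.tangent s = S.jac s t • S.tangent s := rfl
    rw [h4, map_smul, map_smul] at h3
    exact smul_right_injective _ hj.ne' h3
  have e2 : fderiv ℝ P.φ (S.tube (s, t)) (Complex.I * S.tangent s) =
      t + fderiv ℝ χ (S.tube (s, t)) (Complex.I * S.tangent s) := by
    have h1 := hφd.comp_hasDerivAt t (S.hasDerivAt_tube_right s t)
    have h0 : HasDerivAt (fun x : ℝ => (x ^ 2 - S.δ ^ 2) / 2) t t := by
      have := (((hasDerivAt_id t).pow 2).sub_const (S.δ ^ 2)).div_const 2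
      simpa using this
    have h2 := h0.add (hχd.comp_hasDerivAt t (S.hasDerivAt_tube_right s t))
    refine h1.unique (h2.congr_of_eventuallyEq ?_)
    filter_upwards [Ioo_mem_nhds ht.1 ht.2] with x hx using hχ s x hx
  have n1 : |fderiv ℝ P.φ (S.tube (s, t)) (S.tangent s)| ≤ C + S.δ := by
    rw [e1, ← Real.norm_eq_abs]
    refine ((fderiv ℝ χ (S.tube (s, t))).le_opNorm _).trans ?_
    rw [S.norm_tangent, mul_one]
    exact (hC' _).trans (by linarith)
  have n2 : |fderiv ℝ P.φ (S.tube (s, t)) (Complex.I * S.tangent s)| ≤ C + S.δ := by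
    rw [e2]
    refine (abs_add_le _ _).trans ?_
    have : |fderiv ℝ χ (S.tube (s, t)) (Complex.I * S.tangent s)| ≤ C := by
      rw [← Real.norm_eq_abs]
      refine ((fderiv ℝ χ (S.tube (s, t))).le_opNorm _).trans ?_
      rw [norm_mul, S.norm_tangent, Complex.norm_I, mul_one, mul_one]
      exact hC' _
    linarith
  have key : ∀ e : ℂ, ‖e‖ = 1 → |fderiv ℝ P.φ (S.tube (s, t)) e| ≤ 2 * (C + S.δ) := by
    intro e he
    set b := conj (S.tangent s) * e with hb
    have hbn : ‖b‖ = 1 := by rw [hb, norm_mul, he, RCLike.norm_conj, S.norm_tangent, mul_one]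
    have h1 : e = b.re • S.tangent s + b.im • (Complex.I * S.tangent s) := by
      have h2 : e = S.tangent s * b := by rw [hb, ← mul_assoc, S.tangent_mul_conj, one_mul]
      rw [Complex.real_smul, Complex.real_smul]
      nth_rw 1 [h2, ← Complex.re_add_im b]
      ring
    rw [h1, map_add, map_smul, map_smul, smul_eq_mul, smul_eq_mul]
    refine (abs_add_le _ _).trans ?_
    rw [abs_mul, abs_mul, two_mul]
    have h3 := Complex.abs_re_le_norm b
    have h4 := Complex.abs_im_le_norm b
    rw [hbn] at h3 h4
    exact add_le_add ((mul_le_of_le_one_left (abs_nonneg _) h3).trans n1)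
      ((mul_le_of_le_one_left (abs_nonneg _) h4).trans n2)
  have h1 := key 1 (by simp)
  have h2 := key Complex.I (by simp)
  unfold coef A₁ A₂
  refine (norm_sub_le _ _).trans ?_
  rw [norm_neg, norm_mul, Complex.norm_I, one_mul, Complex.norm_real, Complex.norm_real,
    Real.norm_eq_abs, Real.norm_eq_abs, abs_neg, two_mul]
  exact add_le_add h2 h1

theorem memLp_coef_mul {f : ℂ → ℂ} (hf : MemLp f 2 (volume.restrict S.Ω)) :
    MemLp (fun z => P.coef z * f z) 2 (volume.restrict S.Ω) := by
  obtain ⟨C, -, hC⟩ := P.exists_norm_coef_le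
  refine MemLp.of_le_mul (c := C) hf (P.continuous_coef.aestronglyMeasurable.mul hf.1) ?_
  filter_upwards [ae_restrict_mem S.isOpen_Ω.measurableSet] with z hz
  rw [norm_mul]
  exact mul_le_mul_of_nonneg_right (hC z hz) (norm_nonneg _)

theorem phi_tube (s : ℝ) {t : ℝ} (ht : |t| = S.δ) : P.φ (S.tube (s, t)) = 0 :=
  P.boundary _ (S.tube_mem_frontier s ht)

/-- The weight `e^{-φ/h}`. -/
noncomputable def weight (h : ℝ) (z : ℂ) : ℂ := (Real.exp (-P.φ z / h) : ℂ)

theorem contDiff_weight (h : ℝ) : ContDiff ℝ ∞ (P.weight h) :=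
  Complex.ofRealCLM.contDiff.comp (Real.contDiff_exp.comp (P.smooth.neg.div_const h))

theorem fderiv_weight (h : ℝ) (z e : ℂ) :
    fderiv ℝ (P.weight h) z e = -(fderiv ℝ P.φ z e / h : ℝ) * P.weight h z := by
  have h1 := ((P.smooth.differentiable (by simp) z).hasFDerivAt.neg.const_smul (h⁻¹)).exp
  have h2 := (Complex.ofRealCLM.hasFDerivAt (x := Real.exp (h⁻¹ • -P.φ z))).comp z h1
  have h3 : P.weight h = Complex.ofRealCLM ∘ fun z => Real.exp ((h⁻¹ • -P.φ) z) := by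
    ext z; simp [weight, div_eq_inv_mul]
  rw [h3, h2.fderiv]
  simp [div_eq_inv_mul]
  ring

/-- The formal transpose of `d_A^×`. -/
noncomputable def dTest (h : ℝ) (E : ℂ → ℂ) (z : ℂ) : ℂ :=
  Complex.I * h * (fderiv ℝ E z 1 + Complex.I * fderiv ℝ E z Complex.I) + P.coef z * E z

/-- The potential A is the rotated gradient of φ, so the zeroth-order term is exactly what
differentiating e^{-φ/h} produces. -/
theorem dTest_eq {h : ℝ} (hh : h ≠ 0) {E : ℂ → ℂ} (hE : ContDiff ℝ ∞ E) (z : ℂ) :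
    P.weight h z * P.dTest h E z = Complex.I * h * (fderiv ℝ (fun z => P.weight h z * E z) z 1 +
      Complex.I * fderiv ℝ (fun z => P.weight h z * E z) z Complex.I) := by
  rw [fderiv_mul_apply (P.contDiff_weight h) hE, fderiv_mul_apply (P.contDiff_weight h) hE,
    fderiv_weight, fderiv_weight, dTest, coef, A₁, A₂]
  have : (h : ℂ) ≠ 0 := by exact_mod_cast hh
  push_cast
  field_simp
  linear_combination (P.weight h z * E z * (fderiv ℝ P.φ z Complex.I : ℂ)) * Complex.I_sq

theorem memLp_dTest (h : ℝ) {E : ℂ → ℂ} (hE : ContDiff ℝ ∞ E) (hc : HasCompactSupport E) :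
    MemLp (P.dTest h E) 2 (volume.restrict S.Ω) :=
  (((memLp_fderiv hE hc 1 _).add ((memLp_fderiv hE hc Complex.I _).const_mul _)).const_mul _).add
    (P.memLp_coef_mul (memLp_smooth hE.continuous hc))

end Potential

/-! ### Green's formula for weighted Hardy functions -/

theorem bdry_congr_tube {H G : ℂ → ℂ} (h : ∀ s t, |t| = S.δ → H (S.tube (s, t)) = G (S.tube (s, t))) :
    S.bdry H = S.bdry G := by
  have hδ := S.δ_pos
  unfold bdry
  simp_rw [h _ S.δ (abs_of_pos hδ), h _ (-S.δ) (by rw [abs_neg, abs_of_pos hδ])]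

/-- After conjugation by the weight this is the formula for v against e^{-φ/h}E. The function
e^{-φ/h}v contributes no bulk term, being annihilated by d_A^×, and the weight disappears on ∂Ω,
where φ = 0. -/
theorem integral_hardy_dTest (P : S.Potential) {R : S.Uniformization} {h : ℝ} (hh : h ≠ 0)
    {v g : ℂ → ℂ} (hv : MemHardy R v) (hg : IsHardyTrace R v g) (hgm : MemLp g 2 S.boundaryMeasure)
    (hw : MemLp (fun z => P.weight h z * v z) 2 (volume.restrict S.Ω)) {E : ℂ → ℂ}
    (hE : ContDiff ℝ ∞ E) (hc : HasCompactSupport E) :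
    ∫ z in S.Ω, (P.weight h z * v z) * P.dTest h E z =
      Complex.I * h * S.bdry fun z => g z * E z := by
  have hwE : ContDiff ℝ ∞ fun z => P.weight h z * E z := (P.contDiff_weight h).mul hE
  have hh' : (h : ℂ) ≠ 0 := by exact_mod_cast hh
  have hb : (S.bdry fun z => g z * E z) = S.bdry fun z => g z * (P.weight h z * E z) := by
    refine bdry_congr_tube fun s t ht => ?_
    rw [Potential.weight, P.phi_tube s ht]
    simp
  have e : ∀ z, (P.weight h z * v z) * P.dTest h E z =
      Complex.I * h * (v z * (fderiv ℝ (fun z => P.weight h z * E z) z 1 +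
      Complex.I * fderiv ℝ (fun z => P.weight h z * E z) z Complex.I)) := fun z => by
    linear_combination v z * P.dTest_eq hh hE z
  rw [hb, ← Uniformization.integral_hardy_dbar hv hg hgm hwE hc.mul_left, ← integral_const_mul]
  · simp_rw [e]
  · have h1 : Integrable (fun z => (P.weight h z * v z) * P.dTest h E z) (volume.restrict S.Ω) :=
      hw.integrable_mul (P.memLp_dTest h hE hc)
    simp_rw [e] at h1
    rwa [integrable_const_mul_iff] at h1
    exact (mul_ne_zero Complex.I_ne_zero hh').isUnit

end CurvedStrip

namespace CurvedStrip

variable {S : CurvedStrip}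

/-! ### Green's formula on the form domain -/

theorem integrable_mul_of_memLp {α : Type*} [MeasurableSpace α] {μ : Measure α} {f g : α → ℂ}
    (hf : MemLp f 2 μ) (hg : MemLp g 2 μ) : Integrable (fun z => f z * g z) μ :=
  hf.integrable_mul hg

theorem inner_Lp_eq {α : Type*} [MeasurableSpace α] {μ : Measure α} (f g : Lp ℂ 2 μ) :
    ⟪f, g⟫_ℂ = ∫ z, conj (f z) * g z ∂μ := by
  rw [L2.inner_def]
  refine integral_congr_ae (Eventually.of_forall fun z => ?_)
  simp only [RCLike.inner_apply]
  ring

theorem eq_zero_of_forall_test {w : S.L2}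
    (hw : ∀ θ : ℂ → ℝ, IsTestFunction S θ → ∫ z in S.Ω, (θ z : ℂ) * w z = 0) : w = 0 := by
  have hloc : LocallyIntegrableOn w S.Ω volume := by
    have h1 : LocallyIntegrable w (volume.restrict S.Ω) := (Lp.memLp w).locallyIntegrable (by norm_num)
    exact locallyIntegrableOn_of_locallyIntegrable_restrict h1
  have h2 := S.isOpen_Ω.ae_eq_zero_of_integral_contDiff_smul_eq_zero hloc (fun θ h1 h2 h3 => by
    have := hw θ ⟨h1, h2, h3⟩
    rw [← setIntegral_eq_integral_of_forall_compl_eq_zero (s := S.Ω)]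
    · simpa [Complex.real_smul] using this
    · intro z hz
      rw [image_eq_zero_of_notMem_tsupport (fun h => hz (h3 h)), zero_smul])
  rw [Lp.eq_zero_iff_ae_eq_zero]
  exact (ae_restrict_iff' S.isOpen_Ω.measurableSet).2 h2

theorem IsTestFunction.contDiff_ofReal {θ : ℂ → ℝ} (hθ : IsTestFunction S θ) :
    ContDiff ℝ ∞ fun z => (θ z : ℂ) := Complex.ofRealCLM.contDiff.comp hθ.1

theorem IsTestFunction.hasCompactSupport_ofReal {θ : ℂ → ℝ} (hθ : IsTestFunction S θ) :
    HasCompactSupport fun z => (θ z : ℂ) := hθ.2.1.comp_left (g := fun x : ℝ => (x : ℂ)) (by simp)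

theorem IsTestFunction.fderiv_ofReal {θ : ℂ → ℝ} (hθ : IsTestFunction S θ) (z e : ℂ) :
    fderiv ℝ (fun z => (θ z : ℂ)) z e = (fderiv ℝ θ z e : ℂ) := by
  have h1 := (Complex.ofRealCLM.hasFDerivAt (x := θ z)).comp z
    (hθ.1.differentiable (by simp) z).hasFDerivAt
  have h2 : (fun z => (θ z : ℂ)) = Complex.ofRealCLM ∘ θ := rfl
  rw [h2, h1.fderiv]
  simp

theorem IsTestFunction.tube_eq_zero {θ : ℂ → ℝ} (hθ : IsTestFunction S θ) (s : ℝ) {t : ℝ}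
    (ht : |t| = S.δ) : θ (S.tube (s, t)) = 0 := by
  refine image_eq_zero_of_notMem_tsupport fun h => ?_
  have h1 := S.tube_mem_frontier s ht
  rw [S.isOpen_Ω.frontier_eq] at h1
  exact h1.2 (hθ.2.2 h)

theorem IsTestFunction.bdry_eq_zero {θ : ℂ → ℝ} (hθ : IsTestFunction S θ) (g : ℂ → ℂ) :
    (S.bdry fun z => g z * (θ z : ℂ)) = 0 := by
  rw [bdry_congr_tube (G := fun _ => 0) fun s t ht => by rw [hθ.tube_eq_zero s ht]; simp]
  simp [bdry]

theorem isDTimes_iff {P : S.Potential} {h : ℝ} {u d : S.L2} : IsDTimes P h u d ↔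
    ∀ θ : ℂ → ℝ, IsTestFunction S θ → ∫ z in S.Ω, d z * (θ z : ℂ) =
      ∫ z in S.Ω, u z * P.dTest h (fun z => (θ z : ℂ)) z := by
  refine forall₂_congr fun θ hθ => ?_
  have e1 : ∀ z, (θ z : ℂ) * d z = d z * (θ z : ℂ) := fun z => mul_comm _ _
  have e2 : ∀ z, (Complex.I * h * ((fderiv ℝ θ z 1 : ℂ) + Complex.I * (fderiv ℝ θ z Complex.I : ℂ))
        + (-(P.A₁ z : ℂ) - Complex.I * P.A₂ z) * (θ z : ℂ)) * u z =
      u z * P.dTest h (fun z => (θ z : ℂ)) z := fun z => by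
    rw [mul_comm, Potential.dTest, hθ.fderiv_ofReal, hθ.fderiv_ofReal, Potential.coef]
  simp_rw [e1, e2]

/-- `d = d_A^× u` almost everywhere, for a function `u` with weak gradient `(p₁, p₂)`. -/
def IsStrongDTimes (P : S.Potential) (h : ℝ) (u p₁ p₂ d : S.L2) : Prop :=
  ∀ᵐ z ∂(volume.restrict S.Ω), d z =
    -(2 * Complex.I * h) * ((p₁ z + Complex.I * p₂ z) / 2) + P.coef z * u z

theorem IsSobolevTrace.integral_dTest {P : S.Potential} {h : ℝ} {u p₁ p₂ d : S.L2} {g : S.L2b}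
    (H : IsSobolevTrace u p₁ p₂ g) (hd : IsStrongDTimes P h u p₁ p₂ d) {E : ℂ → ℂ}
    (hE : ContDiff ℝ ∞ E) (hc : HasCompactSupport E) :
    ∫ z in S.Ω, u z * P.dTest h E z =
      (Complex.I * h * S.bdry fun z => g z * E z) + ∫ z in S.Ω, d z * E z := by
  have hEm : MemLp E 2 (volume.restrict S.Ω) := memLp_smooth hE.continuous hc
  have hdE : MemLp (fun z => fderiv ℝ E z 1 + Complex.I * fderiv ℝ E z Complex.I) 2
      (volume.restrict S.Ω) :=
    (memLp_fderiv hE hc 1 _).add ((memLp_fderiv hE hc Complex.I _).const_mul _)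
  have i1 := integrable_mul_of_memLp (Lp.memLp u) hdE
  have i2 := integrable_mul_of_memLp (Lp.memLp p₁) hEm
  have i3 := integrable_mul_of_memLp (Lp.memLp p₂) (hEm.const_mul Complex.I)
  have i4 := integrable_mul_of_memLp (Lp.memLp u) (P.memLp_coef_mul hEm)
  have e1 : ∫ z in S.Ω, u z * P.dTest h E z = (Complex.I * h * ∫ z in S.Ω, u z *
      (fderiv ℝ E z 1 + Complex.I * fderiv ℝ E z Complex.I)) +
      ∫ z in S.Ω, u z * (P.coef z * E z) := by
    rw [← integral_const_mul, ← integral_add (i1.const_mul _) i4]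
    refine integral_congr_ae (Eventually.of_forall fun z => ?_)
    simp only [Potential.dTest]
    ring
  have e2 : ∫ z in S.Ω, d z * E z = -(Complex.I * h) * ((∫ z in S.Ω, p₁ z * E z) +
      ∫ z in S.Ω, p₂ z * (Complex.I * E z)) + ∫ z in S.Ω, u z * (P.coef z * E z) := by
    rw [← integral_add i2 i3, ← integral_const_mul, ← integral_add (f := fun z => -(Complex.I * h) *
      (p₁ z * E z + p₂ z * (Complex.I * E z))) ((i2.add i3).const_mul _) i4]
    refine integral_congr_ae ?_
    filter_upwards [hd] with z hz
    rw [hz]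
    ring
  rw [e1, e2, ← H.green hE hc]
  ring

theorem isDTimes_of_strong {P : S.Potential} {h : ℝ} {u p₁ p₂ d : S.L2} {g : S.L2b}
    (H : IsSobolevTrace u p₁ p₂ g) (hd : IsStrongDTimes P h u p₁ p₂ d) : IsDTimes P h u d := by
  rw [isDTimes_iff]
  intro θ hθ
  rw [H.integral_dTest hd hθ.contDiff_ofReal hθ.hasCompactSupport_ofReal, hθ.bdry_eq_zero,
    mul_zero, zero_add]

/-- With a zero Hardy part, first components of Dom D_h become admissible both as elements and as
test elements for q_λ. -/
theorem mem_formGraph_of_sobolev {P : S.Potential} (R : S.Uniformization) {h : ℝ}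
    {u p₁ p₂ d : S.L2} {g : S.L2b} (H : IsSobolevTrace u p₁ p₂ g)
    (hd : IsStrongDTimes P h u p₁ p₂ d) : (u, d, g) ∈ formGraph P R h := by
  refine ⟨isDTimes_of_strong H hd, u, p₁, p₂, g, 0, 0, H, ?_, ?_,
    Eventually.of_forall fun z => by simp, Eventually.of_forall fun z => by simp⟩
  · refine ⟨differentiableOn_const 0, differentiableOn_const 0, 0, fun y _ => ?_⟩
    exact (eLpNorm_zero (p := 2) (μ := (volume : Measure ℝ)) (ε := ℂ)).le
  · refine ⟨measurable_const, ?_, ?_⟩ <;> simp [eLpNorm_zero']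

theorem exists_strongDTimes (P : S.Potential) (h : ℝ) (u p₁ p₂ : S.L2) :
    ∃ d : S.L2, IsStrongDTimes P h u p₁ p₂ d := by
  have h1 : MemLp (fun z => -(2 * Complex.I * h) * ((p₁ z + Complex.I * p₂ z) / 2) +
      P.coef z * u z) 2 (volume.restrict S.Ω) := by
    have h2 := (((Lp.memLp p₁).add ((Lp.memLp p₂).const_mul Complex.I)).const_mul
      (-(Complex.I * h))).add (P.memLp_coef_mul (Lp.memLp u))
    refine h2.ae_eq (Eventually.of_forall fun z => ?_)
    simp only [Pi.add_apply]
    ring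
  exact ⟨h1.toLp _, h1.coeFn_toLp⟩

/-- The Sobolev and Hardy parts each have a Green formula, and only the Sobolev part has a bulk
contribution. Any decomposition of u and any trace allowed by `IsFormTrace` will do, so uniqueness
of the trace is not needed. -/
theorem formGraph_green {P : S.Potential} {R : S.Uniformization} {h : ℝ} (hh : h ≠ 0)
    {u d : S.L2} {g : S.L2b} (hx : (u, d, g) ∈ formGraph P R h) {E : ℂ → ℂ}
    (hE : ContDiff ℝ ∞ E) (hc : HasCompactSupport E) :
    ∫ z in S.Ω, u z * P.dTest h E z =
      (Complex.I * h * S.bdry fun z => g z * E z) + ∫ z in S.Ω, d z * E z := by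
  obtain ⟨hd, u₁, p₁, p₂, g₁, v, g₂, H, hv, hg, hu, hgg⟩ := hx
  simp only at hd hu hgg
  obtain ⟨d₁, hd₁⟩ := exists_strongDTimes P h u₁ p₁ p₂
  have hw : MemLp (fun z => P.weight h z * v z) 2 (volume.restrict S.Ω) := by
    refine ((Lp.memLp u).sub (Lp.memLp u₁)).ae_eq ?_
    filter_upwards [hu] with z hz
    rw [Pi.sub_apply, hz, add_sub_cancel_left]; rfl
  have hg₂ : MemLp g₂ 2 S.boundaryMeasure := by
    refine ((Lp.memLp g).sub (Lp.memLp g₁)).ae_eq ?_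
    filter_upwards [hgg] with z hz
    rw [Pi.sub_apply, hz, add_sub_cancel_left]
  have key : ∀ {E : ℂ → ℂ}, ContDiff ℝ ∞ E → HasCompactSupport E →
      ∫ z in S.Ω, u z * P.dTest h E z =
      (Complex.I * h * S.bdry fun z => g z * E z) + ∫ z in S.Ω, d₁ z * E z := by
    intro E hE hc
    have hEb : MemLp E 2 S.boundaryMeasure := hE.continuous.memLp_of_hasCompactSupport hc
    have hT := P.memLp_dTest h hE hc
    have h1 := H.integral_dTest hd₁ hE hc
    have h2 := integral_hardy_dTest P hh hv hg hg₂ hw hE hc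
    have h3 : ∫ z in S.Ω, u z * P.dTest h E z = (∫ z in S.Ω, u₁ z * P.dTest h E z) +
        ∫ z in S.Ω, (P.weight h z * v z) * P.dTest h E z := by
      rw [← integral_add (integrable_mul_of_memLp (Lp.memLp u₁) hT) (integrable_mul_of_memLp hw hT)]
      refine integral_congr_ae ?_
      filter_upwards [hu] with z hz
      rw [hz, Potential.weight]; ring
    have h4 : (S.bdry fun z => g z * E z) = (S.bdry fun z => g₁ z * E z) +
        S.bdry fun z => g₂ z * E z := by
      rw [← bdry_add (H := fun z => g₁ z * E z) (G := fun z => g₂ z * E z)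
        (integrable_mul_of_memLp (Lp.memLp g₁) hEb) (integrable_mul_of_memLp hg₂ hEb)]
      refine bdry_congr ?_
      filter_upwards [hgg] with z hz
      rw [hz]; ring
    rw [h3, h1, h2, h4]; ring
  -- On test functions supported in Ω the boundary term vanishes, so the distributional d_A^× u
  -- equals the strong one of the Sobolev part.
  have hdd : d = d₁ := by
    rw [← sub_eq_zero]
    refine eq_zero_of_forall_test fun θ hθ => ?_
    have h1 := isDTimes_iff.1 hd θ hθ
    rw [key hθ.contDiff_ofReal hθ.hasCompactSupport_ofReal, hθ.bdry_eq_zero, mul_zero,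
      zero_add] at h1
    have hm : MemLp (fun z => (θ z : ℂ)) 2 (volume.restrict S.Ω) :=
      memLp_smooth hθ.contDiff_ofReal.continuous hθ.hasCompactSupport_ofReal
    rw [← sub_eq_zero, ← integral_sub (integrable_mul_of_memLp (Lp.memLp d) hm)
      (integrable_mul_of_memLp (Lp.memLp d₁) hm)] at h1
    rw [← h1]
    refine integral_congr_ae ?_
    filter_upwards [Lp.coeFn_sub d d₁] with z hz
    rw [hz, Pi.sub_apply]; ring
  rw [key hE hc, hdd]

/-! ### Smooth functions as elements of the domains -/

section smooth

variable {F : ℂ → ℂ} (hF : ContDiff ℝ ∞ F) (hc : HasCompactSupport F)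

/-- A smooth compactly supported function as an element of `L²(Ω)`. -/
noncomputable def smoothL2 : S.L2 := (memLp_smooth hF.continuous hc).toLp F

/-- The derivative of a smooth compactly supported function as an element of `L²(Ω)`. -/
noncomputable def smoothDeriv (e : ℂ) : S.L2 := (memLp_fderiv hF hc e _).toLp _

/-- The restriction of a smooth compactly supported function to the boundary. -/
noncomputable def smoothTrace : S.L2b :=
  MemLp.toLp F (hF.continuous.memLp_of_hasCompactSupport (μ := S.boundaryMeasure) (p := 2) hc)

theorem coeFn_smoothL2 : (smoothL2 hF hc : S.L2) =ᵐ[volume.restrict S.Ω] F := MemLp.coeFn_toLp _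

theorem coeFn_smoothDeriv (e : ℂ) : (smoothDeriv hF hc e : S.L2) =ᵐ[volume.restrict S.Ω]
    fun z => fderiv ℝ F z e := MemLp.coeFn_toLp _

theorem coeFn_smoothTrace : (smoothTrace hF hc : S.L2b) =ᵐ[S.boundaryMeasure] F :=
  MemLp.coeFn_toLp _

theorem isWeakDeriv_smooth (e : ℂ) :
    IsWeakDeriv e (smoothL2 hF hc : S.L2) (smoothDeriv hF hc e) := by
  intro θ hθ
  have hΩ : ∀ f : ℂ → ℂ, (∀ z, z ∉ S.Ω → f z = 0) → ∫ z in S.Ω, f z = ∫ z, f z := fun f hf =>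
    setIntegral_eq_integral_of_forall_compl_eq_zero hf
  have hθd := hθ.contDiff_ofReal
  have hθc := hθ.hasCompactSupport_ofReal
  have hm1 := fun {G : ℂ → ℂ} (hG : Continuous G) (hGc : HasCompactSupport G) =>
    hG.memLp_of_hasCompactSupport (p := 2) (μ := (volume : Measure ℂ)) hGc
  have key := integral_mul_fderiv_eq_neg_fderiv_mul_of_integrable (μ := (volume : Measure ℂ))
    (f := F) (g := fun z => (θ z : ℂ)) (v := e)
    ((memLp_fderiv hF hc e _).integrable_mul (hm1 hθd.continuous hθc))
    ((hm1 hF.continuous hc).integrable_mul (memLp_fderiv hθd hθc e _))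
    ((hm1 hF.continuous hc).integrable_mul (hm1 hθd.continuous hθc))
    (fun x _ => hF.differentiable (by simp) x) (fun x _ => hθd.differentiable (by simp) x)
  simp_rw [hθ.fderiv_ofReal] at key
  have e1 : ∫ z in S.Ω, (fderiv ℝ θ z e : ℂ) * (smoothL2 hF hc : S.L2) z =
      ∫ z, F z * (fderiv ℝ θ z e : ℂ) := by
    rw [← hΩ]
    · refine integral_congr_ae ?_
      filter_upwards [coeFn_smoothL2 (S := S) hF hc] with z hz
      rw [hz, mul_comm]
    · intro z hz
      have : fderiv ℝ θ z = 0 := by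
        by_contra h
        exact hz (hθ.2.2 (support_fderiv_subset ℝ h))
      simp [this]
  have e2 : ∫ z in S.Ω, (θ z : ℂ) * (smoothDeriv hF hc e : S.L2) z =
      ∫ z, fderiv ℝ F z e * (θ z : ℂ) := by
    rw [← hΩ]
    · refine integral_congr_ae ?_
      filter_upwards [coeFn_smoothDeriv (S := S) hF hc e] with z hz
      rw [hz, mul_comm]
    · intro z hz
      rw [image_eq_zero_of_notMem_tsupport (fun h => hz (hθ.2.2 h))]; simp
  rw [e1, e2, key]

theorem isSobolevTrace_smooth : IsSobolevTrace (smoothL2 hF hc : S.L2) (smoothDeriv hF hc 1)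
    (smoothDeriv hF hc Complex.I) (smoothTrace hF hc) := by
  refine ⟨⟨isWeakDeriv_smooth hF hc 1, isWeakDeriv_smooth hF hc Complex.I⟩, fun _ => F,
    fun _ => ⟨hF, hc⟩, ?_, ?_, ?_, ?_⟩
  all_goals
    have key : ∀ {μ : Measure ℂ} {f g : ℂ → ℂ}, g =ᵐ[μ] f →
        Tendsto (fun _ : ℕ => eLpNorm (fun z => f z - g z) 2 μ) atTop (𝓝 0) := by
      intro μ f g h
      have h1 : (fun z => f z - g z) =ᵐ[μ] 0 := by
        filter_upwards [h] with z hz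
        simp [hz]
      rw [eLpNorm_congr_ae h1, eLpNorm_zero]
      exact tendsto_const_nhds
  · exact key (coeFn_smoothL2 hF hc)
  · exact key (coeFn_smoothDeriv hF hc 1)
  · exact key (coeFn_smoothDeriv hF hc Complex.I)
  · exact key (coeFn_smoothTrace hF hc)

end smooth

/-! ### The relations are graphs -/

variable (S) in
-- Each arc-length measure is an image measure, carried by a curve that is closed by properness.
theorem ae_boundary : ∀ᵐ z ∂S.boundaryMeasure, ∃ s t, |t| = S.δ ∧ z = S.tube (s, t) := by
  have hδ := S.δ_pos
  have key : ∀ t, |t| = S.δ → ∀ᵐ z ∂S.arcLength t, ∃ s t, |t| = S.δ ∧ z = S.tube (s, t) := by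
    intro t ht
    rw [S.arcLength_eq ht.le, ae_iff]
    have hcl : IsClosed (range fun s => S.tube (s, t)) := by
      have h1 : (range fun s => S.tube (s, t)) = S.tube '' (univ ×ˢ {t}) := by
        ext z; simp
      rw [h1]
      exact S.isClosed_image_tube_of_subset (isClosed_univ.prod isClosed_singleton)
        fun p hp => S.mem_closedStrip.2 (by rw [show p.2 = t from hp.2]; exact ht.le)
    refine measure_mono_null (t := (range fun s => S.tube (s, t))ᶜ) (fun z hz h => ?_) ?_
    · obtain ⟨s, rfl⟩ := h
      exact hz ⟨s, t, ht, rfl⟩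
    · rw [Measure.map_apply (S.continuous_tube_left t).measurable hcl.measurableSet.compl,
        preimage_compl, preimage_range, compl_univ, measure_empty]
  rw [boundaryMeasure, ae_add_measure_iff]
  exact ⟨key _ (abs_of_pos hδ), key _ (by rw [abs_neg, abs_of_pos hδ])⟩

theorem dTimesGraph_single {P : S.Potential} {h : ℝ} (x : S.L2 × S.L2)
    (hx : x ∈ dTimesGraph P h) (h0 : x.1 = 0) : x.2 = 0 := by
  refine eq_zero_of_forall_test fun θ hθ => ?_
  have h1 : IsDTimes P h x.1 x.2 := hx
  rw [h0] at h1
  rw [h1 θ hθ, integral_mul_zero]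

theorem isWeakDeriv_zero_left {e : ℂ} {p : S.L2} (hp : IsWeakDeriv e 0 p) : p = 0 := by
  refine eq_zero_of_forall_test fun θ hθ => ?_
  have h1 := hp θ hθ
  rw [integral_mul_zero] at h1
  exact neg_eq_zero.1 h1.symm

theorem diracGraph_single {P : S.Potential} {h : ℝ} (x : S.Spinor × S.Spinor)
    (hx : x ∈ diracGraph P h) (h0 : x.1 = 0) : x.2 = 0 := by
  obtain ⟨p₁, p₂, q₁, q₂, g₁, g₂, t1, t2, -, e1, e2⟩ := hx
  rw [h0] at t1 t2 e1 e2
  have z0 := Lp.coeFn_zero ℂ 2 (volume.restrict S.Ω)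
  rw [WithLp.zero_fst] at t1 e2
  rw [WithLp.zero_snd] at t2 e1
  rw [isWeakDeriv_zero_left t1.1.1, isWeakDeriv_zero_left t1.1.2] at e2
  rw [isWeakDeriv_zero_left t2.1.1, isWeakDeriv_zero_left t2.1.2] at e1
  have f1 : x.2.fst = 0 := by
    rw [Lp.eq_zero_iff_ae_eq_zero]
    filter_upwards [e1, z0] with z h1 h2
    rw [h1, h2]; simp
  have f2 : x.2.snd = 0 := by
    rw [Lp.eq_zero_iff_ae_eq_zero]
    filter_upwards [e2, z0] with z h1 h2
    rw [h1, h2]; simp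
  exact (WithLp.ext_iff 2).2 (Prod.ext f1 f2)

/-- If u = 0 then d_A^× u = 0 as a distribution. Testing the form with functions supported in Ω also
removes the boundary term, whatever trace was chosen for u, and leaves w orthogonal to all of them.
-/
theorem effGraph_single {P : S.Potential} {R : S.Uniformization} {h lam : ℝ} (a : S.L2 × S.L2)
    (ha : a ∈ effGraph P R h lam) (h0 : a.1 = 0) : a.2 = 0 := by
  obtain ⟨x, hx, ex, hq⟩ := ha
  have hx2 : x.2.1 = 0 := dTimesGraph_single (x.1, x.2.1) hx.1 (ex.trans h0)
  refine eq_zero_of_forall_test fun θ hθ => ?_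
  have hθd := hθ.contDiff_ofReal
  have hθc := hθ.hasCompactSupport_ofReal
  obtain ⟨d, hd⟩ := exists_strongDTimes P h (smoothL2 hθd hθc) (smoothDeriv hθd hθc 1)
    (smoothDeriv hθd hθc Complex.I)
  have h1 := hq _ (mem_formGraph_of_sobolev R (isSobolevTrace_smooth hθd hθc) hd)
  have ht : (smoothTrace hθd hθc : S.L2b) = 0 := by
    rw [Lp.eq_zero_iff_ae_eq_zero]
    filter_upwards [coeFn_smoothTrace (S := S) hθd hθc, ae_boundary S] with z hz hz'
    obtain ⟨s, t, ht, rfl⟩ := hz'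
    rw [hz, hθ.tube_eq_zero s ht]; simp
  simp only [qForm, hx2, ex, h0, ht, inner_zero_left, inner_zero_right, mul_zero, add_zero,
    sub_zero] at h1
  rw [inner_Lp_eq] at h1
  rw [h1]
  refine integral_congr_ae ?_
  filter_upwards [coeFn_smoothL2 (S := S) hθd hθc] with z hz
  rw [hz, Complex.conj_ofReal]

end CurvedStrip

namespace CurvedStrip

variable {S : CurvedStrip}

/-! ### Integration by parts between the form domain and the Dirac operator -/

/-- Green's formula holds for the function `u` with `d = d_A^× u` and boundary values `g`. -/
def HasGreen (P : S.Potential) (h : ℝ) (u d : S.L2) (g : S.L2b) : Prop :=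
  ∀ E : ℂ → ℂ, ContDiff ℝ ∞ E → HasCompactSupport E →
    ∫ z in S.Ω, u z * P.dTest h E z =
      (Complex.I * h * S.bdry fun z => g z * E z) + ∫ z in S.Ω, d z * E z

/-- The matrix exchanges the components with factors −i conj(N) and iN; since |N| = 1 the two
resulting equations are equivalent. -/
theorem infiniteMassMatrix_mulVec {N a b : ℂ} (hN : ‖N‖ = 1) :
    (infiniteMassMatrix N).mulVec ![a, b] = ![a, b] ↔ b = Complex.I * N * a := by
  have h1 : (infiniteMassMatrix N).mulVec ![a, b] =
      ![-Complex.I * conj N * b, Complex.I * N * a] := by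
    have e1 : conj N = N.re - N.im * Complex.I := by
      apply Complex.ext <;> simp
    ext i
    fin_cases i
    · simp [infiniteMassMatrix, pauli₁, pauli₂, pauli₃, Matrix.mulVec, dotProduct,
        Fin.sum_univ_two, e1]
      left; ring
    · simp [infiniteMassMatrix, pauli₁, pauli₂, pauli₃, Matrix.mulVec, dotProduct,
        Fin.sum_univ_two]
  have hN' : conj N * N = 1 := by
    rw [mul_comm, Complex.mul_conj, Complex.normSq_eq_norm_sq, hN]; simp
  rw [h1]
  constructor
  · intro h
    exact (congrFun h 1).symm
  · rintro rfl
    ext i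
    fin_cases i
    · simp
      linear_combination (-a * conj N * N) * Complex.I_sq + a * hN'
    · simp

theorem norm_of_isOutwardNormal {z N : ℂ} (h : IsOutwardNormal S z N) : ‖N‖ = 1 := by
  have h1 : ∀ s, ‖unitNormal S.γ s‖ = 1 := fun s => by
    rw [S.unitNormal_eq, norm_mul, S.norm_tangent, Complex.norm_I, mul_one]
  obtain ⟨s, ⟨-, rfl⟩ | ⟨-, rfl⟩⟩ := h
  · exact h1 s
  · rw [norm_neg, h1]

theorem infiniteMass_iff {g₁ g₂ : S.L2b} : InfiniteMass g₁ g₂ ↔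
    ∀ᵐ z ∂S.boundaryMeasure, ∀ N : ℂ, IsOutwardNormal S z N → g₂ z = Complex.I * N * g₁ z := by
  refine eventually_congr (Eventually.of_forall fun z => forall₂_congr fun N hN => ?_)
  exact infiniteMassMatrix_mulVec (norm_of_isOutwardNormal hN)

theorem ae_boundaryMeasure_iff {p : ℂ → Prop} : (∀ᵐ z ∂S.boundaryMeasure, p z) ↔
    (∀ᵐ z ∂S.arcLength S.δ, p z) ∧ ∀ᵐ z ∂S.arcLength (-S.δ), p z := by
  rw [boundaryMeasure, ae_add_measure_iff]

theorem integral_boundaryMeasure {f : ℂ → ℂ} (hf : Integrable f S.boundaryMeasure) :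
    ∫ z, f z ∂S.boundaryMeasure = (∫ s, (S.jac s S.δ : ℂ) * f (S.tube (s, S.δ))) +
      ∫ s, (S.jac s (-S.δ) : ℂ) * f (S.tube (s, -S.δ)) := by
  have hi1 : Integrable f (S.arcLength S.δ) := hf.mono_measure (Measure.le_add_right le_rfl)
  have hi2 : Integrable f (S.arcLength (-S.δ)) := hf.mono_measure (Measure.le_add_left le_rfl)
  rw [boundaryMeasure, integral_add_measure hi1 hi2, S.integral_arc S.abs_δ hi1.1,
    S.integral_arc S.abs_neg_δ hi2.1]

theorem InfiniteMass.ae_tube {g₁ g₂ : S.L2b} (bc : InfiniteMass g₁ g₂) :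
    (∀ᵐ s : ℝ, g₂ (S.tube (s, S.δ)) = -(S.tangent s * g₁ (S.tube (s, S.δ)))) ∧
      ∀ᵐ s : ℝ, g₂ (S.tube (s, -S.δ)) = S.tangent s * g₁ (S.tube (s, -S.δ)) := by
  rw [infiniteMass_iff, ae_boundaryMeasure_iff] at bc
  constructor
  · filter_upwards [(S.quasiMeasurePreserving_arc S.abs_δ).ae bc.1] with s hs
    rw [hs _ ⟨s, .inl ⟨rfl, rfl⟩⟩, S.unitNormal_eq]
    linear_combination (S.tangent s * g₁ (S.tube (s, S.δ))) * Complex.I_sq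
  · filter_upwards [(S.quasiMeasurePreserving_arc S.abs_neg_δ).ae bc.2] with s hs
    rw [hs _ ⟨s, .inr ⟨rfl, rfl⟩⟩, S.unitNormal_eq]
    linear_combination (-S.tangent s * g₁ (S.tube (s, -S.δ))) * Complex.I_sq

/-- From g₂ = iN g₁ one gets N conj(g₂) = −i conj(g₁): the normal in the flux cancels the normal in
the boundary condition. -/
theorem bdry_infiniteMass {g₁ g₂ g : S.L2b} (bc : InfiniteMass g₁ g₂) :
    (S.bdry fun z => conj (g₂ z) * g z) = -Complex.I * ⟪g₁, g⟫_ℂ := by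
  have hint : Integrable (fun z => conj (g₁ z) * g z) S.boundaryMeasure := by
    have := L2.integrable_inner (𝕜 := ℂ) g₁ g
    refine this.congr (Eventually.of_forall fun z => ?_)
    simp only [RCLike.inner_apply]; ring
  rw [inner_Lp_eq, integral_boundaryMeasure hint, mul_add, ← integral_const_mul,
    ← integral_const_mul, bdry, sub_eq_add_neg, ← integral_neg]
  congr 1
  · refine integral_congr_ae ?_
    filter_upwards [bc.ae_tube.1] with s hs
    rw [hs, map_neg, map_mul]
    linear_combination (-Complex.I * S.jac s S.δ * conj (g₁ (S.tube (s, S.δ))) *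
      g (S.tube (s, S.δ))) * S.tangent_mul_conj s
  · refine integral_congr_ae ?_
    filter_upwards [bc.ae_tube.2] with s hs
    rw [hs, map_mul]
    linear_combination (-Complex.I * S.jac s (-S.δ) * conj (g₁ (S.tube (s, -S.δ))) *
      g (S.tube (s, -S.δ))) * S.tangent_mul_conj s

theorem tendsto_eLpNorm_conj {α : Type*} [MeasurableSpace α] {μ : Measure α} {F : ℕ → α → ℂ}
    {f : α → ℂ} (h : Tendsto (fun n => eLpNorm (fun z => F n z - f z) 2 μ) atTop (𝓝 0)) :
    Tendsto (fun n => eLpNorm (fun z => conj (F n z) - conj (f z)) 2 μ) atTop (𝓝 0) := by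
  refine h.congr fun n => eLpNorm_congr_norm_ae (Eventually.of_forall fun z => ?_)
  rw [← map_sub, RCLike.norm_conj]

theorem MemLp_conj {α : Type*} [MeasurableSpace α] {μ : Measure α} {f : α → ℂ} (hf : MemLp f 2 μ) :
    MemLp (fun z => conj (f z)) 2 μ := hf.star

theorem fderiv_conj_apply {F : ℂ → ℂ} (hF : ContDiff ℝ ∞ F) (z e : ℂ) :
    fderiv ℝ (fun z => conj (F z)) z e = conj (fderiv ℝ F z e) := by
  have h1 := (Complex.conjCLE.toContinuousLinearMap.hasFDerivAt (x := F z)).comp z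
    (hF.differentiable (by simp) z).hasFDerivAt
  have h2 : (fun z => conj (F z)) = Complex.conjCLE.toContinuousLinearMap ∘ F := rfl
  rw [h2, h1.fderiv]
  rfl

/-- Green's formula for u is available only against smooth functions, so it is applied to the
conjugates of the smooth approximants of ψ. Every term passes to the limit, the boundary one because
the approximants also converge in L²(∂Ω). -/
theorem HasGreen.inner_eq {P : S.Potential} {h : ℝ} {u d ψ q₁ q₂ χ : S.L2} {g g₁ g₂ : S.L2b}
    (hG : HasGreen P h u d g) (hψ : IsSobolevTrace ψ q₁ q₂ g₂) (bc : InfiniteMass g₁ g₂)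
    (hχ : ∀ᵐ z ∂(volume.restrict S.Ω), χ z = -(2 * Complex.I * h) *
      ((q₁ z - Complex.I * q₂ z) / 2) + (-(P.A₁ z : ℂ) + Complex.I * P.A₂ z) * ψ z) :
    ⟪ψ, d⟫_ℂ = ⟪χ, u⟫_ℂ - h * ⟪g₁, g⟫_ℂ := by
  obtain ⟨-, F, hF, a1, a2, a3, a4⟩ := hψ
  have hFm : ∀ n, MemLp (fun z => conj (F n z)) 2 (volume.restrict S.Ω) := fun n =>
    MemLp_conj (memLp_smooth (hF n).1.continuous (hF n).2)
  have hdm : ∀ n e, MemLp (fun z => conj (fderiv ℝ (F n) z e)) 2 (volume.restrict S.Ω) :=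
    fun n e => MemLp_conj (memLp_fderiv (hF n).1 (hF n).2 e _)
  have hu := Lp.memLp u
  have hIu : MemLp (fun z => Complex.I * u z) 2 (volume.restrict S.Ω) := hu.const_mul _
  have hcu := P.memLp_coef_mul hu
  have l1 := tendsto_integral_mul hFm (MemLp_conj (Lp.memLp ψ)) (Lp.memLp d)
    (tendsto_eLpNorm_conj a1)
  have l2 := tendsto_integral_mul hFm (MemLp_conj (Lp.memLp ψ)) hcu (tendsto_eLpNorm_conj a1)
  have l3 := tendsto_integral_mul (fun n => hdm n 1) (MemLp_conj (Lp.memLp q₁)) hu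
    (tendsto_eLpNorm_conj a2)
  have l4 := tendsto_integral_mul (fun n => hdm n Complex.I) (MemLp_conj (Lp.memLp q₂)) hIu
    (tendsto_eLpNorm_conj a3)
  have l5 := tendsto_bdry_mul (fun n => MemLp_conj
    ((hF n).1.continuous.memLp_of_hasCompactSupport (μ := S.boundaryMeasure) (hF n).2))
    (MemLp_conj (Lp.memLp g₂)) (Lp.memLp g) (tendsto_eLpNorm_conj a4)
  have hL := ((l3.add l4).const_mul (Complex.I * h)).add l2
  have hR := (l5.const_mul (Complex.I * h)).add l1
  have key := tendsto_nhds_unique (hL.congr fun n => ?_) hR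
  · rw [bdry_infiniteMass bc, ← inner_Lp_eq ψ d] at key
    have e : ⟪χ, u⟫_ℂ = Complex.I * h * ((∫ z in S.Ω, conj (q₁ z) * u z) +
        ∫ z in S.Ω, conj (q₂ z) * (Complex.I * u z)) +
        ∫ z in S.Ω, conj (ψ z) * (P.coef z * u z) := by
      have i1 := integrable_mul_of_memLp (MemLp_conj (Lp.memLp q₁)) hu
      have i2 := integrable_mul_of_memLp (MemLp_conj (Lp.memLp q₂)) hIu
      have i3 := integrable_mul_of_memLp (MemLp_conj (Lp.memLp ψ)) hcu
      rw [inner_Lp_eq, ← integral_add i1 i2, ← integral_const_mul,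
        ← integral_add (f := fun z => Complex.I * h *
          (conj (q₁ z) * u z + conj (q₂ z) * (Complex.I * u z))) ((i1.add i2).const_mul _) i3]
      refine integral_congr_ae ?_
      filter_upwards [hχ] with z hz
      rw [hz, ← P.conj_coef]
      simp only [map_add, map_mul, map_neg, map_sub, map_div₀, Complex.conj_I, Complex.conj_ofReal,
        Complex.conj_conj, map_ofNat]
      ring
    rw [e]
    linear_combination -key + (h * ⟪g₁, g⟫_ℂ) * Complex.I_sq
  · have hEs : ContDiff ℝ ∞ fun z => conj (F n z) := Complex.conjCLE.contDiff.comp (hF n).1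
    have hEc : HasCompactSupport fun z => conj (F n z) :=
      (hF n).2.comp_left (g := fun w : ℂ => conj w) (by simp)
    have h1 := hG _ hEs hEc
    have e1 : (∫ z in S.Ω, conj (F n z) * d z) = ∫ z in S.Ω, d z * conj (F n z) :=
      integral_congr_ae (Eventually.of_forall fun z => mul_comm _ _)
    have e2 : (S.bdry fun z => conj (F n z) * g z) = S.bdry fun z => g z * conj (F n z) := by
      simp_rw [mul_comm (conj (F n _))]
    rw [e1, e2, ← h1]
    have i1 := integrable_mul_of_memLp (hdm n 1) hu
    have i2 := integrable_mul_of_memLp (hdm n Complex.I) hIu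
    have i3 := integrable_mul_of_memLp (hFm n) hcu
    rw [← integral_add i1 i2, ← integral_const_mul,
      ← integral_add (f := fun z => Complex.I * h * (conj (fderiv ℝ (F n) z 1) * u z +
        conj (fderiv ℝ (F n) z Complex.I) * (Complex.I * u z))) ((i1.add i2).const_mul _) i3]
    refine integral_congr_ae (Eventually.of_forall fun z => ?_)
    simp only [Potential.dTest, fderiv_conj_apply (hF n).1]
    ring

theorem IsSobolevTrace.hasGreen {P : S.Potential} {h : ℝ} {u p₁ p₂ d : S.L2} {g : S.L2b}
    (H : IsSobolevTrace u p₁ p₂ g) (hd : IsStrongDTimes P h u p₁ p₂ d) : HasGreen P h u d g :=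
  fun _ hE hc => H.integral_dTest hd hE hc

/-- The Green formula is used once for each spinor. The two boundary terms are h times the pairing
of the first traces, and they cancel. -/
theorem diracRel_symmetric {P : S.Potential} {h : ℝ} {ψ χ ψ' χ' : S.Spinor}
    (H : DiracRel P h ψ χ) (H' : DiracRel P h ψ' χ') : ⟪χ, ψ'⟫_ℂ = ⟪ψ, χ'⟫_ℂ := by
  obtain ⟨p₁, p₂, q₁, q₂, g₁, g₂, t1, t2, bc, e1, e2⟩ := H
  obtain ⟨p₁', p₂', q₁', q₂', g₁', g₂', t1', t2', bc', e1', e2'⟩ := H'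
  have k1 := (t1'.hasGreen e2').inner_eq t2 bc e1
  have k2 := (t1.hasGreen e2).inner_eq t2' bc' e1'
  have k3 := congrArg conj k2
  simp only [map_sub, map_mul, inner_conj_symm, Complex.conj_ofReal] at k3
  rw [WithLp.prod_inner_apply, WithLp.prod_inner_apply]
  change ⟪χ.fst, ψ'.fst⟫_ℂ + ⟪χ.snd, ψ'.snd⟫_ℂ = ⟪ψ.fst, χ'.fst⟫_ℂ + ⟪ψ.snd, χ'.snd⟫_ℂ
  rw [k1, k3]; ring

/-- A solution of `(D_h - λ) ψ = (a, 0)` gives a solution of `L_λ ψ₁ = λ a`. -/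
theorem mem_effGraph_of_diracRel {P : S.Potential} {R : S.Uniformization} {h lam : ℝ} (hh : h ≠ 0)
    {ψ χ : S.Spinor} {a : S.L2} (H : DiracRel P h ψ χ) (h1 : χ.fst = (lam : ℂ) • ψ.fst + a)
    (h2 : χ.snd = (lam : ℂ) • ψ.snd) :
    (ψ.fst, (lam : ℂ) • a) ∈ effGraph P R h lam ∧ (ψ.fst, χ.snd) ∈ dTimesGraph P h := by
  obtain ⟨p₁, p₂, q₁, q₂, g₁, g₂, t1, t2, bc, e1, e2⟩ := H
  have hmem : (ψ.fst, χ.snd, g₁) ∈ formGraph P R h := mem_formGraph_of_sobolev R t1 e2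
  refine ⟨⟨_, hmem, rfl, ?_⟩, hmem.1⟩
  rintro ⟨v, d, g⟩ hy
  -- Here v plays the part of u: as d_A^×ψ₁ = λψ₂, the leading term of the form is λ⟨d_A^× v, ψ₂⟩,
  -- and Green's formula cancels its boundary part against hλ⟨v, ψ₁⟩ on ∂Ω.
  have k1 := HasGreen.inner_eq (fun E hE hc => formGraph_green hh hy hE hc) t2 bc e1
  have k2 := congrArg conj k1
  simp only [map_sub, map_mul, inner_conj_symm, Complex.conj_ofReal] at k2
  simp only [qForm]
  rw [h2, inner_smul_right, k2, h1, inner_add_right, inner_smul_right, inner_smul_right]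
  push_cast
  ring

end CurvedStrip

namespace CurvedStrip

variable {S : CurvedStrip}

/-! ### Weak equations in the coordinates of the strip -/

variable (S) in
/-- Square-integrable functions of the coordinates `(s, t)`. -/
abbrev StripL2 : Type := Lp ℂ 2 S.stripMeasure

theorem measurePreserving_shift (r : ℝ) :
    MeasurePreserving (fun p : ℝ × ℝ => (p.1 + r, p.2)) S.stripMeasure S.stripMeasure :=
  (measurePreserving_add_right (volume : Measure ℝ) r).prod (MeasurePreserving.id _)

/-- Translation in the longitudinal variable. -/
noncomputable def translate (r : ℝ) : S.StripL2 →ₗᵢ[ℂ] S.StripL2 :=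
  Lp.compMeasurePreservingₗᵢ ℂ _ (measurePreserving_shift r)

theorem coeFn_translate (r : ℝ) (f : S.StripL2) :
    translate r f =ᵐ[S.stripMeasure] fun p => f (p.1 + r, p.2) :=
  Lp.coeFn_compMeasurePreserving f (measurePreserving_shift r)

theorem translate_translate (r r' : ℝ) (f : S.StripL2) :
    translate r (translate r' f) = translate (r + r') f := by
  apply Lp.ext
  refine (coeFn_translate r _).trans (EventuallyEq.trans ?_ (coeFn_translate (r + r') f).symm)
  filter_upwards [(measurePreserving_shift r).quasiMeasurePreserving.ae (coeFn_translate r' f)]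
    with p hp
  rw [hp, add_assoc]

theorem translate_zero (f : S.StripL2) : translate 0 f = f := by
  apply Lp.ext
  filter_upwards [coeFn_translate 0 f] with p hp
  rw [hp, add_zero]

theorem inner_translate (r : ℝ) (f g : S.StripL2) :
    ⟪translate r f, translate r g⟫_ℂ = ⟪f, g⟫_ℂ := LinearIsometry.inner_map_map _ f g

theorem continuous_translate (f : S.StripL2) : Continuous fun r => translate r f := by
  let g : ℝ → C(ℝ × ℝ, ℝ × ℝ) := fun r => ⟨fun p => (p.1 + r, p.2), by fun_prop⟩
  have hg : Continuous g := ContinuousMap.continuous_of_continuous_uncurry _ (by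
    change Continuous fun x : ℝ × ℝ × ℝ => (x.2.1 + x.1, x.2.2)
    fun_prop)
  exact Continuous.compMeasurePreservingLp (f := fun _ => f) (g := g) continuous_const hg
    (fun r => measurePreserving_shift r) (by norm_num)

/-- The mean of the translates by `r ∈ [0, a]`. -/
noncomputable def avg (a : ℝ) (f : S.StripL2) : S.StripL2 :=
  (a : ℂ)⁻¹ • ∫ r in (0 : ℝ)..a, translate r f

/-- The difference quotient in the longitudinal variable. -/
noncomputable def diffQuot (a : ℝ) (f : S.StripL2) : S.StripL2 :=
  (a : ℂ)⁻¹ • (translate a f - f)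

/-- Strong continuity of translations, read as the derivative of the primitive at 0. -/
theorem tendsto_avg (f : S.StripL2) : Tendsto (fun a => avg a f) (𝓝[>] 0) (𝓝 f) := by
  have h1 := (continuous_translate f).integral_hasStrictDerivAt 0 0
  have h2 := h1.hasDerivAt.tendsto_slope_zero
  rw [translate_zero] at h2
  have h3 := h2.mono_left (nhdsWithin_mono 0 (fun x (hx : 0 < x) => hx.ne') : 𝓝[>] (0 : ℝ) ≤ 𝓝[≠] 0)
  refine h3.congr fun a => ?_
  simp only [zero_add, intervalIntegral.integral_same, sub_zero, avg]
  rw [← Complex.ofReal_inv, Complex.coe_smul]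
  rfl

/-- An exact discrete form of Re⟨f, ∂_s f⟩ = 0, valid for every a without any differentiability: by
unitarity Re⟨τ_r f, τ_a f⟩ = Re⟨f, τ_{a−r} f⟩, and r ↦ a − r preserves [0, a]. -/
theorem re_inner_avg_diffQuot (a : ℝ) (f : S.StripL2) :
    (⟪avg a f, diffQuot a f⟫_ℂ).re = 0 := by
  have hcont := continuous_translate f
  have h1 : ∀ g : S.StripL2, (⟪∫ r in (0 : ℝ)..a, translate r f, g⟫_ℂ).re =
      ∫ r in (0 : ℝ)..a, (⟪g, translate r f⟫_ℂ).re := by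
    intro g
    rw [← inner_conj_symm, Complex.conj_re]
    exact ((Complex.reCLM ∘L ((innerSL ℂ g).restrictScalars ℝ)).intervalIntegral_comp_comm
      (hcont.intervalIntegrable 0 a)).symm
  have h2 : ∀ r, (⟪translate a f, translate r f⟫_ℂ).re = (⟪f, translate (a - r) f⟫_ℂ).re := by
    intro r
    rw [← inner_conj_symm, Complex.conj_re, ← inner_translate r f, translate_translate,
      add_sub_cancel]
  have h3 : (⟪∫ r in (0 : ℝ)..a, translate r f, translate a f - f⟫_ℂ).re = 0 := by
    rw [inner_sub_right, Complex.sub_re, h1, h1]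
    simp_rw [h2]
    rw [intervalIntegral.integral_comp_sub_left (fun r => (⟪f, translate r f⟫_ℂ).re) a]
    simp
  rw [avg, diffQuot, inner_smul_left, inner_smul_right, ← mul_assoc, map_inv₀, Complex.conj_ofReal,
    ← Complex.ofReal_inv, ← Complex.ofReal_mul, Complex.re_ofReal_mul, h3, mul_zero]

/-! ### Multiplication operators -/

/-- Measurable functions on the strip with a uniform bound. -/
def IsBddMultiplier (S : CurvedStrip) (b : ℝ × ℝ → ℝ) : Prop :=
  Measurable b ∧ ∃ C, ∀ᵐ p ∂S.stripMeasure, |b p| ≤ C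

theorem IsBddMultiplier.memLp {b : ℝ × ℝ → ℝ} (hb : IsBddMultiplier S b) {f : ℝ × ℝ → ℂ}
    (hf : MemLp f 2 S.stripMeasure) : MemLp (fun p => (b p : ℂ) * f p) 2 S.stripMeasure := by
  obtain ⟨hm, C, hC⟩ := hb
  refine MemLp.of_le_mul (c := C) hf
    ((Complex.measurable_ofReal.comp hm).aestronglyMeasurable.mul hf.1) ?_
  filter_upwards [hC] with p hp
  rw [norm_mul, Complex.norm_real, Real.norm_eq_abs]
  exact mul_le_mul_of_nonneg_right hp (norm_nonneg _)

/-- Multiplication by a bounded function. -/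
noncomputable def mulFun {b : ℝ × ℝ → ℝ} (hb : IsBddMultiplier S b) (f : S.StripL2) : S.StripL2 :=
  (hb.memLp (Lp.memLp f)).toLp _

theorem coeFn_mulFun {b : ℝ × ℝ → ℝ} (hb : IsBddMultiplier S b) (f : S.StripL2) :
    mulFun hb f =ᵐ[S.stripMeasure] fun p => (b p : ℂ) * f p := MemLp.coeFn_toLp _

theorem norm_mulFun_le {b : ℝ × ℝ → ℝ} (hb : IsBddMultiplier S b) {C : ℝ}
    (hC : ∀ᵐ p ∂S.stripMeasure, |b p| ≤ C) (f : S.StripL2) : ‖mulFun hb f‖ ≤ C * ‖f‖ := by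
  refine Lp.norm_le_mul_norm_of_ae_le_mul ?_
  filter_upwards [hC, coeFn_mulFun hb f] with p h1 h2
  rw [h2, norm_mul, Complex.norm_real, Real.norm_eq_abs]
  exact mul_le_mul_of_nonneg_right h1 (norm_nonneg _)

/-- Multiplication by a bounded function as a bounded operator. -/
noncomputable def mulOp {b : ℝ × ℝ → ℝ} (hb : IsBddMultiplier S b) : S.StripL2 →L[ℂ] S.StripL2 :=
  LinearMap.mkContinuousOfExistsBound
    { toFun := mulFun hb
      map_add' := fun f g => by
        apply Lp.ext
        filter_upwards [coeFn_mulFun hb (f + g), Lp.coeFn_add f g, coeFn_mulFun hb f,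
          coeFn_mulFun hb g, Lp.coeFn_add (mulFun hb f) (mulFun hb g)] with p h1 h2 h3 h4 h5
        rw [h1, h2, h5, Pi.add_apply, Pi.add_apply, h3, h4, mul_add]
      map_smul' := fun c f => by
        apply Lp.ext
        filter_upwards [coeFn_mulFun hb (c • f), Lp.coeFn_smul c f, coeFn_mulFun hb f,
          Lp.coeFn_smul c (mulFun hb f)] with p h1 h2 h3 h4
        rw [h1, h2, RingHom.id_apply, h4, Pi.smul_apply, Pi.smul_apply, h3]
        simp only [smul_eq_mul]; ring }
    ⟨_, fun f => norm_mulFun_le hb hb.2.choose_spec f⟩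

theorem coeFn_mulOp {b : ℝ × ℝ → ℝ} (hb : IsBddMultiplier S b) (f : S.StripL2) :
    mulOp hb f =ᵐ[S.stripMeasure] fun p => (b p : ℂ) * f p := coeFn_mulFun hb f

theorem inner_mulOp {b : ℝ × ℝ → ℝ} (hb : IsBddMultiplier S b) (f g : S.StripL2) :
    ⟪f, mulOp hb g⟫_ℂ = ⟪mulOp hb f, g⟫_ℂ := by
  rw [inner_Lp_eq, inner_Lp_eq]
  refine integral_congr_ae ?_
  filter_upwards [coeFn_mulOp hb f, coeFn_mulOp hb g] with p h1 h2
  rw [h1, h2, map_mul, Complex.conj_ofReal]; ring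

theorem abs_snd_le : ∀ᵐ p ∂S.stripMeasure, |p.2| ≤ S.δ := by
  filter_upwards [S.ae_stripMeasure] with p hp using abs_le.2 ⟨hp.1.le, hp.2.le⟩

variable (S) in
theorem isBddMultiplier_jac : IsBddMultiplier S fun p => S.jac p.1 p.2 := by
  refine ⟨S.continuous_jac.measurable, 2, ?_⟩
  filter_upwards [abs_snd_le] with p hp
  rw [abs_of_pos (S.jac_pos hp)]
  exact S.jac_le hp

variable (S) in
theorem isBddMultiplier_curv : IsBddMultiplier S fun p => S.curv p.1 := by
  obtain ⟨C, hC⟩ := (show HasCompactSupport S.curv from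
    S.curvature_compact).exists_bound_of_continuous S.continuous_curv
  exact ⟨(S.continuous_curv.comp continuous_fst).measurable, C, Eventually.of_forall fun p => hC _⟩

/-! ### Test functions and weak equations -/

/-- The pairing of a test function with a square-integrable function. -/
noncomputable def pairing (π : ℝ × ℝ → ℝ) (f : S.StripL2) : ℂ :=
  ∫ p, (π p : ℂ) * f p ∂S.stripMeasure

theorem memLp_ofReal {π : ℝ × ℝ → ℝ} (hπ : Continuous π) (hc : HasCompactSupport π) :
    MemLp (fun p => (π p : ℂ)) 2 S.stripMeasure :=
  (Complex.continuous_ofReal.comp hπ).memLp_of_hasCompactSupport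
    (hc.comp_left (g := fun x : ℝ => (x : ℂ)) (by simp))

theorem integrable_pairing {π : ℝ × ℝ → ℝ} (hπ : Continuous π) (hc : HasCompactSupport π)
    (f : S.StripL2) : Integrable (fun p => (π p : ℂ) * f p) S.stripMeasure :=
  integrable_mul_of_memLp (memLp_ofReal hπ hc) (Lp.memLp f)

theorem exists_pairing_eq_inner {π : ℝ × ℝ → ℝ} (hπ : Continuous π) (hc : HasCompactSupport π) :
    ∃ g : S.StripL2, ∀ f : S.StripL2, pairing π f = ⟪g, f⟫_ℂ := by
  have h1 : MemLp (fun p => (π p : ℂ)) 2 S.stripMeasure := memLp_ofReal hπ hc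
  refine ⟨h1.toLp _, fun f => ?_⟩
  rw [inner_Lp_eq]
  refine integral_congr_ae ?_
  filter_upwards [h1.coeFn_toLp] with p hp
  rw [hp, Complex.conj_ofReal]

/-- Smooth compactly supported functions of `(s, t)` that vanish on the line `t = b`. -/
structure IsStripTest (b : ℝ) (π : ℝ × ℝ → ℝ) : Prop where
  smooth : ContDiff ℝ ∞ π
  compact : HasCompactSupport π
  zero : ∀ s, π (s, b) = 0

theorem IsStripTest.continuous_fderiv {b : ℝ} {π : ℝ × ℝ → ℝ} (hπ : IsStripTest b π)
    (e : ℝ × ℝ) : Continuous fun p => fderiv ℝ π p e :=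
  (hπ.smooth.continuous_fderiv (by simp)).clm_apply continuous_const

theorem IsStripTest.compact_fderiv {b : ℝ} {π : ℝ × ℝ → ℝ} (hπ : IsStripTest b π)
    (e : ℝ × ℝ) : HasCompactSupport fun p => fderiv ℝ π p e :=
  (hπ.compact.fderiv (𝕜 := ℝ)).comp_left (g := fun L : ℝ × ℝ →L[ℝ] ℝ => L e) (by simp)

/-- `i ∂_t y = X` weakly, without boundary condition on `t = b` and with `y = 0` on the other
boundary line. -/
def WeakT (b : ℝ) (y X : S.StripL2) : Prop :=
  ∀ π : ℝ × ℝ → ℝ, IsStripTest b π →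
    Complex.I * pairing (fun p => fderiv ℝ π p (0, 1)) y + pairing π X = 0

/-- `∂_s P + i ∂_t y = X` weakly, with the boundary conditions of `WeakT`. -/
def WeakST (b : ℝ) (P y X : S.StripL2) : Prop :=
  ∀ π : ℝ × ℝ → ℝ, IsStripTest b π → pairing (fun p => fderiv ℝ π p (1, 0)) P +
    (Complex.I * pairing (fun p => fderiv ℝ π p (0, 1)) y + pairing π X) = 0

theorem IsStripTest.shift {b : ℝ} {π : ℝ × ℝ → ℝ} (hπ : IsStripTest b π) (r : ℝ) :
    IsStripTest b fun p => π (p.1 - r, p.2) := by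
  refine ⟨hπ.smooth.comp (by fun_prop), ?_, fun s => hπ.zero _⟩
  exact hπ.compact.comp_homeomorph ((Homeomorph.subRight r).prodCongr (Homeomorph.refl ℝ))

theorem fderiv_shift (π : ℝ × ℝ → ℝ) (r : ℝ) (p e : ℝ × ℝ) :
    fderiv ℝ (fun p : ℝ × ℝ => π (p.1 - r, p.2)) p e = fderiv ℝ π (p.1 - r, p.2) e := by
  have h1 : (fun p : ℝ × ℝ => π (p.1 - r, p.2)) = fun p => π (p - (r, 0)) := by
    ext p; congr 1; ext <;> simp
  rw [h1, fderiv_comp_sub]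
  congr 2; ext <;> simp

theorem pairing_shift (π : ℝ × ℝ → ℝ) (r : ℝ) (f : S.StripL2) :
    pairing (fun p => π (p.1 - r, p.2)) f = pairing π (translate r f) := by
  have he : MeasurableEmbedding fun p : ℝ × ℝ => (p.1 + r, p.2) :=
    ((Homeomorph.addRight r).prodCongr (Homeomorph.refl ℝ)).measurableEmbedding
  rw [pairing, pairing, ← (measurePreserving_shift r).integral_comp he]
  refine integral_congr_ae ?_
  filter_upwards [coeFn_translate r f] with p hp
  rw [hp, add_sub_cancel_right]

/-- The translation is moved to the test function and differentiated there, so f only needs to be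
square integrable. -/
theorem hasDerivAt_pairing {b : ℝ} {π : ℝ × ℝ → ℝ} (hπ : IsStripTest b π) (f : S.StripL2) (r : ℝ) :
    HasDerivAt (fun r => pairing π (translate r f))
      (-pairing (fun p => fderiv ℝ π p (1, 0)) (translate r f)) r := by
  simp_rw [← pairing_shift]
  obtain ⟨C, hC⟩ := (hπ.compact_fderiv (1, 0)).exists_bound_of_continuous (hπ.continuous_fderiv _)
  have hC0 : 0 ≤ C := (norm_nonneg _).trans (hC 0)
  have hd1 : Continuous fun p => fderiv ℝ π p (1, 0) := hπ.continuous_fderiv _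
  obtain ⟨X, hX⟩ : ∃ X : ℝ, tsupport π ⊆ Metric.closedBall 0 X :=
    hπ.compact.isBounded.subset_closedBall 0
  -- A compact set containing the supports of all translates by amounts within distance 1 of r, used
  -- for domination.
  set K : Set (ℝ × ℝ) := Metric.closedBall 0 (X + |r| + 1) with hK
  have hKf : IntegrableOn f K S.stripMeasure := by
    have h1 : MemLp f 2 (S.stripMeasure.restrict K) := (Lp.memLp f).restrict K
    have h2 : IsFiniteMeasure (S.stripMeasure.restrict K) :=
      ⟨by simpa using (isCompact_closedBall (0 : ℝ × ℝ) _).measure_lt_top⟩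
    exact h1.integrable (by norm_num)
  have hsupp : ∀ p : ℝ × ℝ, ∀ x ∈ Metric.ball r 1, p ∉ K → fderiv ℝ π (p.1 - x, p.2) = 0 := by
    intro p x hx hp
    by_contra h
    have h1 := hX (support_fderiv_subset ℝ h)
    apply hp
    rw [mem_closedBall_zero_iff, Prod.norm_def, max_le_iff] at h1
    rw [hK, mem_closedBall_zero_iff, Prod.norm_def, max_le_iff]
    simp only [Real.norm_eq_abs, Metric.mem_ball, Real.dist_eq] at h1 hx ⊢
    have := abs_sub_abs_le_abs_sub x r
    have := abs_sub_abs_le_abs_sub p.1 x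
    constructor <;> linarith [abs_nonneg r]
  have hderiv : ∀ (p : ℝ × ℝ) (x : ℝ), HasDerivAt (fun x => π (p.1 - x, p.2))
      (-fderiv ℝ π (p.1 - x, p.2) (1, 0)) x := by
    intro p x
    have h1 := (hπ.smooth.differentiable (by simp) (p.1 - x, p.2)).hasFDerivAt
    have h2 : HasDerivAt (fun x : ℝ => (p.1 - x, p.2)) (-1, 0) x :=
      ((hasDerivAt_id x).const_sub p.1).prodMk (hasDerivAt_const x p.2)
    have h3 := h1.comp_hasDerivAt x h2
    have h4 : ((-1 : ℝ), (0 : ℝ)) = -(1, 0) := by simp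
    rwa [h4, map_neg] at h3
  have key := hasDerivAt_integral_of_dominated_loc_of_deriv_le (μ := S.stripMeasure) (x₀ := r)
    (s := Metric.ball r 1)
    (F := fun x p => ((π (p.1 - x, p.2) : ℝ) : ℂ) * f p)
    (F' := fun x p => -(((fderiv ℝ π (p.1 - x, p.2) (1, 0) : ℝ) : ℂ) * f p))
    (bound := K.indicator fun p => C * ‖f p‖) (Metric.ball_mem_nhds r one_pos) ?_ ?_ ?_ ?_ ?_ ?_
  · have h2 := key.2
    rwa [integral_neg] at h2
  · refine Eventually.of_forall fun x => ?_
    have : Continuous fun p : ℝ × ℝ => ((π (p.1 - x, p.2) : ℝ) : ℂ) := by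
      have := hπ.smooth.continuous; fun_prop
    exact this.aestronglyMeasurable.mul (Lp.aestronglyMeasurable f)
  · have h1 := (hπ.shift r)
    exact integrable_pairing h1.smooth.continuous h1.compact f
  · have : Continuous fun p : ℝ × ℝ => ((fderiv ℝ π (p.1 - r, p.2) (1, 0) : ℝ) : ℂ) :=
      Complex.continuous_ofReal.comp (hd1.comp (by fun_prop))
    exact (this.aestronglyMeasurable.mul (Lp.aestronglyMeasurable f)).neg
  · refine Eventually.of_forall fun p x hx => ?_
    by_cases hp : p ∈ K
    · rw [indicator_of_mem hp, norm_neg, norm_mul, Complex.norm_real]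
      exact mul_le_mul_of_nonneg_right (hC _) (norm_nonneg _)
    · rw [indicator_of_notMem hp, hsupp p x hx hp]; simp
  · exact (integrable_indicator_iff (measurableSet_closedBall)).2 (hKf.norm.const_mul C)
  · refine Eventually.of_forall fun p x _ => ?_
    have := ((hderiv p x).ofReal_comp).mul_const (f p)
    refine this.congr_deriv ?_
    push_cast; ring

theorem pairing_sub {π : ℝ × ℝ → ℝ} (hπ : Continuous π) (hc : HasCompactSupport π)
    (f g : S.StripL2) : pairing π (f - g) = pairing π f - pairing π g := by
  obtain ⟨w, hw⟩ := exists_pairing_eq_inner (S := S) hπ hc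
  rw [hw, hw, hw, inner_sub_right]

theorem pairing_smul {π : ℝ × ℝ → ℝ} (hπ : Continuous π) (hc : HasCompactSupport π) (c : ℂ)
    (f : S.StripL2) : pairing π (c • f) = c * pairing π f := by
  obtain ⟨w, hw⟩ := exists_pairing_eq_inner (S := S) hπ hc
  rw [hw, hw, inner_smul_right]

theorem pairing_avg {π : ℝ × ℝ → ℝ} (hπ : Continuous π) (hc : HasCompactSupport π) (a : ℝ)
    (f : S.StripL2) :
    pairing π (avg a f) = (a : ℂ)⁻¹ * ∫ r in (0 : ℝ)..a, pairing π (translate r f) := by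
  obtain ⟨w, hw⟩ := exists_pairing_eq_inner (S := S) hπ hc
  simp_rw [hw]
  rw [avg, inner_smul_right]
  congr 1
  exact ((innerSL ℂ w).intervalIntegral_comp_comm
    ((continuous_translate f).intervalIntegrable 0 a)).symm

/-- Averaging the translated equations over [0, a] integrates ∂_s P exactly to a difference
quotient. What remains is an equation in t alone, with a square-integrable right-hand side. -/
theorem WeakST.avg {b : ℝ} {P y X : S.StripL2} (H : WeakST b P y X) (a : ℝ) :
    WeakT b (avg a y) (avg a X - diffQuot a P) := by
  intro π hπ
  have c0 := hπ.smooth.continuous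
  have cs := hπ.continuous_fderiv (1, 0)
  have ct := hπ.continuous_fderiv (0, 1)
  have kt := hπ.compact_fderiv (0, 1)
  have ks := hπ.compact_fderiv (1, 0)
  have hcont : ∀ {π : ℝ × ℝ → ℝ}, Continuous π → HasCompactSupport π → ∀ f : S.StripL2,
      Continuous fun r => pairing π (translate r f) := by
    intro π h1 h2 f
    obtain ⟨w, hw⟩ := exists_pairing_eq_inner (S := S) h1 h2
    simp_rw [hw]
    exact continuous_const.inner (continuous_translate f)
  have h1 : ∀ r, pairing (fun p => fderiv ℝ π p (1, 0)) (translate r P) +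
      (Complex.I * pairing (fun p => fderiv ℝ π p (0, 1)) (translate r y) +
      pairing π (translate r X)) = 0 := by
    intro r
    have := H _ (hπ.shift r)
    simp_rw [fderiv_shift π] at this
    rwa [pairing_shift π r, pairing_shift (fun p => fderiv ℝ π p (1, 0)) r,
      pairing_shift (fun p => fderiv ℝ π p (0, 1)) r] at this
  have h2 : ∫ r in (0 : ℝ)..a, -pairing (fun p => fderiv ℝ π p (1, 0)) (translate r P) =
      pairing π (translate a P) - pairing π P := by
    rw [intervalIntegral.integral_eq_sub_of_hasDerivAt (fun r _ => hasDerivAt_pairing hπ P r)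
      ((hcont cs ks P).neg.intervalIntegrable _ _), translate_zero]
  have h3 : ∫ r in (0 : ℝ)..a, -pairing (fun p => fderiv ℝ π p (1, 0)) (translate r P) =
      Complex.I * (∫ r in (0 : ℝ)..a, pairing (fun p => fderiv ℝ π p (0, 1)) (translate r y)) +
      ∫ r in (0 : ℝ)..a, pairing π (translate r X) := by
    have i1 : IntervalIntegrable (fun r => Complex.I *
        pairing (fun p => fderiv ℝ π p (0, 1)) (translate r y)) volume 0 a :=
      (continuous_const.mul (hcont ct kt y)).intervalIntegrable _ _
    rw [← intervalIntegral.integral_const_mul, ← intervalIntegral.integral_add i1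
      ((hcont c0 hπ.compact X).intervalIntegrable _ _)]
    refine intervalIntegral.integral_congr fun r _ => ?_
    linear_combination -(h1 r)
  rw [pairing_sub c0 hπ.compact, diffQuot, pairing_smul c0 hπ.compact, pairing_sub c0 hπ.compact,
    pairing_avg c0 hπ.compact, pairing_avg ct kt]
  linear_combination (a : ℂ)⁻¹ * (h2 - h3)

theorem pairing_mulOp {b : ℝ × ℝ → ℝ} (hb : IsBddMultiplier S b) (π : ℝ × ℝ → ℝ) (f : S.StripL2) :
    pairing (fun p => b p * π p) f = pairing π (mulOp hb f) := by
  refine integral_congr_ae ?_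
  filter_upwards [coeFn_mulOp hb f] with p hp
  rw [hp]; push_cast; ring

theorem IsStripTest.mul {b : ℝ} {π g : ℝ × ℝ → ℝ} (hπ : IsStripTest b π) (hg : ContDiff ℝ ∞ g) :
    IsStripTest b fun p => g p * π p :=
  ⟨hg.mul hπ.smooth, hπ.compact.mul_left, fun s => by rw [hπ.zero, mul_zero]⟩

/-- J is smooth, so Jπ is again an admissible test function; the correction comes from ∂_t J = −κ.
-/
theorem WeakT.mul_jac {b : ℝ} {y X : S.StripL2} (H : WeakT b y X) :
    WeakT b (mulOp S.isBddMultiplier_jac y)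
      (mulOp S.isBddMultiplier_jac X - Complex.I • mulOp S.isBddMultiplier_curv y) := by
  intro π hπ
  have c0 := hπ.smooth.continuous
  have h1 := H _ (hπ.mul S.contDiff_jac)
  have ct := hπ.continuous_fderiv (0, 1)
  have kt := hπ.compact_fderiv (0, 1)
  have hd : ∀ p : ℝ × ℝ, fderiv ℝ (fun p : ℝ × ℝ => S.jac p.1 p.2 * π p) p (0, 1) =
      S.jac p.1 p.2 * fderiv ℝ π p (0, 1) - S.curv p.1 * π p := by
    intro p
    have e1 := (S.contDiff_jac.differentiable (by simp) p).hasFDerivAt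
    have e2 := (hπ.smooth.differentiable (by simp) p).hasFDerivAt
    have e3 : fderiv ℝ (fun p : ℝ × ℝ => S.jac p.1 p.2) p (0, 1) = -S.curv p.1 := by
      have f1 := e1.comp_hasDerivAt p.2
        ((hasDerivAt_const p.2 p.1).prodMk (hasDerivAt_id p.2))
      have f2 : HasDerivAt (fun x : ℝ => S.jac p.1 x) (-S.curv p.1) p.2 := by
        have := ((hasDerivAt_id p.2).mul_const (S.curv p.1)).const_sub 1
        simpa [jac] using this
      exact f1.unique f2
    have e4 := (e1.mul e2).fderiv
    change fderiv ℝ (fun p : ℝ × ℝ => S.jac p.1 p.2 * π p) p = _ at e4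
    rw [e4]
    simp [e3]
    ring
  simp_rw [hd] at h1
  have h2 : pairing (fun p => S.jac p.1 p.2 * fderiv ℝ π p (0, 1) - S.curv p.1 * π p) y =
      pairing (fun p => fderiv ℝ π p (0, 1)) (mulOp S.isBddMultiplier_jac y) -
      pairing π (mulOp S.isBddMultiplier_curv y) := by
    rw [← pairing_mulOp, ← pairing_mulOp, pairing, pairing, pairing, ← integral_sub]
    · refine integral_congr_ae (Eventually.of_forall fun p => ?_)
      simp only
      push_cast; ring
    · exact integrable_pairing (S.continuous_jac.mul ct) kt.mul_left y
    · exact integrable_pairing ((S.continuous_curv.comp continuous_fst).mul c0)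
        hπ.compact.mul_left y
  rw [h2, pairing_mulOp S.isBddMultiplier_jac] at h1
  rw [pairing_sub c0 hπ.compact, pairing_smul c0 hπ.compact]
  linear_combination h1

end CurvedStrip

namespace CurvedStrip

variable {S : CurvedStrip}

/-! ### Integration in the transverse variable -/

variable (S) in
/-- Lebesgue measure on `(-δ, δ)`. -/
noncomputable def crossMeasure : Measure ℝ := volume.restrict (Ioo (-S.δ) S.δ)

instance : IsFiniteMeasure S.crossMeasure := by unfold crossMeasure; infer_instance

variable (S) in
/-- The primitive in `t` that vanishes at `t = -δ`. -/
noncomputable def primitiveLeft (f : ℝ × ℝ → ℂ) (p : ℝ × ℝ) : ℂ :=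
  ∫ τ, (if τ < p.2 then f (p.1, τ) else 0) ∂S.crossMeasure

variable (S) in
/-- Minus the primitive in `t` that vanishes at `t = δ`. -/
noncomputable def primitiveRight (f : ℝ × ℝ → ℂ) (p : ℝ × ℝ) : ℂ :=
  ∫ τ, (if p.2 < τ then f (p.1, τ) else 0) ∂S.crossMeasure

/-- The exchange of the last two coordinates. -/
def swapLast : (ℝ × ℝ) × ℝ ≃ᵐ (ℝ × ℝ) × ℝ :=
  MeasurableEquiv.prodAssoc.trans (((MeasurableEquiv.refl ℝ).prodCongr
    MeasurableEquiv.prodComm).trans MeasurableEquiv.prodAssoc.symm)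

theorem measurePreserving_swapLast : MeasurePreserving swapLast
    (S.stripMeasure.prod S.crossMeasure) (S.stripMeasure.prod S.crossMeasure) := by
  have h1 := measurePreserving_prodAssoc (volume : Measure ℝ) S.crossMeasure S.crossMeasure
  have h2 : MeasurePreserving (Prod.map (id : ℝ → ℝ) (Prod.swap : ℝ × ℝ → ℝ × ℝ))
      ((volume : Measure ℝ).prod (S.crossMeasure.prod S.crossMeasure))
      ((volume : Measure ℝ).prod (S.crossMeasure.prod S.crossMeasure)) :=
    (MeasurePreserving.id _).prod Measure.measurePreserving_swap
  have h3 := (h1.symm MeasurableEquiv.prodAssoc).comp (h2.comp h1)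
  exact h3

/-- The product of F(s, t) and X(s, τ) is dominated by |F|² + |X|², integrable in the additional
variable because (−δ, δ) has finite length. -/
theorem integrable_volterra {F X : ℝ × ℝ → ℂ} (hF : MemLp F 2 S.stripMeasure)
    (hX : MemLp X 2 S.stripMeasure) :
    Integrable (fun x : (ℝ × ℝ) × ℝ =>
      F x.1 * (if x.2 < x.1.2 then X (x.1.1, x.2) else 0)) (S.stripMeasure.prod S.crossMeasure) := by
  have hsw := measurePreserving_swapLast (S := S)
  have m1 : AEStronglyMeasurable (fun x : (ℝ × ℝ) × ℝ => F x.1)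
      (S.stripMeasure.prod S.crossMeasure) := hF.1.comp_fst
  have m2 : AEStronglyMeasurable (fun x : (ℝ × ℝ) × ℝ => X (x.1.1, x.2))
      (S.stripMeasure.prod S.crossMeasure) :=
    (hX.1.comp_fst (ν := S.crossMeasure)).comp_measurePreserving hsw
  have i1 : Integrable (fun x : (ℝ × ℝ) × ℝ => ‖F x.1‖ ^ 2)
      (S.stripMeasure.prod S.crossMeasure) :=
    ((memLp_two_iff_integrable_sq_norm hF.1).1 hF).comp_fst S.crossMeasure
  have i2 : Integrable (fun x : (ℝ × ℝ) × ℝ => ‖X (x.1.1, x.2)‖ ^ 2)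
      (S.stripMeasure.prod S.crossMeasure) :=
    hsw.integrable_comp_of_integrable
      (((memLp_two_iff_integrable_sq_norm hX.1).1 hX).comp_fst S.crossMeasure)
  have hs : MeasurableSet {x : (ℝ × ℝ) × ℝ | x.2 < x.1.2} :=
    measurableSet_lt measurable_snd (measurable_snd.comp measurable_fst)
  have m3 : AEStronglyMeasurable (fun x : (ℝ × ℝ) × ℝ =>
      if x.2 < x.1.2 then X (x.1.1, x.2) else 0) (S.stripMeasure.prod S.crossMeasure) :=
    m2.indicator hs
  refine (i1.add i2).mono' (m1.mul m3) (Eventually.of_forall fun x => ?_)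
  have h1 : ‖(if x.2 < x.1.2 then X (x.1.1, x.2) else 0)‖ ≤ ‖X (x.1.1, x.2)‖ := by
    split_ifs <;> simp
  rw [norm_mul, Pi.add_apply]
  nlinarith [mul_le_mul_of_nonneg_left h1 (norm_nonneg (F x.1)), norm_nonneg (F x.1),
    norm_nonneg (X (x.1.1, x.2)), sq_nonneg (‖F x.1‖ - ‖X (x.1.1, x.2)‖)]

theorem integrable_mul_primitiveLeft {F X : ℝ × ℝ → ℂ} (hF : MemLp F 2 S.stripMeasure)
    (hX : MemLp X 2 S.stripMeasure) :
    Integrable (fun p => F p * primitiveLeft S X p) S.stripMeasure := by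
  have h := (integrable_volterra hF hX).integral_prod_left
  refine h.congr (Eventually.of_forall fun p => ?_)
  exact integral_const_mul (F p) fun τ => if τ < p.2 then X (p.1, τ) else 0

theorem volterra_swap (F X : ℝ × ℝ → ℂ) (q : ℝ × ℝ) :
    ∫ t, (fun x : (ℝ × ℝ) × ℝ => F x.1 * (if x.2 < x.1.2 then X (x.1.1, x.2) else 0))
      (swapLast (q, t)) ∂S.crossMeasure = X q * primitiveRight S F q := by
  rw [primitiveRight, ← integral_const_mul]
  refine integral_congr_ae (Eventually.of_forall fun t => ?_)
  change F (q.1, t) * (if q.2 < t then X (q.1, q.2) else 0) = X q * if q.2 < t then F (q.1, t) else 0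
  split_ifs <;> ring

theorem integrable_mul_primitiveRight {F X : ℝ × ℝ → ℂ} (hF : MemLp F 2 S.stripMeasure)
    (hX : MemLp X 2 S.stripMeasure) :
    Integrable (fun p => X p * primitiveRight S F p) S.stripMeasure := by
  have h := (measurePreserving_swapLast.integrable_comp_of_integrable
    (integrable_volterra hF hX)).integral_prod_left
  exact h.congr (Eventually.of_forall fun p => volterra_swap F X p)

/-- Fubini on the triangle τ < t: the two Volterra operators are transposes of each other. -/
theorem integral_mul_primitiveLeft {F X : ℝ × ℝ → ℂ} (hF : MemLp F 2 S.stripMeasure)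
    (hX : MemLp X 2 S.stripMeasure) :
    ∫ p, F p * primitiveLeft S X p ∂S.stripMeasure =
      ∫ p, X p * primitiveRight S F p ∂S.stripMeasure := by
  have hi := integrable_volterra hF hX
  have h1 : ∫ p, F p * primitiveLeft S X p ∂S.stripMeasure = _ :=
    (integral_congr_ae (Eventually.of_forall fun p => (integral_const_mul (F p)
      fun τ => if τ < p.2 then X (p.1, τ) else 0).symm)).trans
      (integral_prod _ hi).symm
  have h2 := integral_prod _ (measurePreserving_swapLast.integrable_comp_of_integrable hi)
  rw [h1, ← (measurePreserving_swapLast (S := S)).integral_comp swapLast.measurableEmbedding]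
  refine h2.trans (integral_congr_ae (Eventually.of_forall fun p => volterra_swap F X p))

/-! ### Test functions with a prescribed transverse derivative -/

/-- The function `(s, t) ↦ ∫_{t + c}^{t + c + 2δ} ζ(s, x) dx`. -/
noncomputable def slide (S : CurvedStrip) (c : ℝ) (ζ : ℝ × ℝ → ℝ) (p : ℝ × ℝ) : ℝ :=
  ∫ x in (p.2 + c)..(p.2 + c + 2 * S.δ), ζ (p.1, x)

/-- The integral over a sliding window is the convolution of ζ with a finite measure on a vertical
segment, so it inherits smoothness in both variables. -/
theorem contDiff_slide (c : ℝ) {ζ : ℝ × ℝ → ℝ} (hζ : ContDiff ℝ ∞ ζ) (hc : HasCompactSupport ζ) :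
    ContDiff ℝ ∞ (slide S c ζ) := by
  let μ : Measure (ℝ × ℝ) :=
    (volume.restrict (Ioc c (c + 2 * S.δ))).map fun r => ((0 : ℝ), -r)
  have hm : Measurable fun r : ℝ => ((0 : ℝ), -r) := by fun_prop
  have : IsFiniteMeasure μ := by
    have : IsFiniteMeasure (volume.restrict (Ioc c (c + 2 * S.δ))) := by infer_instance
    exact Measure.isFiniteMeasure_map _ _
  have h1 := hc.contDiff_convolution_right (n := ⊤) (μ := μ) (f := fun _ => (1 : ℝ))
    (ContinuousLinearMap.mul ℝ ℝ) (locallyIntegrable_const 1) hζ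
  convert h1 using 1
  ext p
  rw [convolution, integral_map hm.aemeasurable
    (by have := hζ.continuous; exact Continuous.aestronglyMeasurable (by simp; fun_prop)), slide,
    ← intervalIntegral.integral_of_le (by linarith [S.δ_pos]), add_assoc,
    ← intervalIntegral.integral_comp_add_left (fun x => ζ (p.1, x))]
  refine intervalIntegral.integral_congr fun r _ => ?_
  simp [Prod.sub_def]

theorem hasDerivAt_slide (c : ℝ) {ζ : ℝ × ℝ → ℝ} (hζ : Continuous ζ) (s t : ℝ) :
    HasDerivAt (fun t => slide S c ζ (s, t)) (ζ (s, t + c + 2 * S.δ) - ζ (s, t + c)) t := by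
  have hcont : Continuous fun x => ζ (s, x) := by fun_prop
  have h0 : ∀ b : ℝ, HasDerivAt (fun u => ∫ x in (0 : ℝ)..u, ζ (s, x)) (ζ (s, b)) b :=
    fun b => (hcont.integral_hasStrictDerivAt 0 b).hasDerivAt
  have h1 : HasDerivAt (fun t => (∫ x in (0 : ℝ)..(t + c + 2 * S.δ), ζ (s, x)) -
      ∫ x in (0 : ℝ)..(t + c), ζ (s, x)) (ζ (s, t + c + 2 * S.δ) - ζ (s, t + c)) t := by
    refine HasDerivAt.sub ?_ ?_
    · exact ((h0 (t + c + 2 * S.δ)).comp_add_const (t + c) (2 * S.δ)).comp_add_const t c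
    · exact (h0 (t + c)).comp_add_const t c
  refine h1.congr_of_eventuallyEq (Eventually.of_forall fun t => ?_)
  exact (intervalIntegral.integral_interval_sub_left (hcont.intervalIntegrable _ _)
    (hcont.intervalIntegrable _ _)).symm

theorem fderiv_slide (c : ℝ) {ζ : ℝ × ℝ → ℝ} (hζ : ContDiff ℝ ∞ ζ) (hc : HasCompactSupport ζ)
    (p : ℝ × ℝ) : fderiv ℝ (slide S c ζ) p (0, 1) =
      ζ (p.1, p.2 + c + 2 * S.δ) - ζ (p.1, p.2 + c) := by
  have h1 := ((contDiff_slide (S := S) c hζ hc).differentiable (by simp) p).hasFDerivAt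
  have h2 := h1.comp_hasDerivAt p.2 ((hasDerivAt_const p.2 p.1).prodMk (hasDerivAt_id p.2))
  exact h2.unique (hasDerivAt_slide c hζ.continuous p.1 p.2)

theorem hasCompactSupport_slide (c : ℝ) {ζ : ℝ × ℝ → ℝ} (hc : HasCompactSupport ζ) :
    HasCompactSupport (slide S c ζ) := by
  obtain ⟨X, hX⟩ : ∃ X : ℝ, tsupport ζ ⊆ Metric.closedBall 0 X :=
    hc.isBounded.subset_closedBall 0
  refine HasCompactSupport.of_support_subset_isCompact
    (isCompact_closedBall (0 : ℝ × ℝ) (X + |c| + 2 * S.δ)) fun p hp => ?_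
  by_contra hout
  apply hp
  have h0 : ∀ x ∈ uIcc (p.2 + c) (p.2 + c + 2 * S.δ), ζ (p.1, x) = (fun _ => 0 : ℝ → ℝ) x := by
    intro x hx
    by_contra h
    have h1 := hX (subset_tsupport _ h)
    apply hout
    have hδ := S.δ_pos
    rw [uIcc_of_le (by linarith)] at hx
    rw [mem_closedBall_zero_iff, Prod.norm_def, max_le_iff] at h1 ⊢
    simp only [Real.norm_eq_abs, abs_le] at h1 ⊢
    have := abs_nonneg c
    have := neg_abs_le c
    have := le_abs_self c
    refine ⟨⟨?_, ?_⟩, ?_, ?_⟩ <;> linarith [hx.1, hx.2, h1.1.1, h1.1.2, h1.2.1, h1.2.2]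
  rw [slide, intervalIntegral.integral_congr h0]
  simp

/-- For t in the strip the window of length 2δ starts at t (c = 0) or ends at t (c = −2δ). So it
integrates ζ from t to δ or from −δ to t, and the result vanishes on the corresponding side. -/
theorem isStripTest_slide {b c : ℝ} (hb : b = -S.δ ∧ c = -(2 * S.δ) ∨ b = S.δ ∧ c = 0)
    {ζ : ℝ × ℝ → ℝ} (hζ : ContDiff ℝ ∞ ζ)
    (hc : HasCompactSupport ζ) (hs : ∀ p, p.2 ∉ Ioo (-S.δ) S.δ → ζ p = 0) :
    IsStripTest b (slide S c ζ) := by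
  refine ⟨contDiff_slide c hζ hc, hasCompactSupport_slide c hc, fun s => ?_⟩
  have hδ := S.δ_pos
  have h0 : ∀ x ∈ uIcc (b + c) (b + c + 2 * S.δ), ζ (s, x) = (fun _ => 0 : ℝ → ℝ) x := by
    intro x hx
    rw [uIcc_of_le (by linarith)] at hx
    refine hs _ fun h => ?_
    have h1 := h.1
    have h2 := h.2
    have h3 := hx.1
    have h4 := hx.2
    rcases hb with ⟨rfl, rfl⟩ | ⟨rfl, rfl⟩
    · simp only at h1; linarith
    · simp only at h2; linarith
  rw [slide, intervalIntegral.integral_congr h0]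
  simp

theorem slide_eq_primitiveRight {ζ : ℝ × ℝ → ℝ} (hs : ∀ p, p.2 ∉ Ioo (-S.δ) S.δ → ζ p = 0)
    {p : ℝ × ℝ} (hp : p.2 ∈ Ioo (-S.δ) S.δ) :
    ((slide S 0 ζ p : ℝ) : ℂ) = primitiveRight S (fun p => (ζ p : ℂ)) p := by
  have hδ := S.δ_pos
  rw [slide, primitiveRight, crossMeasure, ← intervalIntegral.integral_ofReal,
    intervalIntegral.integral_of_le (by linarith), ← integral_indicator measurableSet_Ioc,
    ← integral_indicator measurableSet_Ioo]
  congr 1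
  ext x
  by_cases hx : x ∈ Ioo (-S.δ) S.δ
  · rw [indicator_of_mem hx]
    by_cases h : p.2 < x
    · rw [if_pos h, indicator_of_mem]
      exact ⟨by linarith, by linarith [hx.2, hp.1]⟩
    · rw [if_neg h, indicator_of_notMem]
      rintro ⟨h1, -⟩
      exact h (by linarith)
  · rw [indicator_of_notMem hx, indicator_apply_eq_zero]
    intro _
    rw [hs _ hx, Complex.ofReal_zero]

theorem slide_eq_primitiveLeft {ζ : ℝ × ℝ → ℝ} (hs : ∀ p, p.2 ∉ Ioo (-S.δ) S.δ → ζ p = 0)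
    {p : ℝ × ℝ} (hp : p.2 ∈ Ioo (-S.δ) S.δ) :
    ((slide S (-(2 * S.δ)) ζ p : ℝ) : ℂ) = primitiveLeft S (fun p => (ζ p : ℂ)) p := by
  have hδ := S.δ_pos
  rw [slide, primitiveLeft, crossMeasure, ← intervalIntegral.integral_ofReal,
    intervalIntegral.integral_of_le (by linarith), ← integral_indicator measurableSet_Ioc,
    ← integral_indicator measurableSet_Ioo]
  refine integral_congr_ae ?_
  -- The window contains its right endpoint t, whereas the primitive uses the strict inequality τ <
  -- t.
  filter_upwards [(by simp [ae_iff] : ∀ᵐ x : ℝ, x ≠ p.2)] with x hxp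
  by_cases hx : x ∈ Ioo (-S.δ) S.δ
  · rw [indicator_of_mem hx]
    by_cases h : x < p.2
    · rw [if_pos h, indicator_of_mem]
      exact ⟨by linarith [hx.1, hp.2], by linarith⟩
    · rw [if_neg h, indicator_of_notMem]
      rintro ⟨-, h1⟩
      exact h (lt_of_le_of_ne (by linarith) hxp)
  · rw [indicator_of_notMem hx, indicator_apply_eq_zero]
    intro _
    rw [hs _ hx, Complex.ofReal_zero]

/-- A function on the strip that is orthogonal to all test functions vanishes. -/
theorem strip_eq_zero_of_forall_test {w : ℝ × ℝ → ℂ} (hw : LocallyIntegrable w S.stripMeasure)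
    (h : ∀ ζ : ℝ × ℝ → ℝ, ContDiff ℝ ∞ ζ → HasCompactSupport ζ →
      (∀ p, p.2 ∉ Ioo (-S.δ) S.δ → ζ p = 0) → ∫ p, (ζ p : ℂ) * w p ∂S.stripMeasure = 0) :
    w =ᵐ[S.stripMeasure] 0 := by
  rw [stripMeasure_eq] at *
  have hU : IsOpen ((univ : Set ℝ) ×ˢ Ioo (-S.δ) S.δ) := isOpen_univ.prod isOpen_Ioo
  have h2 := hU.ae_eq_zero_of_integral_contDiff_smul_eq_zero
    (locallyIntegrableOn_of_locallyIntegrable_restrict hw) (fun ζ h1 h2 h3 => by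
      have h4 : ∀ p : ℝ × ℝ, p ∉ (univ : Set ℝ) ×ˢ Ioo (-S.δ) S.δ → ζ p = 0 := fun p hp =>
        image_eq_zero_of_notMem_tsupport fun h => hp (h3 h)
      have := h ζ h1 h2 fun p hp => h4 p fun h => hp h.2
      rw [← setIntegral_eq_integral_of_forall_compl_eq_zero
        (s := (univ : Set ℝ) ×ˢ Ioo (-S.δ) S.δ)]
      · simpa [Complex.real_smul] using this
      · intro p hp
        rw [h4 p hp, zero_smul])
  exact (ae_restrict_iff' hU.measurableSet).2 h2

/-- Pairing with the indicator of a compact set, which is square integrable, is enough. -/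
theorem locallyIntegrable_of_forall_mul {w : ℝ × ℝ → ℂ}
    (h : ∀ F : ℝ × ℝ → ℂ, MemLp F 2 S.stripMeasure →
      Integrable (fun p => F p * w p) S.stripMeasure) : LocallyIntegrable w S.stripMeasure := by
  rw [locallyIntegrable_iff]
  intro k hk
  have h1 := h (k.indicator fun _ => 1)
    (memLp_indicator_const 2 hk.measurableSet 1 (Or.inr hk.measure_lt_top.ne))
  rw [← integrable_indicator_iff hk.measurableSet]
  refine h1.congr (Eventually.of_forall fun p => ?_)
  by_cases hp : p ∈ k <;> simp [hp]

/-- Tests with prescribed t-derivative −ζ turn the weak equation, boundary condition included, into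
y being the primitive of −iX that vanishes at t = −δ. -/
theorem WeakT.ae_eq_primitiveLeft {y X : S.StripL2} (H : WeakT S.δ y X) :
    ∀ᵐ p ∂S.stripMeasure, Complex.I * y p = primitiveLeft S X p := by
  have hδ := S.δ_pos
  have hl : LocallyIntegrable (fun p => Complex.I * y p - primitiveLeft S X p) S.stripMeasure := by
    refine locallyIntegrable_of_forall_mul fun F hF => ?_
    refine (((integrable_mul_of_memLp hF (Lp.memLp y)).const_mul Complex.I).sub
      (integrable_mul_primitiveLeft hF (Lp.memLp X))).congr (Eventually.of_forall fun p => ?_)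
    simp only [Pi.sub_apply]; ring
  have := strip_eq_zero_of_forall_test hl fun ζ h1 h2 h3 => ?_
  · filter_upwards [this] with p hp using sub_eq_zero.1 hp
  have hF := memLp_ofReal (S := S) h1.continuous h2
  have e1 : ∫ p, (ζ p : ℂ) * (Complex.I * y p - primitiveLeft S X p) ∂S.stripMeasure =
      Complex.I * pairing ζ y - ∫ p, (ζ p : ℂ) * primitiveLeft S X p ∂S.stripMeasure := by
    rw [pairing, ← integral_const_mul, ← integral_sub
      ((integrable_mul_of_memLp hF (Lp.memLp y)).const_mul Complex.I)
      (integrable_mul_primitiveLeft hF (Lp.memLp X))]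
    refine integral_congr_ae (Eventually.of_forall fun p => ?_)
    simp only; ring
  have e2 := H _ (isStripTest_slide (S := S) (Or.inr ⟨rfl, rfl⟩) h1 h2 h3)
  have e3 : pairing (fun p => fderiv ℝ (slide S 0 ζ) p (0, 1)) y = -pairing ζ y := by
    rw [pairing, pairing, ← integral_neg]
    refine integral_congr_ae ?_
    filter_upwards [S.ae_stripMeasure] with p hp
    rw [fderiv_slide 0 h1 h2, h3 (p.1, p.2 + 0 + 2 * S.δ) (fun h => by
      have := h.2; have := hp.1; simp only at *; linarith), add_zero]
    push_cast; ring
  have e4 : pairing (slide S 0 ζ) X = ∫ p, (ζ p : ℂ) * primitiveLeft S X p ∂S.stripMeasure := by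
    rw [integral_mul_primitiveLeft hF (Lp.memLp X)]
    refine integral_congr_ae ?_
    filter_upwards [S.ae_stripMeasure] with p hp
    rw [slide_eq_primitiveRight h3 hp, mul_comm]
  rw [e3, e4] at e2
  rw [e1]
  linear_combination -e2

theorem WeakT.ae_eq_primitiveRight {z B : S.StripL2} (H : WeakT (-S.δ) z B) :
    ∀ᵐ p ∂S.stripMeasure, Complex.I * z p = -primitiveRight S B p := by
  have hδ := S.δ_pos
  have hl : LocallyIntegrable (fun p => Complex.I * z p + primitiveRight S B p) S.stripMeasure := by
    refine locallyIntegrable_of_forall_mul fun F hF => ?_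
    refine (((integrable_mul_of_memLp hF (Lp.memLp z)).const_mul Complex.I).add
      (integrable_mul_primitiveRight (Lp.memLp B) hF)).congr (Eventually.of_forall fun p => ?_)
    simp only [Pi.add_apply]; ring
  have := strip_eq_zero_of_forall_test hl fun ζ h1 h2 h3 => ?_
  · filter_upwards [this] with p hp using eq_neg_of_add_eq_zero_left hp
  have hF := memLp_ofReal (S := S) h1.continuous h2
  have e1 : ∫ p, (ζ p : ℂ) * (Complex.I * z p + primitiveRight S B p) ∂S.stripMeasure =
      Complex.I * pairing ζ z + ∫ p, (ζ p : ℂ) * primitiveRight S B p ∂S.stripMeasure := by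
    rw [pairing, ← integral_const_mul, ← integral_add
      ((integrable_mul_of_memLp hF (Lp.memLp z)).const_mul Complex.I)
      (integrable_mul_primitiveRight (Lp.memLp B) hF)]
    refine integral_congr_ae (Eventually.of_forall fun p => ?_)
    simp only; ring
  have e2 := H _ (isStripTest_slide (S := S) (Or.inl ⟨rfl, rfl⟩) h1 h2 h3)
  have e3 : pairing (fun p => fderiv ℝ (slide S (-(2 * S.δ)) ζ) p (0, 1)) z = pairing ζ z := by
    rw [pairing, pairing]
    refine integral_congr_ae ?_
    filter_upwards [S.ae_stripMeasure] with p hp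
    rw [fderiv_slide _ h1 h2, h3 (p.1, p.2 + -(2 * S.δ)) (fun h => by
      have := h.1; have := hp.2; simp only at *; linarith), neg_add_cancel_right, sub_zero]
  have e4 : pairing (slide S (-(2 * S.δ)) ζ) B =
      ∫ p, (ζ p : ℂ) * primitiveRight S B p ∂S.stripMeasure := by
    rw [← integral_mul_primitiveLeft (Lp.memLp B) hF]
    refine integral_congr_ae ?_
    filter_upwards [S.ae_stripMeasure] with p hp
    rw [slide_eq_primitiveLeft h3 hp, mul_comm]
  rw [e3, e4] at e2
  rw [e1, e2]

/-- Integration by parts in the transverse variable. -/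
theorem WeakT.inner_eq {y X z B : S.StripL2} (H : WeakT S.δ y X) (H' : WeakT (-S.δ) z B) :
    ⟪z, X⟫_ℂ = ⟪B, y⟫_ℂ := by
  have hB : MemLp (fun p => conj (B p)) 2 S.stripMeasure := MemLp_conj (Lp.memLp B)
  have h1 : ⟪z, X⟫_ℂ = -Complex.I * ∫ p, X p * primitiveRight S (fun p => conj (B p)) p
      ∂S.stripMeasure := by
    rw [inner_Lp_eq, ← integral_const_mul]
    refine integral_congr_ae ?_
    filter_upwards [H'.ae_eq_primitiveRight] with p hp
    have e1 : conj (primitiveRight S B p) = primitiveRight S (fun p => conj (B p)) p := by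
      rw [primitiveRight, ← integral_conj, primitiveRight]
      refine integral_congr_ae (Eventually.of_forall fun t => ?_)
      simp only [apply_ite conj, map_zero]
    have e2 := congrArg conj hp
    rw [map_neg, e1, map_mul, Complex.conj_I] at e2
    linear_combination Complex.I * X p * e2 + (conj (z p)) * X p * (Complex.I_sq)
  have h2 : ⟪B, y⟫_ℂ = -Complex.I * ∫ p, conj (B p) * primitiveLeft S X p ∂S.stripMeasure := by
    rw [inner_Lp_eq, ← integral_const_mul]
    refine integral_congr_ae ?_
    filter_upwards [H.ae_eq_primitiveLeft] with p hp
    rw [← hp]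
    linear_combination (conj (B p)) * y p * (Complex.I_sq)
  -- The two functions vanish on opposite sides, so integration by parts in t leaves no boundary
  -- term: it is the transposition of the two primitives.
  rw [h1, h2, integral_mul_primitiveLeft hB (Lp.memLp X)]

end CurvedStrip

namespace CurvedStrip

variable {S : CurvedStrip}

/-! ### The energy identity for the weak system -/

theorem hasCompactSupport_curv : HasCompactSupport S.curv := S.curvature_compact

variable (S) in
-- κ'' is bounded because it has compact support, so the first-order Taylor error is uniform in s.
-- Uniformity makes the commutator below converge in L² norm.
theorem exists_curv_taylor_bound : ∃ M, ∀ s a : ℝ, 0 < a →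
    |(S.curv (s + a) - S.curv s) / a - deriv S.curv s| ≤ M * a := by
  have hc1 : ContDiff ℝ 1 (deriv S.curv) := by
    have h2 : ContDiff ℝ (1 + 1) S.curv := S.contDiff_curv.of_le (by norm_cast)
    exact (contDiff_succ_iff_deriv.1 h2).2.2
  have hk : HasCompactSupport (deriv (deriv S.curv)) := hasCompactSupport_curv.deriv.deriv
  obtain ⟨M, hM⟩ := hk.exists_bound_of_continuous (hc1.continuous_deriv le_rfl)
  have hM0 : 0 ≤ M := (norm_nonneg _).trans (hM 0)
  have hlip : ∀ x y : ℝ, ‖deriv S.curv y - deriv S.curv x‖ ≤ M * ‖y - x‖ := fun x y =>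
    convex_univ.norm_image_sub_le_of_norm_deriv_le
      (fun z _ => hc1.differentiable (by simp) z) (fun z _ => hM z) (mem_univ x) (mem_univ y)
  have hdiff : Differentiable ℝ S.curv := S.contDiff_curv.differentiable (by simp)
  refine ⟨M, fun s a ha => ?_⟩
  have h1 := (convex_Icc s (s + a)).norm_image_sub_le_of_norm_hasDerivWithin_le
    (f := fun x => S.curv x - x * deriv S.curv s) (f' := fun x => deriv S.curv x - deriv S.curv s)
    (C := M * a) (fun x _ => by
      have h := ((hdiff x).hasDerivAt.sub ((hasDerivAt_id x).mul_const (deriv S.curv s)))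
      rw [one_mul] at h
      exact h.hasDerivWithinAt) (fun x hx => (hlip s x).trans (by
        refine mul_le_mul_of_nonneg_left ?_ hM0
        rw [Real.norm_eq_abs, abs_of_nonneg (by linarith [hx.1])]
        linarith [hx.2])) (left_mem_Icc.2 (by linarith)) (right_mem_Icc.2 (by linarith))
  rw [add_sub_cancel_left, Real.norm_eq_abs, Real.norm_eq_abs, abs_of_pos ha] at h1
  have h2 : (S.curv (s + a) - S.curv s) / a - deriv S.curv s =
      (S.curv (s + a) - (s + a) * deriv S.curv s - (S.curv s - s * deriv S.curv s)) / a := by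
    field_simp; ring
  rw [h2, abs_div, abs_of_pos ha]
  exact div_le_of_le_mul₀ ha.le (by positivity) h1

theorem isBddMultiplier_of_snd_mul {k : ℝ → ℝ} (hk : Continuous k) {C : ℝ} (hC : ∀ s, |k s| ≤ C) :
    IsBddMultiplier S fun p => p.2 * k p.1 := by
  refine ⟨(continuous_snd.mul (hk.comp continuous_fst)).measurable, S.δ * C, ?_⟩
  filter_upwards [abs_snd_le] with p hp
  rw [abs_mul]
  exact mul_le_mul hp (hC _) (abs_nonneg _) S.δ_pos.le

variable (S) in
/-- Multiplication by `t κ'(s)`. -/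
theorem isBddMultiplier_derivCurv : IsBddMultiplier S fun p => p.2 * deriv S.curv p.1 := by
  have hc : Continuous (deriv S.curv) := S.contDiff_curv.continuous_deriv (by simp)
  obtain ⟨C, hC⟩ := (hasCompactSupport_curv (S := S)).deriv.exists_bound_of_continuous hc
  exact isBddMultiplier_of_snd_mul hc hC

theorem tendsto_translate (f : S.StripL2) : Tendsto (fun a => translate a f) (𝓝[>] 0) (𝓝 f) := by
  have := (continuous_translate f).tendsto 0
  rw [translate_zero] at this
  exact this.mono_left nhdsWithin_le_nhds

/-- The commutator of the difference quotient with the multiplication by the Jacobian. -/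
theorem tendsto_commutator (f : S.StripL2) :
    Tendsto (fun a => mulOp S.isBddMultiplier_jac (diffQuot a f) -
      diffQuot a (mulOp S.isBddMultiplier_jac f)) (𝓝[>] 0)
      (𝓝 (mulOp S.isBddMultiplier_derivCurv f)) := by
  obtain ⟨M, hM⟩ := S.exists_curv_taylor_bound
  have h1 : Tendsto (fun a : ℝ => S.δ * (M * a) * ‖f‖) (𝓝[>] 0) (𝓝 0) := by
    have : Tendsto (fun a : ℝ => S.δ * (M * a) * ‖f‖) (𝓝 0) (𝓝 (S.δ * (M * 0) * ‖f‖)) :=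
      Continuous.tendsto (by fun_prop) 0
    simpa using this.mono_left nhdsWithin_le_nhds
  have h2 : Tendsto (fun a => mulOp S.isBddMultiplier_derivCurv (translate a f)) (𝓝[>] 0)
      (𝓝 (mulOp S.isBddMultiplier_derivCurv f)) :=
    ((mulOp S.isBddMultiplier_derivCurv).continuous.tendsto f).comp (tendsto_translate f)
  rw [← sub_zero (mulOp S.isBddMultiplier_derivCurv f)]
  refine (h2.sub (squeeze_zero_norm' ?_ h1 : Tendsto (fun a =>
    mulOp S.isBddMultiplier_derivCurv (translate a f) -
      (mulOp S.isBddMultiplier_jac (diffQuot a f) -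
      diffQuot a (mulOp S.isBddMultiplier_jac f))) (𝓝[>] 0) (𝓝 0))).congr fun a => by abel
  filter_upwards [self_mem_nhdsWithin] with a ha
  have ha : 0 < a := ha
  rw [← LinearIsometry.norm_map (translate a) f]
  refine Lp.norm_le_mul_norm_of_ae_le_mul ?_
  rw [diffQuot, diffQuot]
  set τf := translate a f
  set Jf := mulOp S.isBddMultiplier_jac f
  filter_upwards [abs_snd_le (S := S), coeFn_mulOp S.isBddMultiplier_derivCurv τf,
    coeFn_mulOp S.isBddMultiplier_jac ((a : ℂ)⁻¹ • (τf - f)), Lp.coeFn_smul (a : ℂ)⁻¹ (τf - f),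
    Lp.coeFn_sub τf f, Lp.coeFn_smul (a : ℂ)⁻¹ (translate a Jf - Jf),
    Lp.coeFn_sub (translate a Jf) Jf, coeFn_translate a Jf, coeFn_mulOp S.isBddMultiplier_jac f,
    (measurePreserving_shift a).quasiMeasurePreserving.ae (coeFn_mulOp S.isBddMultiplier_jac f),
    Lp.coeFn_sub (mulOp S.isBddMultiplier_derivCurv τf)
      (mulOp S.isBddMultiplier_jac ((a : ℂ)⁻¹ • (τf - f)) - (a : ℂ)⁻¹ • (translate a Jf - Jf)),
    Lp.coeFn_sub (mulOp S.isBddMultiplier_jac ((a : ℂ)⁻¹ • (τf - f)))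
      ((a : ℂ)⁻¹ • (translate a Jf - Jf)), coeFn_translate a f]
    with p g0 g1 g2 g3 g4 g5 g6 g7 g8 g9 g10 g11 g12
  simp only [Pi.sub_apply, Pi.smul_apply, smul_eq_mul] at *
  rw [g10, g11, g1, g2, g3, g4, g5, g6, g7, g8, g9, g12]
  have ha' : (a : ℂ) ≠ 0 := Complex.ofReal_ne_zero.2 ha.ne'
  have e1 : ((p.2 * deriv S.curv p.1 : ℝ) : ℂ) * f (p.1 + a, p.2) -
      ((S.jac p.1 p.2 : ℂ) * ((a : ℂ)⁻¹ * (f (p.1 + a, p.2) - f p)) -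
      (a : ℂ)⁻¹ * ((S.jac (p.1 + a) p.2 : ℂ) * f (p.1 + a, p.2) - (S.jac p.1 p.2 : ℂ) * f p)) =
      (-(p.2 * ((S.curv (p.1 + a) - S.curv p.1) / a - deriv S.curv p.1)) : ℝ) *
        f (p.1 + a, p.2) := by
    simp only [jac]
    push_cast
    field_simp
    ring
  rw [e1, norm_mul, Complex.norm_real, norm_neg, norm_mul]
  exact mul_le_mul_of_nonneg_right (mul_le_mul g0 (hM _ a ha) (abs_nonneg _) S.δ_pos.le)
    (norm_nonneg _)

/-- J times the quotient of P is the quotient of JP plus a commutator. The quotient of JP is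
invisible to the real part against the average of JP; the commutator tends to multiplication by tκ'.
-/
theorem tendsto_re_inner_avg (P X : S.StripL2) :
    Tendsto (fun a => (⟪avg a (mulOp S.isBddMultiplier_jac P),
      mulOp S.isBddMultiplier_jac (avg a X - diffQuot a P)⟫_ℂ).re) (𝓝[>] 0)
      (𝓝 (⟪mulOp S.isBddMultiplier_jac P, mulOp S.isBddMultiplier_jac X -
        mulOp S.isBddMultiplier_derivCurv P⟫_ℂ).re) := by
  set J := mulOp S.isBddMultiplier_jac
  have h1 : Tendsto (fun a => avg a (J P)) (𝓝[>] 0) (𝓝 (J P)) := tendsto_avg _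
  have h2 : Tendsto (fun a => J (avg a X)) (𝓝[>] 0) (𝓝 (J X)) :=
    (J.continuous.tendsto X).comp (tendsto_avg X)
  have h3 := (Complex.continuous_re.tendsto _).comp (h1.inner (h2.sub (tendsto_commutator P)))
  refine h3.congr fun a => ?_
  have h4 := re_inner_avg_diffQuot a (J P)
  simp only [Function.comp_apply]
  rw [show J (avg a X - diffQuot a P) = (J (avg a X) - (J (diffQuot a P) - diffQuot a (J P))) -
    diffQuot a (J P) by rw [map_sub]; abel, inner_sub_right _ _ (diffQuot a (J P)),
    Complex.sub_re, h4, sub_zero]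

/-- Formally one pairs the first equation with J²P and the second with J²Q and takes the difference
of the real parts. The ∂_s terms leave only commutators, and the ∂_t terms combine by parts, JP and
JQ vanishing on opposite sides; the κ term records ∂_t J. -/
theorem WeakST.energy {P Q X Y : S.StripL2}
    (H : WeakST S.δ P (mulOp S.isBddMultiplier_jac Q) X)
    (H' : WeakST (-S.δ) Q (mulOp S.isBddMultiplier_jac P) Y) :
    (⟪mulOp S.isBddMultiplier_jac P, mulOp S.isBddMultiplier_jac X -
        mulOp S.isBddMultiplier_derivCurv P⟫_ℂ).re -
      (⟪mulOp S.isBddMultiplier_jac Q, mulOp S.isBddMultiplier_jac Y -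
        mulOp S.isBddMultiplier_derivCurv Q⟫_ℂ).re =
      (Complex.I * ⟪mulOp S.isBddMultiplier_jac P,
        mulOp S.isBddMultiplier_curv (mulOp S.isBddMultiplier_jac Q)⟫_ℂ).re := by
  have h1 := tendsto_re_inner_avg P X
  have h2 := tendsto_re_inner_avg Q Y
  set J := mulOp S.isBddMultiplier_jac
  set K := mulOp S.isBddMultiplier_curv
  have h3 : Tendsto (fun a => (Complex.I * ⟪CurvedStrip.avg a (J P), K (CurvedStrip.avg a (J Q))⟫_ℂ).re) (𝓝[>] 0)
      (𝓝 (Complex.I * ⟪J P, K (J Q)⟫_ℂ).re) :=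
    (Complex.continuous_re.tendsto _).comp (((tendsto_avg (J P)).inner
      ((K.continuous.tendsto _).comp (tendsto_avg (J Q)))).const_mul Complex.I)
  refine tendsto_nhds_unique (h1.sub h2) (h3.congr fun a => ?_)
  -- The multiplication by J is carried out in the first equation only; in the second it is moved
  -- across the inner product, where it is symmetric.
  have h4 := (H.avg a).mul_jac.inner_eq (H'.avg a)
  have h5 : ⟪CurvedStrip.avg a Y - diffQuot a Q, J (CurvedStrip.avg a (J Q))⟫_ℂ =
      conj ⟪CurvedStrip.avg a (J Q), J (CurvedStrip.avg a Y - diffQuot a Q)⟫_ℂ := by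
    rw [inner_conj_symm, inner_mulOp]
  rw [inner_sub_right, inner_smul_right, h5] at h4
  have h6 := congrArg Complex.re h4
  rw [Complex.sub_re, Complex.conj_re] at h6
  linarith

end CurvedStrip

namespace CurvedStrip

variable {S : CurvedStrip}

/-! ### The adjoint of the smooth realisation in the coordinates of the strip -/

/-- `d_A F` for a smooth function `F`. -/
noncomputable def dSmooth (P : S.Potential) (h : ℝ) (F : ℂ → ℂ) (z : ℂ) : ℂ :=
  -(Complex.I * h) * (fderiv ℝ F z 1 - Complex.I * fderiv ℝ F z Complex.I) +
    conj (P.coef z) * F z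

/-- `d_A^× F` for a smooth function `F`. -/
noncomputable def dTimesSmooth (P : S.Potential) (h : ℝ) (F : ℂ → ℂ) (z : ℂ) : ℂ :=
  -(Complex.I * h) * (fderiv ℝ F z 1 + Complex.I * fderiv ℝ F z Complex.I) + P.coef z * F z

/-- `χ` is the image of `ψ` under the adjoint of the restriction of `D_h` to smooth functions. -/
def IsAdjointPair (P : S.Potential) (h : ℝ) (ψ χ : S.Spinor) : Prop :=
  ∀ F₁ F₂ : ℂ → ℂ, ContDiff ℝ ∞ F₁ → HasCompactSupport F₁ → ContDiff ℝ ∞ F₂ →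
    HasCompactSupport F₂ → S.SmoothBC F₁ F₂ →
    ∫ z in S.Ω, (conj (dSmooth P h F₂ z) * ψ.fst z + conj (dTimesSmooth P h F₁ z) * ψ.snd z -
      (conj (F₁ z) * χ.fst z + conj (F₂ z) * χ.snd z)) = 0

/-- F is known only on the image of the closed strip, so its derivative is read off from its
restrictions to the coordinate lines through an interior point. -/
theorem fderiv_of_tube_eq {F : ℂ → ℂ} {Φ : ℝ × ℝ → ℂ} (hF : ContDiff ℝ ∞ F)
    (hΦ : ∀ p ∈ S.closedStrip, F (S.tube p) = Φ p) {p : ℝ × ℝ} (hp : p.2 ∈ Ioo (-S.δ) S.δ)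
    {a b : ℂ} (ha : HasDerivAt (fun x => Φ (x, p.2)) a p.1)
    (hb : HasDerivAt (fun x => Φ (p.1, x)) b p.2) :
    S.jac p.1 p.2 * fderiv ℝ F (S.tube p) (S.tangent p.1) = a ∧
      fderiv ℝ F (S.tube p) (Complex.I * S.tangent p.1) = b := by
  constructor
  · refine (S.hasDerivAt_comp_tube_left hF p.1 p.2).unique
      (ha.congr_of_eventuallyEq (Eventually.of_forall fun x => ?_))
    exact hΦ _ (S.mem_closedStrip.2 (abs_le.2 ⟨hp.1.le, hp.2.le⟩))
  · refine (S.hasDerivAt_comp_tube_right hF p.1 p.2).unique (hb.congr_of_eventuallyEq ?_)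
    filter_upwards [Ioo_mem_nhds hp.1 hp.2] with x hx
    exact hΦ _ (S.mem_closedStrip.2 (abs_le.2 ⟨hx.1.le, hx.2.le⟩))

/-- The combination `ψ₁ + σ γ'⁻¹ ψ₂` in the coordinates of the strip. -/
noncomputable def mixed (ψ : S.Spinor) (σ : ℝ) (p : ℝ × ℝ) : ℂ :=
  ψ.fst (S.tube p) + σ * (conj (S.tangent p.1) * ψ.snd (S.tube p))

/-- The right-hand side of the weak equation for `mixed ψ σ`. -/
noncomputable def mixedSource (P : S.Potential) (h : ℝ) (ψ χ : S.Spinor) (σ : ℝ)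
    (p : ℝ × ℝ) : ℂ :=
  Complex.I / h * (conj (S.tangent p.1) * (χ.snd (S.tube p) - P.coef (S.tube p) * ψ.fst (S.tube p))
      + σ * (χ.fst (S.tube p) - conj (P.coef (S.tube p)) * ψ.snd (S.tube p))) +
    (-(Complex.I * σ)) * (((S.curv p.1 * (S.jac p.1 p.2)⁻¹ : ℝ) : ℂ) *
      (conj (S.tangent p.1) * ψ.snd (S.tube p))) +
    ((p.2 * deriv S.curv p.1 * (S.jac p.1 p.2)⁻¹ * (S.jac p.1 p.2)⁻¹ : ℝ) : ℂ) * mixed ψ σ p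

theorem IsBddMultiplier.mul {b b' : ℝ × ℝ → ℝ} (hb : IsBddMultiplier S b)
    (hb' : IsBddMultiplier S b') : IsBddMultiplier S fun p => b p * b' p := by
  obtain ⟨C, hC⟩ := hb.2
  obtain ⟨C', hC'⟩ := hb'.2
  refine ⟨hb.1.mul hb'.1, C * C', ?_⟩
  filter_upwards [hC, hC'] with p h1 h2
  rw [abs_mul]
  exact mul_le_mul h1 h2 (abs_nonneg _) ((abs_nonneg _).trans h1)

variable (S) in
theorem isBddMultiplier_jac_inv : IsBddMultiplier S fun p => (S.jac p.1 p.2)⁻¹ := by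
  obtain ⟨c, hc, hcj⟩ := S.exists_le_jac
  refine ⟨S.continuous_jac.measurable.inv, c⁻¹, ?_⟩
  filter_upwards [abs_snd_le] with p hp
  rw [abs_inv, abs_of_pos (S.jac_pos hp)]
  exact inv_anti₀ hc (hcj _ _ hp)

theorem memLp_conj_tangent_mul {f : ℝ × ℝ → ℂ} (hf : MemLp f 2 S.stripMeasure) :
    MemLp (fun p => conj (S.tangent p.1) * f p) 2 S.stripMeasure := by
  refine hf.of_le ?_ (Eventually.of_forall fun p => ?_)
  · exact (Complex.continuous_conj.comp
      (S.continuous_tangent.comp continuous_fst)).aestronglyMeasurable.mul hf.1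
  · rw [norm_mul, RCLike.norm_conj, S.norm_tangent, one_mul]

theorem memLp_tube (f : S.L2) : MemLp (fun p => f (S.tube p)) 2 S.stripMeasure :=
  S.memLp_comp_tube (Lp.memLp f)

theorem memLp_mixed (ψ : S.Spinor) (σ : ℝ) : MemLp (mixed ψ σ) 2 S.stripMeasure :=
  (memLp_tube ψ.fst).add ((memLp_conj_tangent_mul (memLp_tube ψ.snd)).const_mul _)

theorem memLp_conj_coef_mul (P : S.Potential) {f : ℂ → ℂ}
    (hf : MemLp f 2 (volume.restrict S.Ω)) :
    MemLp (fun z => conj (P.coef z) * f z) 2 (volume.restrict S.Ω) := by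
  refine (P.memLp_coef_mul hf).of_le ?_ (Eventually.of_forall fun p => ?_)
  · exact (Complex.continuous_conj.comp P.continuous_coef).aestronglyMeasurable.mul hf.1
  · rw [norm_mul, norm_mul, RCLike.norm_conj]

theorem memLp_mixedSource (P : S.Potential) (h : ℝ) (ψ χ : S.Spinor) (σ : ℝ) :
    MemLp (mixedSource P h ψ χ σ) 2 S.stripMeasure := by
  have m1 : MemLp (fun p => χ.snd (S.tube p) - P.coef (S.tube p) * ψ.fst (S.tube p)) 2
      S.stripMeasure :=
    (memLp_tube χ.snd).sub (S.memLp_comp_tube (P.memLp_coef_mul (Lp.memLp ψ.fst)))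
  have m2 : MemLp (fun p => χ.fst (S.tube p) - conj (P.coef (S.tube p)) * ψ.snd (S.tube p)) 2
      S.stripMeasure :=
    (memLp_tube χ.fst).sub (S.memLp_comp_tube (memLp_conj_coef_mul P (Lp.memLp ψ.snd)))
  have m3 := (S.isBddMultiplier_curv.mul S.isBddMultiplier_jac_inv).memLp
    (memLp_conj_tangent_mul (memLp_tube ψ.snd))
  have m4 := ((S.isBddMultiplier_derivCurv.mul S.isBddMultiplier_jac_inv).mul
    S.isBddMultiplier_jac_inv).memLp (memLp_mixed ψ σ)
  exact ((((memLp_conj_tangent_mul m1).add (m2.const_mul (σ : ℂ))).const_mul _).add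
    (m3.const_mul _)).add m4

theorem hasDerivAt_div_jac {π : ℝ × ℝ → ℝ} (hπ : ContDiff ℝ ∞ π) {p : ℝ × ℝ}
    (hp : |p.2| ≤ S.δ) :
    HasDerivAt (fun x => π (x, p.2) / S.jac x p.2)
      ((fderiv ℝ π p (1, 0) * S.jac p.1 p.2 + π p * (p.2 * deriv S.curv p.1)) / S.jac p.1 p.2 ^ 2)
      p.1 ∧
    HasDerivAt (fun x => π (p.1, x) / S.jac p.1 x)
      ((fderiv ℝ π p (0, 1) * S.jac p.1 p.2 + π p * S.curv p.1) / S.jac p.1 p.2 ^ 2) p.2 := by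
  have hj := (S.jac_pos (s := p.1) hp).ne'
  have hπd := (hπ.differentiable (by simp) p).hasFDerivAt
  constructor
  · have h1 : HasDerivAt (fun x => π (x, p.2)) (fderiv ℝ π p (1, 0)) p.1 :=
      hπd.comp_hasDerivAt p.1 ((hasDerivAt_id p.1).prodMk (hasDerivAt_const p.1 p.2))
    have h2 : HasDerivAt (fun x => S.jac x p.2) (-(p.2 * deriv S.curv p.1)) p.1 :=
      (((S.contDiff_curv.differentiable (by simp) p.1).hasDerivAt).const_mul p.2).const_sub 1
    exact (h1.div h2 hj).congr_deriv (by ring)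
  · have h1 : HasDerivAt (fun x => π (p.1, x)) (fderiv ℝ π p (0, 1)) p.2 :=
      hπd.comp_hasDerivAt p.2 ((hasDerivAt_const p.2 p.1).prodMk (hasDerivAt_id p.2))
    have h2 : HasDerivAt (fun x => S.jac p.1 x) (-S.curv p.1) p.2 := by
      have := ((hasDerivAt_id p.2).mul_const (S.curv p.1)).const_sub 1
      simpa [jac] using this
    exact (h1.div h2 hj).congr_deriv (by ring)

/-- The choice F₁ = σπ/J, F₂ = γ'π/J gives π_t coefficient 1 after multiplication by J, so the
unknown under ∂_t carries no weight, while the one under ∂_s carries J⁻¹. For F₂ the rotation of γ'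
cancels the derivative of 1/J in t; for F₁ that derivative remains, and with the s-derivative of 1/J
it gives the curvature terms of `mixedSource`. -/
theorem adjointPair_integrand {P : S.Potential} {h : ℝ} (hh : h ≠ 0) (ψ χ : S.Spinor) {σ : ℝ}
    {π : ℝ × ℝ → ℝ} (hπ : ContDiff ℝ ∞ π) {F₁ F₂ : ℂ → ℂ} (hF₁ : ContDiff ℝ ∞ F₁)
    (hF₂ : ContDiff ℝ ∞ F₂)
    (e₁ : ∀ p ∈ S.closedStrip, F₁ (S.tube p) = σ * ((π p / S.jac p.1 p.2 : ℝ) : ℂ))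
    (e₂ : ∀ p ∈ S.closedStrip, F₂ (S.tube p) =
      S.tangent p.1 * ((π p / S.jac p.1 p.2 : ℝ) : ℂ))
    {p : ℝ × ℝ} (hp : p.2 ∈ Ioo (-S.δ) S.δ) :
    (S.jac p.1 p.2 : ℂ) * (conj (dSmooth P h F₂ (S.tube p)) * ψ.fst (S.tube p) +
      conj (dTimesSmooth P h F₁ (S.tube p)) * ψ.snd (S.tube p) -
      (conj (F₁ (S.tube p)) * χ.fst (S.tube p) + conj (F₂ (S.tube p)) * χ.snd (S.tube p))) =
    (Complex.I * h) * ((fderiv ℝ π p (1, 0) : ℂ) * (((S.jac p.1 p.2)⁻¹ : ℝ) * mixed ψ σ p) +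
      (Complex.I * ((fderiv ℝ π p (0, 1) : ℂ) * mixed ψ (-σ) p) +
        (π p : ℂ) * mixedSource P h ψ χ σ p)) := by
  have hp' : |p.2| ≤ S.δ := abs_le.2 ⟨hp.1.le, hp.2.le⟩
  have hpc : p ∈ S.closedStrip := S.mem_closedStrip.2 hp'
  have hj : (S.jac p.1 p.2 : ℂ) ≠ 0 := Complex.ofReal_ne_zero.2 (S.jac_pos (s := p.1) hp').ne'
  have hh' : (h : ℂ) ≠ 0 := Complex.ofReal_ne_zero.2 hh
  obtain ⟨ds, dt⟩ := hasDerivAt_div_jac (S := S) hπ hp'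
  have dsC := ds.ofReal_comp
  have dtC := dt.ofReal_comp
  obtain ⟨a1, a2⟩ := fderiv_of_tube_eq hF₁ e₁ hp (dsC.const_mul (σ : ℂ)) (dtC.const_mul (σ : ℂ))
  obtain ⟨b1, b2⟩ := fderiv_of_tube_eq hF₂ e₂ hp ((S.hasDerivAt_tangent p.1).mul dsC)
    (dtC.const_mul (S.tangent p.1))
  have c1 := clm_dbar_rotate (fderiv ℝ F₁ (S.tube p)) (S.tangent p.1)
  have c2 := clm_d_rotate (fderiv ℝ F₂ (S.tube p)) (S.tangent p.1)
  have hT := S.tangent_mul_conj p.1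
  have d1 : (S.jac p.1 p.2 : ℂ) * (fderiv ℝ F₁ (S.tube p) 1 +
      Complex.I * fderiv ℝ F₁ (S.tube p) Complex.I) = S.tangent p.1 * (σ *
        (((fderiv ℝ π p (1, 0) / S.jac p.1 p.2 + π p * (p.2 * deriv S.curv p.1) /
          S.jac p.1 p.2 ^ 2 : ℝ) : ℂ) + Complex.I *
        ((fderiv ℝ π p (0, 1) + π p * S.curv p.1 / S.jac p.1 p.2 : ℝ) : ℂ))) := by
    have : fderiv ℝ F₁ (S.tube p) 1 + Complex.I * fderiv ℝ F₁ (S.tube p) Complex.I =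
        S.tangent p.1 * (fderiv ℝ F₁ (S.tube p) (S.tangent p.1) +
          Complex.I * fderiv ℝ F₁ (S.tube p) (Complex.I * S.tangent p.1)) := by
      rw [c1, ← mul_assoc, hT, one_mul]
    rw [this, mul_left_comm, mul_add, a1, a2]
    push_cast
    field_simp
  have d2 : (S.jac p.1 p.2 : ℂ) * (fderiv ℝ F₂ (S.tube p) 1 -
      Complex.I * fderiv ℝ F₂ (S.tube p) Complex.I) =
        ((fderiv ℝ π p (1, 0) / S.jac p.1 p.2 + π p * (p.2 * deriv S.curv p.1) /
          S.jac p.1 p.2 ^ 2 : ℝ) : ℂ) - Complex.I * (fderiv ℝ π p (0, 1) : ℂ) := by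
    have : fderiv ℝ F₂ (S.tube p) 1 - Complex.I * fderiv ℝ F₂ (S.tube p) Complex.I =
        conj (S.tangent p.1) * (fderiv ℝ F₂ (S.tube p) (S.tangent p.1) -
          Complex.I * fderiv ℝ F₂ (S.tube p) (Complex.I * S.tangent p.1)) := by
      rw [c2, ← mul_assoc, mul_comm (conj _), hT, one_mul]
    rw [this, mul_left_comm, mul_sub, b1, b2]
    have : (((fderiv ℝ π p (1, 0) * S.jac p.1 p.2 + π p * (p.2 * deriv S.curv p.1)) /
        S.jac p.1 p.2 ^ 2 : ℝ) : ℂ) - Complex.I * ((fderiv ℝ π p (0, 1) : ℂ)) +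
        Complex.I * S.curv p.1 * ((π p / S.jac p.1 p.2 : ℝ) : ℂ) - Complex.I *
        S.curv p.1 * ((π p / S.jac p.1 p.2 : ℝ) : ℂ) = ((fderiv ℝ π p (1, 0) / S.jac p.1 p.2 + π p * (p.2 * deriv S.curv p.1) /
          S.jac p.1 p.2 ^ 2 : ℝ) : ℂ) - Complex.I * (fderiv ℝ π p (0, 1) : ℂ) := by
      push_cast
      field_simp
      ring
    rw [← this]
    push_cast
    field_simp
    linear_combination ((fderiv ℝ π p (1, 0) : ℂ) * S.jac p.1 p.2 + π p * (p.2 * (deriv S.curv p.1 : ℝ)) - Complex.I * (fderiv ℝ π p (0, 1) : ℂ) * (S.jac p.1 p.2) ^ 2) * hT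
  have d1' := congrArg conj d1
  have d2' := congrArg conj d2
  simp only [map_add, map_mul, map_sub, Complex.conj_I, Complex.conj_ofReal] at d1' d2'
  rw [dSmooth, dTimesSmooth, e₁ p hpc, e₂ p hpc, mixedSource, mixed, mixed]
  simp only [map_add, map_mul, map_neg, map_sub, Complex.conj_I, Complex.conj_ofReal,
    Complex.conj_conj]
  generalize conj (S.tangent p.1) = T at *
  have hI : Complex.I / h * (Complex.I * h) = -1 := by
    rw [div_mul_eq_mul_div, ← mul_assoc, Complex.I_mul_I]
    field_simp
  push_cast at d1' d2' ⊢
  simp only [div_eq_mul_inv] at d1' d2' hI ⊢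
  have hn : (S.jac p.1 p.2 : ℂ) * (S.jac p.1 p.2 : ℂ)⁻¹ = 1 := mul_inv_cancel₀ hj
  linear_combination (Complex.I * h * ψ.fst (S.tube p)) * d2' +
    (Complex.I * h * ψ.snd (S.tube p)) * d1' -
    (π p * (T * (χ.snd (S.tube p) - P.coef (S.tube p) * ψ.fst (S.tube p)) +
      σ * (χ.fst (S.tube p) - conj (P.coef (S.tube p)) * ψ.snd (S.tube p)))) * (hn + hI)

theorem contDiffOn_div_jac {π : ℝ × ℝ → ℝ} (hπ : ContDiff ℝ ∞ π) :
    ContDiffOn ℝ ∞ (fun p => ((π p / S.jac p.1 p.2 : ℝ) : ℂ)) {p | S.jac p.1 p.2 ≠ 0} :=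
  Complex.ofRealCLM.contDiff.comp_contDiffOn
    (hπ.contDiffOn.div S.contDiff_jac.contDiffOn fun _ hp => hp)

/-- The ratio F₂/F₁ = σγ' already satisfies the boundary condition on t = −σδ; on t = σδ the sign is
wrong, and both functions must vanish there. -/
theorem exists_test_pair {σ : ℝ} (hσ : σ = 1 ∨ σ = -1) {π : ℝ × ℝ → ℝ}
    (hπ : IsStripTest (σ * S.δ) π) :
    ∃ F₁ F₂ : ℂ → ℂ, ContDiff ℝ ∞ F₁ ∧ HasCompactSupport F₁ ∧ ContDiff ℝ ∞ F₂ ∧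
      HasCompactSupport F₂ ∧ S.SmoothBC F₁ F₂ ∧
      (∀ p ∈ S.closedStrip, F₁ (S.tube p) = σ * ((π p / S.jac p.1 p.2 : ℝ) : ℂ)) ∧
      ∀ p ∈ S.closedStrip, F₂ (S.tube p) = S.tangent p.1 * ((π p / S.jac p.1 p.2 : ℝ) : ℂ) := by
  have hW : IsOpen {p : ℝ × ℝ | S.jac p.1 p.2 ≠ 0} := isOpen_ne_fun S.continuous_jac continuous_const
  have hSW : S.closedStrip ⊆ {p : ℝ × ℝ | S.jac p.1 p.2 ≠ 0} := fun p hp =>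
    (S.jac_pos (S.mem_closedStrip.1 hp)).ne'
  obtain ⟨X, hX⟩ : ∃ X : ℝ, tsupport π ⊆ Metric.closedBall 0 X :=
    hπ.compact.isBounded.subset_closedBall 0
  have h0 : ∀ p : ℝ × ℝ, X < |p.1| → π p = 0 := by
    intro p hp
    by_contra h
    have h1 := hX (subset_tsupport _ h)
    rw [mem_closedBall_zero_iff, Prod.norm_def, max_le_iff] at h1
    exact absurd h1.1 (not_le.2 hp)
  have hV := contDiffOn_div_jac (S := S) hπ.smooth
  obtain ⟨F₁, s1, k1, e1⟩ := S.exists_extension hW hSW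
    (contDiffOn_const (c := (σ : ℂ)) |>.mul hV) X (fun p _ hp => by simp [h0 p hp])
  obtain ⟨F₂, s2, k2, e2⟩ := S.exists_extension hW hSW
    ((S.contDiff_tangent.comp contDiff_fst).contDiffOn.mul hV) X (fun p _ hp => by simp [h0 p hp])
  refine ⟨F₁, F₂, s1, k1, s2, k2, fun s => ?_, e1, e2⟩
  have m1 : (s, S.δ) ∈ S.closedStrip := S.mem_closedStrip.2 S.abs_δ
  have m2 : (s, -S.δ) ∈ S.closedStrip := S.mem_closedStrip.2 S.abs_neg_δ
  rw [e1 _ m1, e2 _ m1, e1 _ m2, e2 _ m2]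
  have hz := hπ.zero s
  rcases hσ with rfl | rfl
  · rw [one_mul] at hz
    simp [hz]
  · rw [neg_one_mul] at hz
    simp [hz]

/-- These test pairs separate the adjoint equation into two scalar ones. For σ = 1 the unknown under
∂_t is ψ₁ − conj(γ')ψ₂, weakly zero on t = −δ; for σ = −1 it is ψ₁ + conj(γ')ψ₂, weakly zero on t =
δ. These zeros are the infinite mass condition. -/
theorem IsAdjointPair.weakST {P : S.Potential} {h : ℝ} (hh : h ≠ 0) {ψ χ : S.Spinor}
    (H : IsAdjointPair P h ψ χ) {σ : ℝ} (hσ : σ = 1 ∨ σ = -1) :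
    WeakST (S := S) (σ * S.δ) ((S.isBddMultiplier_jac_inv.memLp (memLp_mixed ψ σ)).toLp _)
      ((memLp_mixed ψ (-σ)).toLp _) ((memLp_mixedSource P h ψ χ σ).toLp _) := by
  intro π hπ
  obtain ⟨F₁, F₂, s1, k1, s2, k2, bc, e1, e2⟩ := exists_test_pair hσ hπ
  have h1 := H F₁ F₂ s1 k1 s2 k2 bc
  have hcs := P.continuous_coef
  have hm : AEStronglyMeasurable (fun z => conj (dSmooth P h F₂ z) * ψ.fst z +
      conj (dTimesSmooth P h F₁ z) * ψ.snd z - (conj (F₁ z) * χ.fst z + conj (F₂ z) * χ.snd z))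
      (volume.restrict S.Ω) := by
    have d1 : Continuous (fderiv ℝ F₁) := s1.continuous_fderiv (by simp)
    have d2 : Continuous (fderiv ℝ F₂) := s2.continuous_fderiv (by simp)
    have c1 := s1.continuous
    have c2 := s2.continuous
    have g1 : Continuous fun z => conj (dSmooth P h F₂ z) := by unfold dSmooth; fun_prop
    have g2 : Continuous fun z => conj (dTimesSmooth P h F₁ z) := by unfold dTimesSmooth; fun_prop
    have g3 : Continuous fun z => conj (F₁ z) := by fun_prop
    have g4 : Continuous fun z => conj (F₂ z) := by fun_prop
    exact ((g1.aestronglyMeasurable.mul (Lp.aestronglyMeasurable _)).add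
      (g2.aestronglyMeasurable.mul (Lp.aestronglyMeasurable _))).sub
      ((g3.aestronglyMeasurable.mul (Lp.aestronglyMeasurable _)).add
      (g4.aestronglyMeasurable.mul (Lp.aestronglyMeasurable _)))
  rw [S.integral_Ω hm] at h1
  have c0 := hπ.smooth.continuous
  have i1 := integrable_pairing (hπ.continuous_fderiv (1, 0)) (hπ.compact_fderiv (1, 0))
    ((S.isBddMultiplier_jac_inv.memLp (memLp_mixed ψ σ)).toLp _)
  have i2 := (integrable_pairing (hπ.continuous_fderiv (0, 1)) (hπ.compact_fderiv (0, 1))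
    ((memLp_mixed ψ (-σ)).toLp _)).const_mul Complex.I
  have i3 := integrable_pairing c0 hπ.compact ((memLp_mixedSource P h ψ χ σ).toLp _)
  have hIh : (Complex.I * h : ℂ) ≠ 0 := mul_ne_zero Complex.I_ne_zero (Complex.ofReal_ne_zero.2 hh)
  rw [pairing, pairing, pairing, ← integral_const_mul, ← integral_add i2 i3]
  refine (integral_add i1 (i2.add i3)).symm.trans ?_
  refine (mul_eq_zero.1 ?_).resolve_left hIh
  rw [← integral_const_mul, ← h1]
  refine integral_congr_ae ?_
  filter_upwards [S.ae_stripMeasure,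
    (S.isBddMultiplier_jac_inv.memLp (memLp_mixed ψ σ)).coeFn_toLp,
    (memLp_mixed ψ (-σ)).coeFn_toLp, (memLp_mixedSource P h ψ χ σ).coeFn_toLp] with p hp g1 g2 g3
  rw [adjointPair_integrand hh ψ χ hπ.smooth s1 s2 e1 e2 hp]
  simp only [Pi.add_apply, g1, g2, g3]


theorem mulOp_jac_toLp {f : ℝ × ℝ → ℂ} (hf : MemLp f 2 S.stripMeasure) :
    mulOp S.isBddMultiplier_jac ((S.isBddMultiplier_jac_inv.memLp hf).toLp _) = hf.toLp _ := by
  apply Lp.ext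
  filter_upwards [coeFn_mulOp S.isBddMultiplier_jac ((S.isBddMultiplier_jac_inv.memLp hf).toLp _),
    (S.isBddMultiplier_jac_inv.memLp hf).coeFn_toLp, hf.coeFn_toLp, abs_snd_le (S := S)]
    with p h1 h2 h3 h4
  rw [h1, h2, h3, ← mul_assoc, ← Complex.ofReal_mul, mul_inv_cancel₀ (S.jac_pos h4).ne',
    Complex.ofReal_one, one_mul]

theorem re_inner_eq_integral {α : Type*} [MeasurableSpace α] {μ : Measure α} (f g : Lp ℂ 2 μ) :
    Integrable (fun x => conj (f x) * g x) μ ∧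
      (⟪f, g⟫_ℂ).re = ∫ x, (conj (f x) * g x).re ∂μ := by
  have h1 : Integrable (fun x => conj (f x) * g x) μ :=
    integrable_mul_of_memLp (MemLp_conj (Lp.memLp f)) (Lp.memLp g)
  refine ⟨h1, ?_⟩
  rw [inner_Lp_eq]
  exact (integral_re h1).symm

/-- The pointwise identity behind the symmetry of the adjoint. -/
theorem re_energy_density {n h k d : ℝ} (hn : n ≠ 0) {T c a b x y : ℂ}
    (hT : conj T * T = 1) :
    (conj (a + (1 : ℝ) * (conj T * b)) * (n * (Complex.I / h * (conj T * (y - c * a) + (1 : ℝ) *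
        (x - conj c * b)) + (-(Complex.I * (1 : ℝ))) * (((k * n⁻¹ : ℝ) : ℂ) * (conj T * b)) +
        ((d * n⁻¹ * n⁻¹ : ℝ) : ℂ) * (a + (1 : ℝ) * (conj T * b))) -
        (d : ℂ) * ((n⁻¹ : ℝ) * (a + (1 : ℝ) * (conj T * b))))).re -
      (conj (a + (-1 : ℝ) * (conj T * b)) * (n * (Complex.I / h * (conj T * (y - c * a) + (-1 : ℝ) *
        (x - conj c * b)) + (-(Complex.I * (-1 : ℝ))) * (((k * n⁻¹ : ℝ) : ℂ) * (conj T * b)) +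
        ((d * n⁻¹ * n⁻¹ : ℝ) : ℂ) * (a + (-1 : ℝ) * (conj T * b))) -
        (d : ℂ) * ((n⁻¹ : ℝ) * (a + (-1 : ℝ) * (conj T * b))))).re -
      (Complex.I * (conj (a + (1 : ℝ) * (conj T * b)) *
        (k * (a + (-1 : ℝ) * (conj T * b))))).re = -(2 / h) * (n * (conj a * x + conj b * y).im) := by
  have hn' : (n : ℂ) * (n : ℂ)⁻¹ = 1 := mul_inv_cancel₀ (Complex.ofReal_ne_zero.2 hn)
  -- The magnetic coefficient and the curvature enter only through this real quantity, multiplied by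
  -- i, and so drop out of the real part.
  set r : ℂ := 2 * n / h * (conj b * c * a + b * conj c * conj a) + k * (a * conj a - b * conj b) +
    k * (conj a * (conj T * b) + a * (T * conj b)) with hr
  have hr0 : r.im = 0 := by
    rw [← Complex.conj_eq_iff_im, hr]
    simp only [map_add, map_mul, map_sub, map_div₀, Complex.conj_ofReal, Complex.conj_conj, map_ofNat]
    ring
  rw [← Complex.sub_re, ← Complex.sub_re]
  have key : ∀ W : ℂ, W = Complex.I * ((2 * n / h : ℝ) * (conj a * x + conj b * y) - r) →
      W.re = -(2 / h) * (n * (conj a * x + conj b * y).im) := by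
    rintro W rfl
    rw [Complex.I_mul_re, Complex.sub_im, hr0, Complex.im_ofReal_mul]
    ring
  apply key
  rw [hr]
  simp only [map_add, map_mul, Complex.conj_ofReal, Complex.conj_conj]
  push_cast
  linear_combination ((conj a + T * conj b) * (-Complex.I * k * (conj T * b) +
      d * (n : ℂ)⁻¹ * (a + conj T * b)) - (conj a - T * conj b) * (Complex.I * k * (conj T * b) +
      d * (n : ℂ)⁻¹ * (a - conj T * b))) * hn' +
    (2 * Complex.I / h * n * conj b * (y - c * a) + Complex.I * k * b * conj b) * hT

/-! ### Reality of the quadratic form of the adjoint -/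

/-- In the energy identity for the two mixed components all lower-order terms cancel pointwise, and
what is left is −2/h times the imaginary part of the density of ⟨ψ, χ⟩, with weight J. -/
theorem IsAdjointPair.im_inner {P : S.Potential} {h : ℝ} (hh : h ≠ 0) {ψ χ : S.Spinor}
    (H : IsAdjointPair P h ψ χ) : (⟪ψ, χ⟫_ℂ).im = 0 := by
  have w1 := H.weakST hh (.inl rfl : (1 : ℝ) = 1 ∨ (1 : ℝ) = -1)
  have w2 := H.weakST hh (.inr rfl : (-1 : ℝ) = 1 ∨ (-1 : ℝ) = -1)
  rw [one_mul, ← mulOp_jac_toLp (memLp_mixed ψ (-1))] at w1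
  rw [neg_one_mul, ← mulOp_jac_toLp (memLp_mixed ψ (- -1))] at w2
  simp only [neg_neg] at w2
  have e := w1.energy w2
  rw [mulOp_jac_toLp (memLp_mixed ψ 1), mulOp_jac_toLp (memLp_mixed ψ (-1))] at e
  set p := (memLp_mixed ψ 1).toLp (mixed ψ 1) with hp
  set q := (memLp_mixed ψ (-1)).toLp (mixed ψ (-1)) with hq
  set Pm := (S.isBddMultiplier_jac_inv.memLp (memLp_mixed ψ 1)).toLp _ with hPm
  set Qm := (S.isBddMultiplier_jac_inv.memLp (memLp_mixed ψ (-1))).toLp _ with hQm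
  set X := (memLp_mixedSource P h ψ χ 1).toLp _ with hX
  set Y := (memLp_mixedSource P h ψ χ (-1)).toLp _ with hY
  set J := mulOp S.isBddMultiplier_jac with hJ
  set D := mulOp S.isBddMultiplier_derivCurv with hD
  set K := mulOp S.isBddMultiplier_curv with hK
  obtain ⟨i1, e1⟩ := re_inner_eq_integral p (J X - D Pm)
  obtain ⟨i2, e2⟩ := re_inner_eq_integral q (J Y - D Qm)
  obtain ⟨i3, e3⟩ := re_inner_eq_integral p (K q)
  have e3' : (Complex.I * ⟪p, K q⟫_ℂ).re =
      ∫ z, (Complex.I * (conj (p z) * K q z)).re ∂S.stripMeasure := by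
    rw [inner_Lp_eq, ← integral_const_mul]
    exact (integral_re (i3.const_mul Complex.I)).symm
  rw [e1, e2, e3', ← sub_eq_zero] at e
  have e4 : ∫ z, -(2 / h) * (S.jac z.1 z.2 * (conj (ψ.fst (S.tube z)) * χ.fst (S.tube z) +
      conj (ψ.snd (S.tube z)) * χ.snd (S.tube z)).im) ∂S.stripMeasure = 0 := by
    rw [← e]
    refine Eq.trans ?_ ((integral_sub (i1.re.sub i2.re) (i3.const_mul Complex.I).re).trans
      (congrArg (fun x => x - _) (integral_sub i1.re i2.re)))
    refine integral_congr_ae ?_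
    filter_upwards [abs_snd_le (S := S), (memLp_mixed ψ 1).coeFn_toLp,
      (memLp_mixed ψ (-1)).coeFn_toLp,
      (S.isBddMultiplier_jac_inv.memLp (memLp_mixed ψ 1)).coeFn_toLp,
      (S.isBddMultiplier_jac_inv.memLp (memLp_mixed ψ (-1))).coeFn_toLp,
      (memLp_mixedSource P h ψ χ 1).coeFn_toLp, (memLp_mixedSource P h ψ χ (-1)).coeFn_toLp,
      coeFn_mulOp S.isBddMultiplier_jac X, coeFn_mulOp S.isBddMultiplier_jac Y,
      coeFn_mulOp S.isBddMultiplier_derivCurv Pm, coeFn_mulOp S.isBddMultiplier_derivCurv Qm,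
      coeFn_mulOp S.isBddMultiplier_curv q, Lp.coeFn_sub (J X) (D Pm), Lp.coeFn_sub (J Y) (D Qm)]
      with z h0 h1 h2 h3 h4 h5 h6 h7 h8 h9 h10 h11 h12 h13
    have key := re_energy_density (h := h) (k := S.curv z.1) (d := z.2 * deriv S.curv z.1)
      (S.jac_pos (s := z.1) h0).ne' (S.conj_mul_tangent z.1) (c := P.coef (S.tube z))
      (a := ψ.fst (S.tube z)) (b := ψ.snd (S.tube z)) (x := χ.fst (S.tube z))
      (y := χ.snd (S.tube z))
    rw [← key]
    change p z = _ at h1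
    change q z = _ at h2
    change Pm z = _ at h3
    change Qm z = _ at h4
    change X z = _ at h5
    change Y z = _ at h6
    change J X z = _ at h7
    change J Y z = _ at h8
    change D Pm z = _ at h9
    change D Qm z = _ at h10
    change K q z = _ at h11
    simp only [Pi.sub_apply, h1, h2, h3, h4, h5, h6, h7, h8, h9, h10, h11, h12, h13]
    rfl
  rw [integral_const_mul, mul_eq_zero] at e4
  have e5 := e4.resolve_left (neg_ne_zero.2 (div_ne_zero two_ne_zero hh))
  have j1 := (re_inner_eq_integral ψ.fst χ.fst).1
  have j2 := (re_inner_eq_integral ψ.snd χ.snd).1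
  have e6 : ⟪ψ, χ⟫_ℂ = ∫ z in S.Ω, (conj (ψ.fst z) * χ.fst z + conj (ψ.snd z) * χ.snd z) := by
    rw [integral_add j1 j2, ← inner_Lp_eq, ← inner_Lp_eq, WithLp.prod_inner_apply]
    rfl
  have e7 : (⟪ψ, χ⟫_ℂ).im =
      ∫ z in S.Ω, (conj (ψ.fst z) * χ.fst z + conj (ψ.snd z) * χ.snd z).im := by
    rw [e6]
    exact (integral_im (j1.add j2)).symm
  rw [e7]
  exact (S.integral_Ω_smul (Complex.continuous_im.comp_aestronglyMeasurable (j1.add j2).1)).trans e5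

end CurvedStrip

namespace CurvedStrip

variable {S : CurvedStrip}

/-! ### The adjoint of a relation with real quadratic form -/

/-- If the adjoint of a linear relation has a real quadratic form, then it is contained in the
closure of the relation. -/
theorem mem_closure_of_adjoint_real {E : Type*} [NormedAddCommGroup E] [InnerProductSpace ℂ E]
    [CompleteSpace E] (K : Submodule ℂ (WithLp 2 (E × E)))
    (hK : ∀ ψ χ : E, (∀ y ∈ K, ⟪y.snd, ψ⟫_ℂ = ⟪y.fst, χ⟫_ℂ) → (⟪ψ, χ⟫_ℂ).im = 0) {ψ χ : E}
    (hx : ∀ y ∈ K, ⟪y.snd, ψ⟫_ℂ = ⟪y.fst, χ⟫_ℂ) : WithLp.toLp 2 (ψ, χ) ∈ K.topologicalClosure := by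
  rw [← Submodule.orthogonal_orthogonal_eq_closure, Submodule.mem_orthogonal]
  intro w hw
  rw [Submodule.mem_orthogonal] at hw
  -- Orthogonality of w to the graph says that (w₂, −w₁) also belongs to the adjoint relation.
  have hw' : ∀ y ∈ K, ⟪y.snd, w.snd⟫_ℂ = ⟪y.fst, -w.fst⟫_ℂ := by
    intro y hy
    have h1 := hw y hy
    rw [WithLp.prod_inner_apply] at h1
    rw [inner_neg_right]
    exact eq_neg_of_add_eq_zero_right h1
  -- Polarisation: reality of the form at ψ + w₂ and at ψ + i w₂ kills the imaginary and the real
  -- part of the pairing of w with (ψ, χ).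
  have h1 := hK (ψ + w.snd) (χ + -w.fst) fun y hy => by
    rw [inner_add_right, inner_add_right, hx y hy, hw' y hy]
  have h2 := hK (ψ + Complex.I • w.snd) (χ + Complex.I • -w.fst) fun y hy => by
    rw [inner_add_right, inner_add_right, inner_smul_right, inner_smul_right, hx y hy, hw' y hy]
  have h3 := hK ψ χ hx
  have h4 := hK _ _ hw'
  simp only [inner_add_left, inner_add_right, inner_smul_left, inner_smul_right, inner_neg_right,
    Complex.conj_I] at h1 h2 h3 h4
  have e1 : (⟪ψ, w.fst⟫_ℂ).re = (⟪w.fst, ψ⟫_ℂ).re := by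
    rw [← inner_conj_symm, Complex.conj_re]
  have e2 : (⟪ψ, w.fst⟫_ℂ).im = -(⟪w.fst, ψ⟫_ℂ).im := by
    rw [← inner_conj_symm, Complex.conj_im]
  rw [WithLp.prod_inner_apply]
  change ⟪w.fst, ψ⟫_ℂ + ⟪w.snd, χ⟫_ℂ = 0
  apply Complex.ext
  · simp at h1 h2 h3 h4 ⊢
    linarith
  · simp at h1 h2 h3 h4 ⊢
    linarith

/-! ### The smooth core -/

/-- `x = ((F₁, F₂), D_h (F₁, F₂))` for smooth functions with the infinite mass condition. -/
structure CoreRel (P : S.Potential) (h : ℝ) (F₁ F₂ : ℂ → ℂ)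
    (x : WithLp 2 (S.Spinor × S.Spinor)) : Prop where
  smooth₁ : ContDiff ℝ ∞ F₁
  compact₁ : HasCompactSupport F₁
  smooth₂ : ContDiff ℝ ∞ F₂
  compact₂ : HasCompactSupport F₂
  bc : S.SmoothBC F₁ F₂
  fst_fst : x.fst.fst =ᵐ[volume.restrict S.Ω] F₁
  fst_snd : x.fst.snd =ᵐ[volume.restrict S.Ω] F₂
  snd_fst : x.snd.fst =ᵐ[volume.restrict S.Ω] dSmooth P h F₂
  snd_snd : x.snd.snd =ᵐ[volume.restrict S.Ω] dTimesSmooth P h F₁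

theorem fderiv_add_smul {F G : ℂ → ℂ} (hF : ContDiff ℝ ∞ F) (hG : ContDiff ℝ ∞ G) (k : ℂ)
    (z e : ℂ) : fderiv ℝ (fun z => F z + k * G z) z e = fderiv ℝ F z e + k * fderiv ℝ G z e := by
  have h1 := (hF.differentiable (by simp) z).hasFDerivAt.add
    ((hG.differentiable (by simp) z).hasFDerivAt.const_mul k)
  have h2 : fderiv ℝ (fun z => F z + k * G z) z = _ := h1.fderiv
  rw [h2]
  simp

theorem CoreRel.add_smul {P : S.Potential} {h : ℝ} {F₁ F₂ G₁ G₂ : ℂ → ℂ}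
    {x y : WithLp 2 (S.Spinor × S.Spinor)} (hx : CoreRel P h F₁ F₂ x) (hy : CoreRel P h G₁ G₂ y)
    (k : ℂ) : CoreRel P h (fun z => F₁ z + k * G₁ z) (fun z => F₂ z + k * G₂ z) (x + k • y) := by
  have key : ∀ {a b : S.L2} {f g : ℂ → ℂ}, a =ᵐ[volume.restrict S.Ω] f →
      b =ᵐ[volume.restrict S.Ω] g →
      (a + k • b : S.L2) =ᵐ[volume.restrict S.Ω] fun z => f z + k * g z := by
    intro a b f g ha hb
    filter_upwards [ha, hb, Lp.coeFn_add a (k • b), Lp.coeFn_smul k b] with z h1 h2 h3 h4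
    rw [h3, Pi.add_apply, h4, Pi.smul_apply, h1, h2, smul_eq_mul]
  refine ⟨hx.smooth₁.add (contDiff_const.mul hy.smooth₁), hx.compact₁.add hy.compact₁.mul_left,
    hx.smooth₂.add (contDiff_const.mul hy.smooth₂), hx.compact₂.add hy.compact₂.mul_left,
    fun s => ?_, key hx.fst_fst hy.fst_fst, key hx.fst_snd hy.fst_snd, ?_, ?_⟩
  · simp only [(hx.bc s).1, (hx.bc s).2, (hy.bc s).1, (hy.bc s).2]
    constructor <;> ring
  · refine (key hx.snd_fst hy.snd_fst).trans (Eventually.of_forall fun z => ?_)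
    simp only [dSmooth, fderiv_add_smul hx.smooth₂ hy.smooth₂]
    ring
  · refine (key hx.snd_snd hy.snd_snd).trans (Eventually.of_forall fun z => ?_)
    simp only [dTimesSmooth, fderiv_add_smul hx.smooth₁ hy.smooth₁]
    ring

theorem coreRel_zero (P : S.Potential) (h : ℝ) : CoreRel P h (fun _ => 0) (fun _ => 0) 0 := by
  have z0 := Lp.coeFn_zero ℂ 2 (volume.restrict S.Ω)
  refine ⟨contDiff_const, HasCompactSupport.zero, contDiff_const, HasCompactSupport.zero,
    fun s => by simp, z0, z0, ?_, ?_⟩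
  · exact z0.trans (Eventually.of_forall fun z => by simp [dSmooth])
  · exact z0.trans (Eventually.of_forall fun z => by simp [dTimesSmooth])

/-- The graph of the restriction of `D_h` to smooth functions. -/
noncomputable def coreGraph (P : S.Potential) (h : ℝ) :
    Submodule ℂ (WithLp 2 (S.Spinor × S.Spinor)) where
  carrier := {x | ∃ F₁ F₂, CoreRel P h F₁ F₂ x}
  add_mem' := by
    rintro x y ⟨F₁, F₂, hx⟩ ⟨G₁, G₂, hy⟩
    have := hx.add_smul hy 1
    rw [one_smul] at this
    exact ⟨_, _, this⟩
  zero_mem' := ⟨_, _, coreRel_zero P h⟩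
  smul_mem' := by
    rintro k x ⟨F₁, F₂, hx⟩
    have := (coreRel_zero P h).add_smul hx k
    rw [zero_add] at this
    exact ⟨_, _, this⟩

theorem continuous_dSmooth (P : S.Potential) (h : ℝ) {F : ℂ → ℂ} (hF : ContDiff ℝ ∞ F) :
    Continuous (dSmooth P h F) := by
  have d1 : Continuous (fderiv ℝ F) := hF.continuous_fderiv (by simp)
  have c1 := hF.continuous
  have := P.continuous_coef
  unfold dSmooth; fun_prop

theorem continuous_dTimesSmooth (P : S.Potential) (h : ℝ) {F : ℂ → ℂ} (hF : ContDiff ℝ ∞ F) :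
    Continuous (dTimesSmooth P h F) := by
  have d1 : Continuous (fderiv ℝ F) := hF.continuous_fderiv (by simp)
  have c1 := hF.continuous
  have := P.continuous_coef
  unfold dTimesSmooth; fun_prop

theorem hasCompactSupport_dSmooth (P : S.Potential) (h : ℝ) {F : ℂ → ℂ}
    (hc : HasCompactSupport F) : HasCompactSupport (dSmooth P h F) := by
  refine hc.mono' fun z hz => ?_
  by_contra h1
  refine hz ?_
  have h2 : fderiv ℝ F z = 0 := by
    by_contra h3
    exact h1 (support_fderiv_subset ℝ h3)
  simp [dSmooth, h2, image_eq_zero_of_notMem_tsupport h1]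

theorem hasCompactSupport_dTimesSmooth (P : S.Potential) (h : ℝ) {F : ℂ → ℂ}
    (hc : HasCompactSupport F) : HasCompactSupport (dTimesSmooth P h F) := by
  refine hc.mono' fun z hz => ?_
  by_contra h1
  refine hz ?_
  have h2 : fderiv ℝ F z = 0 := by
    by_contra h3
    exact h1 (support_fderiv_subset ℝ h3)
  simp [dTimesSmooth, h2, image_eq_zero_of_notMem_tsupport h1]

theorem exists_coreRel (P : S.Potential) (h : ℝ) {F₁ F₂ : ℂ → ℂ} (s1 : ContDiff ℝ ∞ F₁)
    (k1 : HasCompactSupport F₁) (s2 : ContDiff ℝ ∞ F₂) (k2 : HasCompactSupport F₂)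
    (bc : S.SmoothBC F₁ F₂) : ∃ x, CoreRel P h F₁ F₂ x := by
  have m1 := memLp_smooth (S := S) (continuous_dSmooth P h s2) (hasCompactSupport_dSmooth P h k2)
  have m2 := memLp_smooth (S := S) (continuous_dTimesSmooth P h s1)
    (hasCompactSupport_dTimesSmooth P h k1)
  exact ⟨WithLp.toLp 2 (WithLp.toLp 2 (smoothL2 s1 k1, smoothL2 s2 k2),
    WithLp.toLp 2 (m1.toLp _, m2.toLp _)), s1, k1, s2, k2, bc, coeFn_smoothL2 s1 k1,
    coeFn_smoothL2 s2 k2, m1.coeFn_toLp, m2.coeFn_toLp⟩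

theorem isAdjointPair_iff {P : S.Potential} {h : ℝ} {ψ χ : S.Spinor} :
    IsAdjointPair P h ψ χ ↔ ∀ y ∈ coreGraph P h, ⟪y.snd, ψ⟫_ℂ = ⟪y.fst, χ⟫_ℂ := by
  have key : ∀ {F₁ F₂ : ℂ → ℂ} {y : WithLp 2 (S.Spinor × S.Spinor)}, CoreRel P h F₁ F₂ y →
      ∫ z in S.Ω, (conj (dSmooth P h F₂ z) * ψ.fst z + conj (dTimesSmooth P h F₁ z) * ψ.snd z -
      (conj (F₁ z) * χ.fst z + conj (F₂ z) * χ.snd z)) = ⟪y.snd, ψ⟫_ℂ - ⟪y.fst, χ⟫_ℂ := by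
    intro F₁ F₂ y hy
    have j1 := (re_inner_eq_integral y.snd.fst ψ.fst).1
    have j2 := (re_inner_eq_integral y.snd.snd ψ.snd).1
    have j3 := (re_inner_eq_integral y.fst.fst χ.fst).1
    have j4 := (re_inner_eq_integral y.fst.snd χ.snd).1
    have e1 : ⟪y.snd, ψ⟫_ℂ - ⟪y.fst, χ⟫_ℂ = _ :=
      (congrArg₂ (· - ·) (integral_add j1 j2) (integral_add j3 j4)).symm.trans ((integral_sub
        (j1.add j2) (j3.add j4)).symm) |> Eq.trans (by
          rw [← inner_Lp_eq, ← inner_Lp_eq, ← inner_Lp_eq, ← inner_Lp_eq,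
            WithLp.prod_inner_apply, WithLp.prod_inner_apply]; rfl)
    rw [e1]
    refine integral_congr_ae ?_
    filter_upwards [hy.fst_fst, hy.fst_snd, hy.snd_fst, hy.snd_snd] with z h1 h2 h3 h4
    simp only [Pi.add_apply, h1, h2, h3, h4]
  constructor
  · rintro H y ⟨F₁, F₂, hy⟩
    rw [← sub_eq_zero, ← key hy]
    exact H F₁ F₂ hy.smooth₁ hy.compact₁ hy.smooth₂ hy.compact₂ hy.bc
  · intro H F₁ F₂ s1 k1 s2 k2 bc
    obtain ⟨y, hy⟩ := exists_coreRel P h s1 k1 s2 k2 bc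
    rw [key hy, H y ⟨_, _, hy⟩, sub_self]

theorem IsAdjointPair.mem_closure {P : S.Potential} {h : ℝ} (hh : h ≠ 0) {ψ χ : S.Spinor}
    (H : IsAdjointPair P h ψ χ) : WithLp.toLp 2 (ψ, χ) ∈ (coreGraph P h).topologicalClosure :=
  mem_closure_of_adjoint_real _ (fun _ _ h1 => (isAdjointPair_iff.2 h1).im_inner hh)
    (isAdjointPair_iff.1 H)

end CurvedStrip

namespace CurvedStrip

variable {S : CurvedStrip}

/-! ### The closure of the smooth core -/

theorem norm_sq_Lp {α : Type*} [MeasurableSpace α] {μ : Measure α} (f : Lp ℂ 2 μ) :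
    ‖f‖ ^ 2 = ∫ x, ‖f x‖ ^ 2 ∂μ := by
  have h1 := (re_inner_eq_integral f f).2
  rw [inner_self_eq_norm_sq_to_K] at h1
  have h2 : ((((‖f‖ : ℝ) : ℂ)) ^ 2).re = ‖f‖ ^ 2 := by
    rw [← Complex.ofReal_pow, Complex.ofReal_re]
  rw [← h2]
  refine h1.trans (integral_congr_ae (Eventually.of_forall fun x => ?_))
  simp only
  rw [mul_comm, Complex.mul_conj, Complex.normSq_eq_norm_sq, Complex.ofReal_re]

theorem integrable_norm_sq {α : Type*} [MeasurableSpace α] {μ : Measure α} (f : Lp ℂ 2 μ) :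
    Integrable (fun x => ‖f x‖ ^ 2) μ :=
  (memLp_two_iff_integrable_sq_norm (Lp.aestronglyMeasurable f)).1 (Lp.memLp f)

theorem sqΩ_eq_norm_sq {F : ℂ → ℂ} {f : S.L2} (hf : f =ᵐ[volume.restrict S.Ω] F) :
    S.sqΩ F = ‖f‖ ^ 2 := by
  rw [norm_sq_Lp, sqΩ]
  refine integral_congr_ae ?_
  filter_upwards [hf] with z hz
  rw [hz]

theorem sqΩ_le_of_norm_le {F : ℂ → ℂ} {a b : S.L2} {C : ℝ}
    (hF : ∀ᵐ z ∂(volume.restrict S.Ω), ‖F z‖ ^ 2 ≤ C * (‖a z‖ ^ 2 + ‖b z‖ ^ 2)) :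
    S.sqΩ F ≤ C * (‖a‖ ^ 2 + ‖b‖ ^ 2) := by
  rw [norm_sq_Lp, norm_sq_Lp, ← integral_add (integrable_norm_sq a) (integrable_norm_sq b),
    ← integral_const_mul, sqΩ]
  exact integral_mono_of_nonneg (Eventually.of_forall fun z => sq_nonneg _)
    (((integrable_norm_sq a).add (integrable_norm_sq b)).const_mul C) hF

/-- The derivative part of d_A F is recovered by subtracting a bounded multiple of F and dividing by
h. -/
theorem norm_sq_le_of_eq {h C : ℝ} (hh : h ≠ 0) {D c f G : ℂ} (hc : ‖c‖ ≤ C)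
    (hG : G = -(Complex.I * h) * D + c * f) :
    ‖D‖ ^ 2 ≤ 2 / h ^ 2 * (1 + C ^ 2) * (‖G‖ ^ 2 + ‖f‖ ^ 2) := by
  have h1 : h * ‖D‖ ≤ |h| * ‖D‖ := mul_le_mul_of_nonneg_right (le_abs_self h) (norm_nonneg _)
  have h2 : |h| * ‖D‖ = ‖G - c * f‖ := by
    rw [hG, add_sub_cancel_right, norm_mul, norm_neg, norm_mul, Complex.norm_I, one_mul,
      Complex.norm_real, Real.norm_eq_abs]
  have h3 : ‖G - c * f‖ ≤ ‖G‖ + C * ‖f‖ := by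
    refine (norm_sub_le _ _).trans ?_
    rw [norm_mul]
    gcongr
  have hC : 0 ≤ C := (norm_nonneg _).trans hc
  have h4 : h ^ 2 * ‖D‖ ^ 2 ≤ 2 * (1 + C ^ 2) * (‖G‖ ^ 2 + ‖f‖ ^ 2) := by
    have h5 : h ^ 2 * ‖D‖ ^ 2 ≤ (‖G‖ + C * ‖f‖) ^ 2 := by
      rw [← sq_abs h, ← mul_pow, h2]
      exact pow_le_pow_left₀ (norm_nonneg _) h3 2
    nlinarith [sq_nonneg (‖G‖ - C * ‖f‖), sq_nonneg ‖G‖, mul_nonneg (sq_nonneg C) (sq_nonneg ‖G‖),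
      sq_nonneg ‖f‖]
  have hh2 : 0 < h ^ 2 := by positivity
  rw [div_mul_eq_mul_div, div_mul_eq_mul_div, le_div_iff₀ hh2]
  linarith

/-- The norms of the derivatives and of the boundary values are controlled by the graph norm. -/
theorem exists_core_bound (P : S.Potential) {h : ℝ} (hh : h ≠ 0) :
    ∃ C, 0 ≤ C ∧ ∀ (F₁ F₂ : ℂ → ℂ) (x : WithLp 2 (S.Spinor × S.Spinor))
      (hx : CoreRel P h F₁ F₂ x),
      (‖(smoothDeriv hx.smooth₁ hx.compact₁ 1 : S.L2)‖ ≤ C * ‖x‖ ∧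
      ‖(smoothDeriv hx.smooth₁ hx.compact₁ Complex.I : S.L2)‖ ≤ C * ‖x‖ ∧
      ‖(smoothTrace hx.smooth₁ hx.compact₁ : S.L2b)‖ ≤ C * ‖x‖) ∧
      (‖(smoothDeriv hx.smooth₂ hx.compact₂ 1 : S.L2)‖ ≤ C * ‖x‖ ∧
      ‖(smoothDeriv hx.smooth₂ hx.compact₂ Complex.I : S.L2)‖ ≤ C * ‖x‖ ∧
      ‖(smoothTrace hx.smooth₂ hx.compact₂ : S.L2b)‖ ≤ C * ‖x‖) := by
  obtain ⟨C₁, hC₁, hap⟩ := S.exists_apriori_estimate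
  obtain ⟨C₂, hC₂, htr⟩ := S.exists_trace_inequality
  obtain ⟨C₃, hC₃, hco⟩ := P.exists_norm_coef_le
  -- M removes the magnetic coefficient, A bounds both gradients through the a priori estimate, and
  -- B adds the trace inequality.
  set M := 2 / h ^ 2 * (1 + C₃ ^ 2) with hM
  have hM0 : 0 ≤ M := by positivity
  set A := C₁ * (1 + M) with hA
  have hA0 : 0 ≤ A := by positivity
  set B := A + C₂ * (1 + A) with hB
  have hB0 : 0 ≤ B := by positivity
  refine ⟨Real.sqrt B, Real.sqrt_nonneg _, fun F₁ F₂ x hx => ?_⟩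
  have hco' : ∀ᵐ z ∂(volume.restrict S.Ω), ‖P.coef z‖ ≤ C₃ := by
    filter_upwards [ae_restrict_mem S.isOpen_Ω.measurableSet] with z hz using hco z hz
  have n0 : ‖x‖ ^ 2 = ‖x.fst.fst‖ ^ 2 + ‖x.fst.snd‖ ^ 2 + (‖x.snd.fst‖ ^ 2 + ‖x.snd.snd‖ ^ 2) := by
    rw [WithLp.prod_norm_sq_eq_of_L2, WithLp.prod_norm_sq_eq_of_L2, WithLp.prod_norm_sq_eq_of_L2]
  have p1 := sq_nonneg ‖x.fst.fst‖
  have p2 := sq_nonneg ‖x.fst.snd‖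
  have p3 := sq_nonneg ‖x.snd.fst‖
  have p4 := sq_nonneg ‖x.snd.snd‖
  have g1 : S.sqΩ (fun z => fderiv ℝ F₁ z 1 + Complex.I * fderiv ℝ F₁ z Complex.I) ≤
      M * (‖x.snd.snd‖ ^ 2 + ‖x.fst.fst‖ ^ 2) := by
    refine sqΩ_le_of_norm_le ?_
    filter_upwards [hco', hx.snd_snd, hx.fst_fst] with z h1 h2 h3
    exact norm_sq_le_of_eq hh h1 (by rw [h2, h3]; rfl)
  have g2 : S.sqΩ (fun z => fderiv ℝ F₂ z 1 - Complex.I * fderiv ℝ F₂ z Complex.I) ≤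
      M * (‖x.snd.fst‖ ^ 2 + ‖x.fst.snd‖ ^ 2) := by
    refine sqΩ_le_of_norm_le ?_
    filter_upwards [hco', hx.snd_fst, hx.fst_snd] with z h1 h2 h3
    exact norm_sq_le_of_eq hh (c := conj (P.coef z)) (by rwa [RCLike.norm_conj])
      (by rw [h2, h3]; rfl)
  have g3 := hap F₁ F₂ hx.smooth₁ hx.compact₁ hx.smooth₂ hx.compact₂ hx.bc
  rw [sqΩ_eq_norm_sq hx.fst_fst] at g3
  have g4 : S.gradΩ F₁ + S.gradΩ F₂ ≤ A * ‖x‖ ^ 2 := by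
    refine g3.trans ?_
    rw [hA, mul_assoc]
    refine mul_le_mul_of_nonneg_left ?_ hC₁
    rw [n0]
    nlinarith
  have key : ∀ {F : ℂ → ℂ} (hF : ContDiff ℝ ∞ F) (hc : HasCompactSupport F),
      S.sqΩ F ≤ ‖x‖ ^ 2 → S.gradΩ F ≤ A * ‖x‖ ^ 2 →
      ‖(smoothDeriv hF hc 1 : S.L2)‖ ≤ Real.sqrt B * ‖x‖ ∧
      ‖(smoothDeriv hF hc Complex.I : S.L2)‖ ≤ Real.sqrt B * ‖x‖ ∧
      ‖(smoothTrace hF hc : S.L2b)‖ ≤ Real.sqrt B * ‖x‖ := by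
    intro F hF hc k1 k2
    have t1 : S.gradΩ F = ‖(smoothDeriv hF hc 1 : S.L2)‖ ^ 2 +
        ‖(smoothDeriv hF hc Complex.I : S.L2)‖ ^ 2 := by
      rw [gradΩ, sqΩ_eq_norm_sq (coeFn_smoothDeriv hF hc 1),
        sqΩ_eq_norm_sq (coeFn_smoothDeriv hF hc Complex.I)]
    have t2 : ‖(smoothTrace hF hc : S.L2b)‖ ^ 2 = ∫ z, ‖F z‖ ^ 2 ∂S.boundaryMeasure := by
      rw [norm_sq_Lp]
      refine integral_congr_ae ?_
      filter_upwards [coeFn_smoothTrace (S := S) hF hc] with z hz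
      rw [hz]
    have t3 := htr F hF hc
    have t4 : C₂ * (S.sqΩ F + S.gradΩ F) ≤ C₂ * (‖x‖ ^ 2 + A * ‖x‖ ^ 2) := by gcongr
    have t5 : 0 ≤ C₂ * (1 + A) * ‖x‖ ^ 2 := by positivity
    have t6 : 0 ≤ A * ‖x‖ ^ 2 := by positivity
    have q1 := sq_nonneg ‖(smoothDeriv hF hc 1 : S.L2)‖
    have q2 := sq_nonneg ‖(smoothDeriv hF hc Complex.I : S.L2)‖
    have fin : ∀ {r : ℝ}, r ^ 2 ≤ B * ‖x‖ ^ 2 → r ≤ Real.sqrt B * ‖x‖ := by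
      intro r hr
      refine le_of_sq_le_sq ?_ (by positivity)
      rwa [mul_pow, Real.sq_sqrt hB0]
    refine ⟨fin ?_, fin ?_, fin ?_⟩ <;> rw [hB] <;> nlinarith
  have a1 : S.gradΩ F₁ ≤ A * ‖x‖ ^ 2 := by
    have : 0 ≤ S.gradΩ F₂ := add_nonneg (integral_nonneg fun z => sq_nonneg _)
      (integral_nonneg fun z => sq_nonneg _)
    linarith
  have a2 : S.gradΩ F₂ ≤ A * ‖x‖ ^ 2 := by
    have : 0 ≤ S.gradΩ F₁ := add_nonneg (integral_nonneg fun z => sq_nonneg _)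
      (integral_nonneg fun z => sq_nonneg _)
    linarith
  exact ⟨key _ _ (by rw [sqΩ_eq_norm_sq hx.fst_fst, n0]; linarith) a1,
    key _ _ (by rw [sqΩ_eq_norm_sq hx.fst_snd, n0]; linarith) a2⟩

/-- Sequences dominated by a Cauchy sequence converge. -/
theorem exists_tendsto_of_norm_sub_le {E G : Type*} [NormedAddCommGroup E] [NormedAddCommGroup G]
    [CompleteSpace G] {x : ℕ → E} {x₀ : E} (hx : Tendsto x atTop (𝓝 x₀)) {y : ℕ → G} {C : ℝ}
    (hy : ∀ n m, ‖y n - y m‖ ≤ C * ‖x n - x m‖) : ∃ y₀, Tendsto y atTop (𝓝 y₀) := by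
  refine cauchySeq_tendsto_of_complete ?_
  have h1 := hx.cauchySeq
  rw [cauchySeq_iff_tendsto_dist_atTop_0] at h1 ⊢
  refine squeeze_zero (fun _ => dist_nonneg) (fun n => ?_) (by simpa using h1.const_mul C)
  rw [dist_eq_norm, dist_eq_norm]
  exact hy _ _

theorem tendsto_eLpNorm_sub {α : Type*} [MeasurableSpace α] {μ : Measure α} {y : ℕ → Lp ℂ 2 μ}
    {y₀ : Lp ℂ 2 μ} (hy : Tendsto y atTop (𝓝 y₀)) {F : ℕ → α → ℂ} (hF : ∀ n, y n =ᵐ[μ] F n) :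
    Tendsto (fun n => eLpNorm (fun z => F n z - y₀ z) 2 μ) atTop (𝓝 0) := by
  have h1 := (Lp.tendsto_Lp_iff_tendsto_eLpNorm' y y₀).1 hy
  refine h1.congr fun n => eLpNorm_congr_ae ?_
  filter_upwards [hF n] with z hz
  rw [Pi.sub_apply, hz]

theorem IsWeakDeriv.of_tendsto {e : ℂ} {u p : ℕ → S.L2} {u₀ p₀ : S.L2}
    (H : ∀ n, IsWeakDeriv e (u n) (p n)) (hu : Tendsto u atTop (𝓝 u₀))
    (hp : Tendsto p atTop (𝓝 p₀)) : IsWeakDeriv e u₀ p₀ := by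
  intro θ hθ
  have key : ∀ {η : ℂ → ℂ} (hη : MemLp η 2 (volume.restrict S.Ω)) {v : ℕ → S.L2} {v₀ : S.L2},
      Tendsto v atTop (𝓝 v₀) →
      Tendsto (fun n => ∫ z in S.Ω, η z * v n z) atTop (𝓝 (∫ z in S.Ω, η z * v₀ z)) := by
    intro η hη v v₀ hv
    have e1 : ∀ w : S.L2, ∫ z in S.Ω, η z * w z =
        ⟪((MemLp_conj hη).toLp _ : S.L2), w⟫_ℂ := by
      intro w
      rw [inner_Lp_eq]
      refine integral_congr_ae ?_
      filter_upwards [(MemLp_conj hη).coeFn_toLp] with z hz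
      rw [hz, Complex.conj_conj]
    simp_rw [e1]
    exact tendsto_const_nhds.inner hv
  have m1 : MemLp (fun z => (fderiv ℝ θ z e : ℂ)) 2 (volume.restrict S.Ω) := by
    refine (memLp_fderiv hθ.contDiff_ofReal hθ.hasCompactSupport_ofReal e _).ae_eq
      (Eventually.of_forall fun z => ?_)
    exact hθ.fderiv_ofReal z e
  have m2 : MemLp (fun z => (θ z : ℂ)) 2 (volume.restrict S.Ω) :=
    memLp_smooth hθ.contDiff_ofReal.continuous hθ.hasCompactSupport_ofReal
  exact tendsto_nhds_unique ((key m1 hu).congr fun n => H n θ hθ) (key m2 hp).neg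

/-- Almost everywhere convergence of a common subsequence avoids any bound on k. -/
theorem ae_eq_mul_of_tendsto {α : Type*} [MeasurableSpace α] {μ : Measure α} {k : α → ℂ}
    {a b : ℕ → Lp ℂ 2 μ} {a₀ b₀ : Lp ℂ 2 μ} (H : ∀ n, ∀ᵐ z ∂μ, a n z = k z * b n z)
    (ha : Tendsto a atTop (𝓝 a₀)) (hb : Tendsto b atTop (𝓝 b₀)) :
    ∀ᵐ z ∂μ, a₀ z = k z * b₀ z := by
  obtain ⟨n, hn, h1⟩ := (tendstoInMeasure_of_tendsto_Lp ha).exists_seq_tendsto_ae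
  obtain ⟨m, hm, h2⟩ := (tendstoInMeasure_of_tendsto_Lp
    (hb.comp hn.tendsto_atTop)).exists_seq_tendsto_ae
  filter_upwards [h1, h2, ae_all_iff.2 H] with z k1 k2 k3
  exact tendsto_nhds_unique (k1.comp hm.tendsto_atTop)
    ((k2.const_mul (k z)).congr fun i => (k3 _).symm)

/-- The boundary condition is a pointwise linear relation, so it passes to the limit along a
subsequence on which both traces converge almost everywhere. -/
theorem infiniteMass_of_tendsto {a b : ℕ → S.L2b} {a₀ b₀ : S.L2b}
    (H : ∀ n, InfiniteMass (a n) (b n)) (ha : Tendsto a atTop (𝓝 a₀))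
    (hb : Tendsto b atTop (𝓝 b₀)) : InfiniteMass a₀ b₀ := by
  obtain ⟨n, hn, h1⟩ := (tendstoInMeasure_of_tendsto_Lp ha).exists_seq_tendsto_ae
  obtain ⟨m, hm, h2⟩ := (tendstoInMeasure_of_tendsto_Lp
    (hb.comp hn.tendsto_atTop)).exists_seq_tendsto_ae
  have h3 : ∀ᵐ z ∂S.boundaryMeasure, ∀ k, ∀ N : ℂ, IsOutwardNormal S z N →
      b k z = Complex.I * N * a k z := ae_all_iff.2 fun k => infiniteMass_iff.1 (H k)
  rw [infiniteMass_iff]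
  filter_upwards [h1, h2, h3] with z k1 k2 k3 N hN
  have k4 := ((k1.comp hm.tendsto_atTop).const_mul (Complex.I * N))
  refine tendsto_nhds_unique k2 (k4.congr fun i => ?_)
  exact (k3 _ N hN).symm

theorem SmoothBC.infiniteMass {F₁ F₂ : ℂ → ℂ} (bc : S.SmoothBC F₁ F₂) {g₁ g₂ : S.L2b}
    (h1 : g₁ =ᵐ[S.boundaryMeasure] F₁) (h2 : g₂ =ᵐ[S.boundaryMeasure] F₂) :
    InfiniteMass g₁ g₂ := by
  rw [infiniteMass_iff]
  filter_upwards [h1, h2] with z e1 e2 N hN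
  rw [e1, e2]
  obtain ⟨s, ⟨rfl, rfl⟩ | ⟨rfl, rfl⟩⟩ := hN
  · change F₂ (S.tube (s, S.δ)) = Complex.I * _ * F₁ (S.tube (s, S.δ))
    rw [(bc s).1, S.unitNormal_eq]
    linear_combination (-S.tangent s * F₁ (S.tube (s, S.δ))) * Complex.I_sq
  · change F₂ (S.tube (s, -S.δ)) = Complex.I * -_ * F₁ (S.tube (s, -S.δ))
    rw [(bc s).2, S.unitNormal_eq]
    linear_combination (S.tangent s * F₁ (S.tube (s, -S.δ))) * Complex.I_sq

theorem smoothDeriv_sub {F G K : ℂ → ℂ} (hF : ContDiff ℝ ∞ F) (cF : HasCompactSupport F)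
    (hG : ContDiff ℝ ∞ G) (cG : HasCompactSupport G) (hK : ContDiff ℝ ∞ K)
    (cK : HasCompactSupport K) (e : ℂ) (hFG : K = fun z => F z + -1 * G z) :
    (smoothDeriv hK cK e : S.L2) = smoothDeriv hF cF e - smoothDeriv hG cG e := by
  subst hFG
  apply Lp.ext
  filter_upwards [coeFn_smoothDeriv (S := S) hK cK e, coeFn_smoothDeriv (S := S) hF cF e,
    coeFn_smoothDeriv (S := S) hG cG e, Lp.coeFn_sub (smoothDeriv hF cF e : S.L2)
    (smoothDeriv hG cG e)] with z h1 h2 h3 h4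
  rw [h1, h4, Pi.sub_apply, h2, h3, fderiv_add_smul hF hG]
  ring

theorem smoothTrace_sub {F G K : ℂ → ℂ} (hF : ContDiff ℝ ∞ F) (cF : HasCompactSupport F)
    (hG : ContDiff ℝ ∞ G) (cG : HasCompactSupport G) (hK : ContDiff ℝ ∞ K)
    (cK : HasCompactSupport K) (hFG : K = fun z => F z + -1 * G z) :
    (smoothTrace hK cK : S.L2b) = smoothTrace hF cF - smoothTrace hG cG := by
  subst hFG
  apply Lp.ext
  filter_upwards [coeFn_smoothTrace (S := S) hK cK, coeFn_smoothTrace (S := S) hF cF,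
    coeFn_smoothTrace (S := S) hG cG, Lp.coeFn_sub (smoothTrace hF cF : S.L2b)
    (smoothTrace hG cG)] with z h1 h2 h3 h4
  rw [h1, h4, Pi.sub_apply, h2, h3]
  ring

/-- Differences of core elements are core elements, so the core bound makes derivatives and traces
Cauchy along with the graph. The approximating smooth functions themselves witness the Sobolev
traces of the limit. -/
theorem diracRel_of_mem_closure {P : S.Potential} {h : ℝ} (hh : h ≠ 0)
    {x : WithLp 2 (S.Spinor × S.Spinor)} (hx : x ∈ (coreGraph P h).topologicalClosure) :
    DiracRel P h x.fst x.snd := by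
  obtain ⟨y, hy, hyx⟩ := mem_closure_iff_seq_limit.1 hx
  choose F₁ F₂ H using hy
  obtain ⟨C, hC0, hC⟩ := exists_core_bound P hh
  have Hsub : ∀ n m, CoreRel P h (fun z => F₁ n z + -1 * F₁ m z) (fun z => F₂ n z + -1 * F₂ m z)
      (y n - y m) := by
    intro n m
    have := (H n).add_smul (H m) (-1)
    rwa [neg_one_smul, ← sub_eq_add_neg] at this
  have lim : ∀ {G : Type} [NormedAddCommGroup G] [CompleteSpace G] {v : ℕ → G},
      (∀ n m, ‖v n - v m‖ ≤ C * ‖y n - y m‖) → ∃ v₀, Tendsto v atTop (𝓝 v₀) :=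
    fun hv => exists_tendsto_of_norm_sub_le hyx hv
  have key1 := fun n m => (hC _ _ _ (Hsub n m)).1
  have key2 := fun n m => (hC _ _ _ (Hsub n m)).2
  obtain ⟨p₁, hp₁⟩ := lim (v := fun n => (smoothDeriv (H n).smooth₁ (H n).compact₁ 1 : S.L2))
    fun n m => by rw [← smoothDeriv_sub _ _ _ _ _ _ _ rfl]; exact (key1 n m).1
  obtain ⟨p₂, hp₂⟩ := lim (v := fun n => (smoothDeriv (H n).smooth₁ (H n).compact₁ Complex.I : S.L2))
    fun n m => by rw [← smoothDeriv_sub _ _ _ _ _ _ _ rfl]; exact (key1 n m).2.1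
  obtain ⟨g₁, hg₁⟩ := lim (v := fun n => (smoothTrace (H n).smooth₁ (H n).compact₁ : S.L2b))
    fun n m => by rw [← smoothTrace_sub _ _ _ _ _ _ rfl]; exact (key1 n m).2.2
  obtain ⟨q₁, hq₁⟩ := lim (v := fun n => (smoothDeriv (H n).smooth₂ (H n).compact₂ 1 : S.L2))
    fun n m => by rw [← smoothDeriv_sub _ _ _ _ _ _ _ rfl]; exact (key2 n m).1
  obtain ⟨q₂, hq₂⟩ := lim (v := fun n => (smoothDeriv (H n).smooth₂ (H n).compact₂ Complex.I : S.L2))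
    fun n m => by rw [← smoothDeriv_sub _ _ _ _ _ _ _ rfl]; exact (key2 n m).2.1
  obtain ⟨g₂, hg₂⟩ := lim (v := fun n => (smoothTrace (H n).smooth₂ (H n).compact₂ : S.L2b))
    fun n m => by rw [← smoothTrace_sub _ _ _ _ _ _ rfl]; exact (key2 n m).2.2
  have c1 : Continuous fun w : WithLp 2 (S.Spinor × S.Spinor) => w.fst.fst := by fun_prop
  have c2 : Continuous fun w : WithLp 2 (S.Spinor × S.Spinor) => w.fst.snd := by fun_prop
  have c3 : Continuous fun w : WithLp 2 (S.Spinor × S.Spinor) => w.snd.fst := by fun_prop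
  have c4 : Continuous fun w : WithLp 2 (S.Spinor × S.Spinor) => w.snd.snd := by fun_prop
  have l1 := (c1.tendsto x).comp hyx
  have l2 := (c2.tendsto x).comp hyx
  have l3 := (c3.tendsto x).comp hyx
  have l4 := (c4.tendsto x).comp hyx
  have a1 : ∀ n, (smoothL2 (H n).smooth₁ (H n).compact₁ : S.L2) = (y n).fst.fst := fun n =>
    Lp.ext ((coeFn_smoothL2 _ _).trans (H n).fst_fst.symm)
  have a2 : ∀ n, (smoothL2 (H n).smooth₂ (H n).compact₂ : S.L2) = (y n).fst.snd := fun n =>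
    Lp.ext ((coeFn_smoothL2 _ _).trans (H n).fst_snd.symm)
  refine ⟨p₁, p₂, q₁, q₂, g₁, g₂, ⟨⟨?_, ?_⟩, F₁, fun n => ⟨(H n).smooth₁, (H n).compact₁⟩, ?_, ?_,
    ?_, ?_⟩, ⟨⟨?_, ?_⟩, F₂, fun n => ⟨(H n).smooth₂, (H n).compact₂⟩, ?_, ?_, ?_, ?_⟩, ?_, ?_, ?_⟩
  · exact .of_tendsto (fun n => (congrArg (fun v : S.L2 => IsWeakDeriv 1 v (smoothDeriv (H n).smooth₁ (H n).compact₁ 1)) (a1 n)).mp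
      (isWeakDeriv_smooth _ _ _)) l1 hp₁
  · exact .of_tendsto (fun n => (congrArg (fun v : S.L2 => IsWeakDeriv Complex.I v (smoothDeriv (H n).smooth₁ (H n).compact₁ Complex.I)) (a1 n)).mp
      (isWeakDeriv_smooth _ _ _)) l1 hp₂
  · exact tendsto_eLpNorm_sub l1 fun n => (H n).fst_fst
  · exact tendsto_eLpNorm_sub hp₁ fun n => coeFn_smoothDeriv _ _ _
  · exact tendsto_eLpNorm_sub hp₂ fun n => coeFn_smoothDeriv _ _ _
  · exact tendsto_eLpNorm_sub hg₁ fun n => coeFn_smoothTrace _ _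
  · exact .of_tendsto (fun n => (congrArg (fun v : S.L2 => IsWeakDeriv 1 v (smoothDeriv (H n).smooth₂ (H n).compact₂ 1)) (a2 n)).mp
      (isWeakDeriv_smooth _ _ _)) l2 hq₁
  · exact .of_tendsto (fun n => (congrArg (fun v : S.L2 => IsWeakDeriv Complex.I v (smoothDeriv (H n).smooth₂ (H n).compact₂ Complex.I)) (a2 n)).mp
      (isWeakDeriv_smooth _ _ _)) l2 hq₂
  · exact tendsto_eLpNorm_sub l2 fun n => (H n).fst_snd
  · exact tendsto_eLpNorm_sub hq₁ fun n => coeFn_smoothDeriv _ _ _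
  · exact tendsto_eLpNorm_sub hq₂ fun n => coeFn_smoothDeriv _ _ _
  · exact tendsto_eLpNorm_sub hg₂ fun n => coeFn_smoothTrace _ _
  · exact infiniteMass_of_tendsto (fun n => (H n).bc.infiniteMass (coeFn_smoothTrace _ _)
      (coeFn_smoothTrace _ _)) hg₁ hg₂
  · have hc : ∀ (u v w : S.L2) (k : ℂ), (u + (Complex.I * h) • (v + k • w) : S.L2)
        =ᵐ[volume.restrict S.Ω] fun z => u z + Complex.I * h * (v z + k * w z) := by
      intro u v w k
      filter_upwards [Lp.coeFn_add u ((Complex.I * h) • (v + k • w)),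
        Lp.coeFn_smul (Complex.I * h) (v + k • w), Lp.coeFn_add v (k • w), Lp.coeFn_smul k w]
        with z h1 h2 h3 h4
      rw [h1, Pi.add_apply, h2, Pi.smul_apply, h3, Pi.add_apply, h4]
      rfl
    have := ae_eq_mul_of_tendsto (k := fun z => conj (P.coef z)) (fun n => ?_)
      (l3.add ((hq₁.add (hq₂.const_smul (-Complex.I))).const_smul (Complex.I * h))) l2
    · filter_upwards [this, hc x.snd.fst q₁ q₂ (-Complex.I)] with z h1 h2
      rw [h2] at h1
      rw [← P.conj_coef, ← h1]
      ring
    · filter_upwards [hc (y n).snd.fst (smoothDeriv (H n).smooth₂ (H n).compact₂ 1)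
        (smoothDeriv (H n).smooth₂ (H n).compact₂ Complex.I) (-Complex.I), (H n).snd_fst,
        (H n).fst_snd, coeFn_smoothDeriv (S := S) (H n).smooth₂ (H n).compact₂ 1,
        coeFn_smoothDeriv (S := S) (H n).smooth₂ (H n).compact₂ Complex.I] with z h1 h2 h3 h4 h5
      refine h1.trans ?_
      simp only [Function.comp_apply]
      rw [h2, h3, h4, h5, dSmooth]
      ring
  · have hc : ∀ (u v w : S.L2) (k : ℂ), (u + (Complex.I * h) • (v + k • w) : S.L2)
        =ᵐ[volume.restrict S.Ω] fun z => u z + Complex.I * h * (v z + k * w z) := by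
      intro u v w k
      filter_upwards [Lp.coeFn_add u ((Complex.I * h) • (v + k • w)),
        Lp.coeFn_smul (Complex.I * h) (v + k • w), Lp.coeFn_add v (k • w), Lp.coeFn_smul k w]
        with z h1 h2 h3 h4
      rw [h1, Pi.add_apply, h2, Pi.smul_apply, h3, Pi.add_apply, h4]
      rfl
    have := ae_eq_mul_of_tendsto (k := P.coef) (fun n => ?_)
      (l4.add ((hp₁.add (hp₂.const_smul Complex.I)).const_smul (Complex.I * h))) l1
    · filter_upwards [this, hc x.snd.snd p₁ p₂ Complex.I] with z h1 h2
      rw [h2] at h1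
      change _ = _ + P.coef z * _
      rw [← h1]
      ring
    · filter_upwards [hc (y n).snd.snd (smoothDeriv (H n).smooth₁ (H n).compact₁ 1)
        (smoothDeriv (H n).smooth₁ (H n).compact₁ Complex.I) Complex.I, (H n).snd_snd,
        (H n).fst_fst, coeFn_smoothDeriv (S := S) (H n).smooth₁ (H n).compact₁ 1,
        coeFn_smoothDeriv (S := S) (H n).smooth₁ (H n).compact₁ Complex.I] with z h1 h2 h3 h4 h5
      refine h1.trans ?_
      simp only [Function.comp_apply]
      rw [h2, h3, h4, h5, dTimesSmooth]
      ring

/-- The Dirac operator is the adjoint of its restriction to smooth functions. -/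
theorem diracRel_of_adjointPair {P : S.Potential} {h : ℝ} (hh : h ≠ 0) {ψ χ : S.Spinor}
    (H : IsAdjointPair P h ψ χ) : DiracRel P h ψ χ := diracRel_of_mem_closure hh (H.mem_closure hh)

end CurvedStrip

namespace CurvedStrip

variable {S : CurvedStrip}

/-! ### The Dirac operator is self-adjoint, and its relation to the form -/

/-- The Dirac operator is self-adjoint. -/
theorem diracRel_iff_forall_inner {P : S.Potential} {h : ℝ} (hh : h ≠ 0) {ψ χ : S.Spinor} :
    DiracRel P h ψ χ ↔ ∀ ψ' χ', DiracRel P h ψ' χ' → ⟪χ', ψ⟫_ℂ = ⟪ψ', χ⟫_ℂ := by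
  refine ⟨fun H ψ' χ' H' => diracRel_symmetric H' H, fun H => diracRel_of_adjointPair hh ?_⟩
  exact isAdjointPair_iff.2 fun y hy =>
    H _ _ (diracRel_of_mem_closure hh (Submodule.le_topologicalClosure _ hy))

/-- Self-adjointness writes the graph as an intersection of closed conditions. -/
theorem isClosed_diracGraph (P : S.Potential) {h : ℝ} (hh : h ≠ 0) :
    IsClosed (diracGraph P h : Set (S.Spinor × S.Spinor)) := by
  have : (diracGraph P h : Set (S.Spinor × S.Spinor)) =
      ⋂ ψ', ⋂ χ', ⋂ (_ : DiracRel P h ψ' χ'), {x | ⟪χ', x.1⟫_ℂ = ⟪ψ', x.2⟫_ℂ} := by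
    ext x
    simp only [mem_iInter, mem_ofPred_eq]
    exact diracRel_iff_forall_inner hh
  rw [this]
  exact isClosed_iInter fun ψ' => isClosed_iInter fun χ' => isClosed_iInter fun _ =>
    isClosed_eq (by fun_prop) (by fun_prop)

/-- A solution of `L_λ u = w` gives a solution of `(D_h - λ) ψ = (λ⁻¹ w, 0)`. -/
theorem diracRel_of_form {P : S.Potential} {R : S.Uniformization} {h lam : ℝ} (hh : h ≠ 0)
    (hlam : lam ≠ 0) {u d w : S.L2} {g : S.L2b} (hx : (u, d, g) ∈ formGraph P R h)
    (hq : ∀ y ∈ formGraph P R h, qForm h lam (u, d, g) y = ⟪y.1, w⟫_ℂ) :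
    DiracRel P h (WithLp.toLp 2 (u, (lam : ℂ)⁻¹ • d))
      (WithLp.toLp 2 ((lam : ℂ) • u + (lam : ℂ)⁻¹ • w, d)) := by
  rw [diracRel_iff_forall_inner hh]
  rintro ψ' χ' ⟨p₁, p₂, q₁, q₂, g₁, g₂, t1, t2, bc, e1, e2⟩
  -- Green's formula and the form equation tested on ψ'₁ produce the same boundary term h⟨g₁, g⟩
  -- with opposite signs.
  have k1 := HasGreen.inner_eq (fun E hE hc => formGraph_green hh hx hE hc) t2 bc e1
  have k2 := hq _ (mem_formGraph_of_sobolev R t1 e2)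
  simp only [qForm] at k2
  rw [WithLp.prod_inner_apply, WithLp.prod_inner_apply]
  change ⟪χ'.fst, u⟫_ℂ + ⟪χ'.snd, (lam : ℂ)⁻¹ • d⟫_ℂ =
    ⟪ψ'.fst, (lam : ℂ) • u + (lam : ℂ)⁻¹ • w⟫_ℂ + ⟪ψ'.snd, d⟫_ℂ
  rw [inner_add_right, inner_smul_right, inner_smul_right, inner_smul_right, k1, ← k2]
  have hl : (lam : ℂ) ≠ 0 := by exact_mod_cast hlam
  push_cast
  field_simp
  ring

/-- The energy bound `‖d_A^× u‖² ≤ λ² ‖u‖² + ‖u‖ ‖w‖` for a solution of `L_λ u = w`. -/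
theorem norm_sq_le_of_form {P : S.Potential} {R : S.Uniformization} {h lam : ℝ} (hh : 0 ≤ h)
    (hlam : 0 ≤ lam) {x : S.L2 × S.L2 × S.L2b} {w : S.L2} (hx : x ∈ formGraph P R h)
    (hq : ∀ y ∈ formGraph P R h, qForm h lam x y = ⟪y.1, w⟫_ℂ) :
    ‖x.2.1‖ ^ 2 ≤ lam ^ 2 * ‖x.1‖ ^ 2 + ‖x.1‖ * ‖w‖ := by
  have e : ∀ {α : Type} [MeasurableSpace α] {μ : Measure α} (y : Lp ℂ 2 μ),
      ⟪y, y⟫_ℂ = ((‖y‖ ^ 2 : ℝ) : ℂ) := fun y => by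
    rw [inner_self_eq_norm_sq_to_K]; norm_cast
  have k' := congrArg Complex.re (hq x hx)
  simp only [qForm, e, ← Complex.ofReal_mul, ← Complex.ofReal_add, ← Complex.ofReal_sub,
    Complex.ofReal_re] at k'
  have h1 : (⟪x.1, w⟫_ℂ).re ≤ ‖x.1‖ * ‖w‖ :=
    (Complex.re_le_norm _).trans (norm_inner_le_norm _ _)
  have h2 : 0 ≤ h * lam * ‖x.2.2‖ ^ 2 := by positivity
  linarith

/-- The energy bound makes d_A^× u_n Cauchy along a graph-convergent sequence, so the associated
spinors converge in the closed graph of D_h; the limit is translated back to the form. Convergence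
of the traces in the form domain is never needed. -/
theorem isClosed_effGraph (P : S.Potential) (R : S.Uniformization) {h lam : ℝ} (hh : 0 < h)
    (hlam : 0 < lam) : IsClosed (effGraph P R h lam : Set (S.L2 × S.L2)) := by
  refine isClosed_of_closure_subset fun a ha => ?_
  obtain ⟨b, hb, hba⟩ := mem_closure_iff_seq_limit.1 ha
  choose x hx ex hq using hb
  have l1 : Tendsto (fun n => (b n).1) atTop (𝓝 a.1) := (continuous_fst.tendsto a).comp hba
  have l2 : Tendsto (fun n => (b n).2) atTop (𝓝 a.2) := (continuous_snd.tendsto a).comp hba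
  -- The constant comes from λ² + 1 ≤ (λ + 1)².
  have hC : ∀ n m, ‖(x n).2.1 - (x m).2.1‖ ≤ (lam + 1) * ‖b n - b m‖ := by
    intro n m
    have k := norm_sq_le_of_form hh.le hlam.le (w := (b n).2 - (b m).2)
      (sub_mem (hx n) (hx m)) fun y hy => by
        have e1 := hq n y hy
        have e2 := hq m y hy
        rw [inner_sub_right, ← e1, ← e2]
        simp only [qForm, Prod.fst_sub, Prod.snd_sub, inner_sub_right]
        ring
    simp only [Prod.fst_sub, Prod.snd_sub, ex] at k
    have n1 : ‖(b n).1 - (b m).1‖ ≤ ‖b n - b m‖ := norm_fst_le (b n - b m)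
    have n2 : ‖(b n).2 - (b m).2‖ ≤ ‖b n - b m‖ := norm_snd_le (b n - b m)
    have p0 := norm_nonneg (b n - b m)
    have p1 := norm_nonneg ((b n).1 - (b m).1)
    refine abs_le_of_sq_le_sq' ?_ (by positivity) |>.2
    calc _ ≤ _ := k
      _ ≤ lam ^ 2 * ‖b n - b m‖ ^ 2 + ‖b n - b m‖ * ‖b n - b m‖ := by gcongr
      _ ≤ _ := by nlinarith [mul_nonneg hlam.le (sq_nonneg ‖b n - b m‖)]
  obtain ⟨d, hd⟩ := exists_tendsto_of_norm_sub_le hba hC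
  have hl : (lam : ℂ) ≠ 0 := by exact_mod_cast hlam.ne'
  have key : ∀ n, (WithLp.toLp 2 ((b n).1, (lam : ℂ)⁻¹ • (x n).2.1),
      WithLp.toLp 2 ((lam : ℂ) • (b n).1 + (lam : ℂ)⁻¹ • (b n).2, (x n).2.1)) ∈
      diracGraph P h := fun n => by
    have := diracRel_of_form hh.ne' hlam.ne' (hx n) (hq n)
    rwa [ex] at this
  have hlim := (isClosed_diracGraph P hh.ne').mem_of_tendsto
    (b := atTop) (Tendsto.prodMk_nhds
      (((WithLp.prod_continuous_toLp 2 S.L2 S.L2).tendsto _).comp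
        (l1.prodMk_nhds (hd.const_smul ((lam : ℂ)⁻¹))))
      (((WithLp.prod_continuous_toLp 2 S.L2 S.L2).tendsto _).comp
        (((l1.const_smul (lam : ℂ)).add (l2.const_smul ((lam : ℂ)⁻¹))).prodMk_nhds hd)))
    (Eventually.of_forall key)
  have := (mem_effGraph_of_diracRel (R := R) (lam := lam) (a := (lam : ℂ)⁻¹ • a.2) hh.ne' hlim rfl
    (smul_inv_smul₀ hl d).symm).1
  rwa [smul_inv_smul₀ hl] at this

end CurvedStrip

namespace UnboundedOp

/-! ### Symmetric operators near an isolated point of the spectrum -/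

section normed

variable {H : Type*} [NormedAddCommGroup H] [NormedSpace ℂ H] {T : H →ₗ.[ℂ] H}

theorem mem_graph_shift {z : ℂ} {u v : H} : (u, v) ∈ (shift T z).graph ↔
    (u, v + z • u) ∈ T.graph := by
  simp only [LinearPMap.mem_graph_iff]
  constructor
  · rintro ⟨y, rfl, hy⟩
    refine ⟨y, rfl, ?_⟩
    rw [← hy]
    exact (sub_add_cancel (T y) (z • (y : H))).symm
  · rintro ⟨y, rfl, hy⟩
    exact ⟨y, rfl, sub_eq_iff_eq_add.2 hy⟩

theorem isClosed_shift_iff {z : ℂ} : (shift T z).IsClosed ↔ T.IsClosed := by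
  constructor <;> intro h
  · have : (T.graph : Set (H × H)) = (fun x : H × H => (x.1, x.2 - z • x.1)) ⁻¹'
        ((shift T z).graph : Set (H × H)) := by
      ext x
      change x ∈ T.graph ↔ (x.1, x.2 - z • x.1) ∈ (shift T z).graph
      rw [mem_graph_shift, sub_add_cancel]
    unfold LinearPMap.IsClosed at h ⊢
    rw [this]
    exact h.preimage (by fun_prop)
  · have : ((shift T z).graph : Set (H × H)) = (fun x : H × H => (x.1, x.2 + z • x.1)) ⁻¹'
        (T.graph : Set (H × H)) := by
      ext x
      exact mem_graph_shift
    unfold LinearPMap.IsClosed at h ⊢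
    rw [this]
    exact h.preimage (by fun_prop)

/-- `R` is the bounded inverse of `T - z`. -/
def IsResolventAt (T : H →ₗ.[ℂ] H) (z : ℂ) (R : H →L[ℂ] H) : Prop :=
  (∀ x, (R x, x + z • R x) ∈ T.graph) ∧ ∀ u v, (u, v) ∈ T.graph → R (v - z • u) = u

theorem mem_resolventSet_iff {z : ℂ} : z ∈ resolventSet T ↔ ∃ R, IsResolventAt T z R := by
  refine exists_congr fun R => and_congr (forall_congr' fun x => ?_) ?_
  · rw [← mem_graph_shift, LinearPMap.mem_graph_iff]
    constructor
    · rintro ⟨hx, h⟩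
      exact ⟨⟨R x, hx⟩, rfl, h⟩
    · rintro ⟨⟨y, hy⟩, rfl, h⟩
      exact ⟨hy, h⟩
  · constructor
    · intro h u v huv
      obtain ⟨y, rfl, rfl⟩ := (LinearPMap.mem_graph_iff _).1 huv
      exact h y
    · exact fun h u => h u (T u) (T.mem_graph u)

theorem IsResolventAt.eq_add {a b : ℂ} {R R' : H →L[ℂ] H} (hR : IsResolventAt T a R)
    (hR' : IsResolventAt T b R') (x : H) : R' x = R x + (b - a) • R (R' x) := by
  have := hR.2 _ _ (hR'.1 x)
  rw [add_sub_assoc, ← sub_smul, map_add, map_smul] at this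
  exact this.symm

/-- The kernel of `T`, as a subspace of the whole space. -/
def kerIn (T : H →ₗ.[ℂ] H) : Submodule ℂ H := (ker T).map T.domain.subtype

theorem mem_range_iff_graph {w : H} : w ∈ range T ↔ ∃ u, (u, w) ∈ T.graph := by
  constructor
  · rintro ⟨u, rfl⟩
    exact ⟨u, T.mem_graph u⟩
  · rintro ⟨u, hu⟩
    obtain ⟨y, -, hy⟩ := (LinearPMap.mem_graph_iff _).1 hu
    exact ⟨y, hy⟩

theorem mem_kerIn {u : H} : u ∈ kerIn T ↔ (u, (0 : H)) ∈ T.graph := by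
  rw [LinearPMap.mem_graph_iff, kerIn, Submodule.mem_map]
  constructor
  · rintro ⟨y, hy, rfl⟩
    exact ⟨y, rfl, hy⟩
  · rintro ⟨y, rfl, hy⟩
    exact ⟨y, hy, rfl⟩

/-- The two versions of the kernel are isomorphic. -/
noncomputable def kerEquiv (T : H →ₗ.[ℂ] H) : ker T ≃ₗ[ℂ] kerIn T :=
  Submodule.equivMapOfInjective _ T.domain.subtype_injective _

end normed

/-! ### Closed range and index zero for symmetric operators -/

variable {H : Type*} [NormedAddCommGroup H] [InnerProductSpace ℂ H] [CompleteSpace H]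
  {T : H →ₗ.[ℂ] H}

/-- As 0 is not an accumulation point of the spectrum, x ↦ x⁻¹ with value 0 at 0 is continuous on
it. The functional calculus then gives C with BCB = B, so the range is the fixed set of the bounded
operator BC. -/
theorem isClosed_range_of_isolated {B : H →L[ℂ] H} (hB : IsSelfAdjoint B) {r : ℝ} (hr : 0 < r)
    (hs : ∀ z : ℝ, z ≠ 0 → |z| < r → IsUnit (B - algebraMap ℝ (H →L[ℂ] H) z)) :
    IsClosed (LinearMap.range (B : H →ₗ[ℂ] H) : Set H) := by
  have hf : ContinuousOn (fun x : ℝ => x⁻¹) (_root_.spectrum ℝ B) := by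
    intro x hx
    rcases eq_or_ne x 0 with rfl | h0
    · refine ContinuousWithinAt.congr_of_eventuallyEq (f := fun _ => 0)
        continuousWithinAt_const ?_ (by simp)
      filter_upwards [self_mem_nhdsWithin, mem_nhdsWithin_of_mem_nhds (Metric.ball_mem_nhds 0 hr)]
        with y hy hy'
      by_contra hne
      refine hy ?_
      rw [Metric.mem_ball, dist_zero_right, Real.norm_eq_abs] at hy'
      have := (hs y (fun h => hne (by simp [h])) hy').neg
      rwa [neg_sub] at this
    · exact (continuousAt_inv₀ h0).continuousWithinAt
  have key : B * cfc (fun x : ℝ => x⁻¹) B * B = B := by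
    have h1 : cfc (fun x : ℝ => x * x⁻¹ * x) B = B := by
      rw [cfc_congr (g := fun x : ℝ => x) fun x _ => mul_inv_mul_cancel x, cfc_id' ℝ B]
    conv_rhs => rw [← h1]
    rw [cfc_mul (fun x : ℝ => x * x⁻¹) (fun x => x) B (continuousOn_id.mul hf),
      cfc_mul (fun x : ℝ => x) (fun x => x⁻¹) B, cfc_id' ℝ B]
  have hset : (LinearMap.range (B : H →ₗ[ℂ] H) : Set H) =
      {x | (B * cfc (fun x : ℝ => x⁻¹) B) x = x} := by
    ext x
    constructor
    · rintro ⟨y, rfl⟩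
      exact congrArg (fun A : H →L[ℂ] H => A y) key
    · exact fun h => ⟨_, h⟩
  rw [hset]
  exact isClosed_eq (ContinuousLinearMap.continuous _) continuous_id

/-- The quotient by a closed subspace is isomorphic to the orthogonal complement. -/
theorem nonempty_quotient_equiv_orthogonal {V : Submodule ℂ H} (hV : IsClosed (V : Set H)) :
    Nonempty ((H ⧸ V) ≃ₗ[ℂ] Vᗮ) := by
  have := hV.completeSpace_coe
  exact ⟨V.quotientEquivOfIsCompl _ V.isCompl_orthogonal⟩

theorem IsResolventAt.isSelfAdjoint (hT : T.IsFormalAdjoint T) {μ : ℝ} {R : H →L[ℂ] H}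
    (hR : IsResolventAt T μ R) : IsSelfAdjoint R := by
  rw [ContinuousLinearMap.isSelfAdjoint_iff_isSymmetric]
  intro x y
  obtain ⟨⟨a, ha⟩, rfl, ea⟩ := (LinearPMap.mem_graph_iff _).1 (hR.1 x)
  obtain ⟨⟨b, hb⟩, rfl, eb⟩ := (LinearPMap.mem_graph_iff _).1 (hR.1 y)
  have := hT ⟨R y, hb⟩ ⟨R x, ha⟩
  rw [ea, eb, inner_add_left, inner_add_right, inner_smul_left, inner_smul_right,
    Complex.conj_ofReal, add_left_inj] at this
  have h2 := congrArg conj this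
  rw [inner_conj_symm, inner_conj_symm] at h2
  exact h2

/-- At a real point of its discrete spectrum a symmetric operator is Fredholm of index zero. -/
theorem isFredholm_of_mem_discreteSpectrum (hT : T.IsFormalAdjoint T) (hc : T.IsClosed) {lam : ℝ}
    (hlam : (lam : ℂ) ∈ discreteSpectrum T) :
    IsFredholm (shift T lam) ∧ index (shift T lam) = 0 := by
  obtain ⟨-, ⟨ε, hε, hiso⟩, -, hfin⟩ := hlam
  have hres : ∀ b : ℝ, b ≠ lam → |b - lam| < ε → ∃ R, IsResolventAt T (b : ℂ) R := by
    intro b hb hbε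
    rw [← mem_resolventSet_iff]
    by_contra hn
    have := hiso b hn (by exact_mod_cast hb)
    rw [Complex.dist_eq, ← Complex.ofReal_sub, Complex.norm_real, Real.norm_eq_abs] at this
    linarith
  set c : ℝ := ε / 2 with hcdef
  have hc0 : 0 < c := by positivity
  obtain ⟨R, hR⟩ := hres (lam + c) (by linarith) (by
    rw [add_sub_cancel_left, abs_of_pos hc0]; linarith)
  -- B = (T − λ)R with R the inverse of T − λ − c: a bounded self-adjoint operator with the same
  -- kernel and range as T − λ.
  set B : H →L[ℂ] H := 1 + (c : ℂ) • R with hBdef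
  have hBx : ∀ x, B x = x + (c : ℂ) • R x := fun x => rfl
  have hBsa : IsSelfAdjoint B := by
    refine (IsSelfAdjoint.one _).add (IsSelfAdjoint.smul ?_ (hR.isSelfAdjoint hT))
    exact Complex.conj_ofReal c
  have hgr : ∀ x, (R x, B x) ∈ (shift T lam).graph := fun x => by
    rw [mem_graph_shift, hBx]
    have := hR.1 x
    push_cast at this
    rwa [add_smul, add_comm ((lam : ℂ) • R x), ← add_assoc] at this
  have hinv : ∀ u v, (u, v) ∈ (shift T lam).graph → R (v - (c : ℂ) • u) = u := fun u v huv => by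
    rw [mem_graph_shift] at huv
    have := hR.2 _ _ huv
    push_cast at this
    rwa [add_smul, add_comm ((lam : ℂ) • u), add_sub_add_right_eq_sub] at this
  have hker : kerIn (shift T lam) = LinearMap.ker (B : H →ₗ[ℂ] H) := by
    ext u
    rw [mem_kerIn, LinearMap.mem_ker, ContinuousLinearMap.coe_coe]
    constructor
    · intro hu
      have := hinv _ _ hu
      rw [zero_sub, map_neg, map_smul] at this
      rw [hBx, add_comm]
      exact neg_eq_iff_add_eq_zero.1 this
    · intro hu
      have h1 := Submodule.smul_mem _ (-(c : ℂ)) (hgr u)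
      rw [hu] at h1
      rw [hBx] at hu
      have h2 : u = (-(c : ℂ)) • R u := by rw [neg_smul]; exact eq_neg_of_add_eq_zero_left hu
      rw [Prod.smul_mk, smul_zero, ← h2] at h1
      exact h1
  have hran : range (shift T lam) = LinearMap.range (B : H →ₗ[ℂ] H) := by
    ext w
    rw [mem_range_iff_graph]
    constructor
    · rintro ⟨u, hu⟩
      refine ⟨w - (c : ℂ) • u, ?_⟩
      rw [ContinuousLinearMap.coe_coe, hBx, hinv u w hu, sub_add_cancel]
    · rintro ⟨x, rfl⟩
      exact ⟨_, hgr x⟩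
  have hcl : IsClosed (range (shift T lam) : Set H) := by
    rw [hran]
    refine isClosed_range_of_isolated hBsa (r := 1 / 2) (by norm_num) fun z hz hz2 => ?_
    have hz1 : 0 < 1 - z := by linarith [(abs_lt.1 hz2).2]
    -- B − z = (1 − z)(T − b)R with b = λ + c − c/(1 − z). As |z| < 1/2, b lies within c = ε/2 of λ,
    -- hence in the resolvent set when z ≠ 0.
    obtain ⟨R', hR'⟩ := hres (lam + c - c / (1 - z)) (fun h => by
        field_simp at h
        have : c * z = 0 := by linarith
        rcases mul_eq_zero.1 this with h1 | h1
        · exact hc0.ne' h1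
        · exact hz h1) (by
        have e : lam + c - c / (1 - z) - lam = -(c * (z / (1 - z))) := by field_simp; ring
        rw [e, abs_neg, abs_mul, abs_of_pos hc0, abs_div, abs_of_pos hz1]
        have : |z| / (1 - z) ≤ 1 := by
          rw [div_le_one hz1]; linarith [(abs_lt.1 hz2).2]
        nlinarith)
    have e1 := hR.eq_add hR'
    have e2 := hR'.eq_add hR
    set k : ℂ := ((c / (1 - z) : ℝ) : ℂ) with hk
    have hzc : (1 - z : ℂ) ≠ 0 := by exact_mod_cast hz1.ne'
    have hkc : (1 - z : ℂ) * k = c := by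
      rw [hk]; push_cast; field_simp
    have k1 : ((lam + c - c / (1 - z) : ℝ) : ℂ) - ((lam + c : ℝ) : ℂ) = -k := by
      rw [hk]; push_cast; ring
    have k2 : ((lam + c : ℝ) : ℂ) - ((lam + c - c / (1 - z) : ℝ) : ℂ) = k := by
      rw [hk]; push_cast; ring
    simp only [k1] at e1
    simp only [k2] at e2
    have hB' : B - algebraMap ℝ (H →L[ℂ] H) z = (1 - z : ℂ) • (1 + k • R) := by
      ext x
      have : algebraMap ℝ (H →L[ℂ] H) z x = (z : ℂ) • x := rfl
      rw [_root_.sub_apply, hBx, this]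
      change _ = (1 - z : ℂ) • (x + k • R x)
      rw [smul_add, smul_smul, hkc, sub_smul, one_smul]
      abel
    have u1 : (1 + k • R) * (1 - k • R') = 1 := by
      ext x
      change x - k • R' x + k • R (x - k • R' x) = x
      rw [map_sub, map_smul]
      have := e1 x
      rw [neg_smul] at this
      nth_rewrite 1 [this]
      rw [← sub_eq_add_neg]
      abel
    have u2 : (1 - k • R') * (1 + k • R) = 1 := by
      ext x
      change x + k • R x - k • R' (x + k • R x) = x
      rw [map_add, map_smul]
      nth_rewrite 1 [e2 x]
      abel
    rw [hB']
    exact (isUnit_iff_exists.2 ⟨_, u1, u2⟩).smul (Units.mk0 _ hzc)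
  obtain ⟨e⟩ := nonempty_quotient_equiv_orthogonal hcl
  have horth : (range (shift T lam))ᗮ = kerIn (shift T lam) := by
    rw [hran, hker]
    exact (ContinuousLinearMap.isSelfAdjoint_iff_isSymmetric.1 hBsa).orthogonal_range
  rw [horth] at e
  have e' := (kerEquiv (shift T lam)).trans e.symm
  have hfin' : FiniteDimensional ℂ (ker (shift T lam)) := hfin
  refine ⟨⟨isClosed_shift_iff.2 hc, hfin', hcl, e'.finiteDimensional⟩, ?_⟩
  rw [index, e'.finrank_eq, sub_self]

theorem kerIn_le_orthogonal_range {E : Type*} [NormedAddCommGroup E] [InnerProductSpace ℂ E]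
    {T : E →ₗ.[ℂ] E} (hT : T.IsFormalAdjoint T) : kerIn T ≤ (range T)ᗮ := by
  rintro _ ⟨u, hu, rfl⟩
  rw [Submodule.mem_orthogonal]
  rintro _ ⟨v, rfl⟩
  have := hT v u
  rw [show T u = 0 from hu, inner_zero_right] at this
  exact this

/-- For a symmetric operator the kernel is orthogonal to the range, whose orthogonal complement has
the dimension of the cokernel. -/
theorem finrank_ker_le (hT : T.IsFormalAdjoint T) (hc : IsClosed (range T : Set H))
    [FiniteDimensional ℂ (H ⧸ range T)] :
    Module.finrank ℂ (ker T) ≤ Module.finrank ℂ (H ⧸ range T) := by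
  obtain ⟨e⟩ := nonempty_quotient_equiv_orthogonal hc
  have := e.finiteDimensional
  rw [(kerEquiv T).finrank_eq, e.finrank_eq]
  exact Submodule.finrank_mono (kerIn_le_orthogonal_range hT)

/-- A symmetric Fredholm operator of index zero has the orthogonal complement of its kernel as
range. -/
theorem range_eq_of_isFredholm (hT : T.IsFormalAdjoint T) (hF : IsFredholm T)
    (hi : index T = 0) : range T = (kerIn T)ᗮ := by
  have hle := kerIn_le_orthogonal_range hT
  obtain ⟨e⟩ := nonempty_quotient_equiv_orthogonal hF.closed_range
  have := hF.finite_coker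
  have hfd := e.finiteDimensional
  have hd : Module.finrank ℂ (kerIn T) = Module.finrank ℂ ((range T)ᗮ : Submodule ℂ H) := by
    rw [← e.finrank_eq, ← (kerEquiv T).finrank_eq]
    rw [index] at hi
    omega
  rw [Submodule.eq_of_le_of_finrank_eq hle hd]
  have := hF.closed_range.completeSpace_coe
  exact (Submodule.orthogonal_orthogonal _).symm

end UnboundedOp

/-! ### The reduced inverse and the gap around zero -/

namespace UnboundedOp

variable {H : Type*} [NormedAddCommGroup H] [InnerProductSpace ℂ H] [CompleteSpace H]
  {T : H →ₗ.[ℂ] H}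

/-- The reduced inverse of a symmetric Fredholm operator of index zero. -/
theorem exists_reduced_inverse (hT : T.IsFormalAdjoint T) (hF : IsFredholm T) (hi : index T = 0) :
    ∃ G p : H →L[ℂ] H, (∀ x, (G x, x - p x) ∈ T.graph) ∧ (∀ u v, (u, v) ∈ T.graph →
      G v = u - p u ∧ p v = 0) ∧ (∀ x, p (G x) = 0 ∧ G (p x) = 0 ∧ p (p x) = p x) ∧
      ∀ x, (p x, (0 : H)) ∈ T.graph := by
  have hfin : FiniteDimensional ℂ (kerIn T) := by
    have := hF.finite_ker
    exact (kerEquiv T).finiteDimensional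
  have hran := range_eq_of_isFredholm hT hF hi
  set K := kerIn T with hK
  set p : H →L[ℂ] H := K.starProjection with hp
  have hpK : ∀ x, p x ∈ K := fun x => K.starProjection_apply_mem x
  have hp0 : ∀ {x}, p x = 0 ↔ x ∈ Kᗮ := fun {x} => K.starProjection_apply_eq_zero_iff
  have hpi : ∀ {x}, p x = x ↔ x ∈ K := fun {x} => Submodule.starProjection_eq_self_iff
  have hpp : ∀ x, p (p x) = p x := fun x => hpi.2 (hpK x)
  have hgr : ∀ x, (p x, (0 : H)) ∈ T.graph := fun x => mem_kerIn.1 (hpK x)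
  have hpr : ∀ u v, (u, v) ∈ T.graph → p v = 0 := fun u v huv => by
    rw [hp0, ← hran, mem_range_iff_graph]
    exact ⟨u, huv⟩
  have hex : ∀ x, ∃ u, (u, x - p x) ∈ T.graph ∧ p u = 0 := by
    intro x
    have h1 : x - p x ∈ range T := by
      rw [hran, ← hp0, map_sub, hpp, sub_self]
    obtain ⟨u, hu⟩ := mem_range_iff_graph.1 h1
    refine ⟨u - p u, ?_, by rw [map_sub, hpp, sub_self]⟩
    have := T.graph.sub_mem hu (hgr u)
    rwa [Prod.mk_sub_mk, sub_zero] at this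
  have huniq : ∀ {u u' v : H}, (u, v) ∈ T.graph → p u = 0 → (u', v) ∈ T.graph → p u' = 0 →
      u = u' := by
    intro u u' v h1 h2 h3 h4
    have h5 := T.graph.sub_mem h1 h3
    rw [Prod.mk_sub_mk, sub_self] at h5
    have h6 := hpi.2 (mem_kerIn.2 h5)
    rw [map_sub, h2, h4, sub_zero] at h6
    exact sub_eq_zero.1 h6.symm
  choose g hg hg0 using hex
  let G₀ : H →ₗ[ℂ] H :=
    { toFun := g
      map_add' := fun x y => huniq (hg _) (hg0 _) (by
        have := T.graph.add_mem (hg x) (hg y)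
        rw [Prod.mk_add_mk] at this
        rwa [map_add, add_sub_add_comm]) (by rw [map_add, hg0, hg0, add_zero])
      map_smul' := fun k x => huniq (hg _) (hg0 _) (by
        have := T.graph.smul_mem k (hg x)
        rw [Prod.smul_mk] at this
        rwa [map_smul, ← smul_sub]) (by
          rw [map_smul, hg0, smul_zero]) }
  -- Closed graph theorem: the limit again solves the equation and is orthogonal to the kernel,
  -- which determines it.
  have hcont : Continuous G₀ := by
    refine G₀.continuous_of_seq_closed_graph fun u x y hu hGu => ?_
    refine huniq (v := x - p x) ?_ ?_ (hg x) (hg0 x)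
    · exact hF.closed.mem_of_tendsto (hGu.prodMk_nhds (hu.sub ((p.continuous.tendsto x).comp hu)))
        (Eventually.of_forall fun n => hg (u n))
    · refine tendsto_nhds_unique ((p.continuous.tendsto y).comp hGu) ?_
      exact tendsto_const_nhds.congr fun n => (hg0 (u n)).symm
  refine ⟨⟨G₀, hcont⟩, p, hg, fun u v huv => ⟨?_, hpr u v huv⟩, fun x => ⟨hg0 x, ?_, hpp x⟩, hgr⟩
  · refine huniq (hg v) (hg0 v) ?_ (by rw [map_sub, hpp, sub_self])
    have := T.graph.sub_mem huv (hgr u)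
    rwa [Prod.mk_sub_mk, sub_zero, ← sub_zero v, ← hpr u v huv] at this
  · refine huniq (hg _) (hg0 _) ?_ (map_zero _)
    rw [hpp, sub_self]
    exact T.graph.zero_mem

/-- Zero is not an accumulation point of the spectrum of a symmetric Fredholm operator of index
zero. -/
theorem exists_gap_of_isFredholm (hT : T.IsFormalAdjoint T) (hF : IsFredholm T)
    (hi : index T = 0) : ∃ ε > 0, ∀ w ∈ spectrum T, w ≠ 0 → ε ≤ dist w 0 := by
  obtain ⟨G, p, h1, h2, h3, h4⟩ := exists_reduced_inverse hT hF hi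
  -- The added 1 covers the case G = 0.
  refine ⟨(‖G‖ + 1)⁻¹, by positivity, fun w hw hw0 => ?_⟩
  by_contra hlt
  rw [not_le, dist_zero_right] at hlt
  refine hw (mem_resolventSet_iff.2 ?_)
  have hsmall : ‖w • G‖ < 1 := by
    rw [norm_smul]
    calc ‖w‖ * ‖G‖ ≤ ‖w‖ * (‖G‖ + 1) := by gcongr; linarith
      _ < (‖G‖ + 1)⁻¹ * (‖G‖ + 1) := by gcongr
      _ = 1 := inv_mul_cancel₀ (by positivity)
  obtain ⟨N, hN1, hN2⟩ := isUnit_iff_exists.1 (isUnit_one_sub_of_norm_lt_one hsmall)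
  have n1 : ∀ x, N x - w • G (N x) = x := fun x => congrArg (fun A : H →L[ℂ] H => A x) hN1
  have n2 : ∀ x, N (x - w • G x) = x := fun x => congrArg (fun A : H →L[ℂ] H => A x) hN2
  have pN : ∀ x, p (N x) = p x := fun x => by
    conv_rhs => rw [← n1 x]
    rw [map_sub, map_smul, (h3 _).1, smul_zero, sub_zero]
  have Np : ∀ x, N (p x) = p x := fun x => by
    conv_rhs => rw [← n2 (p x), (h3 x).2.1, smul_zero, sub_zero]
  -- T − w is −w on the kernel and is inverted off it by G(1 − wG)⁻¹, a Neumann series since |w|‖G‖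
  -- < 1.
  refine ⟨G * N - w⁻¹ • p, fun x => ?_, fun u v huv => ?_⟩
  · change (G (N x) - w⁻¹ • p x, x + w • (G (N x) - w⁻¹ • p x)) ∈ T.graph
    have := T.graph.sub_mem (h1 (N x)) (T.graph.smul_mem w⁻¹ (h4 x))
    rw [Prod.smul_mk, smul_zero, Prod.mk_sub_mk, sub_zero, pN] at this
    have e : x + w • (G (N x) - w⁻¹ • p x) = N x - p x := by
      have := sub_eq_iff_eq_add.1 (n1 x)
      rw [smul_sub, smul_inv_smul₀ hw0, ← add_sub_assoc, ← this]
    rwa [e]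
  · change G (N (v - w • u)) - w⁻¹ • p (v - w • u) = u
    obtain ⟨e1, e2⟩ := h2 u v huv
    have comm : ∀ x, G (N x) = N (G x) := fun x => by
      conv_rhs => rw [← n1 x]
      rw [map_sub, map_smul, n2]
    rw [comm, map_sub G, map_smul G, map_sub p, map_smul p, e2, zero_sub, smul_neg, inv_smul_smul₀ hw0, e1,
      sub_neg_eq_add]
    have : u - p u - w • G u = (u - w • G u) - p u := by abel
    rw [this, map_sub, n2, Np]
    abel

end UnboundedOp

namespace CurvedStrip

variable {S : CurvedStrip} {P : S.Potential} {R : S.Uniformization} {h lam : ℝ}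

/-! ### The operators in terms of their graphs -/

theorem graph_dirac : (dirac P h).graph = diracGraph P h :=
  Submodule.toLinearPMap_graph_eq _ diracGraph_single

theorem graph_effOperator : (effOperator P R h lam).graph = effGraph P R h lam :=
  Submodule.toLinearPMap_graph_eq _ effGraph_single

theorem graph_dTimes : (dTimes P h).graph = dTimesGraph P h :=
  Submodule.toLinearPMap_graph_eq _ dTimesGraph_single

theorem isFormalAdjoint_dirac : (dirac P h).IsFormalAdjoint (dirac P h) := fun x y =>
  diracRel_symmetric (graph_dirac.le ((dirac P h).mem_graph x))
    (graph_dirac.le ((dirac P h).mem_graph y))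

theorem isFormalAdjoint_effOperator :
    (effOperator P R h lam).IsFormalAdjoint (effOperator P R h lam) := by
  intro a b
  obtain ⟨x, hx, ex, hqx⟩ := graph_effOperator.le ((effOperator P R h lam).mem_graph a)
  obtain ⟨y, hy, ey, hqy⟩ := graph_effOperator.le ((effOperator P R h lam).mem_graph b)
  have k1 := hqx y hy
  have k2 := congrArg conj (hqy x hx)
  have e : conj (qForm h lam y x) = qForm h lam x y := by
    simp only [qForm, map_add, map_sub, map_mul, inner_conj_symm, Complex.conj_ofReal]
  rw [e, k1, inner_conj_symm] at k2
  change ⟪effOperator P R h lam a, (b : S.L2)⟫_ℂ = ⟪(a : S.L2), effOperator P R h lam b⟫_ℂ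
  rw [ex, ey] at k2
  change ⟪(b : S.L2), effOperator P R h lam a⟫_ℂ = ⟪effOperator P R h lam b, (a : S.L2)⟫_ℂ at k2
  rw [← inner_conj_symm, k2, inner_conj_symm]

theorem isClosed_dirac (hh : h ≠ 0) : (dirac P h).IsClosed := by
  unfold LinearPMap.IsClosed
  rw [graph_dirac]
  exact isClosed_diracGraph P hh

theorem isClosed_effOperator (hh : 0 < h) (hlam : 0 < lam) : (effOperator P R h lam).IsClosed := by
  unfold LinearPMap.IsClosed
  rw [graph_effOperator]
  exact isClosed_effGraph P R hh hlam

theorem jMap_apply (u : (effOperator P R h lam).domain) : jMap P R h lam u =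
    WithLp.toLp 2 ((u : S.L2), (lam : ℂ)⁻¹ •
      dTimes P h ⟨u, effOperator_domain_le P R h lam u.2⟩) := rfl

/-- An element of the domain of `L_λ` together with its data in the form domain. -/
theorem exists_form (u : (effOperator P R h lam).domain) : ∃ x ∈ formGraph P R h,
    x.1 = u ∧ dTimes P h ⟨u, effOperator_domain_le P R h lam u.2⟩ = x.2.1 ∧
    ∀ y ∈ formGraph P R h, qForm h lam x y = ⟪y.1, effOperator P R h lam u⟫_ℂ := by
  obtain ⟨x, hx, ex, hqx⟩ := graph_effOperator.le ((effOperator P R h lam).mem_graph u)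
  refine ⟨x, hx, ex, ?_, hqx⟩
  exact (dTimes P h).mem_graph_snd_inj ((dTimes P h).mem_graph _) (graph_dTimes.ge hx.1) ex.symm

/-- Both the domain inclusion and the equation are read from one membership, supplied by the
self-adjointness of D_h. -/
theorem jMap_mem_graph (hh : h ≠ 0) (hlam : lam ≠ 0) (u : (effOperator P R h lam).domain) :
    (jMap P R h lam u, WithLp.toLp 2 ((lam : ℂ)⁻¹ • effOperator P R h lam u, (0 : S.L2))) ∈
      (shift (dirac P h) lam).graph := by
  obtain ⟨x, hx, ex, ed, hq⟩ := exists_form u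
  rw [mem_graph_shift, graph_dirac, jMap_apply, ed, ← ex]
  have := diracRel_of_form hh hlam hx hq
  have hl : (lam : ℂ) ≠ 0 := by exact_mod_cast hlam
  rw [← WithLp.toLp_smul, ← WithLp.toLp_add, Prod.smul_mk, Prod.mk_add_mk, smul_inv_smul₀ hl,
    zero_add, add_comm]
  exact this

theorem jMap_mem_domain (hh : h ≠ 0) (hlam : lam ≠ 0) (u : (effOperator P R h lam).domain) :
    jMap P R h lam u ∈ (dirac P h).domain :=
  LinearPMap.mem_domain_of_mem_graph (mem_graph_shift.1 (jMap_mem_graph hh hlam u))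

theorem shift_dirac_jMap (hh : h ≠ 0) (hlam : lam ≠ 0) (u : (effOperator P R h lam).domain) :
    shift (dirac P h) lam ⟨jMap P R h lam u, jMap_mem_domain hh hlam u⟩ =
      WithLp.toLp 2 ((lam : ℂ)⁻¹ • effOperator P R h lam u, (0 : S.L2)) :=
  (shift (dirac P h) lam).mem_graph_snd_inj ((shift (dirac P h) lam).mem_graph _)
    (jMap_mem_graph hh hlam u) rfl

/-- The solutions of `(D_h - λ) ψ = (a, 0)` are in the range of `J_λ`. -/
theorem exists_eq_jMap (hh : h ≠ 0) (hlam : lam ≠ 0) {ψ : S.Spinor} {a : S.L2}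
    (H : (ψ, WithLp.toLp 2 (a, (0 : S.L2))) ∈ (shift (dirac P h) lam).graph) :
    ∃ u : (effOperator P R h lam).domain, jMap P R h lam u = ψ ∧
      effOperator P R h lam u = (lam : ℂ) • a := by
  rw [mem_graph_shift, graph_dirac] at H
  obtain ⟨k1, k2⟩ := mem_effGraph_of_diracRel (R := R) hh (a := a) H (add_comm _ _) (zero_add _)
  rw [← graph_effOperator] at k1
  obtain ⟨u, hu, hL⟩ := (LinearPMap.mem_graph_iff _).1 k1
  refine ⟨u, ?_, hL⟩
  rw [← graph_dTimes] at k2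
  have := (dTimes P h).mem_graph_snd_inj ((dTimes P h).mem_graph
    ⟨u, effOperator_domain_le P R h lam u.2⟩) k2 hu
  have hl : (lam : ℂ) ≠ 0 := by exact_mod_cast hlam
  rw [jMap_apply, this, hu]
  change WithLp.toLp 2 (ψ.fst, (lam : ℂ)⁻¹ • (0 + (lam : ℂ) • ψ.snd)) = ψ
  rw [zero_add, inv_smul_smul₀ hl]
  rfl

/-! ### Kernels, ranges and indices through `jMap` -/

/-- The bicontinuity of `J_λ` on the kernel. -/
theorem norm_jMap_le (hh : 0 < h) (hlam : 0 < lam) {u : (effOperator P R h lam).domain}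
    (hu : effOperator P R h lam u = 0) : ‖jMap P R h lam u‖ ≤ 2 * ‖u‖ := by
  obtain ⟨x, hx, ex, ed, hq⟩ := exists_form u
  -- With w = 0 the energy bound reads ‖d_A^× u‖ ≤ λ‖u‖, so the second component is no larger than
  -- the first.
  have k := norm_sq_le_of_form hh.le hlam.le hx hq
  rw [hu, norm_zero, mul_zero, add_zero, ← mul_pow, ex] at k
  have k1 := abs_le_of_sq_le_sq' k (by positivity) |>.2
  have k2 : ‖(lam : ℂ)⁻¹ • x.2.1‖ ≤ ‖u‖ := by
    rw [norm_smul, norm_inv, Complex.norm_real, Real.norm_eq_abs, abs_of_pos hlam,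
      inv_mul_le_iff₀ hlam]
    exact k1
  rw [jMap_apply, ed]
  refine abs_le_of_sq_le_sq' ?_ (by positivity) |>.2
  rw [WithLp.prod_norm_sq_eq_of_L2]
  change ‖(u : S.L2)‖ ^ 2 + ‖(lam : ℂ)⁻¹ • x.2.1‖ ^ 2 ≤ (2 * ‖(u : S.L2)‖) ^ 2
  have := pow_le_pow_left₀ (norm_nonneg _) k2 2
  rw [Submodule.coe_norm] at this
  nlinarith [sq_nonneg ‖(u : S.L2)‖]

theorem norm_le_norm_jMap (u : (effOperator P R h lam).domain) : ‖u‖ ≤ ‖jMap P R h lam u‖ := by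
  rw [jMap_apply]
  exact WithLp.norm_fst_le _ (WithLp.toLp 2 ((u : S.L2), (lam : ℂ)⁻¹ •
    dTimes P h ⟨u, effOperator_domain_le P R h lam u.2⟩))

/-- `J_λ` as a linear map into the domain of `D_h`. -/
noncomputable def jDomain (hh : h ≠ 0) (hlam : lam ≠ 0) :
    (effOperator P R h lam).domain →ₗ[ℂ] (shift (dirac P h) lam).domain :=
  (jMap P R h lam).codRestrict _ (jMap_mem_domain hh hlam)

/-- The first component of J_λ u is u, which gives injectivity and the bound of the inverse;
surjectivity is the case a = 0 of `exists_eq_jMap`. -/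
theorem exists_ker_equiv (hh : 0 < h) (hlam : 0 < lam) :
    ∃ e : ker (effOperator P R h lam) ≃L[ℂ] ker (shift (dirac P h) lam),
      ∀ u : ker (effOperator P R h lam),
        ((e u : (shift (dirac P h) lam).domain) : S.Spinor) = jMap P R h lam u := by
  have hk : ∀ u ∈ ker (effOperator P R h lam),
      jDomain hh.ne' hlam.ne' u ∈ ker (shift (dirac P h) lam) := by
    intro u hu
    have := shift_dirac_jMap hh.ne' hlam.ne' u
    rw [show effOperator P R h lam u = 0 from hu, smul_zero] at this
    exact this
  let f : ker (effOperator P R h lam) →ₗ[ℂ] ker (shift (dirac P h) lam) :=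
    (jDomain hh.ne' hlam.ne').restrict hk
  have hf : ∀ u, (((f u : (shift (dirac P h) lam).domain)) : S.Spinor) = jMap P R h lam u :=
    fun u => rfl
  have hlow : ∀ u, ‖u‖ ≤ ‖f u‖ := fun u => norm_le_norm_jMap (u : (effOperator P R h lam).domain)
  have hinj : Function.Injective f := by
    rw [injective_iff_map_eq_zero]
    intro u hu
    have := hlow u
    rw [hu, norm_zero] at this
    exact norm_le_zero_iff.1 this
  have hsurj : Function.Surjective f := by
    rintro ⟨ψ, hψ⟩
    have h1 := (shift (dirac P h) lam).mem_graph ψ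
    rw [show shift (dirac P h) lam ψ = 0 from hψ] at h1
    obtain ⟨u, hu, hL⟩ := exists_eq_jMap (R := R) hh.ne' hlam.ne' (a := 0) h1
    rw [smul_zero] at hL
    exact ⟨⟨u, hL⟩, Subtype.ext (Subtype.ext hu)⟩
  refine ⟨(LinearEquiv.ofBijective f ⟨hinj, hsurj⟩).toContinuousLinearEquivOfBounds 2 1
    (fun u => norm_jMap_le hh hlam u.2) (fun ψ => ?_), fun u => rfl⟩
  obtain ⟨u, rfl⟩ := hsurj ψ
  rw [one_mul]
  change ‖(LinearEquiv.ofBijective f ⟨hinj, hsurj⟩).symm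
    (LinearEquiv.ofBijective f ⟨hinj, hsurj⟩ u)‖ ≤ _
  rw [LinearEquiv.symm_apply_apply]
  exact hlow u

/-- The range consists of the ψ for which (D_h − λ)ψ has zero second component, a closed condition
on the pair (ψ, D_h ψ). -/
theorem isClosed_range_jMap (hh : h ≠ 0) (hlam : lam ≠ 0)
    (hJ : ∀ u, jMap P R h lam u ∈ (dirac P h).domain) : IsClosed[graphTopology (dirac P h)]
      (Set.range fun u => (⟨jMap P R h lam u, hJ u⟩ : (dirac P h).domain)) := by
  rw [isClosed_induced_iff]
  refine ⟨{x | x.2.snd = (lam : ℂ) • x.1.snd}, isClosed_eq (by fun_prop) (by fun_prop), ?_⟩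
  ext ψ
  have key : ∀ b : S.Spinor, shift (dirac P h) lam ψ = b ↔
      dirac P h ψ = b + (lam : ℂ) • (ψ : S.Spinor) := fun b => sub_eq_iff_eq_add
  constructor
  · intro hψ
    change (dirac P h ψ).snd = (lam : ℂ) • (ψ : S.Spinor).snd at hψ
    have h1 : shift (dirac P h) lam ψ = WithLp.toLp 2
        ((dirac P h ψ).fst - (lam : ℂ) • (ψ : S.Spinor).fst, (0 : S.L2)) := by
      rw [key, WithLp.ext_iff]
      refine Prod.ext (sub_add_cancel _ _).symm ?_
      refine hψ.trans (zero_add _).symm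
    have h2 := (shift (dirac P h) lam).mem_graph ψ
    rw [h1] at h2
    obtain ⟨u, hu, -⟩ := exists_eq_jMap (R := R) hh hlam h2
    exact ⟨u, Subtype.ext hu⟩
  · rintro ⟨u, rfl⟩
    have := (key _).1 (shift_dirac_jMap (P := P) (R := R) hh hlam u)
    change (dirac P h _).snd = (lam : ℂ) • (jMap P R h lam u).snd
    rw [this]
    exact zero_add _

/-- The range of `L_λ` is the trace of the range of `D_h - λ` on `L²(Ω) × {0}`. -/
theorem range_effOperator (hh : h ≠ 0) (hlam : lam ≠ 0) : UnboundedOp.range (effOperator P R h lam) =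
    (UnboundedOp.range (shift (dirac P h) lam)).comap
      ((WithLp.linearEquiv 2 ℂ (S.L2 × S.L2)).symm.toLinearMap ∘ₗ LinearMap.inl ℂ S.L2 S.L2) := by
  have hl : (lam : ℂ) ≠ 0 := by exact_mod_cast hlam
  ext w
  rw [Submodule.mem_comap]
  change w ∈ _ ↔ WithLp.toLp 2 (w, (0 : S.L2)) ∈ _
  constructor
  · rintro ⟨u, rfl⟩
    refine ⟨(lam : ℂ) • ⟨jMap P R h lam u, jMap_mem_domain hh hlam u⟩, ?_⟩
    rw [map_smul]
    refine (congrArg ((lam : ℂ) • ·) (shift_dirac_jMap hh hlam u)).trans ?_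
    rw [← WithLp.toLp_smul, Prod.smul_mk, smul_inv_smul₀ hl, smul_zero]
    rfl
  · intro hw
    obtain ⟨ψ, hψ⟩ := mem_range_iff_graph.1 hw
    obtain ⟨u, -, hu⟩ := exists_eq_jMap (R := R) hh hlam hψ
    refine ⟨(lam : ℂ)⁻¹ • u, ?_⟩
    rw [map_smul]
    exact (congrArg ((lam : ℂ)⁻¹ • ·) hu).trans (inv_smul_smul₀ hl w)

/-- The range of L_λ is a preimage of that of D_h − λ under a ↦ (a, 0), so it is closed and the
cokernels embed. -/
theorem isFredholm_effOperator (hh : 0 < h) (hlam : 0 < lam)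
    (hF : IsFredholm (shift (dirac P h) lam)) (hi : index (shift (dirac P h) lam) = 0) :
    IsFredholm (effOperator P R h lam) ∧ index (effOperator P R h lam) = 0 := by
  obtain ⟨e, -⟩ := exists_ker_equiv (P := P) (R := R) hh hlam
  have h1 := hF.finite_ker
  have h2 := hF.finite_coker
  have hker : FiniteDimensional ℂ (ker (effOperator P R h lam)) :=
    e.symm.toLinearEquiv.finiteDimensional
  have hr := range_effOperator (P := P) (R := R) hh.ne' hlam.ne'
  have hcl : IsClosed (UnboundedOp.range (effOperator P R h lam) : Set S.L2) := by
    rw [hr]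
    exact hF.closed_range.preimage
      ((WithLp.prod_continuous_toLp 2 S.L2 S.L2).comp (continuous_id.prodMk continuous_const))
  set ι : S.L2 →ₗ[ℂ] S.Spinor :=
    (WithLp.linearEquiv 2 ℂ (S.L2 × S.L2)).symm.toLinearMap ∘ₗ LinearMap.inl ℂ S.L2 S.L2
  let f := (UnboundedOp.range (effOperator P R h lam)).mapQ
    (UnboundedOp.range (shift (dirac P h) lam)) ι hr.le
  have hf : Function.Injective f := by
    rw [injective_iff_map_eq_zero]
    intro q hq
    obtain ⟨w, rfl⟩ := Submodule.mkQ_surjective _ q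
    refine (Submodule.Quotient.mk_eq_zero _).2 (hr.ge ?_)
    exact (Submodule.Quotient.mk_eq_zero (UnboundedOp.range (shift (dirac P h) lam))).1 hq
  have hco : FiniteDimensional ℂ (S.L2 ⧸ UnboundedOp.range (effOperator P R h lam)) :=
    FiniteDimensional.of_injective f hf
  refine ⟨⟨isClosed_effOperator hh hlam, hker, hcl, hco⟩, ?_⟩
  -- codim ran L_λ ≤ codim ran(D_h − λ) = dim ker(D_h − λ) = dim ker L_λ ≤ codim ran L_λ, the last
  -- step by symmetry; all are equalities.
  have hle := LinearMap.finrank_le_finrank_of_injective hf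
  have hge := finrank_ker_le (T := effOperator P R h lam) isFormalAdjoint_effOperator hcl
  have := e.toLinearEquiv.finrank_eq
  rw [index] at hi ⊢
  omega

/-- The eigenvector is transported by the kernel isomorphism, and the isolation of 0 comes from the
reduced inverse of L_λ, not from a comparison of the two spectra near λ and 0. -/
theorem zero_mem_discreteSpectrum_effOperator (hh : 0 < h) (hlam : 0 < lam)
    (hs : (lam : ℂ) ∈ discreteSpectrum (dirac P h)) :
    (0 : ℂ) ∈ discreteSpectrum (effOperator P R h lam) := by
  obtain ⟨hF, hi⟩ := isFredholm_of_mem_discreteSpectrum isFormalAdjoint_dirac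
    (isClosed_dirac hh.ne') hs
  obtain ⟨hF', hi'⟩ := isFredholm_effOperator (R := R) hh hlam hF hi
  obtain ⟨e, -⟩ := exists_ker_equiv (P := P) (R := R) hh hlam
  have h0 : shift (effOperator P R h lam) 0 = effOperator P R h lam :=
    LinearPMap.eq_of_eq_graph (by ext ⟨u, v⟩; rw [mem_graph_shift, zero_smul, add_zero])
  obtain ⟨ψ, hψ, hψ0⟩ := (Submodule.ne_bot_iff _).1 hs.2.2.1
  have hne : ker (effOperator P R h lam) ≠ ⊥ := by
    intro hbot
    have : e.symm ⟨ψ, hψ⟩ = 0 := Subtype.ext ((Submodule.mem_bot ℂ).1 (hbot ▸ (e.symm ⟨ψ, hψ⟩).2))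
    rw [e.symm.map_eq_zero_iff] at this
    exact hψ0 (congrArg Subtype.val this)
  refine ⟨fun hres => ?_, exists_gap_of_isFredholm isFormalAdjoint_effOperator hF' hi', ?_, ?_⟩
  · obtain ⟨B, hB⟩ := mem_resolventSet_iff.1 hres
    obtain ⟨u, hu, hu0⟩ := (Submodule.ne_bot_iff _).1 hne
    have h1 := (effOperator P R h lam).mem_graph u
    rw [show effOperator P R h lam u = 0 from hu] at h1
    have h2 := hB.2 _ _ h1
    rw [zero_smul, sub_zero, map_zero] at h2
    exact hu0 (Subtype.ext h2.symm)
  · rwa [h0]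
  · rw [h0]
    exact hF'.finite_ker

end CurvedStrip

theorem mainTheorem5 (S : CurvedStrip) (P : S.Potential) (R : S.Uniformization)
    (h lam : ℝ) (hh : 0 < h) (hlam : 0 < lam) :
    ∃ hJ : ∀ u, jMap P R h lam u ∈ (dirac P h).domain,
      (∀ u, shift (dirac P h) lam ⟨jMap P R h lam u, hJ u⟩ =
        WithLp.toLp 2 ((lam : ℂ)⁻¹ • effOperator P R h lam u, (0 : S.L2))) ∧
      (∃ e : ker (effOperator P R h lam) ≃L[ℂ] ker (shift (dirac P h) lam),
        ∀ u : ker (effOperator P R h lam),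
          ((e u : (shift (dirac P h) lam).domain) : S.Spinor) = jMap P R h lam u) ∧
      IsClosed[graphTopology (dirac P h)]
        (range fun u => (⟨jMap P R h lam u, hJ u⟩ : (dirac P h).domain)) ∧
      (IsFredholm (shift (dirac P h) lam) ∧ index (shift (dirac P h) lam) = 0 →
        IsFredholm (effOperator P R h lam) ∧ index (effOperator P R h lam) = 0) ∧
      ((lam : ℂ) ∈ discreteSpectrum (dirac P h) →
        (0 : ℂ) ∈ discreteSpectrum (effOperator P R h lam)) := by
  refine ⟨jMap_mem_domain hh.ne' hlam.ne', shift_dirac_jMap hh.ne' hlam.ne',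
    exists_ker_equiv hh hlam, isClosed_range_jMap hh.ne' hlam.ne' _,
    fun H => isFredholm_effOperator hh hlam H.1 H.2,
    zero_mem_discreteSpectrum_effOperator hh hlam⟩
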